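/- Let $p$ be a prime, let $g \ge 1$, and let $J \subseteq \mathbb Z$ be non-empty with $J + 2g\mathbb Z = J$ and $-J = J$. For a ring $R$ write $W(R)$ and $W_m(R)$ for the rings of $p$-typical Witt vectors and of Witt vectors of length $m$, and $\sigma$ for the Witt vector Frobenius ($\sigma \colon W_m(R) \to W_n(R)$ for $m \ge n+1$). Put $A = B = W(R)$ in the untruncated case, and $A = W_m(R)$, $B = W_n(R)$ in the $(m,n)$-truncated case ($n \ge 1$, $m \ge n+1$), with $I_R = \ker(A \to R)$; in the $(m,\text{1-rdt})$-truncated case ($m \ge 2$) put $A = W_m(R)$, $B = W_1(R) = R$. A *chain of displays of type $(g,J)$ over $R$* consists of: finite projective $A$-modules $M_i$ ($i \in J$) of rank $2g$; a transitive system of linear maps $\rho_{i,j} \colon M_i \to M_j$ for $i \le j$ and compatible isomorphisms $\theta_i \colon M_i \cong M_{i+2g}$ with $\rho_{i,i+2g} = p\,\theta_i$, such that for $i \le j \le i+2g$ the image of $\rho_{i,j}$ over $R/pR$ is a direct summand of rank $2g-(j-i)$; submodules $I_R M_i \subseteq M_{i,1} \subseteq M_i$, respected by $\rho$ and $\theta$,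 such that $M_{i,1}/I_R M_i \subseteq M_i/I_R M_i$ is a direct summand of rank $g$; and an isomorphism of chains $\Psi_i \colon \widetilde M_{i,1} \cong B \otimes_A M_i$. Here $\widetilde M_{i,1}$ is the universal $B$-module with $\sigma$-linear maps $F_1 \colon M_{i,1} \to \widetilde M_{i,1}$ and $F \colon M_i \to \widetilde M_{i,1}$ such that $F_1(ax) = V^{-1}(a) F(x)$ for $a \in I_R$, $x \in M_i$. In the 1-rdt case $(\Psi_i)_i$ is replaced by isomorphisms $\Psi_{i,j} \colon \ker(\widetilde\rho_{i,j}) \cong \ker(\rho_{i,j})$ over $R$, for consecutive $i<j$ in $J$, compatible with $\theta$. A *homogeneously polarized* chain of displays is a chain of displays together with an invertible $A$-module $I$, an isomorphism $\iota \colon B \otimes_{\sigma,A} I \cong B \otimes_A I$, and perfect antisymmetric pairings $\lambda_i \colon M_i \times M_{-i} \to I$ ($\lambda_{-i}(y,x) = -\lambda_i(x,y)$), compatible with $\rho$ and $\theta$, with $M_{i,1} = \{x : \lambda_i(x, M_{-i,1}) \subseteq I_R I\}$, and compatible with the divided Frobenius and $\iota$. It is *polarized* if $(I,\iota)$ is the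 unit object $(A, \mathrm{can})$. Morphisms over a ring homomorphism $R \to S$ are the isomorphisms from the base change; morphisms of homogeneously polarized chains include an isomorphism of the modules $I$ compatible with $\iota$ and $\lambda$. This gives the stack $\mathrm{PolChDisp}_{g,J}$ (polarized) and $\mathrm{HPolChDisp}_{g,J}$ (homogeneously polarized) over rings in which $p$ is nilpotent, their truncated versions $\mathrm{PolChDisp}^{(m,n)}_{g,J}$, $\mathrm{HPolChDisp}^{(m,n)}_{g,J}$, and, over $\mathbb F_p$-algebras, the versions for $n = \text{1-rdt}$. Let $u \in A^\times$ with $\sigma(u) = u$ in $B$ act by $(M,\lambda) \mapsto (M, u\lambda)$, together with the isomorphism of homogeneously polarized chains given by $\mathrm{id}_M$ and multiplication by $u$ on $I = A$. Call a morphism $\pi \colon X \to Y$ with an action of $G$ on $X$ over $Y$ a *$G$-torsor* if $G \times X \to X \times_Y X$, $(u,x) \mapsto (x, u x)$, is an equivalence and every object of $Y$ lifts to $X$ after some faithfully flat base change $R \to S$. 1. The functor $\mathbb Z_p^\times \colon R \mapsto \mathrm{Cont}(|\mathrm{Spec}\, R|, \mathbb Z_p^\times)$ is a flat affine group scheme over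 $\mathbb Z_p$. There are natural ring isomorphisms $\mathrm{Cont}(|\mathrm{Spec}\, R|, \mathbb Z_p) \cong W(R)^{\sigma = \mathrm{id}}$ for all $R$ in which $p$ is nilpotent, such that for the resulting action of $\mathbb Z_p^\times$ the forgetful morphism $\mathrm{PolChDisp}_{g,J} \to \mathrm{HPolChDisp}_{g,J}$ is a torsor under $\mathbb Z_p^\times$. 2. For $n \ge 1$ and $m \ge n+1$ the functor $(L^{(m)}\mathbb G_m)^{\sigma=\mathrm{id}} \colon R \mapsto W_m(R)^{\times,\sigma=\mathrm{id}} = \{u \in W_m(R)^\times : \sigma(u) = u \text{ in } W_n(R)\}$ is a smooth affine group scheme over $\mathbb Z_p$, and the forgetful morphism $\mathrm{PolChDisp}^{(m,n)}_{g,J} \to \mathrm{HPolChDisp}^{(m,n)}_{g,J}$ is a torsor under it. 3. For $m \ge 2$ the forgetful morphism $\mathrm{PolChDisp}^{(m,\text{1-rdt})}_{g,J} \to \mathrm{HPolChDisp}^{(m,\text{1-rdt})}_{g,J}$ over $\mathbb F_p$-algebras is a torsor under $R \mapsto \{u \in W_m(R)^\times : \sigma(u) = u \text{ in } W_1(R)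 = R\}$. -/

import Mathlib

universe u

/-! ## Base change of modules along a ring homomorphism -/

/-- The base change `B ⊗_{f, A} M` of an `A`-module `M` along a ring homomorphism `f : A → B`. -/
def BC {A B : Type u} [CommRing A] [CommRing B] (f : A →+* B)
    (M : Type u) [AddCommGroup M] [Module A M] : Type u :=
  @TensorProduct A _ B M _ _ f.toAlgebra.toModule _

namespace BC

section

variable {A B : Type u} [CommRing A] [CommRing B] (f : A →+* B)
  {M : Type u} [AddCommGroup M] [Module A M]

noncomputable instance : AddCommGroup (BC f M) :=
  @TensorProduct.addCommGroup A _ B M _ _ f.toAlgebra.toModule _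

noncomputable instance : Module B (BC f M) :=
  letI := f.toAlgebra
  TensorProduct.leftModule (R := A) (M := B) (N := M)

/-- The pure tensor `b ⊗ m`. -/
noncomputable def tmul (b : B) (m : M) : BC f M :=
  @TensorProduct.tmul A _ B M _ _ f.toAlgebra.toModule _ b m

theorem tmul_add (b : B) (m m' : M) : tmul f b (m + m') = tmul f b m + tmul f b m' := by
  let := f.toAlgebra
  exact TensorProduct.tmul_add b m m'

theorem add_tmul (b b' : B) (m : M) : tmul f (b + b') m = tmul f b m + tmul f b' m := by
  let := f.toAlgebra
  exact TensorProduct.add_tmul b b' m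

theorem tmul_smul (b : B) (a : A) (m : M) : tmul f b (a • m) = tmul f (f a * b) m := by
  let := f.toAlgebra
  have h := TensorProduct.smul_tmul (R := A) a b m
  rw [Algebra.smul_def] at h
  exact h.symm

theorem smul_tmul (c b : B) (m : M) : c • tmul f b m = tmul f (c * b) m := rfl

theorem induction {P : BC f M → Prop} (h0 : P 0) (ht : ∀ b m, P (tmul f b m))
    (ha : ∀ x y, P x → P y → P (x + y)) (z : BC f M) : P z := by
  let := f.toAlgebra
  exact TensorProduct.induction_on (motive := P) z h0 ht ha

variable {f}

/-- The universal property: a map `ψ : M → N` that is semilinear along `γ ∘ f` induces the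
`γ`-semilinear map `b ⊗ m ↦ γ(b) ψ(m)`. -/
noncomputable def lift {C : Type u} [CommRing C] {γ : B →+* C} {τ : A →+* C}
    (h : ∀ a, γ (f a) = τ a) {N : Type u} [AddCommGroup N] [Module C N]
    (ψ : M →ₛₗ[τ] N) : BC f M →ₛₗ[γ] N :=
  letI := f.toAlgebra
  let g : TensorProduct A B M →+ N := TensorProduct.liftAddHom
    (AddMonoidHom.mk' (fun b => AddMonoidHom.mk' (fun m => γ b • ψ m)
        (fun m m' => by rw [map_add, smul_add]))
      (fun b b' => by ext m; simp [add_smul]))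
    (fun a b m => by
      change γ (a • b) • ψ m = γ b • ψ (a • m)
      rw [Algebra.smul_def, map_mul, LinearMap.map_smulₛₗ, smul_smul, mul_comm]
      congr 2
      exact h a)
  { toFun := g
    map_add' := g.map_add
    map_smul' := fun c z => by
      induction z using BC.induction f with
      | h0 =>
        rw [smul_zero]
        exact g.map_zero.trans ((smul_zero _).symm.trans (congrArg _ g.map_zero.symm))
      | ht b m =>
        change γ (c * b) • ψ m = γ c • γ b • ψ m
        rw [map_mul, smul_smul]
      | ha x y hx hy =>
        have e1 := g.map_add (c • x) (c • y)
        have e2 := g.map_add x y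
        rw [smul_add]
        refine e1.trans ?_
        rw [hx, hy, ← smul_add]
        exact congrArg _ e2.symm }

theorem lift_tmul {C : Type u} [CommRing C] {γ : B →+* C} {τ : A →+* C}
    (h : ∀ a, γ (f a) = τ a) {N : Type u} [AddCommGroup N] [Module C N]
    (ψ : M →ₛₗ[τ] N) (b : B) (m : M) : lift h ψ (tmul f b m) = γ b • ψ m := rfl

theorem ext {C : Type u} [CommRing C] {γ : B →+* C} {N : Type u} [AddCommGroup N] [Module C N]
    {g g' : BC f M →ₛₗ[γ] N} (h : ∀ m, g (tmul f 1 m) = g' (tmul f 1 m)) : g = g' := by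
  ext z
  induction z using BC.induction f with
  | h0 => rw [map_zero, map_zero]
  | ht b m =>
    have e : tmul f b m = b • tmul f 1 m := by rw [smul_tmul, mul_one]
    rw [e, LinearMap.map_smulₛₗ, LinearMap.map_smulₛₗ, h]
  | ha x y hx hy => rw [map_add, map_add, hx, hy]

variable (f) in
/-- The `f`-semilinear map `M → B ⊗ M`, `m ↦ 1 ⊗ m`. -/
noncomputable def mk : M →ₛₗ[f] BC f M where
  toFun m := tmul f 1 m
  map_add' := tmul_add f 1
  map_smul' a m := by rw [tmul_smul, smul_tmul]

theorem mk_apply (m : M) : mk f m = tmul f 1 m := rfl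

/-- Functoriality: `b ⊗ m ↦ β(b) ⊗ φ(m)`, for an `α`-semilinear map `φ` and a commutative square
of ring homomorphisms `β ∘ f = f' ∘ α`. -/
noncomputable def map {A' B' : Type u} [CommRing A'] [CommRing B'] {f' : A' →+* B'}
    {α : A →+* A'} {β : B →+* B'} (h : ∀ a, β (f a) = f' (α a))
    {M' : Type u} [AddCommGroup M'] [Module A' M'] (φ : M →ₛₗ[α] M') :
    BC f M →ₛₗ[β] BC f' M' :=
  lift (τ := f'.comp α) h
    { toFun := fun m => tmul f' 1 (φ m)
      map_add' := fun m m' => by rw [map_add, tmul_add]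
      map_smul' := fun a m => by
        rw [LinearMap.map_smulₛₗ, tmul_smul, smul_tmul]; rfl }

theorem map_tmul {A' B' : Type u} [CommRing A'] [CommRing B'] {f' : A' →+* B'}
    {α : A →+* A'} {β : B →+* B'} (h : ∀ a, β (f a) = f' (α a))
    {M' : Type u} [AddCommGroup M'] [Module A' M'] (φ : M →ₛₗ[α] M') (b : B) (m : M) :
    map h φ (tmul f b m) = tmul f' (β b) (φ m) := by
  change β b • tmul f' 1 (φ m) = _
  rw [smul_tmul, mul_one]

variable (f) in
/-- The `B`-linear map `id ⊗ φ` induced by an `A`-linear map `φ`. -/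
noncomputable def mapL {M' : Type u} [AddCommGroup M'] [Module A M'] (φ : M →ₗ[A] M') :
    BC f M →ₗ[B] BC f M' :=
  map (α := RingHom.id A) (β := RingHom.id B) (fun _ => rfl) φ

variable (f) in
/-- The base change `(b ⊗ x, c ⊗ y) ↦ bc ⊗ l(x, y)` of an `A`-bilinear map `l`. -/
noncomputable def pair {M' N : Type u} [AddCommGroup M'] [Module A M'] [AddCommGroup N]
    [Module A N] (l : M →ₗ[A] M' →ₗ[A] N) : BC f M →ₗ[B] BC f M' →ₗ[B] BC f N :=
  lift (γ := RingHom.id B) (τ := f) (fun _ => rfl)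
    { toFun := fun x => mapL f (l x)
      map_add' := fun x x' => by
        refine ext fun y => ?_
        simp only [mapL, map_tmul, map_add, LinearMap.add_apply, tmul_add]
      map_smul' := fun a x => by
        refine ext fun y => ?_
        rw [LinearMap.smul_apply]
        simp only [mapL, map_tmul, map_smul, LinearMap.smul_apply, tmul_smul, smul_tmul,
          RingHom.id_apply] }

theorem pair_tmul {M' N : Type u} [AddCommGroup M'] [Module A M'] [AddCommGroup N]
    [Module A N] (l : M →ₗ[A] M' →ₗ[A] N) (b c : B) (x : M) (y : M') :
    pair f l (tmul f b x) (tmul f c y) = tmul f (b * c) (l x y) := by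
  change (b • mapL f (l x)) (tmul f c y) = _
  rw [LinearMap.smul_apply, mapL, map_tmul, smul_tmul]
  rfl

variable (f) in
/-- The canonical isomorphism `B ⊗_{f, A} A ≅ B`. -/
noncomputable def rid : BC f A ≃ₗ[B] B :=
  @TensorProduct.AlgebraTensorModule.rid A B B _ _ f.toAlgebra _ f.toAlgebra.toModule _
    (@IsScalarTower.right A B _ _ f.toAlgebra)

theorem rid_tmul (b : B) (a : A) : rid f (tmul f b a) = f a * b := by
  let := f.toAlgebra
  exact (TensorProduct.AlgebraTensorModule.rid_tmul (R := A) (A := B) (M := B) a b).trans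
    (Algebra.smul_def a b)

end

end BC

/-- A semilinear map `φ : M → M'` along `α : A → A'` exhibits `M'` as the base change
`A' ⊗_A M`. -/
def IsBC {A A' : Type u} [CommRing A] [CommRing A'] {α : A →+* A'}
    {M M' : Type u} [AddCommGroup M] [Module A M] [AddCommGroup M'] [Module A' M']
    (φ : M →ₛₗ[α] M') : Prop :=
  Function.Bijective (BC.lift (f := α) (γ := RingHom.id A') (τ := α) (fun _ => rfl) φ)

theorem IsBC.id {A : Type u} [CommRing A] {α : A →+* A} (hα : ∀ a, α a = a)
    {M : Type u} [AddCommGroup M] [Module A M] (φ : M →ₛₗ[α] M) (hφ : ∀ m, φ m = m) :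
    IsBC φ := by
  obtain rfl : α = RingHom.id A := RingHom.ext hα
  have key : ∀ z : BC (RingHom.id A) M, ∃ m, z = BC.tmul (RingHom.id A) 1 m := by
    intro z
    induction z using BC.induction with
    | h0 => exact ⟨0, ((BC.mk (RingHom.id A)).map_zero).symm⟩
    | ht b m =>
      refine ⟨b • m, ?_⟩
      rw [BC.tmul_smul, mul_one]
      rfl
    | ha x y hx hy =>
      obtain ⟨m, rfl⟩ := hx
      obtain ⟨n, rfl⟩ := hy
      exact ⟨m + n, (BC.tmul_add _ _ _ _).symm⟩
  constructor
  · intro z w h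
    obtain ⟨m, rfl⟩ := key z
    obtain ⟨n, rfl⟩ := key w
    rw [BC.lift_tmul, BC.lift_tmul, map_one, one_smul, one_smul, hφ, hφ] at h
    rw [h]
  · intro m
    refine ⟨BC.tmul _ 1 m, ?_⟩
    rw [BC.lift_tmul, map_one, one_smul, hφ]

theorem IsBC.comp {A A' A'' : Type u} [CommRing A] [CommRing A'] [CommRing A'']
    {α : A →+* A'} {α' : A' →+* A''} {α'' : A →+* A''} (hα : ∀ a, α' (α a) = α'' a)
    {M M' M'' : Type u} [AddCommGroup M] [Module A M] [AddCommGroup M'] [Module A' M']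
    [AddCommGroup M''] [Module A'' M''] {φ : M →ₛₗ[α] M'} {φ' : M' →ₛₗ[α'] M''}
    {φ'' : M →ₛₗ[α''] M''} (h : ∀ m, φ'' m = φ' (φ m)) (hφ : IsBC φ) (hφ' : IsBC φ') :
    IsBC φ'' := by
  let e := LinearEquiv.ofBijective _ hφ
  let e' := LinearEquiv.ofBijective _ hφ'
  have he : ∀ m, e.symm (φ m) = BC.tmul α 1 m := fun m => by
    rw [LinearEquiv.symm_apply_eq]
    change _ = BC.lift (fun _ => rfl) φ (BC.tmul α 1 m)
    rw [BC.lift_tmul, map_one, one_smul]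
  have he' : ∀ m, e'.symm (φ' m) = BC.tmul α' 1 m := fun m => by
    rw [LinearEquiv.symm_apply_eq]
    change _ = BC.lift (fun _ => rfl) φ' (BC.tmul α' 1 m)
    rw [BC.lift_tmul, map_one, one_smul]
  let ψ : M' →ₛₗ[α'] BC α'' M :=
    (BC.lift (f := α) (γ := α') (τ := α'') hα (BC.mk α'')).comp e.symm.toLinearMap
  let k : M'' →ₗ[A''] BC α'' M :=
    (BC.lift (f := α') (γ := RingHom.id A'') (τ := α') (fun _ => rfl) ψ).comp e'.symm.toLinearMap
  have hk : ∀ m, k (φ'' m) = BC.tmul α'' 1 m := fun m => by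
    change BC.lift (fun _ => rfl) ψ (e'.symm (φ'' m)) = _
    rw [h, he', BC.lift_tmul, map_one, one_smul]
    change BC.lift hα (BC.mk α'') (e.symm (φ m)) = _
    rw [he, BC.lift_tmul, map_one, one_smul, BC.mk_apply]
  let L := BC.lift (f := α'') (γ := RingHom.id A'') (τ := α'') (fun _ => rfl) φ''
  have hL : ∀ m, L (BC.tmul α'' 1 m) = φ'' m := fun m => by
    rw [BC.lift_tmul, map_one, one_smul]
  have hkL : k.comp L = LinearMap.id := BC.ext fun m => by
    rw [LinearMap.comp_apply, hL, hk, LinearMap.id_apply]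
  refine ⟨Function.LeftInverse.injective (g := k) fun z => LinearMap.congr_fun hkL z, ?_⟩
  have h2 : ∀ m', φ' m' ∈ LinearMap.range L := by
    intro m'
    obtain ⟨z, rfl⟩ := hφ.2 m'
    induction z using BC.induction with
    | h0 => rw [map_zero, map_zero]; exact Submodule.zero_mem _
    | ht b m =>
      rw [BC.lift_tmul, LinearMap.map_smulₛₗ]
      exact Submodule.smul_mem _ _ ⟨BC.tmul α'' 1 m, by rw [hL, h]⟩
    | ha x y hx hy => rw [map_add, map_add]; exact Submodule.add_mem _ hx hy
  intro m''
  obtain ⟨z, rfl⟩ := hφ'.2 m''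
  induction z using BC.induction with
  | h0 => rw [map_zero]; exact Submodule.zero_mem (LinearMap.range L)
  | ht b m =>
    rw [BC.lift_tmul]
    exact Submodule.smul_mem (LinearMap.range L) _ (h2 m)
  | ha x y hx hy => rw [map_add]; exact Submodule.add_mem (LinearMap.range L) hx hy

/-- An algebra structure map `A → A'` exhibits `A'` as the base change of `A`. -/
theorem IsBC.self {A A' : Type u} [CommRing A] [CommRing A'] {α : A →+* A'}
    (φ : A →ₛₗ[α] A') (hφ : ∀ a, φ a = α a) : IsBC φ := by
  have h : ∀ z, BC.lift (f := α) (γ := RingHom.id A') (τ := α) (fun _ => rfl) φ z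
      = BC.rid α z := by
    intro z
    induction z using BC.induction with
    | h0 => rw [map_zero, map_zero]
    | ht b m => rw [BC.lift_tmul, BC.rid_tmul, hφ, mul_comm]; rfl
    | ha x y hx hy => rw [map_add, map_add, hx, hy]
  have h' : ⇑(BC.lift (f := α) (γ := RingHom.id A') (τ := α) (fun _ => rfl) φ)
      = ⇑(BC.rid α) := funext h
  unfold IsBC
  rw [h']
  exact (BC.rid α).bijective
/-! ## Frames -/

/-- The ring-theoretic data attached to a ring `R` over which displays are defined: rings `A` and
`B` with the augmentation `ev : A → R`, the Frobenius `σ : A → B`, the restriction `res : A → B`,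
and the divided Frobenius `div`, which is only used on the augmentation ideal `ker ev`. -/
structure Frame (R : Type u) [CommRing R] where
  A : Type u
  B : Type u
  [ringA : CommRing A]
  [ringB : CommRing B]
  ev : A →+* R
  σ : A →+* B
  res : A →+* B
  div : A → B

attribute [instance] Frame.ringA Frame.ringB

/-- A morphism of frames over a ring homomorphism `f : R → S`. -/
structure Frame.Map {R S : Type u} [CommRing R] [CommRing S] (f : R →+* S)
    (F : Frame R) (F' : Frame S) where
  α : F.A →+* F'.A
  β : F.B →+* F'.B
  ev_comm : ∀ a, F'.ev (α a) = f (F.ev a)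
  σ_comm : ∀ a, β (F.σ a) = F'.σ (α a)
  res_comm : ∀ a, β (F.res a) = F'.res (α a)
  div_comm : ∀ a, β (F.div a) = F'.div (α a)

/-- A functorial choice of a frame for every ring. -/
structure FrameFunctor where
  frame : ∀ (R : Type u) [CommRing R], Frame R
  map : ∀ {R S : Type u} [CommRing R] [CommRing S] (f : R →+* S),
    Frame.Map f (frame R) (frame S)
  map_id_α : ∀ (R : Type u) [CommRing R] a, (map (RingHom.id R)).α a = a
  map_id_β : ∀ (R : Type u) [CommRing R] b, (map (RingHom.id R)).β b = b
  map_comp_α : ∀ {R S T : Type u} [CommRing R] [CommRing S] [CommRing T]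
    (f : R →+* S) (g : S →+* T) a, (map g).α ((map f).α a) = (map (g.comp f)).α a
  map_comp_β : ∀ {R S T : Type u} [CommRing R] [CommRing S] [CommRing T]
    (f : R →+* S) (g : S →+* T) b, (map g).β ((map f).β b) = (map (g.comp f)).β b

/-- The frames of (untruncated) `p`-typical Witt vectors: `A = B = W(R)`, `res = id`, `σ` is the
Witt vector Frobenius, and `div` is the inverse of the Verschiebung on `ker(W(R) → R)`. -/
noncomputable def wittFrames (p : ℕ) [Fact p.Prime] : FrameFunctor.{u} where
  frame R _ :=
    { A := WittVector p R
      B := WittVector p R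
      ev := WittVector.constantCoeff
      σ := WittVector.frobenius
      res := RingHom.id _
      div := fun x => x.shift 1 }
  map f :=
    { α := WittVector.map f
      β := WittVector.map f
      ev_comm := fun a => WittVector.map_coeff f a 0
      σ_comm := fun a => WittVector.frobenius_isPoly p |>.map f a
      res_comm := fun _ => rfl
      div_comm := fun a => by
        ext n
        simp only [WittVector.map_coeff, WittVector.shift_coeff] }
  map_id_α R _ a := by apply WittVector.ext; intro n; exact WittVector.map_coeff _ a n
  map_id_β R _ a := by apply WittVector.ext; intro n; exact WittVector.map_coeff _ a n
  map_comp_α f g a := by apply WittVector.ext; intro n; simp only [WittVector.map_coeff, RingHom.comp_apply]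
  map_comp_β f g a := by apply WittVector.ext; intro n; simp only [WittVector.map_coeff, RingHom.comp_apply]

section Truncated

variable (p : ℕ) [Fact p.Prime]

/-- A ring homomorphism on `W(R)` that kills the kernel of `W(R) → W_m(R)` descends to
`W_m(R)`. -/
noncomputable def truncLift (m : ℕ) {R C : Type u} [CommRing R] [CommRing C]
    (g : WittVector p R →+* C) (hg : ∀ x : WittVector p R, (∀ i < m, x.coeff i = 0) → g x = 0) :
    TruncatedWittVector p m R →+* C :=
  RingHom.liftOfSurjective (WittVector.truncate m) (WittVector.truncate_surjective p m R)
    ⟨g, fun x hx => hg x ((WittVector.mem_ker_truncate m x).1 hx)⟩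

theorem truncLift_truncate (m : ℕ) {R C : Type u} [CommRing R] [CommRing C]
    (g : WittVector p R →+* C) (hg : ∀ x : WittVector p R, (∀ i < m, x.coeff i = 0) → g x = 0)
    (x : WittVector p R) : truncLift p m g hg (WittVector.truncate m x) = g x :=
  RingHom.liftOfRightInverse_comp_apply _ _ _ _ x

/-- The augmentation `W_m(R) → R`, for `m ≥ 1`. -/
noncomputable def truncEv (m : ℕ) (hm : 0 < m) (R : Type u) [CommRing R] :
    TruncatedWittVector p m R →+* R :=
  truncLift p m WittVector.constantCoeff fun _ hx => hx 0 hm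

theorem frobenius_coeff_eq_zero {R : Type u} [CommRing R] (m n : ℕ) (h : n + 1 ≤ m)
    (x : WittVector p R) (hx : ∀ i < m, x.coeff i = 0) :
    WittVector.truncate n (WittVector.frobenius x) = 0 := by
  rw [WittVector.eq_iterate_verschiebung (n := n + 1) fun i hi => hx i (by omega),
    Function.iterate_succ_apply', WittVector.frobenius_verschiebung, map_mul]
  have : WittVector.truncate n (WittVector.verschiebung^[n] (x.shift (n + 1))) = 0 := by
    ext i
    rw [WittVector.coeff_truncate, WittVector.iterate_verschiebung_coeff_eq_zero _ i.2,
      TruncatedWittVector.coeff_zero]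
  rw [this, zero_mul]

/-- The Frobenius `W_m(R) → W_n(R)`, for `m ≥ n + 1`. -/
noncomputable def truncFrobenius (m n : ℕ) (h : n + 1 ≤ m) (R : Type u) [CommRing R] :
    TruncatedWittVector p m R →+* TruncatedWittVector p n R :=
  truncLift p m ((WittVector.truncate n).comp WittVector.frobenius)
    fun x hx => frobenius_coeff_eq_zero p m n h x hx

/-- The ring homomorphism `W_m(R) → W_m(S)` induced by `f : R → S`. -/
noncomputable def truncMap (m : ℕ) {R S : Type u} [CommRing R] [CommRing S] (f : R →+* S) :
    TruncatedWittVector p m R →+* TruncatedWittVector p m S :=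
  truncLift p m ((WittVector.truncate m).comp (WittVector.map f)) fun x hx => by
    ext i
    rw [RingHom.comp_apply, WittVector.coeff_truncate, WittVector.map_coeff, hx i i.2, map_zero,
      TruncatedWittVector.coeff_zero]

theorem truncMap_coeff (m : ℕ) {R S : Type u} [CommRing R] [CommRing S] (f : R →+* S)
    (x : TruncatedWittVector p m R) (i : Fin m) :
    (truncMap p m f x).coeff i = f (x.coeff i) := by
  obtain ⟨x, rfl⟩ := WittVector.truncate_surjective p m R x
  rw [truncMap, truncLift_truncate, RingHom.comp_apply, WittVector.coeff_truncate,
    WittVector.map_coeff, WittVector.coeff_truncate]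

theorem truncEv_truncate (m : ℕ) (hm : 0 < m) {R : Type u} [CommRing R] (x : WittVector p R) :
    truncEv p m hm R (WittVector.truncate m x) = x.coeff 0 :=
  truncLift_truncate p m WittVector.constantCoeff (fun _ hx => hx 0 hm) x

theorem truncMap_ev (m : ℕ) (hm : 0 < m) {R S : Type u} [CommRing R] [CommRing S] (f : R →+* S)
    (a : TruncatedWittVector p m R) :
    truncEv p m hm S (truncMap p m f a) = f (truncEv p m hm R a) := by
  obtain ⟨a, rfl⟩ := WittVector.truncate_surjective p m R a
  rw [truncMap, truncLift_truncate, RingHom.comp_apply, truncEv_truncate, truncEv_truncate]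
  exact WittVector.map_coeff f a 0

theorem truncMap_frobenius (m n : ℕ) (h : n + 1 ≤ m) {R S : Type u} [CommRing R] [CommRing S]
    (f : R →+* S) (a : TruncatedWittVector p m R) :
    truncMap p n f (truncFrobenius p m n h R a) = truncFrobenius p m n h S (truncMap p m f a) := by
  obtain ⟨a, rfl⟩ := WittVector.truncate_surjective p m R a
  rw [truncFrobenius, truncFrobenius, truncMap, truncMap, truncLift_truncate,
    truncLift_truncate, RingHom.comp_apply, RingHom.comp_apply, truncLift_truncate,
    truncLift_truncate, RingHom.comp_apply, RingHom.comp_apply]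
  exact congrArg _ (WittVector.frobenius_isPoly p |>.map f a)

theorem truncMap_id (m : ℕ) (R : Type u) [CommRing R] (a : TruncatedWittVector p m R) :
    truncMap p m (RingHom.id R) a = a := by
  ext i
  rw [truncMap_coeff, RingHom.id_apply]

theorem truncMap_comp (m : ℕ) {R S T : Type u} [CommRing R] [CommRing S] [CommRing T]
    (f : R →+* S) (g : S →+* T) (a : TruncatedWittVector p m R) :
    truncMap p m g (truncMap p m f a) = truncMap p m (g.comp f) a := by
  ext i
  rw [truncMap_coeff, truncMap_coeff, truncMap_coeff, RingHom.comp_apply]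

/-- The map `(x₀, x₁, …) ↦ (x₁, …, xₙ)`. On `ker(W_m(R) → R)` it is the divided Frobenius,
induced by the inverse of the Verschiebung. -/
def truncDiv (m n : ℕ) (h : n + 1 ≤ m) (R : Type u)
    (x : TruncatedWittVector p m R) : TruncatedWittVector p n R :=
  TruncatedWittVector.mk p fun i : Fin n => x.coeff ⟨i + 1, by omega⟩

theorem truncMap_div (m n : ℕ) (h : n + 1 ≤ m) {R S : Type u} [CommRing R] [CommRing S]
    (f : R →+* S) (a : TruncatedWittVector p m R) :
    truncMap p n f (truncDiv p m n h R a) = truncDiv p m n h S (truncMap p m f a) := by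
  ext i
  rw [truncMap_coeff, truncDiv, truncDiv, TruncatedWittVector.coeff_mk,
    TruncatedWittVector.coeff_mk, truncMap_coeff]

theorem truncMap_res (m n : ℕ) (h : n ≤ m) {R S : Type u} [CommRing R] [CommRing S]
    (f : R →+* S) (a : TruncatedWittVector p m R) :
    truncMap p n f (TruncatedWittVector.truncate h a)
      = TruncatedWittVector.truncate h (truncMap p m f a) := by
  ext i
  rw [truncMap_coeff, TruncatedWittVector.coeff_truncate, TruncatedWittVector.coeff_truncate,
    truncMap_coeff]

/-- The frames of truncated Witt vectors: `A = W_m(R)`, `B = W_n(R)` for `m ≥ n + 1`, where `res`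
is the restriction, `σ` is induced by the Witt vector Frobenius, and `div` is induced by the
inverse of the Verschiebung. -/
noncomputable def truncFrames (m n : ℕ) (h : n + 1 ≤ m) : FrameFunctor.{u} where
  frame R _ :=
    { A := TruncatedWittVector p m R
      B := TruncatedWittVector p n R
      ev := truncEv p m (by omega) R
      σ := truncFrobenius p m n h R
      res := TruncatedWittVector.truncate (by omega)
      div := truncDiv p m n h R }
  map f :=
    { α := truncMap p m f
      β := truncMap p n f
      ev_comm := truncMap_ev p m (by omega) f
      σ_comm := truncMap_frobenius p m n h f
      res_comm := truncMap_res p m n (by omega) f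
      div_comm := truncMap_div p m n h f }
  map_id_α R _ a := truncMap_id p m R a
  map_id_β R _ a := truncMap_id p n R a
  map_comp_α f g a := truncMap_comp p m f g a
  map_comp_β f g a := truncMap_comp p n f g a

end Truncated

theorem BC.map_id {A B : Type u} [CommRing A] [CommRing B] {f : A →+* B} {α : A →+* A}
    {β : B →+* B} (h : ∀ a, β (f a) = f (α a)) (hβ : ∀ b, β b = b) {M : Type u}
    [AddCommGroup M] [Module A M] (φ : M →ₛₗ[α] M) (hφ : ∀ m, φ m = m) (z : BC f M) :
    BC.map h φ z = z := by
  induction z using BC.induction f with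
  | h0 => rw [map_zero]
  | ht b m => rw [BC.map_tmul, hβ, hφ]
  | ha x y hx hy => rw [map_add, hx, hy]

theorem BC.map_map {A B A' B' A'' B'' : Type u} [CommRing A] [CommRing B] [CommRing A']
    [CommRing B'] [CommRing A''] [CommRing B''] {f : A →+* B} {f' : A' →+* B'} {f'' : A'' →+* B''}
    {α : A →+* A'} {β : B →+* B'} {α' : A' →+* A''} {β' : B' →+* B''} {α'' : A →+* A''}
    {β'' : B →+* B''} (h : ∀ a, β (f a) = f' (α a)) (h' : ∀ a, β' (f' a) = f'' (α' a))
    (h'' : ∀ a, β'' (f a) = f'' (α'' a)) (hβ : ∀ b, β' (β b) = β'' b) {M M' M'' : Type u}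
    [AddCommGroup M] [Module A M] [AddCommGroup M'] [Module A' M'] [AddCommGroup M'']
    [Module A'' M''] (φ : M →ₛₗ[α] M') (φ' : M' →ₛₗ[α'] M'') (φ'' : M →ₛₗ[α''] M'')
    (hφ : ∀ m, φ'' m = φ' (φ m)) (z : BC f M) :
    BC.map h'' φ'' z = BC.map h' φ' (BC.map h φ z) := by
  induction z using BC.induction f with
  | h0 => rw [map_zero, map_zero, map_zero]
  | ht b m => rw [BC.map_tmul, BC.map_tmul, BC.map_tmul, hβ, hφ]
  | ha x y hx hy => rw [map_add, map_add, map_add, hx, hy]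


/-! ## The module attached to a pair -/

section Tilde

variable {R : Type u} [CommRing R] (F : Frame R) {M : Type u} [AddCommGroup M] [Module F.A M]

/-- The relations `F₁(a m) = div(a) F(m)` for `a ∈ ker ev` and `m ∈ M`. -/
noncomputable def tildeRel (M1 : Submodule F.A M) : Submodule F.B (BC F.σ M1 × BC F.σ M) :=
  Submodule.span F.B {z | ∃ (a : F.A) (m : M) (x : M1), F.ev a = 0 ∧ (x : M) = a • m ∧
    z = (BC.mk F.σ x, -(F.div a • BC.mk F.σ m))}

/-- The `B`-module `M̃₁` attached to a pair `(M, M₁)`: the universal target of `σ`-linear maps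
`F₁ : M₁ → M̃₁` and `F : M → M̃₁` with `F₁(a m) = div(a) F(m)` for `a` in the augmentation ideal.
(In particular `F(x) = p F₁(x)` for `x ∈ M₁`, as follows from `div(V 1) = 1` and `σ(V 1) = p`.)
For a normal decomposition `M = L ⊕ T`, `M₁ = L ⊕ I T`, the maps `F₁` on `L` and `F` on `T` induce
an isomorphism `L^σ ⊕ T^σ ≅ M̃₁`, and the maps induced by morphisms of pairs are given by the
matrices `(a^σ, p b^σ; c^{σ,div}, d^σ)`. -/
def Tilde (M1 : Submodule F.A M) : Type u := (BC F.σ M1 × BC F.σ M) ⧸ tildeRel F M1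

namespace Tilde

variable (M1 : Submodule F.A M)

noncomputable instance : AddCommGroup (Tilde F M1) := Submodule.Quotient.addCommGroup _

noncomputable instance : Module F.B (Tilde F M1) := Submodule.Quotient.module _

/-- The `σ`-linear map `F₁ : M₁ → M̃₁`. -/
noncomputable def F1 : M1 →ₛₗ[F.σ] Tilde F M1 :=
  ((tildeRel F M1).mkQ.comp (LinearMap.inl F.B _ _)).comp (BC.mk F.σ)

/-- The `σ`-linear map `F : M → M̃₁`. -/
noncomputable def F0 : M →ₛₗ[F.σ] Tilde F M1 :=
  ((tildeRel F M1).mkQ.comp (LinearMap.inr F.B _ _)).comp (BC.mk F.σ)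

theorem F1_smul (a : F.A) (ha : F.ev a = 0) (m : M) (x : M1) (hx : (x : M) = a • m) :
    F1 F M1 x = F.div a • F0 F M1 m := by
  have h : (BC.mk F.σ x, -(F.div a • BC.mk F.σ m)) ∈ tildeRel F M1 :=
    Submodule.subset_span ⟨a, m, x, ha, hx, rfl⟩
  have h2 : (tildeRel F M1).mkQ (BC.mk F.σ x, 0)
      = (tildeRel F M1).mkQ (F.div a • ((0, BC.mk F.σ m) : BC F.σ M1 × BC F.σ M)) := by
    rw [← sub_eq_zero, ← map_sub, Submodule.mkQ_apply, Submodule.Quotient.mk_eq_zero]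
    convert h using 1
    ext <;> simp
  rw [map_smul] at h2
  exact h2

variable {F M1}

/-- The universal property of `M̃₁`. -/
noncomputable def lift {C : Type u} [CommRing C] {γ : F.B →+* C} {τ : F.A →+* C}
    (h : ∀ a, γ (F.σ a) = τ a) {N : Type u} [AddCommGroup N] [Module C N]
    (f1 : M1 →ₛₗ[τ] N) (f0 : M →ₛₗ[τ] N)
    (hf : ∀ (a : F.A) (m : M) (x : M1), F.ev a = 0 → (x : M) = a • m →
      f1 x = γ (F.div a) • f0 m) : Tilde F M1 →ₛₗ[γ] N :=
  (tildeRel F M1).liftQ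
    ((BC.lift h f1).comp (LinearMap.fst F.B _ _) + (BC.lift h f0).comp (LinearMap.snd F.B _ _))
    (by
      rw [tildeRel, Submodule.span_le]
      rintro z ⟨a, m, x, ha, hx, rfl⟩
      rw [SetLike.mem_coe, LinearMap.mem_ker, LinearMap.add_apply, LinearMap.comp_apply,
        LinearMap.comp_apply, LinearMap.fst_apply, LinearMap.snd_apply, map_neg,
        LinearMap.map_smulₛₗ, BC.mk_apply, BC.mk_apply, BC.lift_tmul, BC.lift_tmul, map_one,
        one_smul, one_smul, hf a m x ha hx, add_neg_cancel])

theorem lift_F1 {C : Type u} [CommRing C] {γ : F.B →+* C} {τ : F.A →+* C}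
    (h : ∀ a, γ (F.σ a) = τ a) {N : Type u} [AddCommGroup N] [Module C N]
    (f1 : M1 →ₛₗ[τ] N) (f0 : M →ₛₗ[τ] N)
    (hf : ∀ (a : F.A) (m : M) (x : M1), F.ev a = 0 → (x : M) = a • m →
      f1 x = γ (F.div a) • f0 m) (x : M1) : lift h f1 f0 hf (F1 F M1 x) = f1 x := by
  change (BC.lift h f1) (BC.tmul F.σ 1 x) + (BC.lift h f0) 0 = _
  rw [map_zero, add_zero, BC.lift_tmul, map_one, one_smul]

theorem lift_F0 {C : Type u} [CommRing C] {γ : F.B →+* C} {τ : F.A →+* C}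
    (h : ∀ a, γ (F.σ a) = τ a) {N : Type u} [AddCommGroup N] [Module C N]
    (f1 : M1 →ₛₗ[τ] N) (f0 : M →ₛₗ[τ] N)
    (hf : ∀ (a : F.A) (m : M) (x : M1), F.ev a = 0 → (x : M) = a • m →
      f1 x = γ (F.div a) • f0 m) (m : M) : lift h f1 f0 hf (F0 F M1 m) = f0 m := by
  change (BC.lift h f1) 0 + (BC.lift h f0) (BC.tmul F.σ 1 m) = _
  rw [map_zero, zero_add, BC.lift_tmul, map_one, one_smul]

theorem ext {C : Type u} [CommRing C] {γ : F.B →+* C} {N : Type u} [AddCommGroup N] [Module C N]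
    {k k' : Tilde F M1 →ₛₗ[γ] N} (h1 : ∀ x, k (F1 F M1 x) = k' (F1 F M1 x))
    (h0 : ∀ m, k (F0 F M1 m) = k' (F0 F M1 m)) : k = k' := by
  ext z
  obtain ⟨⟨z1, z0⟩, rfl⟩ := Submodule.Quotient.mk_surjective _ z
  have e1 : (k.comp ((tildeRel F M1).mkQ.comp (LinearMap.inl F.B _ _)))
      = (k'.comp ((tildeRel F M1).mkQ.comp (LinearMap.inl F.B _ _))) := BC.ext h1
  have e0 : (k.comp ((tildeRel F M1).mkQ.comp (LinearMap.inr F.B _ _)))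
      = (k'.comp ((tildeRel F M1).mkQ.comp (LinearMap.inr F.B _ _))) := BC.ext h0
  have hz : (Submodule.Quotient.mk (z1, z0) : Tilde F M1)
      = (tildeRel F M1).mkQ.comp (LinearMap.inl F.B _ _) z1
        + (tildeRel F M1).mkQ.comp (LinearMap.inr F.B _ _) z0 := by
    rw [LinearMap.comp_apply, LinearMap.comp_apply, ← map_add, LinearMap.inl_apply,
      LinearMap.inr_apply, Prod.mk_add_mk, add_zero, zero_add]
    rfl
  rw [hz]
  refine (map_add k _ _).trans (Eq.trans ?_ (map_add k' _ _).symm)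
  exact congrArg₂ (· + ·) (LinearMap.congr_fun e1 z1) (LinearMap.congr_fun e0 z0)

/-- The map `M̃₁ → M̃₁'` induced by a semilinear map `φ : M → M'` with `φ(M₁) ⊆ M₁'`; it sends
`F₁(x)` to `F₁(φ(x))` and `F(m)` to `F(φ(m))`. -/
noncomputable def map {S : Type u} [CommRing S] {F' : Frame S} {α : F.A →+* F'.A}
    {β : F.B →+* F'.B} (hσ : ∀ a, β (F.σ a) = F'.σ (α a)) (hd : ∀ a, β (F.div a) = F'.div (α a))
    (hev : ∀ a, F.ev a = 0 → F'.ev (α a) = 0)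
    {M' : Type u} [AddCommGroup M'] [Module F'.A M'] {M1' : Submodule F'.A M'}
    (φ : M →ₛₗ[α] M') (hφ : ∀ x ∈ M1, φ x ∈ M1') : Tilde F M1 →ₛₗ[β] Tilde F' M1' :=
  lift (τ := F'.σ.comp α) hσ
    { toFun := fun x => F1 F' M1' ⟨φ x, hφ x x.2⟩
      map_add' := fun x y => by
        rw [← map_add]
        congr 1
        exact Subtype.ext (map_add φ _ _)
      map_smul' := fun a x => by
        refine Eq.trans (congrArg _ ?_) (LinearMap.map_smulₛₗ (F1 F' M1') (α a) _)
        exact Subtype.ext (LinearMap.map_smulₛₗ φ a (x : M)) }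
    { toFun := fun m => F0 F' M1' (φ m)
      map_add' := fun m n => by rw [map_add, map_add]
      map_smul' := fun a m => by
        rw [LinearMap.map_smulₛₗ, LinearMap.map_smulₛₗ]; rfl }
    (fun a m x ha hx => by
      rw [hd]
      exact F1_smul F' M1' (α a) (hev a ha) (φ m) _ (by
        change φ (x : M) = _
        rw [hx, LinearMap.map_smulₛₗ]))

theorem map_F1 {S : Type u} [CommRing S] {F' : Frame S} {α : F.A →+* F'.A}
    {β : F.B →+* F'.B} (hσ : ∀ a, β (F.σ a) = F'.σ (α a)) (hd : ∀ a, β (F.div a) = F'.div (α a))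
    (hev : ∀ a, F.ev a = 0 → F'.ev (α a) = 0)
    {M' : Type u} [AddCommGroup M'] [Module F'.A M'] {M1' : Submodule F'.A M'}
    (φ : M →ₛₗ[α] M') (hφ : ∀ x ∈ M1, φ x ∈ M1') (x : M1) :
    map hσ hd hev φ hφ (F1 F M1 x) = F1 F' M1' ⟨φ x, hφ x x.2⟩ :=
  lift_F1 _ _ _ _ x

theorem map_F0 {S : Type u} [CommRing S] {F' : Frame S} {α : F.A →+* F'.A}
    {β : F.B →+* F'.B} (hσ : ∀ a, β (F.σ a) = F'.σ (α a)) (hd : ∀ a, β (F.div a) = F'.div (α a))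
    (hev : ∀ a, F.ev a = 0 → F'.ev (α a) = 0)
    {M' : Type u} [AddCommGroup M'] [Module F'.A M'] {M1' : Submodule F'.A M'}
    (φ : M →ₛₗ[α] M') (hφ : ∀ x ∈ M1, φ x ∈ M1') (m : M) :
    map hσ hd hev φ hφ (F0 F M1 m) = F0 F' M1' (φ m) :=
  lift_F0 _ _ _ _ m

/-- The linear map `M̃₁ → M̃₁'` induced by a morphism of pairs. -/
noncomputable def mapL {M' : Type u} [AddCommGroup M'] [Module F.A M'] {M1' : Submodule F.A M'}
    (φ : M →ₗ[F.A] M') (hφ : ∀ x ∈ M1, φ x ∈ M1') : Tilde F M1 →ₗ[F.B] Tilde F M1' :=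
  map (α := RingHom.id F.A) (β := RingHom.id F.B) (fun _ => rfl) (fun _ => rfl) (fun _ h => h)
    φ hφ

end Tilde

end Tilde

/-! ## Chains of pairs -/

/-- A submodule is a direct summand, of constant rank `r`. -/
def IsSummandOfRank {k P : Type u} [CommRing k] [AddCommGroup P] [Module k P]
    (N : Submodule k P) (r : ℤ) : Prop :=
  (∃ C : Submodule k P, IsCompl N C) ∧ ∀ x : PrimeSpectrum k, (Module.rankAtStalk N x : ℤ) = r

/-- The ring homomorphism `A → R/pR`. -/
def Frame.evModP {R : Type u} [CommRing R] (F : Frame R) (p : ℕ) :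
    F.A →+* R ⧸ Ideal.span {(p : R)} :=
  (Ideal.Quotient.mk _).comp F.ev

/-- A chain of pairs of type `(2g, J, g)` over the frame `F`: a chain
`((M_i)_i, (ρ_{i,j})_{i ≤ j}, (θ_i)_i)` of type `(2g, J)` together with submodules `M_{i,1} ⊆ M_i`.
The isomorphism `θ_i : M_i → M_{i+2g}` is written `θ i j h` with `h : j = i + 2g`. -/
structure PairChain (p g : ℕ) (J : Set ℤ) {R : Type u} [CommRing R] (F : Frame R) where
  M : J → Type u
  [grp : ∀ i, AddCommGroup (M i)]
  [mod : ∀ i, Module F.A (M i)]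
  ρ : ∀ i j : J, (i : ℤ) ≤ j → M i →ₗ[F.A] M j
  θ : ∀ i j : J, (j : ℤ) = i + 2 * g → M i ≃ₗ[F.A] M j
  M1 : ∀ i, Submodule F.A (M i)
  finite : ∀ i, Module.Finite F.A (M i)
  projective : ∀ i, Module.Projective F.A (M i)
  rank : ∀ i (x : PrimeSpectrum F.A), Module.rankAtStalk (M i) x = 2 * g
  ρ_refl : ∀ i x, ρ i i le_rfl x = x
  ρ_trans : ∀ (i j k : J) (hij : (i : ℤ) ≤ j) (hjk : (j : ℤ) ≤ k) x,
    ρ j k hjk (ρ i j hij x) = ρ i k (hij.trans hjk) x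
  /-- modulo `p` and the augmentation ideal, `ρ_{i,j}` has constant rank `2g - (j - i)` -/
  ρ_rank : ∀ (i j : J) (hij : (i : ℤ) ≤ j), (j : ℤ) ≤ i + 2 * g →
    IsSummandOfRank (LinearMap.range (BC.mapL (F.evModP p) (ρ i j hij))) (2 * g - (j - i))
  θ_ρ : ∀ (i j i' j' : J) (hij : (i : ℤ) ≤ j) (hi : (i' : ℤ) = i + 2 * g)
    (hj : (j' : ℤ) = j + 2 * g) (hij' : (i' : ℤ) ≤ j') x,
    θ j j' hj (ρ i j hij x) = ρ i' j' hij' (θ i i' hi x)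
  ρ_eq_p_θ : ∀ (i j : J) (hij : (i : ℤ) ≤ j) (h : (j : ℤ) = i + 2 * g) x,
    ρ i j hij x = (p : F.A) • θ i j h x
  /-- `I M_i ⊆ M_{i,1}` -/
  smul_mem_M1 : ∀ i (a : F.A) (m : M i), F.ev a = 0 → a • m ∈ M1 i
  /-- `M_{i,1} / I M_i ⊆ M_i / I M_i = R ⊗ M_i` is a direct summand of rank `g` -/
  M1_summand : ∀ i, IsSummandOfRank (Submodule.span R (BC.mk F.ev '' (M1 i : Set (M i)))) g
  ρ_M1 : ∀ (i j : J) (hij : (i : ℤ) ≤ j), ∀ x ∈ M1 i, ρ i j hij x ∈ M1 j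
  θ_M1 : ∀ (i j : J) (h : (j : ℤ) = i + 2 * g) x, θ i j h x ∈ M1 j ↔ x ∈ M1 i

attribute [instance] PairChain.grp PairChain.mod

/-- `(i, j)` is an edge of `J`: `i < j` are consecutive elements of `J`. -/
def IsEdge {J : Set ℤ} (i j : J) : Prop := (i : ℤ) < j ∧ ∀ k : J, (k : ℤ) ≤ i ∨ (j : ℤ) ≤ k

theorem IsEdge.le {J : Set ℤ} {i j : J} (h : IsEdge i j) : (i : ℤ) ≤ j := h.1.le

namespace PairChain

variable {p g : ℕ} {J : Set ℤ} {R : Type u} [CommRing R] {F : Frame R}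

section

variable (c : PairChain p g J F)

/-- The `B`-module `M̃_{i,1}`. -/
abbrev T (i : J) : Type u := Tilde F (c.M1 i)

/-- The `B`-module `B ⊗_A M_i`. -/
abbrev N (i : J) : Type u := BC F.res (c.M i)

/-- `ρ̃_{i,j} : M̃_{i,1} → M̃_{j,1}` -/
noncomputable def tρ (i j : J) (h : (i : ℤ) ≤ j) : c.T i →ₗ[F.B] c.T j :=
  Tilde.mapL (c.ρ i j h) (c.ρ_M1 i j h)

/-- `θ̃_i : M̃_{i,1} → M̃_{i+2g,1}` -/
noncomputable def tθ (i j : J) (h : (j : ℤ) = i + 2 * g) : c.T i →ₗ[F.B] c.T j :=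
  Tilde.mapL (c.θ i j h).toLinearMap (fun x hx => (c.θ_M1 i j h x).2 hx)

/-- `ρ_{i,j} : B ⊗ M_i → B ⊗ M_j` -/
noncomputable def rρ (i j : J) (h : (i : ℤ) ≤ j) : c.N i →ₗ[F.B] c.N j :=
  BC.mapL F.res (c.ρ i j h)

/-- `θ_i : B ⊗ M_i → B ⊗ M_{i+2g}` -/
noncomputable def rθ (i j : J) (h : (j : ℤ) = i + 2 * g) : c.N i →ₗ[F.B] c.N j :=
  BC.mapL F.res (c.θ i j h).toLinearMap

end

/-- A morphism of chains of pairs over a morphism of frames that exhibits the target as the base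
change of the source: `M'_i = A' ⊗_A M_i`, and `M'_{i,1}/I' M'_i` is the base change of
`M_{i,1}/I M_i`. Over the identity these are the isomorphisms of chains of pairs. -/
@[ext]
structure Hom {S : Type u} [CommRing S] {F' : Frame S} {f : R →+* S} (T : Frame.Map f F F')
    (c : PairChain p g J F) (c' : PairChain p g J F') where
  φ : ∀ i, c.M i →ₛₗ[T.α] c'.M i
  isBC : ∀ i, IsBC (φ i)
  φ_ρ : ∀ (i j : J) (h : (i : ℤ) ≤ j) x, φ j (c.ρ i j h x) = c'.ρ i j h (φ i x)
  φ_θ : ∀ (i j : J) (h : (j : ℤ) = i + 2 * g) x, φ j (c.θ i j h x) = c'.θ i j h (φ i x)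
  φ_M1 : ∀ i, c'.M1 i = Submodule.span F'.A
    (φ i '' (c.M1 i : Set (c.M i)) ∪ {y | ∃ (a : F'.A) (m : c'.M i), F'.ev a = 0 ∧ y = a • m})

namespace Hom

variable {S : Type u} [CommRing S] {F' : Frame S} {f : R →+* S} {T : Frame.Map f F F'}
  {c : PairChain p g J F} {c' : PairChain p g J F'}

theorem mem_M1 (h : Hom T c c') (i : J) : ∀ x ∈ c.M1 i, h.φ i x ∈ c'.M1 i := fun x hx => by
  rw [h.φ_M1 i]
  exact Submodule.subset_span (Or.inl ⟨x, hx, rfl⟩)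

/-- The induced map `M̃_{i,1} → M̃'_{i,1}`. -/
noncomputable def tφ (h : Hom T c c') (i : J) : c.T i →ₛₗ[T.β] c'.T i :=
  Tilde.map T.σ_comm T.div_comm (fun a ha => by rw [T.ev_comm, ha, map_zero]) (h.φ i) (h.mem_M1 i)

/-- The induced map `B ⊗ M_i → B' ⊗ M'_i`. -/
noncomputable def rφ (h : Hom T c c') (i : J) : c.N i →ₛₗ[T.β] c'.N i :=
  BC.map T.res_comm (h.φ i)

theorem tφ_tρ (h : Hom T c c') (i j : J) (hij : (i : ℤ) ≤ j) (x : c.T i) :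
    h.tφ j (c.tρ i j hij x) = c'.tρ i j hij (h.tφ i x) := by
  have e : (h.tφ j).comp (c.tρ i j hij) = (c'.tρ i j hij).comp (h.tφ i) := by
    refine Tilde.ext (fun x => ?_) (fun m => ?_)
    · simp only [LinearMap.comp_apply, tφ, tρ, Tilde.mapL, Tilde.map_F1]
      congr 1
      exact Subtype.ext (h.φ_ρ i j hij x)
    · simp only [LinearMap.comp_apply, tφ, tρ, Tilde.mapL, Tilde.map_F0, h.φ_ρ]
  exact LinearMap.congr_fun e x

/-- The identity morphism, over a morphism of frames `T` that is the identity. -/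
noncomputable def id {f : R →+* R} (T : Frame.Map f F F) (hT : ∀ a, T.α a = a)
    (c : PairChain p g J F) : Hom T c c where
  φ i :=
    { toFun := fun x => x
      map_add' := fun _ _ => rfl
      map_smul' := fun a x => by rw [hT] }
  isBC i := IsBC.id hT _ fun _ => rfl
  φ_ρ _ _ _ _ := rfl
  φ_θ _ _ _ _ := rfl
  φ_M1 i := by
    apply le_antisymm
    · intro x hx
      exact Submodule.subset_span (Or.inl ⟨x, hx, rfl⟩)
    · rw [Submodule.span_le]
      rintro y (⟨x, hx, rfl⟩ | ⟨a, m, ha, rfl⟩)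
      · exact hx
      · exact c.smul_mem_M1 i a m ha

theorem tφ_id {f : R →+* R} (T : Frame.Map f F F) (hT : ∀ a, T.α a = a) (hT' : ∀ b, T.β b = b)
    (c : PairChain p g J F) (i : J) (x : c.T i) : (Hom.id T hT c).tφ i x = x := by
  obtain ⟨α, β, h1, h2, h3, h4⟩ := T
  obtain rfl : β = RingHom.id F.B := RingHom.ext hT'
  have e : (Hom.id ⟨α, RingHom.id F.B, h1, h2, h3, h4⟩ hT c).tφ i = LinearMap.id := by
    refine Tilde.ext (fun x => ?_) (fun m => ?_)
    · rw [tφ, Tilde.map_F1]; rfl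
    · rw [tφ, Tilde.map_F0]; rfl
  exact LinearMap.congr_fun e x

theorem rφ_id {f : R →+* R} (T : Frame.Map f F F) (hT : ∀ a, T.α a = a) (hT' : ∀ b, T.β b = b)
    (c : PairChain p g J F) (i : J) (x : c.N i) : (Hom.id T hT c).rφ i x = x := by
  obtain ⟨α, β, h1, h2, h3, h4⟩ := T
  obtain rfl : β = RingHom.id F.B := RingHom.ext hT'
  have e : (Hom.id ⟨α, RingHom.id F.B, h1, h2, h3, h4⟩ hT c).rφ i = LinearMap.id := by
    refine BC.ext fun m => ?_
    rw [rφ, BC.map_tmul, map_one]; rfl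
  exact LinearMap.congr_fun e x

section Comp

variable {S' : Type u} [CommRing S'] {F'' : Frame S'} {f' : S →+* S'} {f'' : R →+* S'}
  {T' : Frame.Map f' F' F''} {T'' : Frame.Map f'' F F''} {c'' : PairChain p g J F''}

/-- The composite of two morphisms, over a morphism of frames `T''` that is the composite of `T`
and `T'`. -/
noncomputable def comp (hα : ∀ a, T'.α (T.α a) = T''.α a) (h : Hom T c c') (h' : Hom T' c' c'') :
    Hom T'' c c'' where
  φ i :=
    { toFun := fun x => h'.φ i (h.φ i x)
      map_add' := fun x y => by rw [map_add, map_add]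
      map_smul' := fun a x => by rw [LinearMap.map_smulₛₗ, LinearMap.map_smulₛₗ, hα] }
  isBC i := IsBC.comp hα (fun _ => rfl) (h.isBC i) (h'.isBC i)
  φ_ρ i j hij x := by
    change h'.φ j (h.φ j _) = c''.ρ i j hij (h'.φ i (h.φ i x))
    rw [h.φ_ρ, h'.φ_ρ]
  φ_θ i j hij x := by
    change h'.φ j (h.φ j _) = c''.θ i j hij (h'.φ i (h.φ i x))
    rw [h.φ_θ, h'.φ_θ]
  φ_M1 i := by
    apply le_antisymm
    · rw [h'.φ_M1 i, Submodule.span_le]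
      rintro y (⟨x, hx, rfl⟩ | ⟨a, m, ha, rfl⟩)
      · rw [h.φ_M1 i] at hx
        induction hx using Submodule.span_induction with
        | mem x hx =>
          obtain ⟨z, hz, rfl⟩ | ⟨a, m, ha, rfl⟩ := hx
          · exact Submodule.subset_span (Or.inl ⟨z, hz, rfl⟩)
          · refine Submodule.subset_span (Or.inr ⟨T'.α a, h'.φ i m, ?_, ?_⟩)
            · rw [T'.ev_comm, ha, map_zero]
            · rw [LinearMap.map_smulₛₗ]
        | zero => rw [map_zero]; exact Submodule.zero_mem _
        | add x y _ _ hx hy => rw [map_add]; exact Submodule.add_mem _ hx hy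
        | smul a x _ hx => rw [LinearMap.map_smulₛₗ]; exact Submodule.smul_mem _ _ hx
      · exact Submodule.subset_span (Or.inr ⟨a, m, ha, rfl⟩)
    · rw [Submodule.span_le]
      rintro y (⟨x, hx, rfl⟩ | ⟨a, m, ha, rfl⟩)
      · exact h'.mem_M1 i _ (h.mem_M1 i x hx)
      · exact c''.smul_mem_M1 i a m ha

theorem tφ_comp (hα : ∀ a, T'.α (T.α a) = T''.α a) (hβ : ∀ a, T'.β (T.β a) = T''.β a)
    (h : Hom T c c') (h' : Hom T' c' c'') (i : J) (x : c.T i) :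
    (Hom.comp (T'' := T'') hα h h').tφ i x = h'.tφ i (h.tφ i x) := by
  let k : c.T i →ₛₗ[T''.β] c''.T i :=
    { toFun := fun x => h'.tφ i (h.tφ i x)
      map_add' := fun x y => by rw [map_add, map_add]
      map_smul' := fun a x => by rw [LinearMap.map_smulₛₗ, LinearMap.map_smulₛₗ, hβ] }
  have hk : ∀ x, k x = h'.tφ i (h.tφ i x) := fun _ => rfl
  have e : (Hom.comp (T'' := T'') hα h h').tφ i = k := by
    refine Tilde.ext (fun x => ?_) (fun m => ?_)
    · rw [hk, tφ, tφ, tφ, Tilde.map_F1, Tilde.map_F1, Tilde.map_F1]; rfl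
    · rw [hk, tφ, tφ, tφ, Tilde.map_F0, Tilde.map_F0, Tilde.map_F0]; rfl
  exact LinearMap.congr_fun e x

theorem rφ_comp (hα : ∀ a, T'.α (T.α a) = T''.α a) (hβ : ∀ a, T'.β (T.β a) = T''.β a)
    (h : Hom T c c') (h' : Hom T' c' c'') (i : J) (x : c.N i) :
    (Hom.comp (T'' := T'') hα h h').rφ i x = h'.rφ i (h.rφ i x) := by
  let k : c.N i →ₛₗ[T''.β] c''.N i :=
    { toFun := fun x => h'.rφ i (h.rφ i x)
      map_add' := fun x y => by rw [map_add, map_add]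
      map_smul' := fun a x => by rw [LinearMap.map_smulₛₗ, LinearMap.map_smulₛₗ, hβ] }
  have hk : ∀ x, k x = h'.rφ i (h.rφ i x) := fun _ => rfl
  have e : (Hom.comp (T'' := T'') hα h h').rφ i = k := by
    refine BC.ext fun m => ?_
    rw [hk, rφ, rφ, rφ, BC.map_tmul, BC.map_tmul, BC.map_tmul, map_one, map_one, map_one]; rfl
  exact LinearMap.congr_fun e x

end Comp

end Hom

end PairChain

/-! ## Divided Frobenius and polarizations -/

section Frobenius

variable {p g : ℕ} {J : Set ℤ} {R : Type u} [CommRing R] {F : Frame R}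

/-- The divided Frobenius of a chain of displays: an isomorphism of chains
`(Ψ_i)_i : (M̃_{i,1}, ρ̃_{i,j}, θ̃_i) → (B ⊗ M_i, ρ_{i,j}, θ_i)`. -/
@[ext]
structure FullFrob (c : PairChain p g J F) where
  Ψ : ∀ i, c.T i ≃ₗ[F.B] c.N i
  Ψ_ρ : ∀ (i j : J) (h : (i : ℤ) ≤ j) x, Ψ j (c.tρ i j h x) = c.rρ i j h (Ψ i x)
  Ψ_θ : ∀ (i j : J) (h : (j : ℤ) = i + 2 * g) x, Ψ j (c.tθ i j h x) = c.rθ i j h (Ψ i x)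

/-- The divided Frobenius of a `(m, 1-rdt)`-truncated chain of displays: an isomorphism
`(Ψ_e)_e` between the `1-rdt`-truncations `(ker ρ̃_{i,j})_{e = (i,j)}` and
`(ker ρ_{i,j})_{e = (i,j)}`, compatible with the isomorphisms `θ_e`. -/
@[ext]
structure RdtFrob (c : PairChain p g J F) where
  Ψ : ∀ (i j : J) (e : IsEdge i j),
    LinearMap.ker (c.tρ i j e.le) ≃ₗ[F.B] LinearMap.ker (c.rρ i j e.le)
  Ψ_θ : ∀ (i j i' j' : J) (e : IsEdge i j) (e' : IsEdge i' j') (hi : (i' : ℤ) = i + 2 * g),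
    (j' : ℤ) = j + 2 * g →
    ∀ (x : LinearMap.ker (c.tρ i j e.le)) (y : LinearMap.ker (c.tρ i' j' e'.le)),
      (y : c.T i') = c.tθ i i' hi x → (Ψ i' j' e' y : c.N i') = c.rθ i i' hi (Ψ i j e x)

/-- A polarization of a chain of pairs with values in an invertible module `I`, i.e. an
antisymmetric isomorphism of chains of pairs `(λ_i)_i` from `(M_i, M_{i,1})_i` to
`I ⊗ (M_{-i}^∨, M_{-i,1}^*)_i`. Here `λ_i : M_i → I ⊗ M_{-i}^∨ = Hom(M_{-i}, I)` is written
as a bilinear map `lam i j h : M_i × M_j → I` with `h : i + j = 0`. -/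
structure IsPairPolarization (c : PairChain p g J F) {I : Type u} [AddCommGroup I] [Module F.A I]
    (lam : ∀ i j : J, (i : ℤ) + j = 0 → c.M i →ₗ[F.A] c.M j →ₗ[F.A] I) : Prop where
  bijective : ∀ i j h, Function.Bijective (lam i j h)
  antisymm : ∀ (i j : J) (h : (i : ℤ) + j = 0) (h' : (j : ℤ) + i = 0) x y,
    lam j i h' y x = -lam i j h x y
  ρ_compat : ∀ (i j i' j' : J) (hi : (i : ℤ) + i' = 0) (hj : (j : ℤ) + j' = 0)
    (hij : (i : ℤ) ≤ j) (hij' : (j' : ℤ) ≤ i') x y,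
    lam j j' hj (c.ρ i j hij x) y = lam i i' hi x (c.ρ j' i' hij' y)
  θ_compat : ∀ (i j i' j' : J) (hi : (i : ℤ) + i' = 0) (hj : (j : ℤ) + j' = 0)
    (hij : (j : ℤ) = i + 2 * g) (hij' : (i' : ℤ) = j' + 2 * g) x y,
    lam j j' hj (c.θ i j hij x) y = lam i i' hi x (c.θ j' i' hij' y)
  /-- `λ_i(M_{i,1}) = I ⊗ M_{-i,1}^*`, where `M_{-i,1}^*` consists of the linear forms on `M_{-i}`
  that map `M_{-i,1}` into the augmentation ideal -/
  M1_compat : ∀ i j h x, x ∈ c.M1 i ↔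
    ∀ y ∈ c.M1 j, lam i j h x y ∈ RingHom.ker F.ev • (⊤ : Submodule F.A I)

/-- The bilinear map `μ : M̃₁ × M̃₁' → I^σ` is the one induced by `l : M × M' → I` through the
compatibility of `M̃₁` with duals and twists, i.e. it corresponds to
`l̃ : M̃₁ → (I ⊗ M₁'^*)^~ ≅ I^σ ⊗ M̃₁'^∨`. It is determined by its values on the generators. -/
structure IsTildePairing {M M' I : Type u} [AddCommGroup M] [Module F.A M] [AddCommGroup M']
    [Module F.A M'] [AddCommGroup I] [Module F.A I] {M1 : Submodule F.A M}
    {M1' : Submodule F.A M'} (l : M →ₗ[F.A] M' →ₗ[F.A] I)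
    (μ : Tilde F M1 →ₗ[F.B] Tilde F M1' →ₗ[F.B] BC F.σ I) (p : ℕ) : Prop where
  F0_F0 : ∀ x y, μ (Tilde.F0 F M1 x) (Tilde.F0 F M1' y) = (p : F.B) • BC.mk F.σ (l x y)
  F1_F0 : ∀ (x : M1) y, μ (Tilde.F1 F M1 x) (Tilde.F0 F M1' y) = BC.mk F.σ (l x y)
  F0_F1 : ∀ x (y : M1'), μ (Tilde.F0 F M1 x) (Tilde.F1 F M1' y) = BC.mk F.σ (l x y)
  /-- on `M₁ × M₁'`, where `l` has values in the product of the augmentation ideal and `I`, it is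
  given by the divided Frobenius -/
  F1_F1 : ∀ (x : M1) (y : M1') (k : ℕ) (a : Fin k → F.A) (e : Fin k → I),
    (∀ s, F.ev (a s) = 0) → l x y = ∑ s, a s • e s →
    μ (Tilde.F1 F M1 x) (Tilde.F1 F M1' y) = ∑ s, F.div (a s) • BC.mk F.σ (e s)

/-- The two kinds of divided Frobenius. -/
inductive FrobKind
  | full
  | rdt

/-- The type of divided Frobenii on a chain of pairs. -/
def Frob : FrobKind → PairChain p g J F → Type u
  | .full, c => FullFrob c
  | .rdt, c => RdtFrob c

/-- The pairings `(λ_i)_i` are compatible with the divided Frobenius and `ι : I^σ → B ⊗ I`,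
i.e. `(λ_i)_i` is a morphism from the chain of displays to the `(I, ι)`-twist of its dual. In the
case `1-rdt` the pairing between `N_e = ker ρ_{i,j}` and `N_{-e} = ker ρ_{-j,-i}` is induced by
`λ_i` through the isomorphism `N_{-e} ≅ coker ρ_{-j,-i}`, under which `y ∈ N_{-e}` corresponds to
the class of `z ∈ M_{-i}` if `ρ_{-i,-j+2g}(z) = θ_{-j}(y)`. -/
def Frob.Compat {I : Type u} [AddCommGroup I] [Module F.A I] : (k : FrobKind) →
    {c : PairChain p g J F} → (Φ : Frob k c) → (ι : BC F.σ I ≃ₗ[F.B] BC F.res I) →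
    (lam : ∀ i j : J, (i : ℤ) + j = 0 → c.M i →ₗ[F.A] c.M j →ₗ[F.A] I) → Prop
  | .full, c, (Φ : FullFrob c), ι, lam => ∀ (i j : J) (h : (i : ℤ) + j = 0),
      ∃ μ : c.T i →ₗ[F.B] c.T j →ₗ[F.B] BC F.σ I, IsTildePairing (lam i j h) μ p ∧
        ∀ a b, BC.pair F.res (lam i j h) (Φ.Ψ i a) (Φ.Ψ j b) = ι (μ a b)
  | .rdt, c, (Φ : RdtFrob c), ι, lam => ∀ (i j i' j' : J) (e : IsEdge i j) (e' : IsEdge j' i')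
      (hi : (i : ℤ) + i' = 0), (j : ℤ) + j' = 0 →
      ∃ μ : c.T i →ₗ[F.B] c.T i' →ₗ[F.B] BC F.σ I, IsTildePairing (lam i i' hi) μ p ∧
        ∀ (k : J) (hk : (k : ℤ) = j' + 2 * g) (hik : (i' : ℤ) ≤ k)
          (x : LinearMap.ker (c.tρ i j e.le)) (y : LinearMap.ker (c.tρ j' i' e'.le))
          (tz : c.T i') (z : c.N i'),
          c.tρ i' k hik tz = c.tθ j' k hk y →
          c.rρ i' k hik z = c.rθ j' k hk (Φ.Ψ j' i' e' y) →
          BC.pair F.res (lam i i' hi) (Φ.Ψ i j e x) z = ι (μ x tz)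

/-- A morphism of chains of pairs commutes with the divided Frobenii. -/
def Frob.Commutes {S : Type u} [CommRing S] {F' : Frame S} {f : R →+* S} {T : Frame.Map f F F'}
    {c : PairChain p g J F} {c' : PairChain p g J F'} (h : PairChain.Hom T c c') :
    (k : FrobKind) → Frob k c → Frob k c' → Prop
  | .full, (Φ : FullFrob c), (Φ' : FullFrob c') => ∀ i x, Φ'.Ψ i (h.tφ i x) = h.rφ i (Φ.Ψ i x)
  | .rdt, (Φ : RdtFrob c), (Φ' : RdtFrob c') => ∀ (i j : J) (e : IsEdge i j)
      (x : LinearMap.ker (c.tρ i j e.le)) (y : LinearMap.ker (c'.tρ i j e.le)),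
      (y : c'.T i) = h.tφ i x → (Φ'.Ψ i j e y : c'.N i) = h.rφ i (Φ.Ψ i j e x)

theorem Frob.commutes_id {f : R →+* R} (T : Frame.Map f F F) (hT : ∀ a, T.α a = a)
    (hT' : ∀ b, T.β b = b) (c : PairChain p g J F) (k : FrobKind) (Φ : Frob k c) :
    Frob.Commutes (PairChain.Hom.id T hT c) k Φ Φ := by
  cases k with
  | full =>
    intro i x
    rw [PairChain.Hom.tφ_id T hT hT', PairChain.Hom.rφ_id T hT hT']
  | rdt =>
    intro i j e x y hy
    rw [PairChain.Hom.tφ_id T hT hT'] at hy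
    rw [PairChain.Hom.rφ_id T hT hT', Subtype.ext hy]

theorem Frob.commutes_comp {S S' : Type u} [CommRing S] [CommRing S'] {F' : Frame S}
    {F'' : Frame S'} {f : R →+* S} {f' : S →+* S'} {f'' : R →+* S'} {T : Frame.Map f F F'}
    {T' : Frame.Map f' F' F''} {T'' : Frame.Map f'' F F''} {c : PairChain p g J F}
    {c' : PairChain p g J F'} {c'' : PairChain p g J F''}
    (hα : ∀ a, T'.α (T.α a) = T''.α a) (hβ : ∀ a, T'.β (T.β a) = T''.β a)
    (h : PairChain.Hom T c c') (h' : PairChain.Hom T' c' c'') (k : FrobKind)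
    (Φ : Frob k c) (Φ' : Frob k c') (Φ'' : Frob k c'') (hc : Frob.Commutes h k Φ Φ')
    (hc' : Frob.Commutes h' k Φ' Φ'') :
    Frob.Commutes (PairChain.Hom.comp (T'' := T'') hα h h') k Φ Φ'' := by
  cases k with
  | full =>
    intro i x
    rw [PairChain.Hom.tφ_comp hα hβ, PairChain.Hom.rφ_comp hα hβ, hc' i, hc i]
  | rdt =>
    intro i j e x y hy
    rw [PairChain.Hom.tφ_comp hα hβ] at hy
    have hx : h.tφ i x ∈ LinearMap.ker (c'.tρ i j e.le) := by
      rw [LinearMap.mem_ker, ← h.tφ_tρ, LinearMap.mem_ker.1 x.2, map_zero]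
    rw [PairChain.Hom.rφ_comp hα hβ, hc' i j e ⟨_, hx⟩ y hy, hc i j e x ⟨_, hx⟩ rfl]

end Frobenius

/-! ## Polarized and homogeneously polarized chains of displays -/

section Objects

variable {R : Type u} [CommRing R]

/-- The canonical isomorphism `B ⊗_{σ, A} A ≅ B ≅ B ⊗_{res, A} A`. -/
noncomputable def unitIota (F : Frame R) : BC F.σ F.A ≃ₗ[F.B] BC F.res F.A :=
  (BC.rid F.σ).trans (BC.rid F.res).symm

/-- Polarized chains of displays of type `(g, J)` over the frame `F`. -/
structure PolChain (p g : ℕ) (J : Set ℤ) (k : FrobKind) (F : Frame R) where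
  c : PairChain p g J F
  Φ : Frob k c
  lam : ∀ i j : J, (i : ℤ) + j = 0 → c.M i →ₗ[F.A] c.M j →ₗ[F.A] F.A
  polarization : IsPairPolarization c lam
  compat : Frob.Compat k Φ (unitIota F) lam

/-- Homogeneously polarized chains of displays of type `(g, J)` over the frame `F`. -/
structure HPolChain (p g : ℕ) (J : Set ℤ) (k : FrobKind) (F : Frame R) where
  c : PairChain p g J F
  Φ : Frob k c
  I : Type u
  [grp : AddCommGroup I]
  [mod : Module F.A I]
  invertible : Module.Invertible F.A I
  ι : BC F.σ I ≃ₗ[F.B] BC F.res I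
  lam : ∀ i j : J, (i : ℤ) + j = 0 → c.M i →ₗ[F.A] c.M j →ₗ[F.A] I
  polarization : IsPairPolarization c lam
  compat : Frob.Compat k Φ ι lam

attribute [instance] HPolChain.grp HPolChain.mod

/-- The homogeneously polarized chain of displays with `(I, ι)` the unit object. -/
noncomputable def PolChain.toHPol {p g : ℕ} {J : Set ℤ} {k : FrobKind} {F : Frame R}
    (x : PolChain p g J k F) : HPolChain p g J k F where
  c := x.c
  Φ := x.Φ
  I := F.A
  invertible := inferInstance
  ι := unitIota F
  lam := x.lam
  polarization := x.polarization
  compat := x.compat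

variable {p g : ℕ} {J : Set ℤ} {k : FrobKind} {S : Type u} [CommRing S] {F : Frame R}
  {F' : Frame S} {f : R →+* S}

/-- Morphisms of polarized chains of displays over a morphism of frames (exhibiting the target as
the base change of the source). -/
@[ext]
structure PolChain.Hom (T : Frame.Map f F F') (x : PolChain p g J k F) (y : PolChain p g J k F')
    where
  h : PairChain.Hom T x.c y.c
  commutes : Frob.Commutes h k x.Φ y.Φ
  lam_compat : ∀ i j hij a b, T.α (x.lam i j hij a b) = y.lam i j hij (h.φ i a) (h.φ j b)

/-- Morphisms of homogeneously polarized chains of displays over a morphism of frames (exhibiting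
the target as the base change of the source). -/
@[ext]
structure HPolChain.Hom (T : Frame.Map f F F') (x : HPolChain p g J k F)
    (y : HPolChain p g J k F') where
  h : PairChain.Hom T x.c y.c
  commutes : Frob.Commutes h k x.Φ y.Φ
  ψ : x.I →ₛₗ[T.α] y.I
  isBC : IsBC ψ
  ι_compat : ∀ z, y.ι (BC.map T.σ_comm ψ z) = BC.map T.res_comm ψ (x.ι z)
  lam_compat : ∀ i j hij a b, ψ (x.lam i j hij a b) = y.lam i j hij (h.φ i a) (h.φ j b)

end Objects

theorem unitIota_map {R S : Type u} [CommRing R] [CommRing S] {F : Frame R} {F' : Frame S}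
    {f : R →+* S} (T : Frame.Map f F F') (φ : F.A →ₛₗ[T.α] F'.A) (hφ : ∀ a, φ a = T.α a)
    (z : BC F.σ F.A) :
    unitIota F' (BC.map T.σ_comm φ z) = BC.map T.res_comm φ (unitIota F z) := by
  have key : ∀ (w : BC F.res F.A), BC.rid F'.res (BC.map T.res_comm φ w) = T.β (BC.rid F.res w) := by
    intro w
    induction w using BC.induction with
    | h0 => simp only [map_zero]
    | ht b m => rw [BC.map_tmul, BC.rid_tmul, BC.rid_tmul, map_mul, hφ, T.res_comm]
    | ha x y hx hy => simp only [map_add, hx, hy]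
  have key' : ∀ (w : BC F.σ F.A), BC.rid F'.σ (BC.map T.σ_comm φ w) = T.β (BC.rid F.σ w) := by
    intro w
    induction w using BC.induction with
    | h0 => simp only [map_zero]
    | ht b m => rw [BC.map_tmul, BC.rid_tmul, BC.rid_tmul, map_mul, hφ, T.σ_comm]
    | ha x y hx hy => simp only [map_add, hx, hy]
  apply (BC.rid F'.res).injective
  rw [key]
  simp only [unitIota, LinearEquiv.trans_apply, LinearEquiv.apply_symm_apply, key']

/-! ## Categories over the category of rings, and torsors -/

/-- A category over the (opposite of the) category of rings: objects over every ring, and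
morphisms over every ring homomorphism. -/
structure CatOver where
  Obj : ∀ (R : Type u) [CommRing R], Type (u + 1)
  Hom : ∀ {R S : Type u} [CommRing R] [CommRing S], (R →+* S) → Obj R → Obj S → Type u
  id : ∀ {R : Type u} [CommRing R] (x : Obj R), Hom (RingHom.id R) x x
  comp : ∀ {R S T : Type u} [CommRing R] [CommRing S] [CommRing T] {f : R →+* S} {g : S →+* T}
    {x : Obj R} {y : Obj S} {z : Obj T}, Hom f x y → Hom g y z → Hom (g.comp f) x z
  id_comp : ∀ {R S : Type u} [CommRing R] [CommRing S] {f : R →+* S} {x : Obj R} {y : Obj S}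
    (φ : Hom f x y), comp (id x) φ = φ
  comp_id : ∀ {R S : Type u} [CommRing R] [CommRing S] {f : R →+* S} {x : Obj R} {y : Obj S}
    (φ : Hom f x y), comp φ (id y) = φ
  assoc : ∀ {R S T U : Type u} [CommRing R] [CommRing S] [CommRing T] [CommRing U]
    {f : R →+* S} {g : S →+* T} {h : T →+* U} {x : Obj R} {y : Obj S} {z : Obj T} {w : Obj U}
    (φ : Hom f x y) (χ : Hom g y z) (ψ : Hom h z w),
    comp (comp φ χ) ψ = comp φ (comp χ ψ)

/-- A functor over the category of rings. -/
structure CatOver.Functor (X Y : CatOver.{u}) where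
  obj : ∀ {R : Type u} [CommRing R], X.Obj R → Y.Obj R
  map : ∀ {R S : Type u} [CommRing R] [CommRing S] {f : R →+* S} {x : X.Obj R} {y : X.Obj S},
    X.Hom f x y → Y.Hom f (obj x) (obj y)
  map_id : ∀ {R : Type u} [CommRing R] (x : X.Obj R), map (X.id x) = Y.id (obj x)
  map_comp : ∀ {R S T : Type u} [CommRing R] [CommRing S] [CommRing T] {f : R →+* S}
    {g : S →+* T} {x : X.Obj R} {y : X.Obj S} {z : X.Obj T} (φ : X.Hom f x y) (χ : X.Hom g y z),
    map (X.comp φ χ) = Y.comp (map φ) (map χ)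

/-- A group-valued functor on rings. -/
structure GroupFunctor where
  G : ∀ (R : Type u) [CommRing R], Type u
  [grp : ∀ (R : Type u) [CommRing R], Group (G R)]
  map : ∀ {R S : Type u} [CommRing R] [CommRing S], (R →+* S) → (G R →* G S)
  map_id : ∀ (R : Type u) [CommRing R] (u : G R), map (RingHom.id R) u = u
  map_comp : ∀ {R S T : Type u} [CommRing R] [CommRing S] [CommRing T]
    (f : R →+* S) (g : S →+* T) (u : G R), map g (map f u) = map (g.comp f) u

attribute [instance] GroupFunctor.grp

/-- An action of a group-valued functor `G` on `X` over `Y`, for a functor `π : X → Y`, over the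
rings that satisfy `P`: a functor `G × X → X`, `(u, x) ↦ u • x`, with coherent natural
isomorphisms `x → 1 • x` and `u • (v • x) → (u v) • x`, and with isomorphisms
`iso : π(x) → π(u • x)` that are natural and compatible with the unit and the multiplication
of `G`. Equations between sections of `G` are passed as arguments, to avoid transport of
morphisms along them. -/
structure ActionOver (P : ∀ (R : Type u) [CommRing R], Prop) {X Y : CatOver.{u}}
    (π : X.Functor Y) (G : GroupFunctor.{u}) where
  smul : ∀ {R : Type u} [CommRing R], P R → G.G R → X.Obj R → X.Obj R
  smulMap : ∀ {R S : Type u} [CommRing R] [CommRing S] (hR : P R) (hS : P S) {f : R →+* S}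
    (u : G.G R) (v : G.G S), G.map f u = v → ∀ {x : X.Obj R} {y : X.Obj S},
    X.Hom f x y → X.Hom f (smul hR u x) (smul hS v y)
  smulMap_id : ∀ {R : Type u} [CommRing R] (hR : P R) (u : G.G R)
    (h : G.map (RingHom.id R) u = u) (x : X.Obj R),
    smulMap hR hR u u h (X.id x) = X.id (smul hR u x)
  smulMap_comp : ∀ {R S T : Type u} [CommRing R] [CommRing S] [CommRing T] (hR : P R) (hS : P S)
    (hT : P T) {f : R →+* S} {g : S →+* T} (u : G.G R) (v : G.G S) (w : G.G T)
    (huv : G.map f u = v) (hvw : G.map g v = w) (huw : G.map (g.comp f) u = w)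
    {x : X.Obj R} {y : X.Obj S} {z : X.Obj T} (φ : X.Hom f x y) (χ : X.Hom g y z),
    smulMap hR hT u w huw (X.comp φ χ)
      = X.comp (smulMap hR hS u v huv φ) (smulMap hS hT v w hvw χ)
  one : ∀ {R : Type u} [CommRing R] (hR : P R) (e : G.G R), e = 1 → ∀ x : X.Obj R,
    X.Hom (RingHom.id R) x (smul hR e x)
  one_natural : ∀ {R S : Type u} [CommRing R] [CommRing S] (hR : P R) (hS : P S) {f : R →+* S}
    (e : G.G R) (he : e = 1) (e' : G.G S) (he' : e' = 1) (h : G.map f e = e')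
    {x : X.Obj R} {y : X.Obj S} (φ : X.Hom f x y),
    X.comp (one hR e he x) (smulMap hR hS e e' h φ) = X.comp φ (one hS e' he' y)
  mul : ∀ {R : Type u} [CommRing R] (hR : P R) (u v w : G.G R), u * v = w → ∀ x : X.Obj R,
    X.Hom (RingHom.id R) (smul hR u (smul hR v x)) (smul hR w x)
  mul_natural : ∀ {R S : Type u} [CommRing R] [CommRing S] (hR : P R) (hS : P S) {f : R →+* S}
    (u v w : G.G R) (h : u * v = w) (u' v' w' : G.G S) (h' : u' * v' = w')
    (hu : G.map f u = u') (hv : G.map f v = v') (hw : G.map f w = w')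
    {x : X.Obj R} {y : X.Obj S} (φ : X.Hom f x y),
    X.comp (mul hR u v w h x) (smulMap hR hS w w' hw φ)
      = X.comp (smulMap hR hS u u' hu (smulMap hR hS v v' hv φ)) (mul hS u' v' w' h' y)
  mul_one : ∀ {R : Type u} [CommRing R] (hR : P R) (u : G.G R)
    (hu : G.map (RingHom.id R) u = u) (e : G.G R) (he : e = 1) (h : u * e = u) (x : X.Obj R),
    X.comp (smulMap hR hR u u hu (one hR e he x)) (mul hR u e u h x) = X.id (smul hR u x)
  one_mul : ∀ {R : Type u} [CommRing R] (hR : P R) (u e : G.G R) (he : e = 1)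
    (h : e * u = u) (x : X.Obj R),
    X.comp (one hR e he (smul hR u x)) (mul hR e u u h x) = X.id (smul hR u x)
  mul_assoc : ∀ {R : Type u} [CommRing R] (hR : P R) (u v w uv vw uvw : G.G R)
    (huv : u * v = uv) (hvw : v * w = vw) (h : uv * w = uvw) (h' : u * vw = uvw)
    (hu : G.map (RingHom.id R) u = u) (x : X.Obj R),
    X.comp (mul hR u v uv huv (smul hR w x)) (mul hR uv w uvw h x)
      = X.comp (smulMap hR hR u u hu (mul hR v w vw hvw x)) (mul hR u vw uvw h' x)
  iso : ∀ {R : Type u} [CommRing R] (hR : P R) (u : G.G R) (x : X.Obj R),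
    Y.Hom (RingHom.id R) (π.obj x) (π.obj (smul hR u x))
  iso_natural : ∀ {R S : Type u} [CommRing R] [CommRing S] (hR : P R) (hS : P S) {f : R →+* S}
    (u : G.G R) (v : G.G S) (h : G.map f u = v) {x : X.Obj R} {y : X.Obj S} (φ : X.Hom f x y),
    Y.comp (iso hR u x) (π.map (smulMap hR hS u v h φ)) = Y.comp (π.map φ) (iso hS v y)
  iso_one : ∀ {R : Type u} [CommRing R] (hR : P R) (e : G.G R) (he : e = 1) (x : X.Obj R),
    iso hR e x = π.map (one hR e he x)
  iso_mul : ∀ {R : Type u} [CommRing R] (hR : P R) (u v w : G.G R) (h : u * v = w) (x : X.Obj R),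
    Y.comp (Y.comp (iso hR v x) (iso hR u (smul hR v x))) (π.map (mul hR u v w h x))
      = iso hR w x

/-- The restriction of an action of `G` along a homomorphism `η : G' → G`. -/
def ActionOver.restrict {P : ∀ (R : Type u) [CommRing R], Prop} {X Y : CatOver.{u}}
    {π : X.Functor Y} {G : GroupFunctor.{u}} (act : ActionOver P π G) (G' : GroupFunctor.{u})
    (η : ∀ {R : Type u} [CommRing R], P R → (G'.G R →* G.G R))
    (hη : ∀ {R S : Type u} [CommRing R] [CommRing S] (hR : P R) (hS : P S) (f : R →+* S)
      (u : G'.G R), G.map f (η hR u) = η hS (G'.map f u)) : ActionOver P π G' where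
  smul hR u x := act.smul hR (η hR u) x
  smulMap hR hS _ u v h _ _ φ := act.smulMap hR hS (η hR u) (η hS v) (by rw [hη hR hS, h]) φ
  smulMap_id hR u _ x := act.smulMap_id hR (η hR u) _ x
  smulMap_comp hR hS hT _ _ u v w _ _ _ _ _ _ φ χ :=
    act.smulMap_comp hR hS hT (η hR u) (η hS v) (η hT w) _ _ _ φ χ
  one hR e he x := act.one hR (η hR e) (by rw [he, map_one]) x
  one_natural hR hS _ e _ e' _ _ _ _ φ :=
    act.one_natural hR hS (η hR e) _ (η hS e') _ _ φ
  mul hR u v w h x := act.mul hR (η hR u) (η hR v) (η hR w) (by rw [← map_mul, h]) x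
  mul_natural hR hS _ u v w _ u' v' w' _ _ _ _ _ _ φ :=
    act.mul_natural hR hS (η hR u) (η hR v) (η hR w) _ (η hS u') (η hS v') (η hS w') _ _ _ _ φ
  mul_one hR u _ e _ _ x := act.mul_one hR (η hR u) _ (η hR e) _ _ x
  one_mul hR u e _ _ x := act.one_mul hR (η hR u) (η hR e) _ _ x
  mul_assoc hR u v w uv vw uvw _ _ _ _ _ x :=
    act.mul_assoc hR (η hR u) (η hR v) (η hR w) (η hR uv) (η hR vw) (η hR uvw) _ _ _ _ _ x
  iso hR u x := act.iso hR (η hR u) x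
  iso_natural hR hS _ u v _ _ _ φ := act.iso_natural hR hS (η hR u) (η hS v) _ φ
  iso_one hR e _ x := act.iso_one hR (η hR e) _ x
  iso_mul hR u v w _ x := act.iso_mul hR (η hR u) (η hR v) (η hR w) _ x

/-- A functor `π : X → Y` (a morphism of stacks), with an action of `G` on `X` over `Y`, is a
`G`-torsor for the fpqc topology:
* the morphism `G × X → X ×_Y X`, `(u, x) ↦ (x, u • x)`, is an equivalence, i.e. every isomorphism
  `χ : π(x) → π(x')` is obtained from a unique pair consisting of a section `u` of `G` and an
  isomorphism `u • x → x'`;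
* every object of `Y` lifts to `X` after base change along a faithfully flat ring homomorphism. -/
structure IsTorsor {P : ∀ (R : Type u) [CommRing R], Prop} {X Y : CatOver.{u}}
    {π : X.Functor Y} {G : GroupFunctor.{u}} (act : ActionOver P π G) : Prop where
  simply_transitive : ∀ {R : Type u} [CommRing R] (hR : P R) (x x' : X.Obj R)
    (χ : Y.Hom (RingHom.id R) (π.obj x) (π.obj x')),
    ∃! q : Σ u : G.G R, X.Hom (RingHom.id R) (act.smul hR u x) x',
      Y.comp (act.iso hR q.1 x) (π.map q.2) = χ
  locally_nonempty : ∀ {R : Type u} [CommRing R], P R → ∀ y : Y.Obj R,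
    ∃ (S : Type u) (_ : CommRing S) (f : R →+* S), f.FaithfullyFlat ∧
      ∃ x : X.Obj S, Nonempty (Y.Hom f y (π.obj x))

section Categories

variable (p g : ℕ) (J : Set ℤ) (k : FrobKind) (W : FrameFunctor.{u})

/-- The category of polarized chains of displays of type `(g, J)`. -/
noncomputable def polCat : CatOver.{u} where
  Obj R _ := PolChain p g J k (W.frame R)
  Hom f x y := PolChain.Hom (W.map f) x y
  id {R} _ x :=
    { h := PairChain.Hom.id _ (W.map_id_α R) x.c
      commutes := Frob.commutes_id _ (W.map_id_α R) (W.map_id_β R) x.c k x.Φ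
      lam_compat := fun _ _ _ _ _ => W.map_id_α R _ }
  comp {R S T} _ _ _ f g x y z φ χ :=
    { h := PairChain.Hom.comp (W.map_comp_α f g) φ.h χ.h
      commutes := Frob.commutes_comp (W.map_comp_α f g) (W.map_comp_β f g) φ.h χ.h k x.Φ y.Φ z.Φ
        φ.commutes χ.commutes
      lam_compat := fun i j hij a b => by
        rw [← W.map_comp_α f g, φ.lam_compat, χ.lam_compat]; rfl }
  id_comp _ := rfl
  comp_id _ := rfl
  assoc _ _ _ := rfl

/-- The category of homogeneously polarized chains of displays of type `(g, J)`. -/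
noncomputable def hpolCat : CatOver.{u} where
  Obj R _ := HPolChain p g J k (W.frame R)
  Hom f x y := HPolChain.Hom (W.map f) x y
  id {R} _ x :=
    { h := PairChain.Hom.id _ (W.map_id_α R) x.c
      commutes := Frob.commutes_id _ (W.map_id_α R) (W.map_id_β R) x.c k x.Φ
      ψ :=
        { toFun := fun x => x
          map_add' := fun _ _ => rfl
          map_smul' := fun a x => by rw [W.map_id_α R] }
      isBC := IsBC.id (W.map_id_α R) _ fun _ => rfl
      ι_compat := fun z => by
        rw [BC.map_id _ (W.map_id_β R) _ (fun _ => rfl), BC.map_id _ (W.map_id_β R) _ (fun _ => rfl)]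
      lam_compat := fun _ _ _ _ _ => rfl }
  comp {R S T} _ _ _ f g x y z φ χ :=
    { h := PairChain.Hom.comp (W.map_comp_α f g) φ.h χ.h
      commutes := Frob.commutes_comp (W.map_comp_α f g) (W.map_comp_β f g) φ.h χ.h k x.Φ y.Φ z.Φ
        φ.commutes χ.commutes
      ψ :=
        { toFun := fun x => χ.ψ (φ.ψ x)
          map_add' := fun x y => by rw [map_add, map_add]
          map_smul' := fun a x => by
            rw [LinearMap.map_smulₛₗ, LinearMap.map_smulₛₗ, W.map_comp_α f g] }
      isBC := IsBC.comp (W.map_comp_α f g) (fun _ => rfl) φ.isBC χ.isBC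
      ι_compat := fun w => by
        rw [BC.map_map (W.map f).σ_comm (W.map g).σ_comm _ (W.map_comp_β f g) φ.ψ χ.ψ _
            (fun _ => rfl), BC.map_map (W.map f).res_comm (W.map g).res_comm _ (W.map_comp_β f g)
            φ.ψ χ.ψ _ (fun _ => rfl), χ.ι_compat, φ.ι_compat]
      lam_compat := fun i j hij a b =>
        (congrArg χ.ψ (φ.lam_compat i j hij a b)).trans (χ.lam_compat i j hij _ _) }
  id_comp _ := rfl
  comp_id _ := rfl
  assoc _ _ _ := rfl

/-- The forgetful functor from polarized to homogeneously polarized chains of displays. -/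
noncomputable def forget : (polCat p g J k W).Functor (hpolCat p g J k W) where
  obj x := x.toHPol
  map {R S} _ _ f x y φ :=
    { h := φ.h
      commutes := φ.commutes
      ψ :=
        { toFun := (W.map f).α
          map_add' := map_add _
          map_smul' := fun a b => (W.map f).α.map_mul a b }
      isBC := IsBC.self _ fun _ => rfl
      ι_compat := fun z => unitIota_map (W.map f) _ (fun _ => rfl) z
      lam_compat := φ.lam_compat }
  map_id {R} _ x := by
    refine HPolChain.Hom.ext rfl (LinearMap.ext fun a => W.map_id_α R a)
  map_comp {R S T} _ _ _ f g x y z φ χ := by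
    refine HPolChain.Hom.ext rfl (LinearMap.ext fun a => (W.map_comp_α f g a).symm)

/-- The group-valued functor `R ↦ {u ∈ Aˣ | σ(u) = u in B}`. -/
noncomputable def sigmaUnits : GroupFunctor.{u} where
  G R _ := MonoidHom.eqLocus (Units.map ((W.frame R).σ : (W.frame R).A →* (W.frame R).B))
    (Units.map ((W.frame R).res : (W.frame R).A →* (W.frame R).B))
  map {R S} _ _ f :=
    { toFun := fun u => ⟨Units.map ((W.map f).α : (W.frame R).A →* (W.frame S).A) u, by
        have h := congrArg Units.val u.2
        refine Units.ext ?_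
        change (W.frame S).σ ((W.map f).α (u : (W.frame R).Aˣ)) = (W.frame S).res ((W.map f).α (u : (W.frame R).Aˣ))
        rw [← (W.map f).σ_comm, ← (W.map f).res_comm]
        exact congrArg _ h⟩
      map_one' := by ext; simp
      map_mul' := fun u v => by ext; simp }
  map_id R _ u := Subtype.ext (Units.ext (W.map_id_α R _))
  map_comp f g u := Subtype.ext (Units.ext (W.map_comp_α f g _))

end Categories

/-! ## The scalar action -/

section Scalar

variable {R : Type u} [CommRing R]

theorem IsTildePairing.scale {F : Frame R} {M M' : Type u} [AddCommGroup M]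
    [Module F.A M] [AddCommGroup M'] [Module F.A M'] {M1 : Submodule F.A M}
    {M1' : Submodule F.A M'} {l : M →ₗ[F.A] M' →ₗ[F.A] F.A}
    {μ : Tilde F M1 →ₗ[F.B] Tilde F M1' →ₗ[F.B] BC F.σ F.A} {p : ℕ} (h : IsTildePairing l μ p)
    (u : F.Aˣ) : IsTildePairing ((u : F.A) • l) (F.σ u • μ) p := by
  have hs : ∀ (a x : F.A), BC.mk F.σ (a • x) = F.σ a • BC.mk F.σ x := fun a x =>
    LinearMap.map_smulₛₗ _ _ _
  constructor
  · intro x y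
    rw [LinearMap.smul_apply, LinearMap.smul_apply, LinearMap.smul_apply, LinearMap.smul_apply,
      h.F0_F0, hs, smul_comm]
  · intro x y
    rw [LinearMap.smul_apply, LinearMap.smul_apply, LinearMap.smul_apply, LinearMap.smul_apply,
      h.F1_F0, hs]
  · intro x y
    rw [LinearMap.smul_apply, LinearMap.smul_apply, LinearMap.smul_apply, LinearMap.smul_apply,
      h.F0_F1, hs]
  · intro x y k a e ha hl
    rw [LinearMap.smul_apply, LinearMap.smul_apply] at hl
    have hl' : l x y = ∑ s, a s • ((u⁻¹ : F.Aˣ) : F.A) • e s := by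
      have : l x y = ((u⁻¹ : F.Aˣ) : F.A) • (u : F.A) • l x y := by
        rw [smul_smul, Units.inv_mul, one_smul]
      rw [this, hl, Finset.smul_sum]
      exact Finset.sum_congr rfl fun s _ => smul_comm _ _ _
    rw [LinearMap.smul_apply, LinearMap.smul_apply, h.F1_F1 x y k a _ ha hl', Finset.smul_sum]
    refine Finset.sum_congr rfl fun s _ => ?_
    rw [hs, smul_comm, smul_smul (F.σ u), ← map_mul, Units.mul_inv, map_one, one_smul]

theorem BC.pair_scale {F : Frame R} {M M' : Type u} [AddCommGroup M]
    [Module F.A M] [AddCommGroup M'] [Module F.A M'] (l : M →ₗ[F.A] M' →ₗ[F.A] F.A) (u : F.A)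
    (a : BC F.res M) (b : BC F.res M') :
    BC.pair F.res (u • l) a b = F.res u • BC.pair F.res l a b := by
  induction a using BC.induction with
  | h0 => rw [map_zero, map_zero, LinearMap.zero_apply, smul_zero]
  | ha x y hx hy =>
    rw [map_add, map_add, LinearMap.add_apply, LinearMap.add_apply, hx, hy, smul_add]
  | ht c x =>
    induction b using BC.induction with
    | h0 => rw [map_zero, map_zero, smul_zero]
    | ha x y hx hy => rw [map_add, map_add, hx, hy, smul_add]
    | ht d y =>
      rw [BC.pair_tmul, BC.pair_tmul, LinearMap.smul_apply, LinearMap.smul_apply, BC.tmul_smul,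
        BC.smul_tmul]

variable {p g : ℕ} {J : Set ℤ} {k : FrobKind} {F : Frame R}

/-- The polarized chain of displays `(M, u λ)`, for a unit `u` of `A` with `σ(u) = u` in `B`. -/
def PolChain.scale (x : PolChain p g J k F) (u : F.Aˣ) (hu : F.σ u = F.res u) :
    PolChain p g J k F where
  c := x.c
  Φ := x.Φ
  lam i j h := (u : F.A) • x.lam i j h
  polarization :=
    { bijective := fun i j h => by
        have e : ⇑((u : F.A) • x.lam i j h) = (fun y => u • y) ∘ ⇑(x.lam i j h) := rfl
        rw [e]
        exact (MulAction.bijective u).comp (x.polarization.bijective i j h)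
      antisymm := fun i j h h' a b => by
        change (u : F.A) • x.lam j i h' b a = -((u : F.A) • x.lam i j h a b)
        rw [x.polarization.antisymm i j h h', smul_neg]
      ρ_compat := fun i j i' j' hi hj hij hij' a b =>
        congrArg ((u : F.A) • ·) (x.polarization.ρ_compat i j i' j' hi hj hij hij' a b)
      θ_compat := fun i j i' j' hi hj hij hij' a b =>
        congrArg ((u : F.A) • ·) (x.polarization.θ_compat i j i' j' hi hj hij hij' a b)
      M1_compat := fun i j h a => by
        rw [x.polarization.M1_compat i j h a]
        refine forall₂_congr fun b _ => ?_
        exact (Submodule.smul_mem_iff_of_isUnit _ u.isUnit).symm }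
  compat := by
    cases k with
    | full =>
      intro i j h
      obtain ⟨μ, h1, h2⟩ := x.compat i j h
      refine ⟨_, h1.scale u, fun a b => ?_⟩
      rw [BC.pair_scale, h2, LinearMap.smul_apply, LinearMap.smul_apply, map_smul, hu]
    | rdt =>
      intro i j i' j' e e' hi hj
      obtain ⟨μ, h1, h2⟩ := x.compat i j i' j' e e' hi hj
      refine ⟨_, h1.scale u, fun k hk hik a b tz z h3 h4 => ?_⟩
      rw [BC.pair_scale, h2 k hk hik a b tz z h3 h4, LinearMap.smul_apply, LinearMap.smul_apply,
        map_smul, hu]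

/-- Multiplication by a unit, as a semilinear map along a ring homomorphism that is the identity. -/
def unitMul {A : Type u} [CommRing A] (α : A →+* A) (hα : ∀ a, α a = a) (u : A) :
    A →ₛₗ[α] A where
  toFun a := u * a
  map_add' a b := mul_add u a b
  map_smul' a b := by rw [hα]; exact mul_left_comm u a b

theorem unitMul_isBC {A : Type u} [CommRing A] (α : A →+* A) (hα : ∀ a, α a = a) (u : Aˣ) :
    IsBC (unitMul α hα u) := by
  obtain rfl : α = RingHom.id A := RingHom.ext hα
  have h : ∀ z, BC.lift (f := RingHom.id A) (γ := RingHom.id A) (τ := RingHom.id A)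
      (fun _ => rfl) (unitMul (RingHom.id A) hα u) z = u • BC.rid (RingHom.id A) z := by
    intro z
    induction z using BC.induction with
    | h0 => rw [map_zero, map_zero, smul_zero]
    | ht b m =>
      rw [BC.lift_tmul, BC.rid_tmul]
      change b * ((u : A) * m) = (u : A) * (m * b)
      ring
    | ha x y hx hy => rw [map_add, map_add, hx, hy, smul_add]
  have h2 : ⇑(BC.lift (f := RingHom.id A) (γ := RingHom.id A) (τ := RingHom.id A)
      (fun _ => rfl) (unitMul (RingHom.id A) hα u))
      = (fun y => u • y) ∘ ⇑(BC.rid (RingHom.id A)) := funext h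
  unfold IsBC
  rw [h2]
  exact (MulAction.bijective u).comp (BC.rid (RingHom.id A)).bijective

theorem unitIota_unitMul {F : Frame R} {f : R →+* R} (T : Frame.Map f F F)
    (hT : ∀ a, T.α a = a) (u : F.A) (hu : F.σ u = F.res u) (z : BC F.σ F.A) :
    unitIota F (BC.map T.σ_comm (unitMul T.α hT u) z)
      = BC.map T.res_comm (unitMul T.α hT u) (unitIota F z) := by
  have key : ∀ w : BC F.res F.A, BC.rid F.res (BC.map T.res_comm (unitMul T.α hT u) w)
      = F.res u * T.β (BC.rid F.res w) := by
    intro w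
    induction w using BC.induction with
    | h0 => simp only [map_zero, mul_zero]
    | ht b m =>
      rw [BC.map_tmul, BC.rid_tmul, BC.rid_tmul, map_mul, T.res_comm, hT]
      change F.res (u * m) * _ = _
      rw [map_mul, mul_assoc]
    | ha x y hx hy => simp only [map_add, hx, hy, mul_add]
  have key' : ∀ w : BC F.σ F.A, BC.rid F.σ (BC.map T.σ_comm (unitMul T.α hT u) w)
      = F.res u * T.β (BC.rid F.σ w) := by
    intro w
    induction w using BC.induction with
    | h0 => simp only [map_zero, mul_zero]
    | ht b m =>
      rw [BC.map_tmul, BC.rid_tmul, BC.rid_tmul, map_mul, T.σ_comm, hT]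
      change F.σ (u * m) * _ = _
      rw [map_mul, mul_assoc, hu]
    | ha x y hx hy => simp only [map_add, hx, hy, mul_add]
  apply (BC.rid F.res).injective
  rw [key]
  simp only [unitIota, LinearEquiv.trans_apply, LinearEquiv.apply_symm_apply, key']

/-- The isomorphism from `(M, (A, can), λ)` to `(M, (A, can), u λ)` given by the identity on `M` and
the multiplication by `u` on `A`. -/
noncomputable def PolChain.scaleIso {f : R →+* R} (T : Frame.Map f F F) (hT : ∀ a, T.α a = a)
    (hT' : ∀ b, T.β b = b) (x : PolChain p g J k F) (u : F.Aˣ) (hu : F.σ u = F.res u) :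
    HPolChain.Hom T x.toHPol (x.scale u hu).toHPol where
  h := PairChain.Hom.id T hT x.c
  commutes := Frob.commutes_id T hT hT' x.c k x.Φ
  ψ := unitMul T.α hT u
  isBC := unitMul_isBC T.α hT u
  ι_compat := unitIota_unitMul T hT u hu
  lam_compat _ _ _ _ _ := rfl

/-- The isomorphism `(M, λ) → (M, u λ)` for `u = 1`. -/
noncomputable def PolChain.scaleOne {f : R →+* R} (T : Frame.Map f F F) (hT : ∀ a, T.α a = a)
    (hT' : ∀ b, T.β b = b) (x : PolChain p g J k F) (u : F.Aˣ) (hu : F.σ u = F.res u)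
    (h1 : u = 1) : PolChain.Hom T x (x.scale u hu) where
  h := PairChain.Hom.id T hT x.c
  commutes := Frob.commutes_id T hT hT' x.c k x.Φ
  lam_compat i j hij a b := by
    subst h1
    exact (hT _).trans (one_mul (x.lam i j hij a b)).symm

/-- The isomorphism `(M, u v λ) → (M, w λ)` for `u v = w`. -/
noncomputable def PolChain.scaleMul {f : R →+* R} (T : Frame.Map f F F) (hT : ∀ a, T.α a = a)
    (hT' : ∀ b, T.β b = b) (x : PolChain p g J k F) (u v w : F.Aˣ) (hu : F.σ u = F.res u)
    (hv : F.σ v = F.res v) (hw : F.σ w = F.res w) (h : u * v = w) :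
    PolChain.Hom T ((x.scale v hv).scale u hu) (x.scale w hw) where
  h := PairChain.Hom.id T hT x.c
  commutes := Frob.commutes_id T hT hT' x.c k x.Φ
  lam_compat i j hij a b := by
    subst h
    exact (hT _).trans (mul_assoc (u : F.A) (v : F.A) (x.lam i j hij a b)).symm

/-- The morphism `(M, u λ) → (M', α(u) λ')` given by a morphism `(M, λ) → (M', λ')`. -/
def PolChain.Hom.scale {S : Type u} [CommRing S] {F' : Frame S} {f : R →+* S}
    {T : Frame.Map f F F'} {x : PolChain p g J k F} {y : PolChain p g J k F'}
    (φ : PolChain.Hom T x y) (u : F.Aˣ) (hu : F.σ u = F.res u) (v : F'.Aˣ)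
    (hv : F'.σ v = F'.res v) (h : T.α u = v) : PolChain.Hom T (x.scale u hu) (y.scale v hv) where
  h := φ.h
  commutes := φ.commutes
  lam_compat i j hij a b := by
    change T.α ((u : F.A) * x.lam i j hij a b)
      = (v : F'.A) * y.lam i j hij (φ.h.φ i a) (φ.h.φ j b)
    rw [map_mul, h]
    exact congrArg ((v : F'.A) * ·) (φ.lam_compat i j hij a b)

/-- Morphisms between homogeneously polarized chains with `I = A` are determined by their components. -/
theorem HPolChain.Hom.ext_unit {S : Type u} [CommRing S] {F' : Frame S} {f : R →+* S}
    {T : Frame.Map f F F'} {x : PolChain p g J k F} {y : PolChain p g J k F'}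
    {φ χ : HPolChain.Hom T x.toHPol y.toHPol} (h : φ.h = χ.h) (φ' χ' : F.A →ₛₗ[T.α] F'.A)
    (hφ : φ.ψ = φ') (hχ : χ.ψ = χ') (H : ∀ a, φ' a = χ' a) : φ = χ := by
  refine HPolChain.Hom.ext h ?_
  rw [hφ, hχ]
  exact LinearMap.ext H

end Scalar

section ScalarAction

variable (p g : ℕ) (J : Set ℤ) (k : FrobKind) (W : FrameFunctor.{u})

theorem sigmaUnits_spec {R : Type u} [CommRing R] (u : (sigmaUnits W).G R) :
    (W.frame R).σ (u.1 : (W.frame R).A) = (W.frame R).res (u.1 : (W.frame R).A) :=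
  congrArg Units.val u.2

/-- The action of `{u ∈ Aˣ | σ(u) = u in B}` on polarized chains of displays over the homogeneously
polarized ones: `u • (M, λ) = (M, u λ)`, together with the isomorphism from `(M, (A, can), λ)` to
`(M, (A, can), u λ)` that is the identity on `M` and the multiplication by `u` on `A`. -/
noncomputable def scalarAction (P : ∀ (R : Type u) [CommRing R], Prop) :
    ActionOver P (forget p g J k W) (sigmaUnits W) where
  smul _ u x := PolChain.scale x u.1 (sigmaUnits_spec W u)
  smulMap {R S} _ _ _ _ f u v huv x y φ :=
    PolChain.Hom.scale φ u.1 (sigmaUnits_spec W u) v.1 (sigmaUnits_spec W v)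
      (congrArg (fun w : (sigmaUnits W).G S => ((w.1 : (W.frame S).Aˣ) : (W.frame S).A)) huv)
  smulMap_id _ _ _ _ := rfl
  smulMap_comp _ _ _ _ _ _ _ _ _ _ _ _ _ _ _ _ := rfl
  one {R} _ _ e he x := PolChain.scaleOne _ (W.map_id_α R) (W.map_id_β R) x e.1
    (sigmaUnits_spec W e) (congrArg Subtype.val he)
  one_natural _ _ _ _ _ _ _ _ _ _ _ := rfl
  mul {R} _ _ u v w h x := PolChain.scaleMul _ (W.map_id_α R) (W.map_id_β R) x u.1 v.1 w.1
    (sigmaUnits_spec W u) (sigmaUnits_spec W v) (sigmaUnits_spec W w) (congrArg Subtype.val h)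
  mul_natural _ _ _ _ _ _ _ _ _ _ _ _ _ _ _ _ _ := rfl
  mul_one _ _ _ _ _ _ _ := rfl
  one_mul _ _ _ _ _ _ := rfl
  mul_assoc _ _ _ _ _ _ _ _ _ _ _ _ _ := rfl
  iso {R} _ _ u x :=
    PolChain.scaleIso _ (W.map_id_α R) (W.map_id_β R) x u.1 (sigmaUnits_spec W u)
  iso_natural {R S} _ _ _ _ f u v h x y φ := by
    refine HPolChain.Hom.ext_unit rfl _ _ rfl rfl fun a => ?_
    have e : (W.map f).α (u.1 : (W.frame R).A) = (v.1 : (W.frame S).A) :=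
      congrArg (fun w : (sigmaUnits W).G S => ((w.1 : (W.frame S).Aˣ) : (W.frame S).A)) h
    change (W.map f).α ((u.1 : (W.frame R).A) * a) = (v.1 : (W.frame S).A) * (W.map f).α a
    rw [map_mul, e]
  iso_one {R} _ _ e he x := by
    refine HPolChain.Hom.ext_unit rfl _ _ rfl rfl fun a => ?_
    subst he
    refine (one_mul (M := (W.frame R).A) a).trans ?_
    exact (W.map_id_α R a).symm
  iso_mul {R} _ _ u v w h x := by
    refine HPolChain.Hom.ext_unit rfl _ _ rfl rfl fun a => ?_
    subst h
    refine (W.map_id_α R _).trans ?_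
    exact (mul_assoc (u.1 : (W.frame R).A) (v.1 : (W.frame R).A) a).symm

end ScalarAction

/-! ## The group scheme of `p`-adic units, and representability -/

section PadicUnits

variable (p : ℕ) [Fact p.Prime]

/-- The continuous map `Spec S → Spec R` induced by `f : R → S`. -/
def specMap {R S : Type u} [CommRing R] [CommRing S] (f : R →+* S) :
    C(PrimeSpectrum S, PrimeSpectrum R) :=
  ⟨PrimeSpectrum.comap f, PrimeSpectrum.continuous_comap f⟩

/-- The group scheme `ℤ_p^×`, i.e. the functor `R ↦ Cont(|Spec R|, ℤ_p^×)`. -/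
noncomputable def padicUnits : GroupFunctor.{u} where
  G R _ := C(PrimeSpectrum R, ℤ_[p]ˣ)
  map f :=
    { toFun := fun u => u.comp (specMap f)
      map_one' := rfl
      map_mul' := fun _ _ => rfl }
  map_id _ _ _ := rfl
  map_comp _ _ _ := rfl

/-- A continuous map to `ℤ_p^×`, as a continuous map to `ℤ_p`. -/
noncomputable def unitsVal {X : Type u} [TopologicalSpace X] (u : C(X, ℤ_[p]ˣ)) : C(X, ℤ_[p]) :=
  ⟨fun x => (u x : ℤ_[p]), Units.continuous_val.comp u.continuous⟩

/-- A ring isomorphism `Cont(|Spec R|, ℤ_p) ≅ {x ∈ W(R) | σ(x) = x}` for every ring `R` in which `p`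
is nilpotent, natural in `R`. -/
structure PadicWittIso where
  E : ∀ {R : Type u} [CommRing R], IsNilpotent (p : R) → (C(PrimeSpectrum R, ℤ_[p]) ≃+*
    RingHom.eqLocus ((wittFrames p).frame R).σ ((wittFrames p).frame R).res)
  natural : ∀ {R S : Type u} [CommRing R] [CommRing S] (hR : IsNilpotent (p : R))
    (hS : IsNilpotent (p : S)) (f : R →+* S) (a : C(PrimeSpectrum R, ℤ_[p])),
    ((wittFrames p).map f).α (E hR a).1 = (E hS (a.comp (specMap f))).1

variable {p}

/-- The induced homomorphism `Cont(|Spec R|, ℤ_p^×) → {u ∈ W(R)^× | σ(u) = u}`. -/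
noncomputable def PadicWittIso.units (e : PadicWittIso.{u} p) {R : Type u} [CommRing R]
    (hR : IsNilpotent (p : R)) : (padicUnits p).G R →* (sigmaUnits (wittFrames p)).G R where
  toFun u :=
    ⟨{ val := (e.E hR (unitsVal p u)).1
       inv := (e.E hR (unitsVal p u⁻¹)).1
       val_inv := by
        have h : unitsVal p u * unitsVal p u⁻¹ = 1 :=
          ContinuousMap.ext fun x => Units.mul_inv ((show C(PrimeSpectrum R, ℤ_[p]ˣ) from u) x)
        have h2 := congrArg (e.E hR) h
        rw [map_mul, map_one] at h2
        exact congrArg Subtype.val h2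
       inv_val := by
        have h : unitsVal p u⁻¹ * unitsVal p u = 1 :=
          ContinuousMap.ext fun x => Units.inv_mul ((show C(PrimeSpectrum R, ℤ_[p]ˣ) from u) x)
        have h2 := congrArg (e.E hR) h
        rw [map_mul, map_one] at h2
        exact congrArg Subtype.val h2 }, Units.ext (e.E hR (unitsVal p u)).2⟩
  map_one' := by
    refine Subtype.ext (Units.ext ?_)
    exact congrArg Subtype.val (map_one (e.E hR))
  map_mul' u v := by
    refine Subtype.ext (Units.ext ?_)
    exact congrArg Subtype.val (map_mul (e.E hR) (unitsVal p u) (unitsVal p v))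

/-- The action of the group scheme `ℤ_p^×` on polarized chains of displays, over the homogeneously
polarized ones, through the identification with `{u ∈ W(R)^× | σ(u) = u}`. -/
noncomputable def PadicWittIso.action (e : PadicWittIso.{u} p) (g : ℕ) (J : Set ℤ) (k : FrobKind) :
    ActionOver (fun R _ => IsNilpotent (p : R)) (forget p g J k (wittFrames p)) (padicUnits p) :=
  (scalarAction p g J k (wittFrames p) _).restrict (padicUnits p) (fun hR => e.units hR)
    (fun hR hS f u => Subtype.ext (Units.ext (e.natural hR hS f (unitsVal p u))))

end PadicUnits

/-- The `k`-algebra `H` represents the restriction of the group-valued functor `G` to `k`-algebras,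
i.e. `G` is the affine group scheme `Spec H` over `k`. -/
def IsRepresentedBy {k : Type} [CommRing k] (G : GroupFunctor.{u}) (H : Type u) [CommRing H]
    [Algebra k H] : Prop :=
  ∃ e : ∀ (R : Type u) [CommRing R] [Algebra k R], (H →ₐ[k] R) ≃ G.G R,
    ∀ (R S : Type u) [CommRing R] [CommRing S] [Algebra k R] [Algebra k S] (f : R →ₐ[k] S)
      (φ : H →ₐ[k] R), e S (f.comp φ) = G.map f.toRingHom (e R φ)

/-- `G` is a flat affine group scheme over `k`. -/
def IsFlatAffine (k : Type) [CommRing k] (G : GroupFunctor.{u}) : Prop :=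
  ∃ (H : Type u) (_ : CommRing H) (_ : Algebra k H), Module.Flat k H ∧
    IsRepresentedBy (k := k) G H

/-- `G` is a smooth affine group scheme over `k`. -/
def IsSmoothAffine (k : Type) [CommRing k] (G : GroupFunctor.{u}) : Prop :=
  ∃ (H : Type u) (_ : CommRing H) (_ : Algebra k H), Algebra.Smooth k H ∧
    IsRepresentedBy (k := k) G H

/-! ## Semilinear maps that exhibit a base change -/

section IsBCLibrary

variable {A A' A'' : Type u} [CommRing A] [CommRing A'] [CommRing A''] {α : A →+* A'}
  {M M' M'' : Type u} [AddCommGroup M] [Module A M] [AddCommGroup M'] [Module A' M']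
  [AddCommGroup M''] [Module A'' M'']

/-! Everything is proved for a functorial frame with a few formal properties, and then specialized
to full and truncated Witt vectors.

Simple transitivity is formal. An isomorphism between the homogeneously polarized chains attached to
`(M, λ)` and `(M', λ')` has a component `ψ` on `A`, linear over the identity. It is multiplication
by `u = ψ(1)`, which is a unit because `ψ` is a base change. Compatibility with the two unit
isomorphisms says `σ(u) = u` in `B`, and compatibility with the pairings says that the remaining
component is an isomorphism from `(M, u λ)` to `(M', λ')`. So `u` and the isomorphism are both
forced (`scalarAction_simply_transitive`).

Local existence means trivializing `(I, ι)` over a faithfully flat extension and base changing the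
chain. The module `I` becomes trivial over a product of localizations of `R`, because an element of
`A` whose image in `R` is a unit is itself a unit. Then `ι` is given by a unit `w` of `B`, and it is
removed by a solution of `σ(v) = w v` (`exists_trivialization`). Modulo `p` this equation reads `y_n
^ p = (w y)_n` in Witt coordinates. Each such equation is monic of degree `p` in `y_n` once the
earlier coordinates are known, so a countable tower of root adjunctions solves it
(`WittVector.exists_faithfullyFlat_pow_eq`). The Frobenius sends coordinates in `p ^ k R`, for
positive `k`, to coordinates in `p ^ (k + 1) R`. As `p` is nilpotent, iterating `x ↦ w⁻¹ F(x)` turns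
a solution modulo `p` into a solution (`WittVector.exists_frobenius_eq_mul`).

For the base change, the formation of `M̃₁` commutes with arbitrary base change, by a normal
decomposition (`Tilde.map_isBC`). Flatness is used for the duality condition on `M_{i,1}` and, in
the `1-rdt` case, for the kernels over `B = W_1(R) ≅ R`.

The groups are treated separately. A Frobenius-invariant Witt vector has coordinates in `F_p` at
every residue field, hence gives a function from `Spec R` to `W(F_p) = ℤ_p`. The contraction
property of the Frobenius shows that this function is an arbitrary continuous one and determines the
vector. The functor `R ↦ Cont(|Spec R|, ℤ_p^×)` is represented by the ring of locally constant
functions from `ℤ_p^×` to `ℤ_p`, which is torsion-free. The truncated groups are cut out by finitely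
many equations. They satisfy the infinitesimal lifting criterion because, on Witt vectors with
coordinates in an ideal of square zero, `η - F η = d` is solved up to truncation by a finite
geometric series. -/

theorem isBC_mk (α : A →+* A') (M : Type u) [AddCommGroup M] [Module A M] :
    IsBC (BC.mk α : M →ₛₗ[α] BC α M) := by
  have h : BC.lift (f := α) (γ := RingHom.id A') (τ := α) (fun _ => rfl) (BC.mk α (M := M))
      = LinearMap.id := BC.ext fun m => by
    rw [BC.lift_tmul, map_one, one_smul, BC.mk_apply, LinearMap.id_apply]
  unfold IsBC
  rw [h]
  exact Function.bijective_id

/-- The identification of the base change with its model. -/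
noncomputable def IsBC.toBC {φ : M →ₛₗ[α] M'} (hφ : IsBC φ) : BC α M ≃ₗ[A'] M' :=
  LinearEquiv.ofBijective _ hφ

theorem IsBC.toBC_tmul {φ : M →ₛₗ[α] M'} (hφ : IsBC φ) (a : A') (m : M) :
    hφ.toBC (BC.tmul α a m) = a • φ m := rfl

theorem IsBC.toBC_symm {φ : M →ₛₗ[α] M'} (hφ : IsBC φ) (m : M) :
    hφ.toBC.symm (φ m) = BC.tmul α 1 m := by
  rw [LinearEquiv.symm_apply_eq, hφ.toBC_tmul, one_smul]

theorem IsBC.induction {φ : M →ₛₗ[α] M'} (hφ : IsBC φ) {P : M' → Prop} (h0 : P 0)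
    (hs : ∀ (a : A') (m : M), P (a • φ m)) (ha : ∀ x y, P x → P y → P (x + y)) (x : M') : P x := by
  obtain ⟨z, rfl⟩ := hφ.2 x
  induction z using BC.induction with
  | h0 => rwa [map_zero]
  | ht b m => exact hs b m
  | ha x y hx hy => rw [map_add]; exact ha _ _ hx hy

theorem IsBC.ext {φ : M →ₛₗ[α] M'} (hφ : IsBC φ) {C : Type u} [CommRing C] {γ : A' →+* C}
    {N : Type u} [AddCommGroup N] [Module C N] {g g' : M' →ₛₗ[γ] N}
    (h : ∀ m, g (φ m) = g' (φ m)) (x : M') : g x = g' x := by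
  induction x using hφ.induction with
  | h0 => rw [map_zero, map_zero]
  | hs a m => rw [LinearMap.map_smulₛₗ, LinearMap.map_smulₛₗ, h]
  | ha x y hx hy => rw [map_add, map_add, hx, hy]

/-- The universal property of a base change. -/
noncomputable def IsBC.lift {φ : M →ₛₗ[α] M'} (hφ : IsBC φ) {C : Type u} [CommRing C]
    {γ : A' →+* C} {τ : A →+* C} (h : ∀ a, γ (α a) = τ a) {N : Type u} [AddCommGroup N]
    [Module C N] (ψ : M →ₛₗ[τ] N) : M' →ₛₗ[γ] N :=
  (BC.lift h ψ).comp hφ.toBC.symm.toLinearMap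

theorem IsBC.lift_apply {φ : M →ₛₗ[α] M'} (hφ : IsBC φ) {C : Type u} [CommRing C]
    {γ : A' →+* C} {τ : A →+* C} (h : ∀ a, γ (α a) = τ a) {N : Type u} [AddCommGroup N]
    [Module C N] (ψ : M →ₛₗ[τ] N) (m : M) : hφ.lift h ψ (φ m) = ψ m := by
  change BC.lift h ψ (hφ.toBC.symm (φ m)) = _
  rw [hφ.toBC_symm, BC.lift_tmul, map_one, one_smul]

/-- The linear map between base changes induced by a linear map. -/
noncomputable def IsBC.mapL {φ : M →ₛₗ[α] M'} (hφ : IsBC φ) {N N' : Type u} [AddCommGroup N]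
    [Module A N] [AddCommGroup N'] [Module A' N'] (χ : N →ₛₗ[α] N') (l : M →ₗ[A] N) :
    M' →ₗ[A'] N' :=
  hφ.lift (γ := RingHom.id A') (τ := α) (fun _ => rfl) (χ.comp l)

theorem IsBC.mapL_apply {φ : M →ₛₗ[α] M'} (hφ : IsBC φ) {N N' : Type u} [AddCommGroup N]
    [Module A N] [AddCommGroup N'] [Module A' N'] (χ : N →ₛₗ[α] N') (l : M →ₗ[A] N) (m : M) :
    hφ.mapL χ l (φ m) = χ (l m) :=
  hφ.lift_apply _ _ _

/-- The isomorphism between base changes induced by an isomorphism. -/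
noncomputable def IsBC.congr {φ : M →ₛₗ[α] M'} (hφ : IsBC φ) {N N' : Type u} [AddCommGroup N]
    [Module A N] [AddCommGroup N'] [Module A' N'] {χ : N →ₛₗ[α] N'} (hχ : IsBC χ)
    (l : M ≃ₗ[A] N) : M' ≃ₗ[A'] N' :=
  LinearEquiv.ofLinearMap (hφ.mapL χ l.toLinearMap) (hχ.mapL φ l.symm.toLinearMap)
    (LinearMap.ext <| hχ.ext fun m => by
      rw [LinearMap.comp_apply, hχ.mapL_apply, hφ.mapL_apply]
      exact congrArg χ (l.apply_symm_apply m))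
    (LinearMap.ext <| hφ.ext fun m => by
      rw [LinearMap.comp_apply, hφ.mapL_apply, hχ.mapL_apply]
      exact congrArg φ (l.symm_apply_apply m))

theorem IsBC.congr_apply {φ : M →ₛₗ[α] M'} (hφ : IsBC φ) {N N' : Type u} [AddCommGroup N]
    [Module A N] [AddCommGroup N'] [Module A' N'] {χ : N →ₛₗ[α] N'} (hχ : IsBC χ)
    (l : M ≃ₗ[A] N) (m : M) : hφ.congr hχ l (φ m) = χ (l m) :=
  hφ.mapL_apply _ _ _

/-- Two base changes of the same module are isomorphic. -/
noncomputable def IsBC.unique {φ : M →ₛₗ[α] M'} (hφ : IsBC φ) {N' : Type u} [AddCommGroup N']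
    [Module A' N'] {χ : M →ₛₗ[α] N'} (hχ : IsBC χ) : M' ≃ₗ[A'] N' :=
  hφ.congr hχ (LinearEquiv.refl A M)

theorem IsBC.unique_apply {φ : M →ₛₗ[α] M'} (hφ : IsBC φ) {N' : Type u} [AddCommGroup N']
    [Module A' N'] {χ : M →ₛₗ[α] N'} (hχ : IsBC χ) (m : M) : hφ.unique hχ (φ m) = χ m :=
  hφ.mapL_apply _ _ _

/-- A criterion for a base change in terms of a left inverse on generators. -/
theorem IsBC.of_leftInverse (φ : M →ₛₗ[α] M') (hs : Submodule.span A' (Set.range φ) = ⊤)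
    (g : M' →ₗ[A'] BC α M) (hg : ∀ m, g (φ m) = BC.tmul α 1 m) : IsBC φ := by
  set L := BC.lift (f := α) (γ := RingHom.id A') (τ := α) (fun _ => rfl) φ
  have hL : ∀ m, L (BC.tmul α 1 m) = φ m := fun m => by
    rw [BC.lift_tmul, map_one, one_smul]
  have hgL : g.comp L = LinearMap.id := BC.ext fun m => by
    rw [LinearMap.comp_apply, hL, hg, LinearMap.id_apply]
  refine ⟨Function.LeftInverse.injective (g := g) fun z => LinearMap.congr_fun hgL z, ?_⟩
  rw [← LinearMap.range_eq_top, eq_top_iff, ← hs, Submodule.span_le]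
  rintro _ ⟨m, rfl⟩
  exact ⟨_, hL m⟩

theorem IsBC.span_range {φ : M →ₛₗ[α] M'} (hφ : IsBC φ) :
    Submodule.span A' (Set.range φ) = ⊤ := by
  rw [eq_top_iff]
  intro x _
  induction x using hφ.induction with
  | h0 => exact Submodule.zero_mem _
  | hs a m => exact Submodule.smul_mem _ _ (Submodule.subset_span ⟨m, rfl⟩)
  | ha x y hx hy => exact Submodule.add_mem _ (hx trivial) (hy trivial)

theorem IsBC.linearEquiv_comp {φ : M →ₛₗ[α] M'} (hφ : IsBC φ) {N' : Type u} [AddCommGroup N']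
    [Module A' N'] (e : M' ≃ₗ[A'] N') (χ : M →ₛₗ[α] N') (h : ∀ m, χ m = e (φ m)) : IsBC χ := by
  refine IsBC.of_leftInverse χ ?_ (hφ.toBC.symm.toLinearMap.comp e.symm.toLinearMap) fun m => ?_
  · have : Set.range χ = e '' Set.range φ := by
      rw [← Set.range_comp]; exact congrArg Set.range (funext h)
    rw [this]
    have := Submodule.map_span e.toLinearMap (Set.range φ)
    rw [hφ.span_range, Submodule.map_top, LinearMap.range_eq_top.2 e.surjective] at this
    exact this.symm
  · rw [h]
    change hφ.toBC.symm (e.symm (e (φ m))) = _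
    rw [LinearEquiv.symm_apply_apply, hφ.toBC_symm]

/-- The composite of semilinear maps, over a given composite of the ring homomorphisms. -/
def semiComp {α' : A' →+* A''} {α'' : A →+* A''} (hα : ∀ a, α' (α a) = α'' a)
    (φ' : M' →ₛₗ[α'] M'') (φ : M →ₛₗ[α] M') : M →ₛₗ[α''] M'' where
  toFun m := φ' (φ m)
  map_add' x y := by rw [map_add, map_add]
  map_smul' a x := by rw [LinearMap.map_smulₛₗ, LinearMap.map_smulₛₗ, hα]

theorem semiComp_apply {α' : A' →+* A''} {α'' : A →+* A''} (hα : ∀ a, α' (α a) = α'' a)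
    (φ' : M' →ₛₗ[α'] M'') (φ : M →ₛₗ[α] M') (m : M) : semiComp hα φ' φ m = φ' (φ m) := rfl

theorem IsBC.semiComp {α' : A' →+* A''} {α'' : A →+* A''} (hα : ∀ a, α' (α a) = α'' a)
    {φ' : M' →ₛₗ[α'] M''} {φ : M →ₛₗ[α] M'} (hφ : IsBC φ) (hφ' : IsBC φ') :
    IsBC (semiComp hα φ' φ) :=
  IsBC.comp hα (fun _ => rfl) hφ hφ'

/-- Both `BC α' M'` and `M''` are base changes of `M` along the composite, so they are canonically
isomorphic. This isomorphism is the one induced by `φ'`, because the two agree on the image of `φ`.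
-/
theorem IsBC.of_comp {α' : A' →+* A''} {α'' : A →+* A''} (hα : ∀ a, α' (α a) = α'' a)
    {φ : M →ₛₗ[α] M'} {φ' : M' →ₛₗ[α'] M''} {φ'' : M →ₛₗ[α''] M''} (h : ∀ m, φ'' m = φ' (φ m))
    (hφ : IsBC φ) (hφ'' : IsBC φ'') : IsBC φ' := by
  have h1 := IsBC.semiComp hα hφ (isBC_mk α' M')
  refine (isBC_mk α' M').linearEquiv_comp (h1.unique hφ'') φ' fun m => ?_
  refine hφ.ext (γ := α') (g' := _root_.semiComp (fun _ => rfl) (h1.unique hφ'').toLinearMap (BC.mk α'))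
    (fun m => ?_) m
  rw [← h]
  exact (h1.unique_apply hφ'' m).symm

/-- The base change of a base change. -/
theorem IsBC.map {B B' : Type u} [CommRing B] [CommRing B'] {f : A →+* B} {f' : A' →+* B'}
    {β : B →+* B'} (h : ∀ a, β (f a) = f' (α a)) {φ : M →ₛₗ[α] M'} (hφ : IsBC φ) :
    IsBC (BC.map h φ) := by
  have h1 := IsBC.semiComp (α'' := f'.comp α) (fun _ => rfl) hφ (isBC_mk f' M')
  refine IsBC.of_comp (fun a => h a) (fun m => ?_) (isBC_mk f M) h1
  rw [BC.mk_apply, BC.map_tmul, map_one]; rfl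

/-- The inverses on the two factors are added up. The `1-rdt` compatibility is a condition on
triples subject to linear equations, and it is transported along a base change of threefold
products. -/
theorem IsBC.prodMap {N N' : Type u} [AddCommGroup N] [Module A N] [AddCommGroup N'] [Module A' N']
    {φ : M →ₛₗ[α] M'} (hφ : IsBC φ) {χ : N →ₛₗ[α] N'} (hχ : IsBC χ) (ψ : M × N →ₛₗ[α] M' × N')
    (hψ : ∀ z, ψ z = (φ z.1, χ z.2)) : IsBC ψ := by
  refine IsBC.of_leftInverse ψ ?_
    ((BC.mapL α (LinearMap.inl A M N)).comp (hφ.toBC.symm.toLinearMap.comp (LinearMap.fst A' _ _))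
      + (BC.mapL α (LinearMap.inr A M N)).comp
        (hχ.toBC.symm.toLinearMap.comp (LinearMap.snd A' _ _))) fun m => ?_
  · rw [eq_top_iff]
    rintro ⟨x, y⟩ -
    have hx : ((x, 0) : M' × N') ∈ Submodule.span A' (Set.range ψ) := by
      induction x using hφ.induction with
      | h0 => exact Submodule.zero_mem _
      | hs a m =>
        have : ((a • φ m, 0) : M' × N') = a • ψ (m, 0) := by rw [hψ, map_zero]; simp
        rw [this]
        exact Submodule.smul_mem _ _ (Submodule.subset_span ⟨_, rfl⟩)
      | ha x y hx hy => simpa using Submodule.add_mem _ hx hy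
    have hy : ((0, y) : M' × N') ∈ Submodule.span A' (Set.range ψ) := by
      induction y using hχ.induction with
      | h0 => exact Submodule.zero_mem _
      | hs a m =>
        have : ((0, a • χ m) : M' × N') = a • ψ (0, m) := by rw [hψ, map_zero]; simp
        rw [this]
        exact Submodule.smul_mem _ _ (Submodule.subset_span ⟨_, rfl⟩)
      | ha x y hx hy => simpa using Submodule.add_mem _ hx hy
    simpa using Submodule.add_mem _ hx hy
  · rw [hψ]
    simp only [LinearMap.add_apply, LinearMap.comp_apply, LinearMap.fst_apply,
      LinearMap.snd_apply, LinearEquiv.coe_coe, IsBC.toBC_symm, BC.mapL, BC.map_tmul,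
      RingHom.id_apply, LinearMap.inl_apply, LinearMap.inr_apply]
    rw [← BC.tmul_add]
    simp

/-- `IsBC` in terms of `IsBaseChange`. -/
theorem isBC_iff_isBaseChange (φ : M →ₛₗ[α] M') :
    letI := α.toAlgebra
    letI := Module.compHom M' α
    haveI : IsScalarTower A A' M' := ⟨fun a b m => mul_smul (α a) b m⟩
    IsBC φ ↔ IsBaseChange A' ({
      toFun := φ
      map_add' := map_add φ
      map_smul' := fun a m => LinearMap.map_smulₛₗ φ a m } : M →ₗ[A] M') := by
  let := α.toAlgebra
  let := Module.compHom M' α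
  have : IsScalarTower A A' M' := ⟨fun a b m => mul_smul (α a) b m⟩
  have key : ⇑(BC.lift (f := α) (γ := RingHom.id A') (τ := α) (fun _ => rfl) φ)
      = ⇑(TensorProduct.lift (((Algebra.linearMap A' (Module.End A' (M →ₗ[A] M'))).flip
        ({
          toFun := φ
          map_add' := map_add φ
          map_smul' := fun a m => LinearMap.map_smulₛₗ φ a m } : M →ₗ[A] M')).restrictScalars A)) := by
    funext z
    induction z using BC.induction with
    | h0 => exact (map_zero _).trans (map_zero (TensorProduct.lift _)).symm
    | ht b m => rfl
    | ha x y hx hy =>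
      refine (map_add _ _ _).trans (Eq.trans ?_ (map_add (TensorProduct.lift _) _ _).symm)
      rw [hx, hy]
  unfold IsBC
  rw [key]
  exact Iff.rfl

theorem IsBC.rankAtStalk [Module.Finite A M] [Module.Projective A M] {φ : M →ₛₗ[α] M'}
    (hφ : IsBC φ) (x : PrimeSpectrum A') :
    Module.rankAtStalk M' x = Module.rankAtStalk M (x.comap α) := by
  let := α.toAlgebra
  let := Module.compHom M' α
  have : IsScalarTower A A' M' := ⟨fun a b m => mul_smul (α a) b m⟩
  exact Module.rankAtStalk_isBaseChange ((isBC_iff_isBaseChange φ).1 hφ) x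

theorem BC.finite (α : A →+* A') (M : Type u) [AddCommGroup M] [Module A M] [Module.Finite A M] :
    Module.Finite A' (BC α M) := by
  let := α.toAlgebra
  exact Module.Finite.base_change A A' M

theorem BC.projective (α : A →+* A') (M : Type u) [AddCommGroup M] [Module A M]
    [Module.Projective A M] : Module.Projective A' (BC α M) := by
  let := α.toAlgebra
  exact inferInstanceAs (Module.Projective A' (TensorProduct A A' M))

theorem IsBC.finite [Module.Finite A M] {φ : M →ₛₗ[α] M'} (hφ : IsBC φ) : Module.Finite A' M' :=
  have := BC.finite α M
  Module.Finite.equiv hφ.toBC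

theorem IsBC.projective [Module.Projective A M] {φ : M →ₛₗ[α] M'} (hφ : IsBC φ) :
    Module.Projective A' M' :=
  have := BC.projective α M
  Module.Projective.of_equiv hφ.toBC

/-- Flat base change preserves the left exact sequence `0 → ker h → X → Y`. Whenever flatness enters
the base change of chains, it enters through this statement. -/
theorem IsBC.ker (hα : α.Flat) {X X' Y Y' : Type u} [AddCommGroup X] [Module A X] [AddCommGroup X']
    [Module A' X'] [AddCommGroup Y] [Module A Y] [AddCommGroup Y'] [Module A' Y']
    {φ : X →ₛₗ[α] X'} (hφ : IsBC φ) {χ : Y →ₛₗ[α] Y'} (hχ : IsBC χ) (h : X →ₗ[A] Y)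
    (h' : X' →ₗ[A'] Y') (hh : ∀ x, h' (φ x) = χ (h x))
    (ψ : LinearMap.ker h →ₛₗ[α] LinearMap.ker h') (hψ : ∀ x, (ψ x : X') = φ x) : IsBC ψ := by
  let := α.toAlgebra
  let := Module.compHom X' α
  let := Module.compHom Y' α
  let i : Module A (LinearMap.ker h') := Module.compHom _ α
  have : IsScalarTower A A' X' := ⟨fun a b m => mul_smul (α a) b m⟩
  have : IsScalarTower A A' Y' := ⟨fun a b m => mul_smul (α a) b m⟩
  have : @IsScalarTower A A' (LinearMap.ker h') _ _ i.toSMul := ⟨fun a b m => mul_smul (α a) b m⟩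
  have : Module.Flat A A' := hα
  refine (isBC_iff_isBaseChange ψ).2 (@IsBaseChange.of_left_exact A _ A' _ _ _
    X Y _ X' Y' _ _ _ _ _ _ _ _ _
    i _ _ _ _ _ _ _ _ _ _ _ (LinearMap.ker h).subtype h (LinearMap.ker h').subtype h' ?_ ?_ this
    ((isBC_iff_isBaseChange φ).1 hφ) ((isBC_iff_isBaseChange χ).1 hχ) ?_
    (Submodule.injective_subtype _) ?_
    (Submodule.injective_subtype _))
  · ext x; exact (hψ x).symm
  · ext x; exact (hh x).symm
  · exact LinearMap.exact_subtype_ker_map h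
  · have hexact := LinearMap.exact_subtype_ker_map h'
    exact hexact

/-- Elements of the kernel of a flat base change come from the kernel. -/
theorem IsBC.ker_induction (hα : α.Flat) {X X' Y Y' : Type u} [AddCommGroup X] [Module A X]
    [AddCommGroup X'] [Module A' X'] [AddCommGroup Y] [Module A Y] [AddCommGroup Y'] [Module A' Y']
    {φ : X →ₛₗ[α] X'} (hφ : IsBC φ) {χ : Y →ₛₗ[α] Y'} (hχ : IsBC χ) (h : X →ₗ[A] Y)
    (h' : X' →ₗ[A'] Y') (hh : ∀ x, h' (φ x) = χ (h x)) {P : X' → Prop} (h0 : P 0)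
    (hs : ∀ (a : A') (x : X), h x = 0 → P (a • φ x)) (ha : ∀ x y, P x → P y → P (x + y)) (x : X')
    (hx : h' x = 0) : P x := by
  let ψ : LinearMap.ker h →ₛₗ[α] LinearMap.ker h' :=
    { toFun := fun x => ⟨φ x, by rw [LinearMap.mem_ker, hh, LinearMap.mem_ker.1 x.2, map_zero]⟩
      map_add' := fun x y => Subtype.ext (map_add φ _ _)
      map_smul' := fun a x => Subtype.ext (LinearMap.map_smulₛₗ φ a (x : X)) }
  have hψ : IsBC ψ := IsBC.ker hα hφ hχ h h' hh ψ fun _ => rfl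
  have key : ∀ z : LinearMap.ker h', P z := fun z => by
    induction z using hψ.induction with
    | h0 => exact h0
    | hs a m => exact hs a m m.2
    | ha x y hx hy => exact ha _ _ hx hy
  exact key ⟨x, hx⟩

end IsBCLibrary

/-! ## The augmentation ideal, and the divided Frobenius on it -/

/-- Right exactness of the tensor product, applied to `ker f → A → B`. It turns membership in `I M`
into an equation over `R`. -/
theorem BC.mk_eq_zero_iff {A B : Type u} [CommRing A] [CommRing B] {f : A →+* B}
    (hf : Function.Surjective f) {M : Type u} [AddCommGroup M] [Module A M] (m : M) :
    BC.mk f m = 0 ↔ m ∈ RingHom.ker f • (⊤ : Submodule A M) := by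
  constructor
  · intro h
    let := f.toAlgebra
    have hex : Function.Exact (RingHom.ker f).subtype (Algebra.linearMap A B) := by
      intro a
      constructor
      · intro ha
        exact ⟨⟨a, ha⟩, rfl⟩
      · rintro ⟨a, rfl⟩
        exact a.2
    have h2 := (rTensor_exact M hex hf) (TensorProduct.tmul A (1 : A) m)
    have h3 : (LinearMap.rTensor M (Algebra.linearMap A B)) (TensorProduct.tmul A (1 : A) m) = 0 := by
      rw [LinearMap.rTensor_tmul, Algebra.linearMap_apply, map_one]
      exact h
    obtain ⟨z, hz⟩ := h2.1 h3
    have h4 : ∀ z : TensorProduct A (RingHom.ker f) M,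
        TensorProduct.lid A M (LinearMap.rTensor M (RingHom.ker f).subtype z)
          ∈ RingHom.ker f • (⊤ : Submodule A M) := by
      intro z
      induction z using TensorProduct.induction_on with
      | zero => simp
      | tmul a m =>
        rw [LinearMap.rTensor_tmul, TensorProduct.lid_tmul]
        exact Submodule.smul_mem_smul a.2 trivial
      | add x y hx hy => rw [map_add, map_add]; exact Submodule.add_mem _ hx hy
    have := h4 z
    rwa [hz, TensorProduct.lid_tmul, one_smul] at this
  · intro h
    induction h using Submodule.smul_induction_on' with
    | smul a ha n _ =>
      rw [LinearMap.map_smulₛₗ, (RingHom.mem_ker).1 ha, zero_smul]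
    | add x _ y _ hx hy => rw [map_add, hx, hy, add_zero]

/-- Splitting a surjection from a finite free module gives generators together with coordinate
forms. The forms carry `I P` into `I`, which lets the divided Frobenius act coordinatewise. -/
theorem exists_finite_dual_basis (A P : Type*) [CommRing A] [AddCommGroup P] [Module A P]
    [Module.Finite A P] [Module.Projective A P] :
    ∃ (n : ℕ) (e : Fin n → P) (s : Fin n → P →ₗ[A] A), ∀ x, x = ∑ k, s k x • e k := by
  obtain ⟨n, q, hq⟩ := Module.Finite.exists_fin' A P
  obtain ⟨s, hs⟩ := Module.projective_lifting_property q LinearMap.id hq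
  refine ⟨n, fun k => q (Pi.single k 1), fun k => (LinearMap.proj k).comp s, fun x => ?_⟩
  have h1 : x = q (s x) := (LinearMap.congr_fun hs x).symm
  conv_lhs => rw [h1, ← LinearMap.sum_single_apply (fun _ => A) (s x), map_sum]
  refine Finset.sum_congr rfl fun k _ => ?_
  rw [← map_smul]
  congr 1
  ext j
  by_cases h : j = k
  · subst h; simp
  · simp [h]

/-- The properties of the frames of Witt vectors that govern the construction of `M̃₁`. -/
structure Frame.IsWitt (p : ℕ) {R : Type u} [CommRing R] (F : Frame R) : Prop where
  ev_surjective : Function.Surjective F.ev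
  div_add : ∀ a b, F.ev a = 0 → F.ev b = 0 → F.div (a + b) = F.div a + F.div b
  div_mul : ∀ a b, F.ev b = 0 → F.div (a * b) = F.σ a * F.div b
  σ_eq : ∀ a, F.ev a = 0 → F.σ a = p * F.div a
  exists_div_eq_one : ∃ v, F.ev v = 0 ∧ F.div v = 1

section Div

variable {p : ℕ} {R : Type u} [CommRing R] {F : Frame R}

theorem Frame.IsWitt.div_mul' (hF : F.IsWitt p) (a b : F.A) (ha : F.ev a = 0) :
    F.div (a * b) = F.div a * F.σ b := by
  rw [mul_comm, hF.div_mul b a ha, mul_comm]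

theorem Frame.IsWitt.div_zero (hF : F.IsWitt p) : F.div 0 = 0 := by
  have := hF.div_add 0 0 (map_zero _) (map_zero _)
  simpa using this

theorem Frame.IsWitt.div_sum (hF : F.IsWitt p) {ι : Type*} (s : Finset ι) (a : ι → F.A)
    (ha : ∀ i, F.ev (a i) = 0) : F.div (∑ i ∈ s, a i) = ∑ i ∈ s, F.div (a i) := by
  classical
  induction s using Finset.induction_on with
  | empty => simpa using hF.div_zero
  | insert i s hi ih =>
    rw [Finset.sum_insert hi, Finset.sum_insert hi, hF.div_add _ _ (ha i), ih]
    rw [map_sum]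
    exact Finset.sum_eq_zero fun j _ => ha j

/-- A `σ`-linear map on a finite projective module `P` induces a divided `σ`-linear map on `I P`. -/
theorem Frame.IsWitt.exists_divided (hF : F.IsWitt p) {P : Type u} [AddCommGroup P] [Module F.A P]
    [Module.Finite F.A P] [Module.Projective F.A P] {N : Type u} [AddCommGroup N] [Module F.B N]
    (f0 : P →ₛₗ[F.σ] N) :
    ∃ D : (RingHom.ker F.ev • (⊤ : Submodule F.A P) : Submodule F.A P) →ₛₗ[F.σ] N,
      ∀ (a : F.A) (m : P) (x : (RingHom.ker F.ev • (⊤ : Submodule F.A P) : Submodule F.A P)),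
        F.ev a = 0 → (x : P) = a • m → D x = F.div a • f0 m := by
  obtain ⟨n, e, s, hs⟩ := exists_finite_dual_basis F.A P
  have hev : ∀ (x : P), x ∈ RingHom.ker F.ev • (⊤ : Submodule F.A P) → ∀ k, F.ev (s k x) = 0 := by
    intro x hx k
    induction hx using Submodule.smul_induction_on' with
    | smul a ha n _ =>
      rw [map_smul, smul_eq_mul, map_mul, (RingHom.mem_ker).1 ha, zero_mul]
    | add x _ y _ hx hy => rw [map_add, map_add, hx, hy, add_zero]
  have hf0 : ∀ m, f0 m = ∑ k, F.σ (s k m) • f0 (e k) := fun m => by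
    conv_lhs => rw [hs m, map_sum]
    refine Finset.sum_congr rfl fun k _ => ?_
    rw [LinearMap.map_smulₛₗ]
  -- `D` applies `div` to the coordinates of `x`. These lie in the augmentation ideal by `hev`, and
  -- only there is `div` additive and `σ`-linear.
  refine ⟨
    { toFun := fun x => ∑ k, F.div (s k x) • f0 (e k)
      map_add' := fun x y => by
        rw [← Finset.sum_add_distrib]
        refine Finset.sum_congr rfl fun k _ => ?_
        rw [Submodule.coe_add, map_add, hF.div_add _ _ (hev x x.2 k) (hev y y.2 k), add_smul]
      map_smul' := fun a x => by
        rw [Finset.smul_sum]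
        refine Finset.sum_congr rfl fun k _ => ?_
        rw [Submodule.coe_smul, map_smul, smul_eq_mul, hF.div_mul _ _ (hev x x.2 k), mul_smul] },
    fun a m x ha hx => ?_⟩
  change ∑ k, F.div (s k x) • f0 (e k) = _
  rw [hf0 m, Finset.smul_sum]
  refine Finset.sum_congr rfl fun k _ => ?_
  rw [hx, map_smul, smul_eq_mul, hF.div_mul' _ _ ha, mul_smul]

variable {M : Type u} [AddCommGroup M] [Module F.A M]

/-- Since `A → R` is surjective, the image of `M₁` in `R ⊗ M` is already stable under `R`, so that
the span adds nothing. -/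
theorem mem_span_mk (hF : Function.Surjective F.ev) (M1 : Submodule F.A M) (z : BC F.ev M)
    (hz : z ∈ Submodule.span R (BC.mk F.ev '' (M1 : Set M))) : ∃ x ∈ M1, BC.mk F.ev x = z := by
  induction hz using Submodule.span_induction with
  | mem z hz => exact hz
  | zero => exact ⟨0, M1.zero_mem, map_zero _⟩
  | add x y _ _ hx hy =>
    obtain ⟨x, hx, rfl⟩ := hx
    obtain ⟨y, hy, rfl⟩ := hy
    exact ⟨x + y, M1.add_mem hx hy, map_add _ _ _⟩
  | smul r x _ hx =>
    obtain ⟨x, hx, rfl⟩ := hx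
    obtain ⟨a, rfl⟩ := hF r
    exact ⟨a • x, M1.smul_mem a hx, LinearMap.map_smulₛₗ _ _ _⟩

/-- A projector onto `M₁ / I M` lifts to an endomorphism of `M` with image in `M₁`. -/
theorem exists_normal_projector (hF : Function.Surjective F.ev) [Module.Projective F.A M]
    (M1 : Submodule F.A M)
    (h : ∃ C, IsCompl (Submodule.span R (BC.mk F.ev '' (M1 : Set M))) C) :
    ∃ e : M →ₗ[F.A] M1, ∀ x ∈ M1, x - e x ∈ RingHom.ker F.ev • (⊤ : Submodule F.A M) := by
  obtain ⟨C, hC⟩ := h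
  let := Module.compHom (BC F.ev M) F.ev
  let i : Module F.A (Submodule.span R (BC.mk F.ev '' (M1 : Set M))) := Module.compHom _ F.ev
  let π := Submodule.projectionOnto _ C hC
  let q : M1 →ₗ[F.A] Submodule.span R (BC.mk F.ev '' (M1 : Set M)) :=
    { toFun := fun x => ⟨BC.mk F.ev x, Submodule.subset_span ⟨x, x.2, rfl⟩⟩
      map_add' := fun x y => Subtype.ext (map_add (BC.mk F.ev) (x : M) y)
      map_smul' := fun a x => Subtype.ext (LinearMap.map_smulₛₗ (BC.mk F.ev) a (x : M)) }
  have hq : Function.Surjective q := by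
    rintro ⟨z, hz⟩
    obtain ⟨x, hx, rfl⟩ := mem_span_mk hF M1 z hz
    exact ⟨⟨x, hx⟩, rfl⟩
  let t : M →ₗ[F.A] Submodule.span R (BC.mk F.ev '' (M1 : Set M)) :=
    { toFun := fun m => π (BC.mk F.ev m)
      map_add' := fun x y => by rw [map_add, map_add]
      map_smul' := fun a x => by
        rw [LinearMap.map_smulₛₗ, LinearMap.map_smul]; rfl }
  -- Projectivity of `M` lifts the composite of `M → R ⊗ M` and the projection along `C` through the
  -- surjection `q` from `M₁`.
  obtain ⟨e, he⟩ := Module.projective_lifting_property q t hq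
  refine ⟨e, fun x hx => ?_⟩
  rw [← BC.mk_eq_zero_iff hF, map_sub, sub_eq_zero]
  have h1 := congrArg Subtype.val (LinearMap.congr_fun he x)
  have h2 : π (BC.mk F.ev x) = q ⟨x, hx⟩ :=
    Submodule.projectionOnto_apply_left hC (q ⟨x, hx⟩)
  refine Eq.trans ?_ h1.symm
  exact (congrArg Subtype.val h2).symm

/-- `F(x) = p F₁(x)` for `x ∈ M₁`. -/
theorem Tilde.F0_eq (hF : F.IsWitt p) (M1 : Submodule F.A M) (x : M1) :
    Tilde.F0 F M1 x = (p : F.B) • Tilde.F1 F M1 x := by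
  obtain ⟨v, hv, hv1⟩ := hF.exists_div_eq_one
  have h := Tilde.F1_smul F M1 v hv (x : M) (v • x) rfl
  rw [LinearMap.map_smulₛₗ, hF.σ_eq v hv, hv1, mul_one, one_smul] at h
  exact h.symm

/-- The quotient map by this span vanishes on all `F₁(x)` and `F(m)`, and a linear map out of `M̃₁`
is determined by its values there. -/
theorem Tilde.span_eq_top (M1 : Submodule F.A M) :
    Submodule.span F.B (Set.range (Tilde.F1 F M1) ∪ Set.range (Tilde.F0 F M1)) = ⊤ := by
  set U := Submodule.span F.B (Set.range (Tilde.F1 F M1) ∪ Set.range (Tilde.F0 F M1))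
  have h : U.mkQ = 0 := Tilde.ext (fun x => ?_) (fun m => ?_)
  · rw [← Submodule.ker_mkQ U, h, LinearMap.ker_zero]
  · exact (Submodule.Quotient.mk_eq_zero _).2 (Submodule.subset_span (Or.inl ⟨x, rfl⟩))
  · exact (Submodule.Quotient.mk_eq_zero _).2 (Submodule.subset_span (Or.inr ⟨m, rfl⟩))

end Div

/-! ## Base change of `M̃₁` -/

section TildeBaseChange

variable {p : ℕ} {R S : Type u} [CommRing R] [CommRing S] {F : Frame R} {F' : Frame S} {f : R →+* S}

/-- The submodule generated by the image of `M₁` and by `I M'`. -/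
def baseChangeM1 (F' : Frame S) {A : Type u} [CommRing A] {α : A →+* F'.A} {M : Type u}
    [AddCommGroup M] [Module A M] {M' : Type u} [AddCommGroup M'] [Module F'.A M']
    (φ : M →ₛₗ[α] M') (M1 : Submodule A M) : Submodule F'.A M' :=
  Submodule.span F'.A (φ '' (M1 : Set M) ∪ {y | ∃ (a : F'.A) (m : M'), F'.ev a = 0 ∧ y = a • m})

section

variable {A : Type u} [CommRing A] {α : A →+* F'.A} {M : Type u}
    [AddCommGroup M] [Module A M] {M' : Type u} [AddCommGroup M'] [Module F'.A M']
    {φ : M →ₛₗ[α] M'} {M1 : Submodule A M}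

theorem mem_baseChangeM1 (x : M) (hx : x ∈ M1) : φ x ∈ baseChangeM1 F' φ M1 :=
  Submodule.subset_span (Or.inl ⟨x, hx, rfl⟩)

theorem smul_mem_baseChangeM1 (a : F'.A) (m : M') (ha : F'.ev a = 0) :
    a • m ∈ baseChangeM1 F' φ M1 :=
  Submodule.subset_span (Or.inr ⟨a, m, ha, rfl⟩)

/-- Scalars are absorbed into the two kinds of generators, using `b • (a • m) = (b a) • m` with `b
a` again in the augmentation ideal. This leaves no separate case for scalar multiplication, and
membership proofs are available to the predicate. -/
theorem baseChangeM1_induction {P : ∀ x, x ∈ baseChangeM1 F' φ M1 → Prop}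
    (h0 : P 0 (Submodule.zero_mem _))
    (h1 : ∀ (b : F'.A) x (hx : x ∈ M1), P (b • φ x) (Submodule.smul_mem _ b (mem_baseChangeM1 x hx)))
    (h2 : ∀ (a : F'.A) m (ha : F'.ev a = 0), P (a • m) (smul_mem_baseChangeM1 a m ha))
    (ha : ∀ x y hx hy, P x hx → P y hy → P (x + y) (Submodule.add_mem _ hx hy))
    {x : M'} (hx : x ∈ baseChangeM1 F' φ M1) : P x hx := by
  suffices ∃ hx, P x hx from this.2
  have hx' : x ∈ Submodule.span F'.A (φ '' (M1 : Set M) ∪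
    {y | ∃ (a : F'.A) (m : M'), F'.ev a = 0 ∧ y = a • m}) := hx
  clear hx
  induction hx' using Submodule.closure_induction with
  | zero => exact ⟨_, h0⟩
  | add x y h h' hx hy =>
    obtain ⟨h1, hx⟩ := hx
    obtain ⟨h2, hy⟩ := hy
    exact ⟨_, ha x y _ _ hx hy⟩
  | smul_mem b x hx =>
    obtain ⟨x, hx, rfl⟩ | ⟨a, m, hm, rfl⟩ := hx
    · exact ⟨_, h1 b x hx⟩
    · have h := h2 (b * a) m (by rw [map_mul, hm, mul_zero])
      simp only [mul_smul] at h
      exact ⟨_, h⟩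

end

variable {M : Type u} [AddCommGroup M] [Module F.A M] {M' : Type u} [AddCommGroup M']
  [Module F'.A M']

theorem Frame.Map.ev_eq_zero (T : Frame.Map f F F') (a : F.A) (ha : F.ev a = 0) :
    F'.ev (T.α a) = 0 := by
  rw [T.ev_comm, ha, map_zero]

/-- A normal decomposition is used in the form of a map `e : M → M₁` lifting the projector onto `M₁
/ I M`. Its base change `e'` writes each `x ∈ M₁'` as `e' x` plus an element of `I M'`. The inverse
of the comparison map sends `F₁(x)` to the image of `F₁ ∘ e` on the first part plus the divided
Frobenius of the second. No flatness is involved. -/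
theorem Tilde.map_isBC (hF : F.IsWitt p) (hF' : F'.IsWitt p) (T : Frame.Map f F F')
    [Module.Finite F.A M] [Module.Projective F.A M] {φ : M →ₛₗ[T.α] M'} (hφ : IsBC φ)
    (M1 : Submodule F.A M) (hI : ∀ (a : F.A) (m : M), F.ev a = 0 → a • m ∈ M1)
    (hM1 : ∃ C, IsCompl (Submodule.span R (BC.mk F.ev '' (M1 : Set M))) C)
    (M1' : Submodule F'.A M') (hM1' : M1' = baseChangeM1 F' φ M1) (h : ∀ x ∈ M1, φ x ∈ M1') :
    IsBC (Tilde.map T.σ_comm T.div_comm T.ev_eq_zero φ h) := by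
  subst hM1'
  set M1' := baseChangeM1 F' φ M1
  have := hφ.finite
  have := hφ.projective
  obtain ⟨e, he⟩ := exists_normal_projector hF.ev_surjective M1 hM1
  let N := BC T.β (Tilde F M1)
  let f0 : M' →ₛₗ[F'.σ] N := hφ.lift (τ := T.β.comp F.σ) (fun a => (T.σ_comm a).symm)
    (semiComp (fun _ => rfl) (BC.mk T.β) (Tilde.F0 F M1))
  have hf0 : ∀ m, f0 (φ m) = BC.mk T.β (Tilde.F0 F M1 m) := fun m => hφ.lift_apply _ _ m
  let fL : M' →ₛₗ[F'.σ] N := hφ.lift (τ := T.β.comp F.σ) (fun a => (T.σ_comm a).symm)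
    (semiComp (fun _ => rfl) (BC.mk T.β) ((Tilde.F1 F M1).comp e))
  have hfL : ∀ m, fL (φ m) = BC.mk T.β (Tilde.F1 F M1 (e m)) := fun m => hφ.lift_apply _ _ m
  obtain ⟨D, hD⟩ := hF'.exists_divided f0
  let e' : M' →ₗ[F'.A] M' := hφ.mapL φ (M1.subtype.comp e)
  have he' : ∀ m, e' (φ m) = φ (e m) := fun m => hφ.mapL_apply _ _ m
  -- This is `F = p F₁` on `M₁`, transported to the base change. It supplies the term that cancels
  -- in the verification of the defining relation of `M̃₁'`.
  have hfe : ∀ m, f0 (e' m) = (p : F'.B) • fL m := fun m => by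
    refine hφ.ext (g := f0.comp e') (g' := (p : F'.B) • fL) (fun m => ?_) m
    rw [LinearMap.comp_apply, LinearMap.smul_apply, he', hf0, hfL, Tilde.F0_eq hF,
      LinearMap.map_smulₛₗ, map_natCast]
  have hsub : ∀ x ∈ M1', x - e' x ∈ RingHom.ker F'.ev • (⊤ : Submodule F'.A M') := by
    intro x hx
    induction hx using baseChangeM1_induction with
    | h0 => rw [map_zero, sub_zero]; exact Submodule.zero_mem _
    | h1 b x hx =>
      rw [map_smul, he', ← smul_sub, ← map_sub]
      refine Submodule.smul_mem _ _ ?_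
      have h1 := he x hx
      rw [← BC.mk_eq_zero_iff hF.ev_surjective] at h1
      rw [← BC.mk_eq_zero_iff hF'.ev_surjective]
      have h2 := BC.map_tmul (f' := F'.ev) (β := f) (fun a => (T.ev_comm a).symm) φ 1 (x - e x)
      rw [map_one] at h2
      refine h2.symm.trans ((congrArg _ h1).trans (map_zero _))
    | h2 a m ha =>
      rw [map_smul, ← smul_sub]
      exact Submodule.smul_mem_smul ha trivial
    | ha x y _ _ hx hy =>
      rw [map_add, add_sub_add_comm]
      exact Submodule.add_mem _ hx hy
  let f1 : M1' →ₛₗ[F'.σ] N :=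
    { toFun := fun x => fL x + D ⟨x - e' x, hsub x x.2⟩
      map_add' := fun x y => by
        have : (⟨((x + y : M1') : M') - e' ((x + y : M1') : M'), hsub _ (x + y).2⟩ :
            (RingHom.ker F'.ev • (⊤ : Submodule F'.A M') : Submodule F'.A M'))
            = ⟨x - e' x, hsub x x.2⟩ + ⟨y - e' y, hsub y y.2⟩ := by
          refine Subtype.ext ?_
          change ((x : M') + y) - e' (x + y) = (x - e' x) + (y - e' y)
          rw [map_add, add_sub_add_comm]
        rw [this, map_add, Submodule.coe_add, map_add, add_add_add_comm]
      map_smul' := fun a x => by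
        have : (⟨((a • x : M1') : M') - e' ((a • x : M1') : M'), hsub _ (a • x).2⟩ :
            (RingHom.ker F'.ev • (⊤ : Submodule F'.A M') : Submodule F'.A M'))
            = a • ⟨x - e' x, hsub x x.2⟩ := by
          refine Subtype.ext ?_
          change (a • (x : M')) - e' (a • (x : M')) = a • (x - e' x)
          rw [map_smul, smul_sub]
        rw [this, LinearMap.map_smulₛₗ, Submodule.coe_smul, LinearMap.map_smulₛₗ, smul_add] }
  -- For `x = a m` the first summand is `σ(a) fL(m) = p div(a) fL(m)`, while the second is `div(a)
  -- (f0(m) - p fL(m))`. The sum is `div(a) f0(m)`, as the relation requires.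
  let g : Tilde F' M1' →ₗ[F'.B] N := Tilde.lift (γ := RingHom.id F'.B) (τ := F'.σ)
    (fun _ => rfl) f1 f0 (fun a m x ha hx => by
      change fL x + D ⟨x - e' x, hsub x x.2⟩ = F'.div a • f0 m
      rw [hD a (m - e' m) ⟨x - e' x, hsub x x.2⟩ ha (by
        change (x : M') - e' x = _
        rw [hx, map_smul, smul_sub]), hx, LinearMap.map_smulₛₗ, map_sub, smul_sub, hfe,
        hF'.σ_eq a ha, smul_smul, mul_comm (F'.div a) (p : F'.B)]
      abel)
  refine IsBC.of_leftInverse _ ?_ g fun z => ?_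
  · rw [eq_top_iff, ← Tilde.span_eq_top (F := F') M1', Submodule.span_le]
    set V := Submodule.span F'.B (Set.range (Tilde.map T.σ_comm T.div_comm T.ev_eq_zero φ h))
    have hV0 : ∀ m, Tilde.F0 F' M1' m ∈ V := fun m => by
      induction m using hφ.induction with
      | h0 => rw [map_zero]; exact V.zero_mem
      | hs a m =>
        rw [LinearMap.map_smulₛₗ]
        exact V.smul_mem _ (Submodule.subset_span ⟨Tilde.F0 F M1 m, Tilde.map_F0 _ _ _ _ _ _⟩)
      | ha x y hx hy => rw [map_add]; exact V.add_mem hx hy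
    have hV1 : ∀ x, ∀ hx : x ∈ M1', Tilde.F1 F' M1' ⟨x, hx⟩ ∈ V := fun x hx => by
      induction hx using baseChangeM1_induction with
      | h0 =>
        rw [show (⟨0, M1'.zero_mem⟩ : M1') = 0 from rfl, map_zero]; exact V.zero_mem
      | h1 b x hx =>
        rw [show (⟨b • φ x, M1'.smul_mem b (h x hx)⟩ : M1') = b • ⟨φ x, h x hx⟩ from rfl,
          LinearMap.map_smulₛₗ]
        exact V.smul_mem _ (Submodule.subset_span
          ⟨Tilde.F1 F M1 ⟨x, hx⟩, Tilde.map_F1 _ _ _ _ _ _⟩)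
      | h2 a m ha =>
        rw [Tilde.F1_smul F' M1' a ha m _ rfl]
        exact V.smul_mem _ (hV0 m)
      | ha x y hx hy hx' hy' =>
        rw [show (⟨x + y, M1'.add_mem hx hy⟩ : M1') = ⟨x, hx⟩ + ⟨y, hy⟩ from rfl, map_add]
        exact V.add_mem hx' hy'
    rintro _ (⟨x, rfl⟩ | ⟨m, rfl⟩)
    · exact hV1 x x.2
    · exact hV0 m
  · have key : semiComp (α' := RingHom.id F'.B) (α'' := T.β) (fun _ => rfl) g
        (Tilde.map T.σ_comm T.div_comm T.ev_eq_zero φ h) = BC.mk T.β := by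
      refine Tilde.ext (fun x => ?_) (fun m => ?_)
      · rw [semiComp_apply, Tilde.map_F1]
        refine (Tilde.lift_F1 _ f1 f0 _ _).trans ?_
        change fL (φ x) + D ⟨φ x - e' (φ x), _⟩ = _
        have hx : (x : M) = e x + (x - e x) := by abel
        have hxe : (x : M) - e x ∈ M1 := M1.sub_mem x.2 (e x).2
        have hx' : x = e x + ⟨x - e x, hxe⟩ := Subtype.ext hx
        -- On images of elements of `I M` the divided map `D` agrees with `F₁`. Applied to `x - e
        -- x`, this completes the comparison of `g (F₁ (φ x))` with `F₁(x)`.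
        have hDx : ∀ y : M, y ∈ RingHom.ker F.ev • (⊤ : Submodule F.A M) →
            ∃ (hy : y ∈ M1) (hy' : φ y ∈ RingHom.ker F'.ev • (⊤ : Submodule F'.A M')),
              D ⟨φ y, hy'⟩ = BC.mk T.β (Tilde.F1 F M1 ⟨y, hy⟩) := by
          intro y hy
          induction hy using Submodule.smul_induction_on' with
          | smul a ha m _ =>
            have ham : a • m ∈ M1 := hI a m ha
            have hφam : φ (a • m) = T.α a • φ m := LinearMap.map_smulₛₗ _ _ _
            refine ⟨ham, ?_, ?_⟩
            · rw [hφam]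
              exact Submodule.smul_mem_smul (T.ev_eq_zero a ha) trivial
            · rw [hD (T.α a) (φ m) _ (T.ev_eq_zero a ha) hφam, Tilde.F1_smul F M1 a ha m _ rfl,
                LinearMap.map_smulₛₗ, T.div_comm, hf0]
          | add x _ y _ hx hy =>
            obtain ⟨h1, h2, h3⟩ := hx
            obtain ⟨h4, h5, h6⟩ := hy
            refine ⟨M1.add_mem h1 h4, (map_add φ x y).symm ▸ Submodule.add_mem _ h2 h5, ?_⟩
            have e1 : BC.mk T.β (Tilde.F1 F M1 ⟨x + y, M1.add_mem h1 h4⟩)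
                = BC.mk T.β (Tilde.F1 F M1 ⟨x, h1⟩) + BC.mk T.β (Tilde.F1 F M1 ⟨y, h4⟩) := by
              rw [← map_add, ← map_add]; rfl
            rw [e1, ← h3, ← h6]
            refine Eq.trans (congrArg D ?_) (map_add D _ _)
            exact Subtype.ext (map_add φ x y)
        obtain ⟨h1, h2, h3⟩ := hDx _ (he x x.2)
        conv_rhs => rw [hx', map_add, map_add, ← h3]
        rw [hfL]
        congr 3
        rw [he', map_sub]
      · rw [semiComp_apply, Tilde.map_F0]
        exact (Tilde.lift_F0 _ f1 f0 _ _).trans (hf0 m)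
    exact LinearMap.congr_fun key z

end TildeBaseChange

/-! ## Base change of chains of pairs -/

section Summand

variable {k k' : Type u} [CommRing k] [CommRing k'] {f : k →+* k'}
  {P P' : Type u} [AddCommGroup P] [Module k P] [AddCommGroup P'] [Module k' P']

/-- The projector onto `N` along `C` base changes to an endomorphism that is the identity on the
span of the image of `N` and zero on that of `C`, so these spans are complementary. The same
projector gives a left inverse which identifies the first span with the base change of the finite
projective module `N`, and ranks at points are preserved. -/
theorem IsSummandOfRank.isBC [Module.Finite k P] [Module.Projective k P] {φ : P →ₛₗ[f] P'}
    (hφ : IsBC φ) {N : Submodule k P} {r : ℤ} (h : IsSummandOfRank N r) :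
    IsSummandOfRank (Submodule.span k' (φ '' (N : Set P))) r := by
  obtain ⟨⟨C, hC⟩, hr⟩ := h
  set N' := Submodule.span k' (φ '' (N : Set P))
  set C' := Submodule.span k' (φ '' (C : Set P))
  let π : P →ₗ[k] N := Submodule.projectionOnto N C hC
  have hπN : ∀ x : N, π x = x := Submodule.projectionOnto_apply_left hC
  have hπC : ∀ x ∈ C, π x = 0 := fun x hx => (Submodule.projectionOnto_apply_eq_zero_iff hC).2 hx
  let π' : P' →ₗ[k'] P' := hφ.mapL φ (N.subtype.comp π)
  have hπ' : ∀ x, π' (φ x) = φ (π x) := fun x => hφ.mapL_apply _ _ _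
  have h1 : ∀ x ∈ N', π' x = x := fun x hx => by
    induction hx using Submodule.span_induction with
    | mem x hx =>
      obtain ⟨x, hx, rfl⟩ := hx
      rw [hπ', hπN ⟨x, hx⟩]
    | zero => exact map_zero _
    | add x y _ _ hx hy => rw [map_add, hx, hy]
    | smul a x _ hx => rw [map_smul, hx]
  have h2 : ∀ x ∈ C', π' x = 0 := fun x hx => by
    induction hx using Submodule.span_induction with
    | mem x hx =>
      obtain ⟨x, hx, rfl⟩ := hx
      rw [hπ', hπC x hx, Submodule.coe_zero, map_zero]
    | zero => exact map_zero _
    | add x y _ _ hx hy => rw [map_add, hx, hy, add_zero]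
    | smul a x _ hx => rw [map_smul, hx, smul_zero]
  refine ⟨⟨C', ?_, ?_⟩, fun x => ?_⟩
  · rw [Submodule.disjoint_def]
    intro x hx hx'
    rw [← h1 x hx, h2 x hx']
  · rw [codisjoint_iff, ← Submodule.span_union, eq_top_iff, ← hφ.span_range, Submodule.span_le]
    rintro _ ⟨m, rfl⟩
    have hm : m ∈ N ⊔ C := by rw [hC.sup_eq_top]; trivial
    obtain ⟨y, hy, z, hz, rfl⟩ := Submodule.mem_sup.1 hm
    rw [map_add]
    exact Submodule.add_mem _ (Submodule.subset_span (Or.inl ⟨y, hy, rfl⟩))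
      (Submodule.subset_span (Or.inr ⟨z, hz, rfl⟩))
  · let ψ : N →ₛₗ[f] N' :=
      { toFun := fun x => ⟨φ x, Submodule.subset_span ⟨x, x.2, rfl⟩⟩
        map_add' := fun x y => Subtype.ext (map_add φ _ _)
        map_smul' := fun a x => Subtype.ext (LinearMap.map_smulₛₗ φ a (x : P)) }
    have hπs : Function.Surjective π := fun x => ⟨x, hπN x⟩
    have : Module.Finite k N := Module.Finite.of_surjective π hπs
    have : Module.Projective k N := Module.Projective.of_split N.subtype π (LinearMap.ext hπN)
    have hψ : IsBC ψ := by
      refine IsBC.of_leftInverse ψ ?_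
        ((BC.mapL f π).comp (hφ.toBC.symm.toLinearMap.comp N'.subtype)) fun m => ?_
      · rw [eq_top_iff]
        rintro ⟨x, hx⟩ -
        induction hx using Submodule.span_induction with
        | mem x hx =>
          obtain ⟨x, hx, rfl⟩ := hx
          exact Submodule.subset_span ⟨⟨x, hx⟩, rfl⟩
        | zero => exact Submodule.zero_mem _
        | add x y _ _ hx hy => exact Submodule.add_mem _ hx hy
        | smul a x _ hx => exact Submodule.smul_mem _ a hx
      · change BC.mapL f π (hφ.toBC.symm (φ m)) = _
        rw [hφ.toBC_symm, BC.mapL, BC.map_tmul, hπN]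
        rfl
    rw [hψ.rankAtStalk]
    exact hr _

theorem IsBC.range {Q Q' : Type u} [AddCommGroup Q] [Module k Q] [AddCommGroup Q'] [Module k' Q']
    {φ : P →ₛₗ[f] P'} (hφ : IsBC φ) (χ : Q →ₛₗ[f] Q') (l : P →ₗ[k] Q) (l' : P' →ₗ[k'] Q')
    (h : ∀ x, l' (φ x) = χ (l x)) :
    LinearMap.range l' = Submodule.span k' (χ '' (LinearMap.range l : Set Q)) := by
  apply le_antisymm
  · rintro _ ⟨x, rfl⟩
    induction x using hφ.induction with
    | h0 => rw [map_zero]; exact Submodule.zero_mem _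
    | hs a m =>
      rw [map_smul, h]
      exact Submodule.smul_mem _ _ (Submodule.subset_span ⟨_, ⟨m, rfl⟩, rfl⟩)
    | ha x y hx hy => rw [map_add]; exact Submodule.add_mem _ hx hy
  · rw [Submodule.span_le]
    rintro _ ⟨_, ⟨m, rfl⟩, rfl⟩
    exact ⟨φ m, h m⟩

end Summand

theorem BC.mapL_mk {A B : Type u} [CommRing A] [CommRing B] (f : A →+* B) {M M' : Type u}
    [AddCommGroup M] [Module A M] [AddCommGroup M'] [Module A M'] (l : M →ₗ[A] M') (m : M) :
    BC.mapL f l (BC.mk f m) = BC.mk f (l m) := by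
  rw [BC.mk_apply, BC.mapL, BC.map_tmul]; rfl

/-! ### Chains of pairs over an extension, and the maps induced on `M̃_{i,1}` and `B ⊗ M_i` -/

section PairBaseChange

variable {p g : ℕ} {J : Set ℤ} {R S : Type u} [CommRing R] [CommRing S] {F : Frame R}
  {F' : Frame S} {f : R →+* S}

/-- The generators in `I M'` die in `S ⊗ M'`. What remains is the base change of `M₁ / I M`, for
which the summand condition is inherited. -/
theorem span_mk_baseChangeM1 (T : Frame.Map f F F') {M M' : Type u} [AddCommGroup M] [Module F.A M]
    [AddCommGroup M'] [Module F'.A M'] (φ : M →ₛₗ[T.α] M') (M1 : Submodule F.A M)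
    (χ : BC F.ev M →ₛₗ[f] BC F'.ev M') (hχ : ∀ m, χ (BC.mk F.ev m) = BC.mk F'.ev (φ m)) :
    Submodule.span S (BC.mk F'.ev '' (baseChangeM1 F' φ M1 : Set M'))
      = Submodule.span S (χ '' (Submodule.span R (BC.mk F.ev '' (M1 : Set M)) : Set (BC F.ev M))) := by
  apply le_antisymm
  · rw [Submodule.span_le]
    rintro _ ⟨x, hx, rfl⟩
    induction hx using baseChangeM1_induction with
    | h0 => rw [map_zero]; exact Submodule.zero_mem _
    | h1 b x hx =>
      rw [LinearMap.map_smulₛₗ, ← hχ]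
      exact Submodule.smul_mem _ _
        (Submodule.subset_span ⟨_, Submodule.subset_span ⟨x, hx, rfl⟩, rfl⟩)
    | h2 a m ha =>
      rw [LinearMap.map_smulₛₗ, ha, zero_smul]; exact Submodule.zero_mem _
    | ha x y _ _ hx hy => rw [map_add]; exact Submodule.add_mem _ hx hy
  · rw [Submodule.span_le]
    rintro _ ⟨z, hz, rfl⟩
    induction hz using Submodule.span_induction with
    | mem z hz =>
      obtain ⟨x, hx, rfl⟩ := hz
      rw [hχ]
      exact Submodule.subset_span ⟨_, mem_baseChangeM1 x hx, rfl⟩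
    | zero => rw [map_zero]; exact Submodule.zero_mem _
    | add x y _ _ hx hy => rw [map_add]; exact Submodule.add_mem _ hx hy
    | smul a x _ hx => rw [LinearMap.map_smulₛₗ]; exact Submodule.smul_mem _ _ hx

/-- The homomorphism `R / pR → S / pS`. -/
noncomputable def quotMapP (p : ℕ) (f : R →+* S) :
    R ⧸ Ideal.span {(p : R)} →+* S ⧸ Ideal.span {(p : S)} :=
  Ideal.quotientMap _ f (by
    rw [Ideal.span_le, Set.singleton_subset_iff]
    change f p ∈ Ideal.span {(p : S)}
    rw [map_natCast]
    exact Ideal.mem_span_singleton_self _)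

theorem quotMapP_evModP (T : Frame.Map f F F') (a : F.A) :
    quotMapP p f (F.evModP p a) = F'.evModP p (T.α a) := by
  change quotMapP p f (Ideal.Quotient.mk _ (F.ev a)) = Ideal.Quotient.mk _ (F'.ev (T.α a))
  rw [T.ev_comm]
  exact Ideal.quotientMap_mk

/-- The base change of a chain of pairs. -/
noncomputable def PairChain.baseChange (T : Frame.Map f F F') (c : PairChain p g J F) :
    PairChain p g J F' where
  M i := BC T.α (c.M i)
  ρ i j h := BC.mapL T.α (c.ρ i j h)
  θ i j h := (isBC_mk T.α (c.M i)).congr (isBC_mk T.α (c.M j)) (c.θ i j h)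
  M1 i := baseChangeM1 F' (BC.mk T.α) (c.M1 i)
  finite i := have := c.finite i; BC.finite T.α (c.M i)
  projective i := have := c.projective i; BC.projective T.α (c.M i)
  rank i x := by
    have := c.finite i
    have := c.projective i
    rw [(isBC_mk T.α (c.M i)).rankAtStalk, c.rank]
  ρ_refl i x := by
    refine (isBC_mk T.α (c.M i)).ext (g := BC.mapL T.α (c.ρ i i le_rfl)) (g' := LinearMap.id)
      (fun m => ?_) x
    rw [BC.mk_apply, BC.mapL, BC.map_tmul, c.ρ_refl]
    rfl
  ρ_trans i j k hij hjk x := by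
    refine (isBC_mk T.α (c.M i)).ext
      (g := (BC.mapL T.α (c.ρ j k hjk)).comp (BC.mapL T.α (c.ρ i j hij)))
      (g' := BC.mapL T.α (c.ρ i k (hij.trans hjk))) (fun m => ?_) x
    rw [LinearMap.comp_apply, BC.mk_apply, BC.mapL, BC.mapL, BC.mapL, BC.map_tmul, BC.map_tmul,
      BC.map_tmul, c.ρ_trans]
    rfl
  ρ_rank i j hij hj := by
    have := c.finite j
    have := c.projective j
    have := BC.finite (F.evModP p) (c.M j)
    have := BC.projective (F.evModP p) (c.M j)
    -- Reduction of the extended module modulo `p` is the base change along `R / pR → S / pS` of the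
    -- reduction of the original module. The image of `ρ` there is generated by the old image.
    have hB : ∀ i, IsBC (BC.map (quotMapP_evModP (p := p) T) (BC.mk T.α (M := c.M i))) :=
      fun i => IsBC.map _ (isBC_mk _ _)
    have h := (c.ρ_rank i j hij hj).isBC (hB j)
    rwa [← (hB i).range (BC.map (quotMapP_evModP (p := p) T) (BC.mk T.α (M := c.M j)))
      (BC.mapL (F.evModP p) (c.ρ i j hij))
      (BC.mapL (F'.evModP p) (BC.mapL T.α (c.ρ i j hij))) fun x => ?_] at h
    induction x using BC.induction with
    | h0 => rw [map_zero, map_zero, map_zero, map_zero]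
    | ht b m => simp only [BC.mapL, BC.map_tmul, BC.mk_apply, RingHom.id_apply, map_one]
    | ha x y hx hy => simp only [map_add, hx, hy]
  θ_ρ i j i' j' hij hi hj hij' x := by
    refine (isBC_mk T.α (c.M i)).ext
      (g := ((isBC_mk T.α (c.M j)).congr (isBC_mk T.α (c.M j')) (c.θ j j' hj)).toLinearMap.comp
        (BC.mapL T.α (c.ρ i j hij)))
      (g' := (BC.mapL T.α (c.ρ i' j' hij')).comp
        ((isBC_mk T.α (c.M i)).congr (isBC_mk T.α (c.M i')) (c.θ i i' hi)).toLinearMap)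
      (fun m => ?_) x
    rw [LinearMap.comp_apply, LinearMap.comp_apply, LinearEquiv.coe_coe, LinearEquiv.coe_coe,
      IsBC.congr_apply]
    have h : ∀ (i j : J) (h : (i : ℤ) ≤ j) m, BC.mapL T.α (c.ρ i j h) (BC.mk T.α m)
        = BC.mk T.α (c.ρ i j h m) := fun i j h m => by
      rw [BC.mk_apply, BC.mapL, BC.map_tmul]; rfl
    rw [h, h, IsBC.congr_apply, c.θ_ρ i j i' j' hij hi hj hij']
  ρ_eq_p_θ i j hij h x := by
    refine (isBC_mk T.α (c.M i)).ext (g := BC.mapL T.α (c.ρ i j hij))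
      (g' := (p : F'.A) •
        ((isBC_mk T.α (c.M i)).congr (isBC_mk T.α (c.M j)) (c.θ i j h)).toLinearMap)
      (fun m => ?_) x
    rw [LinearMap.smul_apply, LinearEquiv.coe_coe, IsBC.congr_apply, BC.mk_apply, BC.mapL,
      BC.map_tmul, c.ρ_eq_p_θ i j hij h, BC.tmul_smul, BC.mk_apply, BC.smul_tmul, map_natCast]
    rfl
  smul_mem_M1 i a m ha := smul_mem_baseChangeM1 a m ha
  M1_summand i := by
    have := c.finite i
    have := c.projective i
    have := BC.finite F.ev (c.M i)
    have := BC.projective F.ev (c.M i)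
    have hc : ∀ a, f (F.ev a) = F'.ev (T.α a) := fun a => (T.ev_comm a).symm
    rw [span_mk_baseChangeM1 T (BC.mk T.α) (c.M1 i) (BC.map hc (BC.mk T.α)) fun m => by
      rw [BC.mk_apply, BC.map_tmul, map_one]; rfl]
    exact (c.M1_summand i).isBC (IsBC.map hc (isBC_mk _ _))
  ρ_M1 i j hij x hx := by
    induction hx using baseChangeM1_induction with
    | h0 => rw [map_zero]; exact Submodule.zero_mem _
    | h1 b x hx =>
      rw [map_smul, BC.mk_apply, BC.mapL, BC.map_tmul, map_one]
      exact Submodule.smul_mem _ _ (mem_baseChangeM1 (φ := BC.mk T.α) _ (c.ρ_M1 i j hij x hx))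
    | h2 a m ha => rw [map_smul]; exact smul_mem_baseChangeM1 a _ ha
    | ha x y _ _ hx hy => rw [map_add]; exact Submodule.add_mem _ hx hy
  θ_M1 i j h x := by
    have key : ∀ (i j : J) (e : c.M i ≃ₗ[F.A] c.M j), (∀ x ∈ c.M1 i, e x ∈ c.M1 j) →
        ∀ x ∈ baseChangeM1 F' (BC.mk T.α) (c.M1 i),
        (isBC_mk T.α (c.M i)).congr (isBC_mk T.α (c.M j)) e x
          ∈ baseChangeM1 F' (BC.mk T.α) (c.M1 j) := by
      intro i j e he x hx
      induction hx using baseChangeM1_induction with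
      | h0 => rw [map_zero]; exact Submodule.zero_mem _
      | h1 b x hx =>
        rw [map_smul, IsBC.congr_apply]
        exact Submodule.smul_mem _ _ (mem_baseChangeM1 (φ := BC.mk T.α) _ (he x hx))
      | h2 a m ha => rw [map_smul]; exact smul_mem_baseChangeM1 a _ ha
      | ha x y _ _ hx hy => rw [map_add]; exact Submodule.add_mem _ hx hy
    refine ⟨fun hx => ?_, key i j _ (fun x hx => (c.θ_M1 i j h x).2 hx) x⟩
    have h2 := key j i (c.θ i j h).symm (fun x hx => by
      rw [← c.θ_M1 i j h, LinearEquiv.apply_symm_apply]; exact hx) _ hx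
    have h3 : (isBC_mk T.α (c.M j)).congr (isBC_mk T.α (c.M i)) (c.θ i j h).symm
        ((isBC_mk T.α (c.M i)).congr (isBC_mk T.α (c.M j)) (c.θ i j h) x) = x :=
      ((isBC_mk T.α (c.M i)).congr (isBC_mk T.α (c.M j)) (c.θ i j h)).symm_apply_apply x
    rwa [h3] at h2

/-- The morphism from a chain of pairs to its base change. -/
noncomputable def PairChain.toBaseChange (T : Frame.Map f F F') (c : PairChain p g J F) :
    PairChain.Hom T c (c.baseChange T) where
  φ i := BC.mk T.α
  isBC i := isBC_mk T.α (c.M i)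
  φ_ρ i j h x := (BC.mapL_mk T.α (c.ρ i j h) x).symm
  φ_θ i j h x := (IsBC.congr_apply _ _ _ _).symm
  φ_M1 i := rfl

namespace PairChain

variable {T : Frame.Map f F F'} {c : PairChain p g J F} {c' : PairChain p g J F'}

theorem Hom.tφ_isBC (hF : F.IsWitt p) (hF' : F'.IsWitt p) (h : Hom T c c') (i : J) :
    IsBC (h.tφ i) := by
  have := c.finite i
  have := c.projective i
  exact Tilde.map_isBC hF hF' T (h.isBC i) (c.M1 i) (c.smul_mem_M1 i) (c.M1_summand i).1 (c'.M1 i)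
    (h.φ_M1 i) (h.mem_M1 i)

theorem Hom.rφ_isBC (h : Hom T c c') (i : J) : IsBC (h.rφ i) :=
  IsBC.map _ (h.isBC i)

theorem Hom.tφ_tθ (h : Hom T c c') (i j : J) (hij : (j : ℤ) = i + 2 * g) (x : c.T i) :
    h.tφ j (c.tθ i j hij x) = c'.tθ i j hij (h.tφ i x) := by
  have e : (h.tφ j).comp (c.tθ i j hij) = (c'.tθ i j hij).comp (h.tφ i) := by
    refine Tilde.ext (fun x => ?_) (fun m => ?_)
    · simp only [LinearMap.comp_apply, tφ, tθ, Tilde.mapL, Tilde.map_F1]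
      congr 1
      exact Subtype.ext (h.φ_θ i j hij x)
    · simp only [LinearMap.comp_apply, tφ, tθ, Tilde.mapL, Tilde.map_F0]
      exact congrArg _ (h.φ_θ i j hij m)
  exact LinearMap.congr_fun e x

theorem Hom.rφ_rρ (h : Hom T c c') (i j : J) (hij : (i : ℤ) ≤ j) (x : c.N i) :
    h.rφ j (c.rρ i j hij x) = c'.rρ i j hij (h.rφ i x) := by
  refine (isBC_mk F.res (c.M i)).ext (g := (h.rφ j).comp (c.rρ i j hij))
    (g' := (c'.rρ i j hij).comp (h.rφ i)) (fun m => ?_) x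
  simp only [LinearMap.comp_apply, rφ, rρ, BC.mapL, BC.mk_apply, BC.map_tmul, h.φ_ρ]
  rfl

theorem Hom.rφ_rθ (h : Hom T c c') (i j : J) (hij : (j : ℤ) = i + 2 * g) (x : c.N i) :
    h.rφ j (c.rθ i j hij x) = c'.rθ i j hij (h.rφ i x) := by
  refine (isBC_mk F.res (c.M i)).ext (g := (h.rφ j).comp (c.rθ i j hij))
    (g' := (c'.rθ i j hij).comp (h.rφ i)) (fun m => ?_) x
  simp only [LinearMap.comp_apply, rφ, rθ, BC.mapL, BC.mk_apply, BC.map_tmul]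
  exact congrArg₂ (BC.tmul _) rfl (h.φ_θ i j hij m)

end PairChain

end PairBaseChange

/-! ## Base change of pairings -/

section Bilinear

variable {A A' : Type u} [CommRing A] [CommRing A'] {α : A →+* A'}
  {M M' N N' P P' : Type u} [AddCommGroup M] [Module A M] [AddCommGroup M'] [Module A' M']
  [AddCommGroup N] [Module A N] [AddCommGroup N'] [Module A' N']
  [AddCommGroup P'] [Module A' P'] [AddCommGroup P] [Module A P]

/-- The bilinear map between base changes induced by a bilinear map. -/
noncomputable def IsBC.bilin {φ : M →ₛₗ[α] M'} (hφ : IsBC φ) {χ : N →ₛₗ[α] N'} (hχ : IsBC χ)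
    (ψ : P →ₛₗ[α] P') (l : M →ₗ[A] N →ₗ[A] P) : M' →ₗ[A'] N' →ₗ[A'] P' :=
  hφ.lift (γ := RingHom.id A') (τ := α) (fun _ => rfl)
    { toFun := fun x => hχ.mapL ψ (l x)
      map_add' := fun x y => LinearMap.ext <| hχ.ext fun m => by
        simp only [LinearMap.add_apply, hχ.mapL_apply, map_add]
      map_smul' := fun a x => LinearMap.ext <| hχ.ext fun m => by
        simp only [LinearMap.smul_apply, hχ.mapL_apply, map_smul, LinearMap.map_smulₛₗ] }

theorem IsBC.bilin_apply {φ : M →ₛₗ[α] M'} (hφ : IsBC φ) {χ : N →ₛₗ[α] N'} (hχ : IsBC χ)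
    (ψ : P →ₛₗ[α] P') (l : M →ₗ[A] N →ₗ[A] P) (x : M) (y : N) :
    hφ.bilin hχ ψ l (φ x) (χ y) = ψ (l x y) := by
  rw [IsBC.bilin, IsBC.lift_apply]
  exact hχ.mapL_apply _ _ _

/-- Two bilinear maps that agree on generators agree. -/
theorem IsBC.ext₂ {φ : M →ₛₗ[α] M'} (hφ : IsBC φ) {χ : N →ₛₗ[α] N'} (hχ : IsBC χ) {C : Type u}
    [CommRing C] {γ : A' →+* C} {Q : Type u} [AddCommGroup Q] [Module C Q]
    {b b' : M' →ₛₗ[γ] N' →ₛₗ[γ] Q} (h : ∀ x y, b (φ x) (χ y) = b' (φ x) (χ y)) (x : M') (y : N') :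
    b x y = b' x y := by
  induction y using hχ.induction with
  | h0 => rw [map_zero, map_zero]
  | hs a n =>
    rw [LinearMap.map_smulₛₗ, LinearMap.map_smulₛₗ]
    congr 1
    exact hφ.ext (g := (LinearMap.flip b) (χ n)) (g' := (LinearMap.flip b') (χ n)) (fun m => h m n) x
  | ha y z hy hz => rw [map_add, map_add, hy, hz]

/-- For a finite projective `N` the formation of `Hom(N, P)` commutes with base change. The new
pairing, viewed as a map to `Hom(N', P')`, is then the base change of the isomorphism `l`.
Perfectness of the polarization is preserved for this reason. -/
theorem IsBC.linearMap_bijective [Module.Finite A N] [Module.Projective A N] {φ : M →ₛₗ[α] M'}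
    (hφ : IsBC φ) {χ : N →ₛₗ[α] N'} (hχ : IsBC χ) {ψ : P →ₛₗ[α] P'} (hψ : IsBC ψ)
    (l : M →ₗ[A] N →ₗ[A] P) (hl : Function.Bijective l) :
    Function.Bijective (hφ.bilin hχ ψ l) := by
  obtain ⟨n, e, s, hs⟩ := exists_finite_dual_basis A N
  let Θ : (N →ₗ[A] P) →ₛₗ[α] (N' →ₗ[A'] P') :=
    { toFun := fun m => hχ.mapL ψ m
      map_add' := fun x y => LinearMap.ext <| hχ.ext fun m => by
        simp only [LinearMap.add_apply, hχ.mapL_apply, map_add]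
      map_smul' := fun a x => LinearMap.ext <| hχ.ext fun m => by
        simp only [LinearMap.smul_apply, hχ.mapL_apply, LinearMap.map_smulₛₗ] }
  have hΘ' : ∀ m x, Θ m (χ x) = ψ (m x) := fun m x => hχ.mapL_apply _ _ _
  -- The map `i ↦ s_k ⊗ i` into `Hom(N, P)`. By the dual basis, `h = ∑ c_k(h(e_k))`, and the base
  -- change of this formula inverts `Θ`.
  let c : Fin n → P →ₗ[A] (N →ₗ[A] P) := fun k =>
    { toFun := fun i => (s k).smulRight i
      map_add' := fun x y => by ext; simp
      map_smul' := fun a x => by ext; simp [smul_comm a] }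
  have hΘ : IsBC Θ := by
    refine IsBC.of_leftInverse Θ ?_ (∑ k, (BC.mapL α (c k)).comp
      (hψ.toBC.symm.toLinearMap.comp (LinearMap.applyₗ (χ (e k))))) fun m => ?_
    · rw [eq_top_iff]
      rintro h -
      have h1 : h = ∑ k, hψ.mapL Θ (c k) (h (χ (e k))) := LinearMap.ext <| hχ.ext fun m => by
        have h2 : ∀ k y, hψ.mapL Θ (c k) y (χ m) = α (s k m) • y := fun k y => by
          induction y using hψ.induction with
          | h0 => rw [map_zero, LinearMap.zero_apply, smul_zero]
          | hs a i =>
            rw [map_smul, hψ.mapL_apply, LinearMap.smul_apply, hΘ', smul_comm,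
              ← LinearMap.map_smulₛₗ]
            rfl
          | ha x y hx hy => rw [map_add, LinearMap.add_apply, hx, hy, smul_add]
        rw [LinearMap.sum_apply]
        simp only [h2]
        conv_lhs => rw [hs m, map_sum, map_sum]
        refine Finset.sum_congr rfl fun k _ => ?_
        rw [LinearMap.map_smulₛₗ, map_smul]
      rw [h1]
      refine Submodule.sum_mem _ fun k _ => ?_
      generalize h (χ (e k)) = y
      induction y using hψ.induction with
      | h0 => rw [map_zero]; exact Submodule.zero_mem _
      | hs a m =>
        rw [map_smul, hψ.mapL_apply]
        exact Submodule.smul_mem _ _ (Submodule.subset_span ⟨_, rfl⟩)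
      | ha x y hx hy => rw [map_add]; exact Submodule.add_mem _ hx hy
    · rw [LinearMap.sum_apply]
      have h1 : m = ∑ k, c k (m (e k)) := LinearMap.ext fun x => by
        rw [LinearMap.sum_apply]
        conv_lhs => rw [hs x, map_sum]
        refine Finset.sum_congr rfl fun k _ => ?_
        rw [map_smul]; rfl
      conv_rhs => rw [h1, ← BC.mk_apply, map_sum]
      refine Finset.sum_congr rfl fun k _ => ?_
      change BC.mapL α (c k) (hψ.toBC.symm (Θ m (χ (e k)))) = _
      rw [hΘ', hψ.toBC_symm, ← BC.mk_apply, BC.mapL_mk]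
  exact (hφ.congr hΘ (LinearEquiv.ofBijective l hl)).bijective

/-- Used for the target of the map that tests orthogonality against finitely many generators. -/
theorem IsBC.pi {n : ℕ} {ψ : P →ₛₗ[α] P'} (hψ : IsBC ψ) (Ψ : (Fin n → P) →ₛₗ[α] (Fin n → P'))
    (hΨ : ∀ v k, Ψ v k = ψ (v k)) : IsBC Ψ := by
  have hsingle : ∀ k i, Ψ (Pi.single k i) = Pi.single k (ψ i) := fun k i => by
    ext j
    rw [hΨ]
    by_cases h : j = k
    · subst h; simp
    · simp [h]
  refine IsBC.of_leftInverse Ψ ?_ (∑ k, (BC.mapL α (LinearMap.single A (fun _ => P) k)).comp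
    (hψ.toBC.symm.toLinearMap.comp (LinearMap.proj k))) fun v => ?_
  · rw [eq_top_iff]
    rintro v -
    rw [← LinearMap.sum_single_apply (fun _ => P') v]
    refine Submodule.sum_mem _ fun k _ => ?_
    generalize v k = y
    induction y using hψ.induction with
    | h0 => rw [Pi.single_zero]; exact Submodule.zero_mem _
    | hs a m =>
      rw [Pi.single_smul, ← hsingle]
      exact Submodule.smul_mem _ _ (Submodule.subset_span ⟨_, rfl⟩)
    | ha x y hx hy => rw [Pi.single_add]; exact Submodule.add_mem _ hx hy
  · rw [LinearMap.sum_apply]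
    conv_rhs => rw [← LinearMap.sum_single_apply (fun _ => P) v, ← BC.mk_apply, map_sum]
    refine Finset.sum_congr rfl fun k _ => ?_
    change BC.mapL α (LinearMap.single A (fun _ => P) k) (hψ.toBC.symm (Ψ v k)) = _
    rw [hΨ, hψ.toBC_symm, ← BC.mk_apply, BC.mapL_mk]
    rfl

end Bilinear

/-! ## Base change of polarizations -/

theorem BC.mk_surjective {A B : Type u} [CommRing A] [CommRing B] {f : A →+* B}
    (hf : Function.Surjective f) {M : Type u} [AddCommGroup M] [Module A M] :
    Function.Surjective (BC.mk f : M →ₛₗ[f] BC f M) := by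
  intro z
  induction z using BC.induction with
  | h0 => exact ⟨0, map_zero _⟩
  | ht b m =>
    obtain ⟨a, rfl⟩ := hf b
    exact ⟨a • m, by rw [BC.mk_apply, BC.tmul_smul, mul_one]⟩
  | ha x y hx hy =>
    obtain ⟨x, rfl⟩ := hx
    obtain ⟨y, rfl⟩ := hy
    exact ⟨x + y, map_add _ _ _⟩

section PolarizationBaseChange

variable {p g : ℕ} {J : Set ℤ} {R S : Type u} [CommRing R] [CommRing S] {F : Frame R}
  {F' : Frame S} {f : R →+* S}

theorem IsBC.mem_ker_smul_top {A A' : Type u} [CommRing A] [CommRing A'] {α : A →+* A'}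
    {I I' : Type u} [AddCommGroup I] [Module A I] [AddCommGroup I'] [Module A' I']
    (ψ : I →ₛₗ[α] I') {a : Ideal A} {a' : Ideal A'} (h : ∀ x ∈ a, α x ∈ a') (i : I)
    (hi : i ∈ a • (⊤ : Submodule A I)) : ψ i ∈ a' • (⊤ : Submodule A' I') := by
  induction hi using Submodule.smul_induction_on' with
  | smul x hx n _ =>
    rw [LinearMap.map_smulₛₗ]
    exact Submodule.smul_mem_smul (h x hx) trivial
  | add x _ y _ hx hy => rw [map_add]; exact Submodule.add_mem _ hx hy

/-- The orthogonal of `M₁` is compatible with flat base change. -/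
theorem mem_baseChangeM1_iff (hf : f.Flat) (hF : F.IsWitt p) (hF' : F'.IsWitt p)
    (T : Frame.Map f F F') {M N I M' N' I' : Type u} [AddCommGroup M] [Module F.A M]
    [AddCommGroup N] [Module F.A N] [AddCommGroup I] [Module F.A I] [AddCommGroup M']
    [Module F'.A M'] [AddCommGroup N'] [Module F'.A N'] [AddCommGroup I'] [Module F'.A I']
    {φ : M →ₛₗ[T.α] M'} (hφ : IsBC φ) {χ : N →ₛₗ[T.α] N'} (hχ : IsBC χ) {ψ : I →ₛₗ[T.α] I'}
    (hψ : IsBC ψ) (l : M →ₗ[F.A] N →ₗ[F.A] I) (M1 : Submodule F.A M) (N1 : Submodule F.A N)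
    [Module.Finite F.A N]
    (hN1 : ∃ C, IsCompl (Submodule.span R (BC.mk F.ev '' (N1 : Set N))) C)
    (hl : ∀ x, x ∈ M1 ↔ ∀ y ∈ N1, l x y ∈ RingHom.ker F.ev • (⊤ : Submodule F.A I)) (x : M') :
    x ∈ baseChangeM1 F' φ M1 ↔ ∀ y ∈ baseChangeM1 F' χ N1,
      hφ.bilin hχ ψ l x y ∈ RingHom.ker F'.ev • (⊤ : Submodule F'.A I') := by
  have hker : ∀ a ∈ RingHom.ker F.ev, T.α a ∈ RingHom.ker F'.ev := fun a ha =>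
    T.ev_eq_zero a ha
  constructor
  · intro hx y hy
    induction hx using baseChangeM1_induction with
    | h0 => rw [map_zero]; exact Submodule.zero_mem _
    | h1 b x hx =>
      rw [map_smul, LinearMap.smul_apply]
      refine Submodule.smul_mem _ b ?_
      induction hy using baseChangeM1_induction with
      | h0 => rw [map_zero]; exact Submodule.zero_mem _
      | h1 b y hy =>
        rw [map_smul, IsBC.bilin_apply]
        exact Submodule.smul_mem _ b (IsBC.mem_ker_smul_top ψ hker _ ((hl x).1 hx y hy))
      | h2 a m ha =>
        rw [map_smul]
        exact Submodule.smul_mem_smul ha trivial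
      | ha x y _ _ hx hy => rw [map_add]; exact Submodule.add_mem _ hx hy
    | h2 a m ha =>
      rw [map_smul, LinearMap.smul_apply]
      exact Submodule.smul_mem_smul ha trivial
    | ha x y _ _ hx hy =>
      rw [map_add, LinearMap.add_apply]; exact Submodule.add_mem _ hx hy
  · intro hx
    have hc : ∀ a, f (F.ev a) = F'.ev (T.α a) := fun a => (T.ev_comm a).symm
    have hmk : ∀ {Q Q' : Type u} [AddCommGroup Q] [Module F.A Q] [AddCommGroup Q'] [Module F'.A Q']
        (φ : Q →ₛₗ[T.α] Q') (m : Q), BC.map hc φ (BC.mk F.ev m) = BC.mk F'.ev (φ m) := fun φ m => by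
      rw [BC.mk_apply, BC.map_tmul, map_one]; rfl
    have : Module.Finite R (Submodule.span R (BC.mk F.ev '' (N1 : Set N))) := by
      obtain ⟨C, hC⟩ := hN1
      have := BC.finite F.ev N
      exact Module.Finite.of_surjective (Submodule.projectionOnto _ C hC)
        fun x => ⟨x, Submodule.projectionOnto_apply_left hC x⟩
    obtain ⟨n, y, hy⟩ := Submodule.fg_iff_exists_fin_generating_family.1
      (Module.Finite.iff_fg.1 this)
    have hy' : ∀ k, ∃ z ∈ N1, BC.mk F.ev z = y k := fun k =>
      mem_span_mk hF.ev_surjective N1 _ (by rw [← hy]; exact Submodule.subset_span ⟨k, rfl⟩)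
    choose z hz hzy using hy'
    -- Over `R`, the orthogonal of `N₁` is the kernel of the pairing with finitely many generators
    -- of `N₁ / I N`. Being the kernel of a map to a finite power, it commutes with the flat base
    -- change `f`.
    let Λ : BC F.ev M →ₗ[R] (Fin n → BC F.ev I) := LinearMap.pi fun k =>
      (BC.pair F.ev l).flip (y k)
    have hΛ : ∀ m k, Λ (BC.mk F.ev m) k = BC.mk F.ev (l m (z k)) := fun m k => by
      change BC.pair F.ev l (BC.mk F.ev m) (y k) = _
      rw [← hzy, BC.mk_apply, BC.mk_apply, BC.pair_tmul, one_mul]; rfl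
    let Λ' : BC F'.ev M' →ₗ[S] (Fin n → BC F'.ev I') := LinearMap.pi fun k =>
      (BC.pair F'.ev (hφ.bilin hχ ψ l)).flip (BC.mk F'.ev (χ (z k)))
    have hΛ' : ∀ m k, Λ' (BC.mk F'.ev m) k = BC.mk F'.ev (hφ.bilin hχ ψ l m (χ (z k))) :=
      fun m k => by
        change BC.pair F'.ev (hφ.bilin hχ ψ l) (BC.mk F'.ev m) (BC.mk F'.ev (χ (z k))) = _
        rw [BC.mk_apply, BC.mk_apply, BC.pair_tmul, one_mul]; rfl
    let Ψ : (Fin n → BC F.ev I) →ₛₗ[f] (Fin n → BC F'.ev I') :=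
      { toFun := fun v k => BC.map hc ψ (v k)
        map_add' := fun v w => by ext k; simp
        map_smul' := fun a v => by ext k; simp }
    have hΨ : IsBC Ψ := IsBC.pi (IsBC.map hc hψ) Ψ fun _ _ => rfl
    have hcomm : ∀ w, Λ' (BC.map hc φ w) = Ψ (Λ w) := fun w => by
      refine (isBC_mk F.ev M).ext (γ := f) (g := semiComp (fun _ => rfl) Λ' (BC.map hc φ))
        (g' := semiComp (fun _ => rfl) Ψ Λ) (fun m => ?_) w
      ext k
      change Λ' (BC.map hc φ (BC.mk F.ev m)) k = BC.map hc ψ (Λ (BC.mk F.ev m) k)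
      rw [hmk, hΛ', hΛ, hmk, IsBC.bilin_apply]
    have hmem : ∀ w, Λ' w = 0 → ∃ v ∈ baseChangeM1 F' φ M1, BC.mk F'.ev v = w := by
      intro w hw
      refine IsBC.ker_induction (P := fun w => ∃ v ∈ baseChangeM1 F' φ M1, BC.mk F'.ev v = w) hf
        (IsBC.map hc hφ) hΨ Λ Λ' hcomm ⟨0, Submodule.zero_mem _, map_zero _⟩ ?_ ?_ w hw
      · intro b w hw
        obtain ⟨m, rfl⟩ := BC.mk_surjective hF.ev_surjective w
        obtain ⟨b, rfl⟩ := hF'.ev_surjective b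
        refine ⟨b • φ m, Submodule.smul_mem _ _ (mem_baseChangeM1 m ((hl m).2 fun v hv => ?_)), ?_⟩
        · rw [← BC.mk_eq_zero_iff hF.ev_surjective]
          have h1 : BC.mk F.ev v ∈ Submodule.span R (BC.mk F.ev '' (N1 : Set N)) :=
            Submodule.subset_span ⟨v, hv, rfl⟩
          rw [← hy] at h1
          have h2 : Submodule.span R (Set.range y)
              ≤ LinearMap.ker (BC.pair F.ev l (BC.mk F.ev m)) := by
            rw [Submodule.span_le]
            rintro _ ⟨k, rfl⟩
            exact congrFun hw k
          have h3 := LinearMap.mem_ker.1 (h2 h1)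
          rwa [BC.mk_apply, BC.mk_apply, BC.pair_tmul, one_mul] at h3
        · rw [LinearMap.map_smulₛₗ, hmk]
      · rintro _ _ ⟨v, hv, rfl⟩ ⟨w, hw, rfl⟩
        exact ⟨v + w, Submodule.add_mem _ hv hw, map_add _ _ _⟩
    obtain ⟨v, hv, hvx⟩ := hmem (BC.mk F'.ev x) (funext fun k => by
      rw [hΛ']
      exact (BC.mk_eq_zero_iff hF'.ev_surjective _).2 (hx _ (mem_baseChangeM1 _ (hz k))))
    -- `x` and `v` agree over `S`, so they differ by an element of `I M'`, which is contained in the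
    -- extended `M₁` by construction.
    have hvx' : x - v ∈ RingHom.ker F'.ev • (⊤ : Submodule F'.A M') := by
      rw [← BC.mk_eq_zero_iff hF'.ev_surjective, map_sub, hvx, sub_self]
    have hle : RingHom.ker F'.ev • (⊤ : Submodule F'.A M') ≤ baseChangeM1 F' φ M1 :=
      Submodule.smul_le.2 fun a ha m _ => smul_mem_baseChangeM1 a m ha
    rw [← sub_add_cancel x v]
    exact Submodule.add_mem _ (hle hvx') hv

/-- The identities between bilinear maps are checked on generators, and perfectness is the
compatibility of `Hom` with base change. Flatness of `f` serves only the last condition, where an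
orthogonal complement must be base changed. -/
theorem IsPairPolarization.baseChange (hf : f.Flat) (hF : F.IsWitt p) (hF' : F'.IsWitt p)
    {T : Frame.Map f F F'} {c : PairChain p g J F} {c' : PairChain p g J F'}
    (h : PairChain.Hom T c c') {I I' : Type u} [AddCommGroup I] [Module F.A I] [AddCommGroup I']
    [Module F'.A I'] {ψ : I →ₛₗ[T.α] I'} (hψ : IsBC ψ)
    {lam : ∀ i j : J, (i : ℤ) + j = 0 → c.M i →ₗ[F.A] c.M j →ₗ[F.A] I}
    (hlam : IsPairPolarization c lam) :
    IsPairPolarization c' (fun i j e => (h.isBC i).bilin (h.isBC j) ψ (lam i j e)) where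
  bijective i j e := by
    have := c.finite j
    have := c.projective j
    exact IsBC.linearMap_bijective _ _ hψ _ (hlam.bijective i j e)
  antisymm i j e e' x y := by
    refine (h.isBC i).ext₂ (h.isBC j) (γ := RingHom.id F'.A)
      (b := ((h.isBC j).bilin (h.isBC i) ψ (lam j i e')).flip)
      (b' := -((h.isBC i).bilin (h.isBC j) ψ (lam i j e))) (fun x y => ?_) x y
    rw [LinearMap.flip_apply, LinearMap.neg_apply, LinearMap.neg_apply, IsBC.bilin_apply,
      IsBC.bilin_apply, hlam.antisymm i j e e', map_neg]
  ρ_compat i j i' j' hi hj hij hij' x y := by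
    refine (h.isBC i).ext₂ (h.isBC j') (γ := RingHom.id F'.A)
      (b := ((h.isBC j).bilin (h.isBC j') ψ (lam j j' hj)).comp (c'.ρ i j hij))
      (b' := ((h.isBC i).bilin (h.isBC i') ψ (lam i i' hi)).compl₂ (c'.ρ j' i' hij'))
      (fun x y => ?_) x y
    rw [LinearMap.comp_apply, LinearMap.compl₂_apply, ← h.φ_ρ, ← h.φ_ρ, IsBC.bilin_apply,
      IsBC.bilin_apply, hlam.ρ_compat i j i' j' hi hj hij hij']
  θ_compat i j i' j' hi hj hij hij' x y := by
    refine (h.isBC i).ext₂ (h.isBC j') (γ := RingHom.id F'.A)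
      (b := ((h.isBC j).bilin (h.isBC j') ψ (lam j j' hj)).comp (c'.θ i j hij).toLinearMap)
      (b' := ((h.isBC i).bilin (h.isBC i') ψ (lam i i' hi)).compl₂ (c'.θ j' i' hij').toLinearMap)
      (fun x y => ?_) x y
    rw [LinearMap.comp_apply, LinearMap.compl₂_apply, LinearEquiv.coe_coe, LinearEquiv.coe_coe,
      ← h.φ_θ, ← h.φ_θ, IsBC.bilin_apply, IsBC.bilin_apply,
      hlam.θ_compat i j i' j' hi hj hij hij']
  M1_compat i j e x := by
    have := c.finite j
    rw [h.φ_M1 i, h.φ_M1 j]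
    exact mem_baseChangeM1_iff hf hF hF' T (h.isBC i) (h.isBC j) hψ (lam i j e) (c.M1 i) (c.M1 j)
      (c.M1_summand j).1 (hlam.M1_compat i j e) x

end PolarizationBaseChange

/-! ## Base change of the pairings on `M̃₁` -/

section TildePairing

variable {p : ℕ} {R S : Type u} [CommRing R] [CommRing S] {F : Frame R} {F' : Frame S} {f : R →+* S}

theorem exists_fin_sum_of_mem_smul_top {A I : Type u} [CommRing A] [AddCommGroup I] [Module A I]
    {a : Ideal A} {x : I} (hx : x ∈ a • (⊤ : Submodule A I)) :
    ∃ (k : ℕ) (r : Fin k → A) (e : Fin k → I), (∀ s, r s ∈ a) ∧ x = ∑ s, r s • e s := by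
  induction hx using Submodule.smul_induction_on' with
  | smul r hr n _ => exact ⟨1, fun _ => r, fun _ => n, fun _ => hr, by simp⟩
  | add x _ y _ hx hy =>
    obtain ⟨k, r, e, hr, rfl⟩ := hx
    obtain ⟨l, s, d, hs, rfl⟩ := hy
    refine ⟨k + l, Fin.append r s, Fin.append e d, fun t => ?_, ?_⟩
    · induction t using Fin.addCases with
      | left t => rw [Fin.append_left]; exact hr t
      | right t => rw [Fin.append_right]; exact hs t
    · rw [Fin.sum_univ_add]
      simp

/-- The target of the new pairing is the ring `F'.A`, so `div` can be applied to its values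
directly. The condition on `F₁ × F₁`, which speaks of all expressions `∑ a_s e_s`, reduces to the
single formula `μ'(F₁ x, F₁ y) = div(l'(x, y)) ⊗ 1`. Each formula is proved on the generators of the
extended submodules. -/
theorem IsTildePairing.baseChange (hF' : F'.IsWitt p) (T : Frame.Map f F F') {M N I M' N' : Type u}
    [AddCommGroup M] [Module F.A M]
    [AddCommGroup N] [Module F.A N] [AddCommGroup I] [Module F.A I] [AddCommGroup M']
    [Module F'.A M'] [AddCommGroup N'] [Module F'.A N']
    {φ : M →ₛₗ[T.α] M'} (hφ : IsBC φ) {χ : N →ₛₗ[T.α] N'} (hχ : IsBC χ) (ψ : I →ₛₗ[T.α] F'.A)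
    {l : M →ₗ[F.A] N →ₗ[F.A] I} {M1 : Submodule F.A M} {N1 : Submodule F.A N}
    {μ : Tilde F M1 →ₗ[F.B] Tilde F N1 →ₗ[F.B] BC F.σ I} (h : IsTildePairing l μ p)
    (hl : ∀ x ∈ M1, ∀ y ∈ N1, l x y ∈ RingHom.ker F.ev • (⊤ : Submodule F.A I))
    {M1' : Submodule F'.A M'} (hM1' : M1' = baseChangeM1 F' φ M1) {N1' : Submodule F'.A N'}
    (hN1' : N1' = baseChangeM1 F' χ N1) (hφ1 : ∀ x ∈ M1, φ x ∈ M1') (hχ1 : ∀ x ∈ N1, χ x ∈ N1')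
    (hM : IsBC (Tilde.map T.σ_comm T.div_comm T.ev_eq_zero φ hφ1))
    (hN : IsBC (Tilde.map T.σ_comm T.div_comm T.ev_eq_zero χ hχ1)) :
    IsTildePairing (hφ.bilin hχ ψ l) (hM.bilin hN (BC.map T.σ_comm ψ) μ) p := by
  subst hM1' hN1'
  set M1' := baseChangeM1 F' φ M1
  set N1' := baseChangeM1 F' χ N1
  set l' := hφ.bilin hχ ψ l
  set μ' := hM.bilin hN (BC.map T.σ_comm ψ) μ
  have hl' : ∀ x y, l' (φ x) (χ y) = ψ (l x y) := hφ.bilin_apply hχ ψ l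
  have hμ' : ∀ x y, μ' (Tilde.map T.σ_comm T.div_comm T.ev_eq_zero φ hφ1 x)
    (Tilde.map T.σ_comm T.div_comm T.ev_eq_zero χ hχ1 y) = BC.map T.σ_comm ψ (μ x y) :=
    hM.bilin_apply hN _ μ
  have hmk : ∀ i, BC.map T.σ_comm ψ (BC.mk F.σ i) = BC.mk F'.σ (ψ i) := fun i => by
    rw [BC.mk_apply, BC.map_tmul, map_one]; rfl
  have hmk1 : ∀ a : F'.A, BC.mk F'.σ a = F'.σ a • BC.mk F'.σ (1 : F'.A) := fun a => by
    rw [← LinearMap.map_smulₛₗ, smul_eq_mul, mul_one]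
  have hm0 : ∀ m, Tilde.F0 F' M1' (φ m)
      = Tilde.map T.σ_comm T.div_comm T.ev_eq_zero φ hφ1 (Tilde.F0 F M1 m) :=
    fun m => (Tilde.map_F0 _ _ _ _ _ m).symm
  have hn0 : ∀ m, Tilde.F0 F' N1' (χ m)
      = Tilde.map T.σ_comm T.div_comm T.ev_eq_zero χ hχ1 (Tilde.F0 F N1 m) :=
    fun m => (Tilde.map_F0 _ _ _ _ _ m).symm
  have hm1 : ∀ (b : F'.A) (m : M) (hm : m ∈ M1), Tilde.F1 F' M1' (b • ⟨φ m, hφ1 m hm⟩) =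
      F'.σ b • Tilde.map T.σ_comm T.div_comm T.ev_eq_zero φ hφ1 (Tilde.F1 F M1 ⟨m, hm⟩) :=
    fun b m hm => by rw [LinearMap.map_smulₛₗ, Tilde.map_F1]
  have hn1 : ∀ (b : F'.A) (m : N) (hm : m ∈ N1), Tilde.F1 F' N1' (b • ⟨χ m, hχ1 m hm⟩) =
      F'.σ b • Tilde.map T.σ_comm T.div_comm T.ev_eq_zero χ hχ1 (Tilde.F1 F N1 ⟨m, hm⟩) :=
    fun b m hm => by rw [LinearMap.map_smulₛₗ, Tilde.map_F1]
  have l1 : ∀ (a : F'.A) x y, l' (a • x) y = a * l' x y := fun a x y => by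
    rw [map_smul]; rfl
  have l2 : ∀ (a : F'.A) x y, l' x (a • y) = a * l' x y := fun a x y => by
    rw [map_smul]; rfl
  have μ1 : ∀ (b : F'.B) x y, μ' (b • x) y = b • μ' x y := fun b x y => by
    rw [map_smul]; rfl
  have μ2 : ∀ (b : F'.B) x y, μ' x (b • y) = b • μ' x y := fun b x y => by
    rw [map_smul]
  have h00 : ∀ x y, μ' (Tilde.F0 F' M1' x) (Tilde.F0 F' N1' y)
      = (p : F'.B) • BC.mk F'.σ (l' x y) := by
    intro x y
    induction x using hφ.induction with
    | h0 => simp only [map_zero, LinearMap.zero_apply, smul_zero]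
    | ha x y hx hy => simp only [map_add, LinearMap.add_apply, smul_add, hx, hy]
    | hs b x =>
      rw [LinearMap.map_smulₛₗ (Tilde.F0 F' M1'), map_smul, LinearMap.smul_apply, map_smul,
        LinearMap.smul_apply, LinearMap.map_smulₛₗ, smul_comm (p : F'.B)]
      congr 1
      induction y using hχ.induction with
      | h0 => simp only [map_zero, smul_zero]
      | ha x y hx hy => simp only [map_add, smul_add, hx, hy]
      | hs c y =>
        rw [LinearMap.map_smulₛₗ (Tilde.F0 F' N1'), map_smul, map_smul, LinearMap.map_smulₛₗ,
          smul_comm (p : F'.B), hm0, hn0, hμ', h.F0_F0, LinearMap.map_smulₛₗ, hmk, hl', map_natCast]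
  have h10 : ∀ x y, μ' (Tilde.F1 F' M1' x) (Tilde.F0 F' N1' y) = BC.mk F'.σ (l' x y) := by
    rintro ⟨x, hx⟩ y
    induction hx using baseChangeM1_induction with
    | h0 =>
      change μ' (Tilde.F1 F' M1' 0) _ = BC.mk F'.σ (l' 0 y)
      simp only [map_zero, LinearMap.zero_apply]
    | ha x y hx hy hx' hy' =>
      change μ' (Tilde.F1 F' M1' (⟨x, hx⟩ + ⟨y, hy⟩)) _ = BC.mk F'.σ (l' (x + y) _)
      simp only [map_add, LinearMap.add_apply, hx', hy']
    | h2 a m ha =>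
      -- On the generators `a m` of `I M'` the factor `p` coming from `F × F` is absorbed by `p
      -- div(a) = σ(a)`.
      rw [Tilde.F1_smul F' M1' a ha m _ rfl, map_smul, LinearMap.smul_apply, h00]
      change _ = BC.mk F'.σ (l' (a • m) y)
      rw [map_smul, LinearMap.smul_apply, LinearMap.map_smulₛₗ, hF'.σ_eq a ha, smul_smul, mul_comm]
    | h1 b x hx =>
      change μ' (Tilde.F1 F' M1' (b • ⟨φ x, hφ1 x hx⟩)) _ = BC.mk F'.σ (l' (b • φ x) _)
      rw [hm1 b x hx, map_smul, LinearMap.smul_apply, map_smul, LinearMap.smul_apply,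
        LinearMap.map_smulₛₗ]
      congr 1
      induction y using hχ.induction with
      | h0 => simp only [map_zero]
      | ha x y hx hy => simp only [map_add, hx, hy]
      | hs c y =>
        rw [LinearMap.map_smulₛₗ, map_smul, map_smul, LinearMap.map_smulₛₗ, hn0, hμ', h.F1_F0, hmk,
          hl']
  have h01 : ∀ x y, μ' (Tilde.F0 F' M1' x) (Tilde.F1 F' N1' y) = BC.mk F'.σ (l' x y) := by
    rintro x ⟨y, hy⟩
    induction hy using baseChangeM1_induction with
    | h0 =>
      change μ' _ (Tilde.F1 F' N1' 0) = BC.mk F'.σ (l' x 0)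
      simp only [map_zero]
    | ha y z hy hz hy' hz' =>
      change μ' _ (Tilde.F1 F' N1' (⟨y, hy⟩ + ⟨z, hz⟩)) = BC.mk F'.σ (l' _ (y + z))
      simp only [map_add, hy', hz']
    | h2 a m ha =>
      rw [Tilde.F1_smul F' N1' a ha m _ rfl, map_smul, h00]
      change _ = BC.mk F'.σ (l' x (a • m))
      rw [map_smul, LinearMap.map_smulₛₗ, hF'.σ_eq a ha, smul_smul, mul_comm]
    | h1 c y hy =>
      change μ' _ (Tilde.F1 F' N1' (c • ⟨χ y, hχ1 y hy⟩)) = BC.mk F'.σ (l' _ (c • χ y))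
      rw [hn1 c y hy, map_smul, map_smul, LinearMap.map_smulₛₗ]
      congr 1
      induction x using hφ.induction with
      | h0 => simp only [map_zero, LinearMap.zero_apply]
      | ha x y hx hy => simp only [map_add, LinearMap.add_apply, hx, hy]
      | hs b x =>
        rw [LinearMap.map_smulₛₗ, map_smul, LinearMap.smul_apply, map_smul, LinearMap.smul_apply,
          LinearMap.map_smulₛₗ, hm0, hμ', h.F0_F1, hmk, hl']
  -- The vanishing of `ev` is carried through the induction, since `div` is additive and `σ`-linear
  -- only on the augmentation ideal.
  have h11 : ∀ (x : M1') (y : N1'), F'.ev (l' (x : M') (y : N')) = 0 ∧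
      μ' (Tilde.F1 F' M1' x) (Tilde.F1 F' N1' y)
      = F'.div (l' x y) • BC.mk F'.σ (1 : F'.A) := by
    rintro ⟨x, hx⟩ ⟨y, hy⟩
    induction hx using baseChangeM1_induction with
    | h0 =>
      change F'.ev (l' 0 y) = 0 ∧ μ' (Tilde.F1 F' M1' 0) _ = F'.div (l' 0 y) • _
      simp only [map_zero, LinearMap.zero_apply, hF'.div_zero, zero_smul, and_self]
    | ha x z hx hz hx' hz' =>
      change F'.ev (l' (x + z) y) = 0 ∧
        μ' (Tilde.F1 F' M1' (⟨x, hx⟩ + ⟨z, hz⟩)) _ = F'.div (l' (x + z) y) • _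
      simp only [map_add, LinearMap.add_apply, hx'.2, hz'.2]
      refine ⟨by rw [hx'.1, hz'.1, add_zero], ?_⟩
      rw [hF'.div_add _ _ hx'.1 hz'.1, add_smul]
    | h2 a m ha =>
      rw [Tilde.F1_smul F' M1' a ha m _ rfl, μ1, h01]
      change F'.ev (l' (a • m) y) = 0 ∧ _ = F'.div (l' (a • m) y) • BC.mk F'.σ (1 : F'.A)
      rw [l1, map_mul, ha, zero_mul, hF'.div_mul' _ _ ha, mul_smul, ← hmk1]
      exact ⟨rfl, rfl⟩
    | h1 b x hx =>
      change F'.ev (l' (b • φ x) y) = 0 ∧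
        μ' (Tilde.F1 F' M1' (b • ⟨φ x, hφ1 x hx⟩)) _ = F'.div (l' (b • φ x) y) • _
      rw [hm1 b x hx, μ1, l1, map_mul]
      suffices F'.ev (l' (φ x) y) = 0 ∧ μ' (Tilde.map T.σ_comm T.div_comm T.ev_eq_zero φ hφ1
          (Tilde.F1 F M1 ⟨x, hx⟩)) (Tilde.F1 F' N1' ⟨y, hy⟩)
          = F'.div (l' (φ x) y) • BC.mk F'.σ (1 : F'.A) by
        rw [this.1, mul_zero, this.2, hF'.div_mul _ _ this.1, mul_smul]
        exact ⟨rfl, rfl⟩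
      induction hy using baseChangeM1_induction with
      | h0 =>
        change F'.ev (l' _ 0) = 0 ∧ μ' _ (Tilde.F1 F' N1' 0) = F'.div (l' _ 0) • _
        simp only [map_zero, hF'.div_zero, zero_smul, and_self]
      | ha y z hy hz hy' hz' =>
        change F'.ev (l' _ (y + z)) = 0 ∧
          μ' _ (Tilde.F1 F' N1' (⟨y, hy⟩ + ⟨z, hz⟩)) = F'.div (l' _ (y + z)) • _
        simp only [map_add, hy'.2, hz'.2]
        refine ⟨by rw [hy'.1, hz'.1, add_zero], ?_⟩
        rw [hF'.div_add _ _ hy'.1 hz'.1, add_smul]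
      | h2 a m ha =>
        rw [Tilde.F1_smul F' N1' a ha m _ rfl, μ2, Tilde.map_F1, h10]
        rw [l2, map_mul, ha, zero_mul, hF'.div_mul' _ _ ha, mul_smul, ← hmk1]
        exact ⟨rfl, rfl⟩
      | h1 c y hy =>
        change F'.ev (l' _ (c • χ y)) = 0 ∧
          μ' _ (Tilde.F1 F' N1' (c • ⟨χ y, hχ1 y hy⟩)) = F'.div (l' _ (c • χ y)) • _
        -- For generators coming from `M₁` and `N₁` the old formula is available for any chosen
        -- expression of `l x y` in `I · (target)`. Applying `ψ` to that expression gives an element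
        -- of `F'.A` on which `div` can be computed.
        obtain ⟨k, a, e, ha, hsum⟩ := exists_fin_sum_of_mem_smul_top (hl x hx y hy)
        have hψ : ψ (l x y) = ∑ s, T.α (a s) * ψ (e s) := by
          rw [hsum, map_sum]
          exact Finset.sum_congr rfl fun s _ => LinearMap.map_smulₛₗ _ _ _
        have ha' : ∀ s, F'.ev (T.α (a s) * ψ (e s)) = 0 := fun s => by
          rw [map_mul, T.ev_eq_zero _ (ha s), zero_mul]
        have hev : F'.ev (ψ (l x y)) = 0 := by
          rw [hψ, map_sum]
          exact Finset.sum_eq_zero fun s _ => ha' s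
        rw [hn1 c y hy, μ2, l2, hμ', hl', h.F1_F1 ⟨x, hx⟩ ⟨y, hy⟩ k a e ha hsum,
          map_mul, hev, mul_zero, hF'.div_mul _ _ hev, hψ, hF'.div_sum _ _ ha', mul_smul]
        refine ⟨rfl, ?_⟩
        congr 1
        rw [map_sum, Finset.sum_smul]
        refine Finset.sum_congr rfl fun s _ => ?_
        rw [LinearMap.map_smulₛₗ, hmk, T.div_comm, hF'.div_mul' _ _ (T.ev_eq_zero _ (ha s)),
          mul_smul, ← hmk1]
  refine ⟨h00, h10, h01, fun x y k a e ha hsum => ?_⟩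
  have ha' : ∀ s, F'.ev (a s * e s) = 0 := fun s => by rw [map_mul, ha s, zero_mul]
  rw [(h11 x y).2, hsum]
  simp only [smul_eq_mul]
  rw [hF'.div_sum _ _ ha', Finset.sum_smul]
  refine Finset.sum_congr rfl fun s _ => ?_
  rw [hF'.div_mul' _ _ (ha s), mul_smul, ← hmk1]

end TildePairing

/-! ## Base change of divided Frobenii and of homogeneously polarized chains -/

/-- The product of two semilinear maps. -/
def LinearMap.semiProd {A A' : Type u} [CommRing A] [CommRing A'] {α : A →+* A'}
    {M M' N N' : Type u} [AddCommGroup M] [Module A M] [AddCommGroup M'] [Module A' M']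
    [AddCommGroup N] [Module A N] [AddCommGroup N'] [Module A' N'] (φ : M →ₛₗ[α] M')
    (χ : N →ₛₗ[α] N') : M × N →ₛₗ[α] M' × N' where
  toFun z := (φ z.1, χ z.2)
  map_add' x y := by simp
  map_smul' a x := by simp

theorem BC.pair_map {A B A' B' : Type u} [CommRing A] [CommRing B] [CommRing A'] [CommRing B']
    {f : A →+* B} {f' : A' →+* B'} {α : A →+* A'} {β : B →+* B'} (h : ∀ a, β (f a) = f' (α a))
    {M N P M' N' P' : Type u} [AddCommGroup M] [Module A M] [AddCommGroup N] [Module A N]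
    [AddCommGroup P] [Module A P] [AddCommGroup M'] [Module A' M'] [AddCommGroup N'] [Module A' N']
    [AddCommGroup P'] [Module A' P'] (φ : M →ₛₗ[α] M') (χ : N →ₛₗ[α] N') (ψ : P →ₛₗ[α] P')
    (l : M →ₗ[A] N →ₗ[A] P) (l' : M' →ₗ[A'] N' →ₗ[A'] P') (hl : ∀ x y, l' (φ x) (χ y) = ψ (l x y))
    (u : BC f M) (v : BC f N) :
    BC.pair f' l' (BC.map h φ u) (BC.map h χ v) = BC.map h ψ (BC.pair f l u v) := by
  induction u using BC.induction with
  | h0 => simp only [map_zero, LinearMap.zero_apply]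
  | ha x y hx hy => simp only [map_add, LinearMap.add_apply, hx, hy]
  | ht b m =>
    induction v using BC.induction with
    | h0 => simp only [map_zero]
    | ha x y hx hy => simp only [map_add, hx, hy]
    | ht c n =>
      rw [BC.map_tmul, BC.map_tmul, BC.pair_tmul, BC.pair_tmul, BC.map_tmul, hl, map_mul]

section FrobeniusBaseChange

variable {p g : ℕ} {J : Set ℤ} {R S : Type u} [CommRing R] [CommRing S] {F : Frame R} {F' : Frame S}
  {f : R →+* S} {T : Frame.Map f F F'} {c : PairChain p g J F} {c' : PairChain p g J F'}

theorem PairChain.tθ_tρ (c : PairChain p g J F) (i j i' j' : J) (hij : (i : ℤ) ≤ j)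
    (hi : (i' : ℤ) = i + 2 * g) (hj : (j' : ℤ) = j + 2 * g) (hij' : (i' : ℤ) ≤ j') (x : c.T i) :
    c.tθ j j' hj (c.tρ i j hij x) = c.tρ i' j' hij' (c.tθ i i' hi x) := by
  have e : (c.tθ j j' hj).comp (c.tρ i j hij) = (c.tρ i' j' hij').comp (c.tθ i i' hi) := by
    refine Tilde.ext (fun x => ?_) (fun m => ?_)
    · simp only [LinearMap.comp_apply, tθ, tρ, Tilde.mapL, Tilde.map_F1]
      congr 1
      exact Subtype.ext (c.θ_ρ i j i' j' hij hi hj hij' x)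
    · simp only [LinearMap.comp_apply, tθ, tρ, Tilde.mapL, Tilde.map_F0]
      exact congrArg _ (c.θ_ρ i j i' j' hij hi hj hij' m)
  exact LinearMap.congr_fun e x

/-- The base change of a divided Frobenius. -/
noncomputable def FullFrob.baseChange (h : PairChain.Hom T c c') (ht : ∀ i, IsBC (h.tφ i))
    (Φ : FullFrob c) : FullFrob c' where
  Ψ i := (ht i).congr (h.rφ_isBC i) (Φ.Ψ i)
  Ψ_ρ i j hij x := by
    refine (ht i).ext (γ := RingHom.id F'.B)
      (g := ((ht j).congr (h.rφ_isBC j) (Φ.Ψ j)).toLinearMap.comp (c'.tρ i j hij))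
      (g' := (c'.rρ i j hij).comp ((ht i).congr (h.rφ_isBC i) (Φ.Ψ i)).toLinearMap) (fun m => ?_) x
    simp only [LinearMap.comp_apply, LinearEquiv.coe_coe]
    rw [← h.tφ_tρ, IsBC.congr_apply, IsBC.congr_apply, Φ.Ψ_ρ, h.rφ_rρ]
  Ψ_θ i j hij x := by
    refine (ht i).ext (γ := RingHom.id F'.B)
      (g := ((ht j).congr (h.rφ_isBC j) (Φ.Ψ j)).toLinearMap.comp (c'.tθ i j hij))
      (g' := (c'.rθ i j hij).comp ((ht i).congr (h.rφ_isBC i) (Φ.Ψ i)).toLinearMap) (fun m => ?_) x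
    simp only [LinearMap.comp_apply, LinearEquiv.coe_coe]
    rw [← h.tφ_tθ, IsBC.congr_apply, IsBC.congr_apply, Φ.Ψ_θ, h.rφ_rθ]

namespace PairChain.Hom

/-- The map `ker ρ̃_{i,j} → ker ρ̃'_{i,j}` induced by a morphism of chains of pairs. -/
noncomputable def tφKer (h : PairChain.Hom T c c') (i j : J) (hij : (i : ℤ) ≤ j) :
    LinearMap.ker (c.tρ i j hij) →ₛₗ[T.β] LinearMap.ker (c'.tρ i j hij) where
  toFun x := ⟨h.tφ i x, by rw [LinearMap.mem_ker, ← h.tφ_tρ, LinearMap.mem_ker.1 x.2, map_zero]⟩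
  map_add' x y := Subtype.ext (map_add (h.tφ i) _ _)
  map_smul' a x := Subtype.ext (LinearMap.map_smulₛₗ (h.tφ i) a (x : c.T i))

/-- The map `ker ρ_{i,j} → ker ρ'_{i,j}` induced by a morphism of chains of pairs. -/
noncomputable def rφKer (h : PairChain.Hom T c c') (i j : J) (hij : (i : ℤ) ≤ j) :
    LinearMap.ker (c.rρ i j hij) →ₛₗ[T.β] LinearMap.ker (c'.rρ i j hij) where
  toFun x := ⟨h.rφ i x, by rw [LinearMap.mem_ker, ← h.rφ_rρ, LinearMap.mem_ker.1 x.2, map_zero]⟩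
  map_add' x y := Subtype.ext (map_add (h.rφ i) _ _)
  map_smul' a x := Subtype.ext (LinearMap.map_smulₛₗ (h.rφ i) a (x : c.N i))

theorem tφKer_isBC (hβ : T.β.Flat) (h : PairChain.Hom T c c') (ht : ∀ i, IsBC (h.tφ i)) (i j : J)
    (hij : (i : ℤ) ≤ j) : IsBC (h.tφKer i j hij) :=
  IsBC.ker hβ (ht i) (ht j) _ _ (fun x => (h.tφ_tρ i j hij x).symm) _ fun _ => rfl

theorem rφKer_isBC (hβ : T.β.Flat) (h : PairChain.Hom T c c') (i j : J) (hij : (i : ℤ) ≤ j) :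
    IsBC (h.rφKer i j hij) :=
  IsBC.ker hβ (h.rφ_isBC i) (h.rφ_isBC j) _ _ (fun x => (h.rφ_rρ i j hij x).symm) _ fun _ => rfl

end PairChain.Hom

/-- The base change of the divided Frobenius of a `1-rdt`-truncated chain of displays. -/
noncomputable def RdtFrob.baseChange (hβ : T.β.Flat) (h : PairChain.Hom T c c')
    (ht : ∀ i, IsBC (h.tφ i)) (Φ : RdtFrob c) : RdtFrob c' where
  Ψ i j e := (h.tφKer_isBC hβ ht i j e.le).congr (h.rφKer_isBC hβ i j e.le) (Φ.Ψ i j e)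
  Ψ_θ i j i' j' e e' hi hj x := by
    induction x using (h.tφKer_isBC hβ ht i j e.le).induction with
    | h0 =>
      intro y hy
      obtain rfl : y = 0 := Subtype.ext (hy.trans (map_zero _))
      simp only [map_zero, ZeroMemClass.coe_zero]
    | ha x z hx hz =>
      intro y hy
      have hθ : ∀ w : LinearMap.ker (c'.tρ i j e.le), c'.tθ i i' hi w ∈
          LinearMap.ker (c'.tρ i' j' e'.le) := fun w => by
        rw [LinearMap.mem_ker, ← c'.tθ_tρ i j i' j' e.le hi hj e'.le, LinearMap.mem_ker.1 w.2,
          map_zero]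
      obtain rfl : y = ⟨_, hθ x⟩ + ⟨_, hθ z⟩ := Subtype.ext (hy.trans (map_add _ _ _))
      rw [map_add, Submodule.coe_add, hx _ rfl, hz _ rfl, map_add, Submodule.coe_add, map_add]
    | hs b m =>
      intro y hy
      have hm : c.tθ i i' hi m ∈ LinearMap.ker (c.tρ i' j' e'.le) := by
        rw [LinearMap.mem_ker, ← c.tθ_tρ i j i' j' e.le hi hj e'.le, LinearMap.mem_ker.1 m.2,
          map_zero]
      obtain rfl : y = b • h.tφKer i' j' e'.le ⟨_, hm⟩ := by
        refine Subtype.ext (hy.trans ?_)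
        refine (map_smul (c'.tθ i i' hi) b (h.tφ i m)).trans (congrArg (b • ·) ?_)
        exact (h.tφ_tθ i i' hi m).symm
      rw [map_smul, IsBC.congr_apply, map_smul, IsBC.congr_apply, Submodule.coe_smul,
        Submodule.coe_smul, map_smul]
      refine congrArg (b • ·) ?_
      refine (congrArg (h.rφ i') (Φ.Ψ_θ i j i' j' e e' hi hj m ⟨_, hm⟩ rfl)).trans ?_
      exact h.rφ_rθ i i' hi _

/-- The base change of a divided Frobenius of either kind exists as soon as `B → B'` is flat in the
case of kernels. -/
theorem Frob.exists_baseChange {k : FrobKind} (hβ : k = .rdt → T.β.Flat) (hF : F.IsWitt p)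
    (hF' : F'.IsWitt p) (h : PairChain.Hom T c c') (Φ : Frob k c) {I : Type u} [AddCommGroup I]
    [Module F.A I] {ι : BC F.σ I ≃ₗ[F.B] BC F.res I}
    {lam : ∀ i j : J, (i : ℤ) + j = 0 → c.M i →ₗ[F.A] c.M j →ₗ[F.A] I} (hΦ : Frob.Compat k Φ ι lam)
    (hlam : IsPairPolarization c lam) (ψ : I →ₛₗ[T.α] F'.A)
    (hψ : ∀ z, unitIota F' (BC.map T.σ_comm ψ z) = BC.map T.res_comm ψ (ι z)) :
    ∃ Φ' : Frob k c', Frob.Commutes h k Φ Φ' ∧ Frob.Compat k Φ' (unitIota F')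
      (fun i j e => (h.isBC i).bilin (h.isBC j) ψ (lam i j e)) := by
  have ht : ∀ i, IsBC (h.tφ i) := h.tφ_isBC hF hF'
  have hμ : ∀ (i j : J) (e : (i : ℤ) + j = 0)
      (μ : c.T i →ₗ[F.B] c.T j →ₗ[F.B] BC F.σ I), IsTildePairing (lam i j e) μ p →
      IsTildePairing ((h.isBC i).bilin (h.isBC j) ψ (lam i j e))
        ((ht i).bilin (ht j) (BC.map T.σ_comm ψ) μ) p := fun i j e μ hμ =>
    hμ.baseChange hF' T (h.isBC i) (h.isBC j) ψ
      (fun x hx y hy => (hlam.M1_compat i j e x).1 hx y hy) (h.φ_M1 i) (h.φ_M1 j) (h.mem_M1 i)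
      (h.mem_M1 j) (ht i) (ht j)
  have hpair : ∀ (i j : J) (e : (i : ℤ) + j = 0) (u : c.N i) (v : c.N j),
      BC.pair F'.res ((h.isBC i).bilin (h.isBC j) ψ (lam i j e)) (h.rφ i u) (h.rφ j v)
        = BC.map T.res_comm ψ (BC.pair F.res (lam i j e) u v) := fun i j e u v =>
    BC.pair_map T.res_comm (h.φ i) (h.φ j) ψ _ _ ((h.isBC i).bilin_apply (h.isBC j) ψ _) u v
  cases k with
  | full =>
    refine ⟨FullFrob.baseChange h ht Φ, fun i x => IsBC.congr_apply _ _ _ _, fun i j e => ?_⟩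
    obtain ⟨μ, h1, h2⟩ := hΦ i j e
    refine ⟨_, hμ i j e μ h1, fun a b => ?_⟩
    induction a using (ht i).induction with
    | h0 => simp only [map_zero, LinearMap.zero_apply]
    | ha x y hx hy => simp only [map_add, LinearMap.add_apply, hx, hy]
    | hs r a =>
      simp only [map_smul, LinearMap.smul_apply]
      congr 1
      induction b using (ht j).induction with
      | h0 => simp only [map_zero]
      | ha x y hx hy => simp only [map_add, hx, hy]
      | hs s b =>
        simp only [map_smul]
        congr 1
        rw [IsBC.bilin_apply, hψ, ← h2, ← hpair]
        exact congrArg₂ (fun u v => BC.pair F'.res _ u v) (IsBC.congr_apply _ _ _ _)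
          (IsBC.congr_apply _ _ _ _)
  | rdt =>
    have hβ := hβ rfl
    refine ⟨RdtFrob.baseChange hβ h ht Φ, fun i j e x y hy => ?_, fun i j i' j' e e' hi hj => ?_⟩
    · obtain rfl : y = h.tφKer i j e.le x := Subtype.ext hy
      exact congrArg Subtype.val (IsBC.congr_apply (h.tφKer_isBC hβ ht i j e.le) _ _ _)
    · obtain ⟨μ, h1, h2⟩ := hΦ i j i' j' e e' hi hj
      refine ⟨_, hμ i i' hi μ h1, fun k hk hik x y tz z hy hz => ?_⟩
      set Φ' := RdtFrob.baseChange hβ h ht Φ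
      have hΦ' : ∀ (i j : J) (e : IsEdge i j) x, (Φ'.Ψ i j e (h.tφKer i j e.le x) : c'.N i)
          = h.rφ i (Φ.Ψ i j e x) := fun i j e x =>
        congrArg Subtype.val (IsBC.congr_apply (h.tφKer_isBC hβ ht i j e.le) _ _ _)
      let K := LinearMap.ker (c.tρ j' i' e'.le)
      let K' := LinearMap.ker (c'.tρ j' i' e'.le)
      -- The triples `(y, tz, z)` admitted in the `1-rdt` compatibility form the kernel of `L`.
      -- Flatness of `B → B'` shows that the triples over `B'` are generated by those over `B`,
      -- where the compatibility is known. It then remains to extend it linearly in the triple and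
      -- in `x`.
      let L : K × c.T i' × c.N i' →ₗ[F.B] c.T k × c.N k :=
        ((c.tρ i' k hik).comp (LinearMap.fst _ _ _ ∘ₗ LinearMap.snd _ _ _)
          - (c.tθ j' k hk).comp (K.subtype.comp (LinearMap.fst _ _ _))).prod
        ((c.rρ i' k hik).comp (LinearMap.snd _ _ _ ∘ₗ LinearMap.snd _ _ _)
          - (c.rθ j' k hk).comp ((Submodule.subtype _).comp
            ((Φ.Ψ j' i' e').toLinearMap.comp (LinearMap.fst _ _ _))))
      let L' : K' × c'.T i' × c'.N i' →ₗ[F'.B] c'.T k × c'.N k :=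
        ((c'.tρ i' k hik).comp (LinearMap.fst _ _ _ ∘ₗ LinearMap.snd _ _ _)
          - (c'.tθ j' k hk).comp (K'.subtype.comp (LinearMap.fst _ _ _))).prod
        ((c'.rρ i' k hik).comp (LinearMap.snd _ _ _ ∘ₗ LinearMap.snd _ _ _)
          - (c'.rθ j' k hk).comp ((Submodule.subtype _).comp
            ((Φ'.Ψ j' i' e').toLinearMap.comp (LinearMap.fst _ _ _))))
      have hX := (h.tφKer_isBC hβ ht j' i' e'.le).prodMap (IsBC.prodMap (ht i') (h.rφ_isBC i')
        (LinearMap.semiProd (h.tφ i') (h.rφ i')) fun _ => rfl)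
        (LinearMap.semiProd (h.tφKer j' i' e'.le) (LinearMap.semiProd (h.tφ i') (h.rφ i')))
        fun _ => rfl
      have hY := IsBC.prodMap (ht k) (h.rφ_isBC k) (LinearMap.semiProd (h.tφ k) (h.rφ k))
        fun _ => rfl
      refine IsBC.ker_induction hβ hX hY L L' (fun w => ?_)
        (P := fun w => BC.pair F'.res ((h.isBC i).bilin (h.isBC i') ψ (lam i i' hi))
          (Φ'.Ψ i j e x) w.2.2 = unitIota F' ((ht i).bilin (ht i') (BC.map T.σ_comm ψ) μ x w.2.1))
        ?_ (fun b w hw => ?_) (fun u v hu hv => ?_) (y, tz, z) ?_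
      · refine Prod.ext ?_ ?_
        · refine (congrArg₂ (· - ·) (h.tφ_tρ i' k hik w.2.1).symm
            (h.tφ_tθ j' k hk w.1).symm).trans (map_sub (h.tφ k) _ _).symm
        · refine (congrArg₂ (· - ·) (h.rφ_rρ i' k hik w.2.2).symm ?_).trans
            (map_sub (h.rφ k) _ _).symm
          refine Eq.trans ?_ (h.rφ_rθ j' k hk _).symm
          exact congrArg (c'.rθ j' k hk) (hΦ' j' i' e' w.1)
      · simp only [Prod.snd_zero, Prod.fst_zero, map_zero]
      · have hw1 : c.tρ i' k hik w.2.1 = c.tθ j' k hk w.1 := sub_eq_zero.1 (congrArg Prod.fst hw)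
        have hw2 : c.rρ i' k hik w.2.2 = c.rθ j' k hk (Φ.Ψ j' i' e' w.1) :=
          sub_eq_zero.1 (congrArg Prod.snd hw)
        change BC.pair F'.res _ _ (b • h.rφ i' w.2.2)
          = unitIota F' ((ht i).bilin (ht i') _ μ x (b • h.tφ i' w.2.1))
        rw [map_smul, map_smul, map_smul]
        congr 1
        clear hy hz
        induction x using (h.tφKer_isBC hβ ht i j e.le).induction with
        | h0 => simp only [map_zero, LinearMap.zero_apply, ZeroMemClass.coe_zero]
        | ha x y hx hy => simp only [map_add, LinearMap.add_apply, Submodule.coe_add, hx, hy]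
        | hs r a =>
          simp only [map_smul, LinearMap.smul_apply, Submodule.coe_smul]
          congr 1
          rw [hΦ', hpair, h2 k hk hik a w.1 w.2.1 w.2.2 hw1 hw2, ← hψ]
          exact congrArg _ ((ht i).bilin_apply (ht i') _ μ a w.2.1).symm
      · simp only [Prod.snd_add, Prod.fst_add, map_add, hu, hv]
      · refine Prod.ext ?_ ?_
        · exact sub_eq_zero.2 hy
        · exact sub_eq_zero.2 hz

/-- A homogeneously polarized chain of displays becomes polarized over a flat extension over which
`(I, ι)` is trivial. -/
theorem HPolChain.exists_polChain {k : FrobKind} (hf : f.Flat) (hβ : k = .rdt → T.β.Flat)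
    (hF : F.IsWitt p) (hF' : F'.IsWitt p) (y : HPolChain p g J k F) (ψ : y.I →ₛₗ[T.α] F'.A)
    (hψ : IsBC ψ)
    (hι : ∀ z, unitIota F' (BC.map T.σ_comm ψ z) = BC.map T.res_comm ψ (y.ι z)) :
    ∃ x : PolChain p g J k F', Nonempty (HPolChain.Hom T y x.toHPol) := by
  let h := y.c.toBaseChange T
  obtain ⟨Φ', h1, h2⟩ := Frob.exists_baseChange hβ hF hF' h y.Φ y.compat y.polarization ψ hι
  exact ⟨⟨_, Φ', _, y.polarization.baseChange hf hF hF' h hψ, h2⟩,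
    ⟨⟨h, h1, ψ, hψ, hι, fun i j e a b => ((h.isBC i).bilin_apply (h.isBC j) ψ _ a b).symm⟩⟩⟩

end FrobeniusBaseChange

/-! ## Simple transitivity of the scalar action -/

section SimplyTransitive

variable {p g : ℕ} {J : Set ℤ} {k : FrobKind}

theorem HPolChain.Hom.ψ_apply {R : Type u} [CommRing R] {F : Frame R} {f : R →+* R}
    {T : Frame.Map f F F} (hT : ∀ a, T.α a = a) (ψ : F.A →ₛₗ[T.α] F.A) (a : F.A) :
    ψ a = ψ 1 * a := by
  have h := LinearMap.map_smulₛₗ ψ a 1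
  rw [smul_eq_mul, mul_one, hT, smul_eq_mul, mul_comm] at h
  exact h

/-- The values of `ψ` generate the whole ring, and all of them are multiples of `ψ 1`. -/
theorem isUnit_of_isBC {A : Type u} [CommRing A] {α : A →+* A} (hα : ∀ a, α a = a)
    {ψ : A →ₛₗ[α] A} (hψ : IsBC ψ) : IsUnit (ψ 1) := by
  have h : ∀ x : A, ψ 1 ∣ x := fun x => by
    induction x using hψ.induction with
    | h0 => exact dvd_zero _
    | hs a m =>
      have h := LinearMap.map_smulₛₗ ψ m 1
      rw [smul_eq_mul, mul_one, hα] at h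
      rw [h]
      exact ⟨m * a, by simp only [smul_eq_mul]; ring⟩
    | ha x y hx hy => exact dvd_add hx hy
  exact isUnit_of_dvd_one (h 1)

theorem unitIota_tmul_one {R : Type u} [CommRing R] (F : Frame R) :
    unitIota F (BC.tmul F.σ 1 1) = BC.tmul F.res 1 1 := by
  rw [unitIota, LinearEquiv.trans_apply, LinearEquiv.symm_apply_eq, BC.rid_tmul, BC.rid_tmul,
    map_one, map_one]

/-- Evaluate at `1 ⊗ 1`, which the unit isomorphisms preserve. The two sides become `σ(ψ 1)` and
`res(ψ 1)`. -/
theorem σ_eq_res_of_ι_compat {R S : Type u} [CommRing R] [CommRing S] {F : Frame R} {F' : Frame S}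
    {f : R →+* S} (T : Frame.Map f F F') (ψ : F.A →ₛₗ[T.α] F'.A)
    (h : ∀ z, unitIota F' (BC.map T.σ_comm ψ z) = BC.map T.res_comm ψ (unitIota F z)) :
    F'.σ (ψ 1) = F'.res (ψ 1) := by
  have h1 := congrArg (BC.rid F'.res) (h (BC.tmul F.σ 1 1))
  rw [unitIota_tmul_one, BC.map_tmul, BC.map_tmul, unitIota, LinearEquiv.trans_apply,
    LinearEquiv.apply_symm_apply, BC.rid_tmul, BC.rid_tmul, map_one T.β, mul_one, mul_one] at h1
  exact h1

/-- The scalar is read off from the component on `A = I`, as `u = ψ(1)`. The component on the chain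
is kept as it is and becomes a morphism from `(M, u λ)`, because compatibility of `χ` with the
pairings already contains the factor `u`. -/
theorem scalarAction_simply_transitive (W : FrameFunctor.{u}) (P : ∀ (R : Type u) [CommRing R], Prop)
    {R : Type u} [CommRing R] (hR : P R) (x x' : (polCat p g J k W).Obj R)
    (χ : (hpolCat p g J k W).Hom (RingHom.id R) ((forget p g J k W).obj x)
      ((forget p g J k W).obj x')) :
    ∃! q : Σ u : (sigmaUnits W).G R, (polCat p g J k W).Hom (RingHom.id R)
        ((scalarAction p g J k W P).smul hR u x) x',
      (hpolCat p g J k W).comp ((scalarAction p g J k W P).iso hR q.1 x)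
        ((forget p g J k W).map q.2) = χ := by
  change PolChain p g J k (W.frame R) at x x'
  change HPolChain.Hom (W.map (RingHom.id R)) x.toHPol x'.toHPol at χ
  have hα := W.map_id_α R
  let ψ : (W.frame R).A →ₛₗ[(W.map (RingHom.id R)).α] (W.frame R).A := χ.ψ
  have hψ : ∀ a, ψ a = ψ 1 * a := HPolChain.Hom.ψ_apply hα ψ
  have hu : IsUnit (ψ 1) := isUnit_of_isBC hα χ.isBC
  let u : (sigmaUnits W).G R :=
    ⟨hu.unit, Units.ext (σ_eq_res_of_ι_compat (W.map (RingHom.id R)) ψ χ.ι_compat)⟩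
  let φ : PolChain.Hom (W.map (RingHom.id R)) (x.scale u.1 (sigmaUnits_spec W u)) x' :=
    { h := χ.h
      commutes := χ.commutes
      lam_compat := fun i j hij a b =>
        (hα _).trans ((hψ (x.lam i j hij a b)).symm.trans (χ.lam_compat i j hij a b)) }
  refine ⟨⟨u, φ⟩, HPolChain.Hom.ext_unit (x := x) (y := x') rfl _ ψ rfl rfl fun a => ?_, ?_⟩
  · exact (hα (ψ 1 * a)).trans (hψ a).symm
  · rintro ⟨v, θ⟩ hv
    change PolChain.Hom (W.map (RingHom.id R)) (x.scale v.1 (sigmaUnits_spec W v)) x' at θ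
    have h1 : θ.h = χ.h := congrArg (fun w : HPolChain.Hom _ x.toHPol x'.toHPol => w.h) hv
    -- Comparing the components on `A` at the element `1` forces the scalar of any other solution to
    -- be `ψ 1`.
    have h2 : (W.map (RingHom.id R)).α ((v.1 : (W.frame R).A) * 1) = ψ 1 :=
      congrArg (fun w : HPolChain.Hom (W.map (RingHom.id R)) x.toHPol x'.toHPol =>
        (w.ψ : x.toHPol.I → x'.toHPol.I) (1 : (W.frame R).A)) hv
    rw [hα, mul_one] at h2
    obtain rfl : v = u := Subtype.ext (Units.ext h2)
    exact congrArg (Sigma.mk u) (PolChain.Hom.ext h1)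

end SimplyTransitive

/-! ## Witt vectors with coordinates in an ideal -/

namespace WittVector

variable {p : ℕ} [hp : Fact p.Prime]

theorem map_frobenius' {R S : Type*} [CommRing R] [CommRing S] (f : R →+* S) (x : WittVector p R) :
    map f (frobenius x) = frobenius (map f x) := by
  ext n
  rw [map_coeff, coeff_frobenius, coeff_frobenius]
  change (f.comp (MvPolynomial.aeval x.coeff).toRingHom) (frobeniusPoly p n)
    = (MvPolynomial.aeval (map f x).coeff).toRingHom (frobeniusPoly p n)
  congr 1
  refine MvPolynomial.ringHom_ext (fun r => ?_) fun i => ?_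
  · simp
  · simp [map_coeff]

/-- The ghost component of index `n` is `p ^ n x_n` plus an expression in the earlier coordinates,
so the coordinates are recovered recursively by cancelling powers of `p`. -/
theorem ghost_injective {R : Type*} [CommRing R] (hR : ∀ a : R, (p : R) * a = 0 → a = 0)
    {x y : WittVector p R} (h : ∀ n, ghostComponent n x = ghostComponent n y) : x = y := by
  have hpow : ∀ (n : ℕ) (a : R), (p : R) ^ n * a = 0 → a = 0 := fun n => by
    induction n with
    | zero => simp
    | succ n ih => intro a ha; exact ih a (hR _ (by rw [← mul_assoc, ← pow_succ', ha]))
  ext n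
  induction n using Nat.strong_induction_on with
  | _ n ih =>
    have h1 := h n
    rw [ghostComponent_apply, ghostComponent_apply, wittPolynomial_eq_sum_C_mul_X_pow, map_sum,
      map_sum, Finset.sum_range_succ, Finset.sum_range_succ] at h1
    have hs : ∀ i ∈ Finset.range n,
        MvPolynomial.aeval x.coeff (MvPolynomial.C ((p : ℤ) ^ i) * MvPolynomial.X i ^ p ^ (n - i))
        = MvPolynomial.aeval y.coeff
          (MvPolynomial.C ((p : ℤ) ^ i) * MvPolynomial.X i ^ p ^ (n - i)) := fun i hi => by
      simp only [map_mul, map_pow, MvPolynomial.aeval_X, MvPolynomial.aeval_C,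
        ih i (Finset.mem_range.1 hi)]
    rw [Finset.sum_congr rfl hs] at h1
    have h2 := add_left_cancel h1
    simp only [map_mul, map_pow, MvPolynomial.aeval_X, Nat.sub_self, pow_zero,
      pow_one, map_natCast] at h2
    exact sub_eq_zero.1 (hpow n _ (by rw [mul_sub]; exact sub_eq_zero.2 (by simpa using h2)))

/-- In the summand `p ^ i x_i ^ (p ^ (n - i))` with `i < n` the exponent is at least two, and
squares of the coordinates vanish. Only the top summand survives, so the ghost map is linear here.
-/
theorem ghostComponent_inr {M : Type*} [AddCommGroup M] [Module ℤᵐᵒᵖ M]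
    [IsCentralScalar ℤ M] (x : WittVector p (TrivSqZeroExt ℤ M)) (h : ∀ i, (x.coeff i).fst = 0)
    (n : ℕ) :
    ghostComponent n x = (p : TrivSqZeroExt ℤ M) ^ n * x.coeff n := by
  have h0 : ∀ i, ∀ m : ℕ, 2 ≤ m → x.coeff i ^ m = 0 := fun i m hm => by
    have : x.coeff i ^ 2 = 0 := by
      rw [pow_two]
      ext <;> simp [h]
    obtain ⟨k, rfl⟩ := Nat.exists_eq_add_of_le hm
    rw [pow_add, this, zero_mul]
  rw [ghostComponent_apply, wittPolynomial_eq_sum_C_mul_X_pow, map_sum, Finset.sum_range_succ,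
    Finset.sum_eq_zero fun i hi => ?_]
  · simp
  · have : 2 ≤ p ^ (n - i) := by
      have := Finset.mem_range.1 hi
      exact hp.out.two_le.trans (Nat.le_self_pow (by omega) p)
    simp [h0 i _ this]

/-- Witt vectors with coordinates in an ideal of square zero: the sum is computed coordinatewise,
products vanish, and the Frobenius is given by `(x₀, x₁, …) ↦ (p x₁, p x₂, …)`. -/
theorem of_sq_zero {R : Type*} [CommRing R] {I : Ideal R} (hI : ∀ a ∈ I, ∀ b ∈ I, a * b = 0)
    {x y : WittVector p R} (hx : ∀ n, x.coeff n ∈ I) (hy : ∀ n, y.coeff n ∈ I) :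
    (∀ n, (x + y).coeff n = x.coeff n + y.coeff n) ∧ x * y = 0 ∧
      ∀ n, (frobenius x).coeff n = p * x.coeff (n + 1) := by
  -- The universal case: the square-zero extension of `ℤ` by a free group on the coordinates of both
  -- vectors. Here `p` is a nonzerodivisor, so the three identities can be checked on ghost
  -- components, and they are then transported along `f`.
  let M := ℕ ⊕ ℕ →₀ ℤ
  let U := TrivSqZeroExt ℤ M
  let c : ℕ ⊕ ℕ → R := Sum.elim x.coeff y.coeff
  have hc : ∀ i, c i ∈ I := by rintro (i | i); exacts [hx i, hy i]
  let g : M →ₗ[ℤ] R := Finsupp.linearCombination ℤ c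
  have hg : ∀ m, g m ∈ I := fun m => by
    rw [Finsupp.linearCombination_apply]
    exact Ideal.sum_mem _ fun i _ => zsmul_mem (hc i) _
  let f : U →ₐ[ℤ] R := TrivSqZeroExt.liftEquivOfComm ⟨g, fun a b => hI _ (hg a) _ (hg b)⟩
  have hf : ∀ m, f (TrivSqZeroExt.inr m) = g m := fun m => by
    simp only [f, TrivSqZeroExt.liftEquivOfComm, Equiv.trans_apply, TrivSqZeroExt.liftEquiv_apply]
    exact TrivSqZeroExt.lift_apply_inr _ _ _ _ _ m
  have hU : ∀ a : U, (p : U) * a = 0 → a = 0 := fun a ha => by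
    rw [← nsmul_eq_mul] at ha
    have e1 := congrArg TrivSqZeroExt.fst ha
    have e2 := congrArg TrivSqZeroExt.snd ha
    rw [TrivSqZeroExt.fst_smul] at e1
    rw [TrivSqZeroExt.snd_smul] at e2
    exact TrivSqZeroExt.ext ((smul_eq_zero.1 e1).resolve_left hp.out.ne_zero)
      ((smul_eq_zero.1 e2).resolve_left hp.out.ne_zero)
  let x' : WittVector p U := mk p fun i => TrivSqZeroExt.inr (Finsupp.single (Sum.inl i) 1)
  let y' : WittVector p U := mk p fun i => TrivSqZeroExt.inr (Finsupp.single (Sum.inr i) 1)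
  have hx' : map f.toRingHom x' = x := by
    ext n
    rw [map_coeff, coeff_mk]
    exact (hf _).trans ((Finsupp.linearCombination_single ℤ _ _).trans (one_smul ℤ _))
  have hy' : map f.toRingHom y' = y := by
    ext n
    rw [map_coeff, coeff_mk]
    exact (hf _).trans ((Finsupp.linearCombination_single ℤ _ _).trans (one_smul ℤ _))
  have fx : ∀ n, (x'.coeff n).fst = 0 := fun i => by rw [coeff_mk]; rfl
  have fy : ∀ n, (y'.coeff n).fst = 0 := fun i => by rw [coeff_mk]; rfl
  have gx : ∀ n, ghostComponent n x' = (p : U) ^ n * x'.coeff n := ghostComponent_inr x' fx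
  have gy : ∀ n, ghostComponent n y' = (p : U) ^ n * y'.coeff n := ghostComponent_inr y' fy
  have hxy : ∀ n, x'.coeff n * y'.coeff n = 0 := fun n => by
    rw [coeff_mk, coeff_mk, TrivSqZeroExt.inr_mul_inr]
  clear_value x' y'
  refine ⟨fun n => ?_, ?_, fun n => ?_⟩
  · have : x' + y' = mk p fun i => x'.coeff i + y'.coeff i := ghost_injective hU fun n => by
      rw [map_add, gx, gy, ghostComponent_inr _ fun i => by
        rw [coeff_mk, TrivSqZeroExt.fst_add, fx, fy, add_zero], coeff_mk, mul_add]
    rw [← hx', ← hy', ← map_add, this, map_coeff, map_coeff, map_coeff, coeff_mk, map_add]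
  · have : x' * y' = 0 := ghost_injective hU fun n => by
      rw [map_mul, gx, gy, map_zero, mul_mul_mul_comm, hxy, mul_zero]
    rw [← hx', ← hy', ← map_mul, this, map_zero]
  · have : frobenius x' = mk p fun i => (p : U) * x'.coeff (i + 1) := ghost_injective hU fun n => by
      rw [ghostComponent_frobenius, gx, ghostComponent_inr _ fun i => ?_, coeff_mk, ← mul_assoc,
        pow_succ]
      rw [coeff_mk, TrivSqZeroExt.fst_mul, fx, mul_zero]
    rw [← hx', ← map_frobenius', this, map_coeff, map_coeff, coeff_mk, map_mul, map_natCast]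

theorem map_mk_eq_zero_iff {R : Type*} [CommRing R] (I : Ideal R) (x : WittVector p R) :
    map (Ideal.Quotient.mk I) x = 0 ↔ ∀ n, x.coeff n ∈ I := by
  rw [WittVector.ext_iff]
  simp only [map_coeff, zero_coeff, Ideal.Quotient.eq_zero_iff_mem]

/-- Induction on the exponent that kills `p`. In characteristic `p` an inverse is built coordinate
by coordinate (`mkUnit`). The inductive step passes to the quotient by `p ^ N`, whose kernel has
square zero because `2 N ≥ N + 1`. A lift `z` of the inverse satisfies `(1 - x z) ^ 2 = 0`, which
exhibits `z (2 - x z)` as an inverse. -/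
theorem isUnit_of_coeff_zero {R : Type u} [CommRing R] (hR : IsNilpotent (p : R))
    (x : WittVector p R) (hx : IsUnit (x.coeff 0)) : IsUnit x := by
  obtain ⟨N, hN⟩ := hR
  induction N generalizing R with
  | zero =>
    have := subsingleton_of_zero_eq_one (hN.symm.trans (pow_zero _))
    have : x = 1 := by ext n; exact Subsingleton.elim _ _
    rw [this]; exact isUnit_one
  | succ N ih =>
    rcases Nat.eq_zero_or_pos N with rfl | h
    · rw [zero_add, pow_one] at hN
      rcases subsingleton_or_nontrivial R with hs | hs
      · have : x = 1 := by ext n; exact Subsingleton.elim _ _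
        rw [this]; exact isUnit_one
      · have := (CharP.charP_iff_prime_eq_zero hp.out).2 hN
        exact (mkUnit (p := p) (a := hx.unit) rfl).isUnit
    · let I : Ideal R := Ideal.span {(p : R) ^ N}
      have hI : ∀ a ∈ I, ∀ b ∈ I, a * b = 0 := fun a ha b hb => by
        obtain ⟨a, rfl⟩ := Ideal.mem_span_singleton.1 ha
        obtain ⟨b, rfl⟩ := Ideal.mem_span_singleton.1 hb
        obtain ⟨k, rfl⟩ := Nat.exists_eq_add_of_le' h
        have : (p : R) ^ (k + 1) * a * (p ^ (k + 1) * b) = p ^ (k + 1 + 1) * (p ^ k * (a * b)) := by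
          ring
        rw [this, hN, zero_mul]
      obtain ⟨y, hy⟩ := ih (map (Ideal.Quotient.mk I) x)
        (by rw [map_coeff]; exact hx.map _)
        (by rw [← map_natCast (Ideal.Quotient.mk I), ← map_pow, Ideal.Quotient.eq_zero_iff_mem]
            exact Ideal.mem_span_singleton_self _)
      obtain ⟨z, hz⟩ := map_surjective (p := p) _ (Ideal.Quotient.mk_surjective (I := I)) (↑y⁻¹)
      have h1 : map (Ideal.Quotient.mk I) (1 - x * z) = 0 := by
        rw [map_sub, map_one, map_mul, hz, ← hy, Units.mul_inv, sub_self]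
      have h2 := (map_mk_eq_zero_iff I _).1 h1
      have h3 := (of_sq_zero hI h2 h2).2.1
      refine IsUnit.of_mul_eq_one (z * (2 - x * z)) ?_
      linear_combination -h3

/-- The coordinate of index `n` of `F x` is `x_n ^ p` plus `p` times a polynomial without constant
term in the coordinates. The second part gains one factor `p`. The first lies in `p ^ (2 (k + 1))
R`, which is enough. This contraction property drives all successive approximations below. -/
theorem frobenius_coeff_mem {R : Type*} [CommRing R] {k : ℕ} {x : WittVector p R}
    (hx : ∀ n, x.coeff n ∈ Ideal.span {(p : R) ^ (k + 1)}) (n : ℕ) :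
    (frobenius x).coeff n ∈ Ideal.span {(p : R) ^ (k + 2)} := by
  -- The constant term vanishes because `F 0 = 0`, tested over `ℤ`, where `p` can be cancelled.
  have h0 : MvPolynomial.constantCoeff (frobeniusPolyAux p n) = 0 := by
    have h1 : (frobenius (0 : WittVector p ℤ)).coeff n = 0 := by rw [map_zero, zero_coeff]
    rw [coeff_frobenius, frobeniusPoly] at h1
    have h2 : (0 : WittVector p ℤ).coeff = fun _ => 0 := funext fun i => zero_coeff _ _ i
    rw [h2, MvPolynomial.aeval_zero'] at h1
    simpa [hp.out.ne_zero] using h1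
  have h1 : MvPolynomial.aeval x.coeff (frobeniusPolyAux p n) ∈ Ideal.span {(p : R) ^ (k + 1)} := by
    rw [← Ideal.Quotient.eq_zero_iff_mem]
    have h2 : (Ideal.Quotient.mkₐ ℤ (Ideal.span {(p : R) ^ (k + 1)})).comp
        (MvPolynomial.aeval x.coeff) = MvPolynomial.aeval fun _ => 0 := by
      refine MvPolynomial.algHom_ext fun i => ?_
      rw [AlgHom.comp_apply, MvPolynomial.aeval_X, MvPolynomial.aeval_X]
      exact Ideal.Quotient.eq_zero_iff_mem.2 (hx i)
    have h3 := DFunLike.congr_fun h2 (frobeniusPolyAux p n)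
    rw [MvPolynomial.aeval_zero', h0, map_zero] at h3
    exact h3
  obtain ⟨a, ha⟩ := Ideal.mem_span_singleton.1 h1
  obtain ⟨b, hb⟩ := Ideal.mem_span_singleton.1 (hx n)
  rw [coeff_frobenius, frobeniusPoly, map_add, map_pow, MvPolynomial.aeval_X, map_mul, ha, hb,
    MvPolynomial.aeval_C]
  obtain ⟨l, hl⟩ := Nat.exists_eq_add_of_le' hp.out.two_le
  refine Ideal.mem_span_singleton.2 (dvd_add ?_ ⟨a, ?_⟩)
  · nth_rw 3 [hl]
    exact ⟨(p ^ (k + 1) * b) ^ l * b ^ 2 * p ^ k, by ring⟩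
  · simp; ring

end WittVector

/-! ## The frames of Witt vectors -/

section WittFrames

variable {p : ℕ} [hp : Fact p.Prime]

namespace WittVector

theorem verschiebung_shift_one {R : Type*} [CommRing R] {x : WittVector p R} (hx : x.coeff 0 = 0) :
    verschiebung (x.shift 1) = x := by
  have h := eq_iterate_verschiebung (x := x) (n := 1) fun i hi => by
    obtain rfl : i = 0 := by omega
    exact hx
  exact h.symm

theorem shift_one_verschiebung {R : Type*} [CommRing R] (x : WittVector p R) :
    (verschiebung x).shift 1 = x := by
  ext n
  rw [shift_coeff, add_comm, verschiebung_coeff_succ]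

theorem shift_one_add {R : Type*} [CommRing R] {x y : WittVector p R} (hx : x.coeff 0 = 0)
    (hy : y.coeff 0 = 0) : (x + y).shift 1 = x.shift 1 + y.shift 1 := by
  conv_lhs => rw [← verschiebung_shift_one hx, ← verschiebung_shift_one hy, ← map_add,
    shift_one_verschiebung]

/-- The projection formula `x V(y) = V(F(x) y)`, read through the inverse of `V`. -/
theorem shift_one_mul {R : Type*} [CommRing R] (x : WittVector p R) {y : WittVector p R}
    (hy : y.coeff 0 = 0) : (x * y).shift 1 = frobenius x * y.shift 1 := by
  conv_lhs => rw [← verschiebung_shift_one hy, mul_comm, ← verschiebung_mul_frobenius,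
    shift_one_verschiebung, mul_comm]

theorem frobenius_eq_mul_shift_one {R : Type*} [CommRing R] {x : WittVector p R}
    (hx : x.coeff 0 = 0) : frobenius x = p * x.shift 1 := by
  conv_lhs => rw [← verschiebung_shift_one hx, frobenius_verschiebung, mul_comm]

end WittVector

theorem wittFrames_isWitt (R : Type u) [CommRing R] : ((wittFrames p).frame R).IsWitt p where
  ev_surjective r := ⟨WittVector.teichmuller p r, WittVector.teichmuller_coeff_zero p r⟩
  div_add _ _ ha hb := WittVector.shift_one_add ha hb
  div_mul a _ hb := WittVector.shift_one_mul a hb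
  σ_eq _ ha := WittVector.frobenius_eq_mul_shift_one ha
  exists_div_eq_one := ⟨WittVector.verschiebung (p := p) 1,
    WittVector.verschiebung_coeff_zero (p := p) 1, WittVector.shift_one_verschiebung (p := p) 1⟩

theorem truncDiv_truncate {m n : ℕ} (h : n + 1 ≤ m) {R : Type u} [CommRing R] (x : WittVector p R) :
    truncDiv p m n h R (WittVector.truncate m x) = WittVector.truncate n (x.shift 1) := by
  ext i
  rw [truncDiv, TruncatedWittVector.coeff_mk, WittVector.coeff_truncate, WittVector.coeff_truncate,
    WittVector.shift_coeff]
  exact congrArg x.coeff (add_comm _ _)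

theorem truncFrobenius_truncate {m n : ℕ} (h : n + 1 ≤ m) {R : Type u} [CommRing R]
    (x : WittVector p R) : truncFrobenius p m n h R (WittVector.truncate m x)
      = WittVector.truncate n (WittVector.frobenius x) :=
  truncLift_truncate _ _ _ _ _

theorem truncMap_truncate {m : ℕ} {R S : Type u} [CommRing R] [CommRing S] (f : R →+* S)
    (x : WittVector p R) :
    truncMap p m f (WittVector.truncate m x) = WittVector.truncate m (WittVector.map f x) :=
  truncLift_truncate _ _ _ _ _

theorem truncDiv_add {m n : ℕ} (h : n + 1 ≤ m) {R : Type u} [CommRing R]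
    (a b : TruncatedWittVector p m R) (ha : truncEv p m (by omega) R a = 0)
    (hb : truncEv p m (by omega) R b = 0) :
    truncDiv p m n h R (a + b) = truncDiv p m n h R a + truncDiv p m n h R b := by
  obtain ⟨a, rfl⟩ := WittVector.truncate_surjective p m R a
  obtain ⟨b, rfl⟩ := WittVector.truncate_surjective p m R b
  rw [truncEv_truncate] at ha hb
  rw [← map_add, truncDiv_truncate, truncDiv_truncate, truncDiv_truncate,
    WittVector.shift_one_add ha hb, map_add]

theorem truncDiv_mul {m n : ℕ} (h : n + 1 ≤ m) {R : Type u} [CommRing R]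
    (a b : TruncatedWittVector p m R) (hb : truncEv p m (by omega) R b = 0) :
    truncDiv p m n h R (a * b) = truncFrobenius p m n h R a * truncDiv p m n h R b := by
  obtain ⟨a, rfl⟩ := WittVector.truncate_surjective p m R a
  obtain ⟨b, rfl⟩ := WittVector.truncate_surjective p m R b
  rw [truncEv_truncate] at hb
  rw [← map_mul, truncDiv_truncate, truncDiv_truncate, truncFrobenius_truncate,
    WittVector.shift_one_mul a hb, map_mul]

theorem truncFrobenius_eq_mul_truncDiv {m n : ℕ} (h : n + 1 ≤ m) {R : Type u} [CommRing R]
    (a : TruncatedWittVector p m R) (ha : truncEv p m (by omega) R a = 0) :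
    truncFrobenius p m n h R a = (p : TruncatedWittVector p n R) * truncDiv p m n h R a := by
  obtain ⟨a, rfl⟩ := WittVector.truncate_surjective p m R a
  rw [truncEv_truncate] at ha
  rw [truncFrobenius_truncate, truncDiv_truncate, WittVector.frobenius_eq_mul_shift_one ha,
    map_mul, map_natCast]

theorem exists_truncDiv_eq_one {m n : ℕ} (h : n + 1 ≤ m) (R : Type u) [CommRing R] :
    ∃ v, truncEv p m (by omega) R v = 0 ∧ truncDiv p m n h R v = 1 :=
  ⟨WittVector.truncate m (WittVector.verschiebung 1), by
    rw [truncEv_truncate, WittVector.verschiebung_coeff_zero], by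
    rw [truncDiv_truncate, WittVector.shift_one_verschiebung, map_one]⟩

theorem truncEv_surjective {m : ℕ} (h : 0 < m) (R : Type u) [CommRing R] :
    Function.Surjective (truncEv p m h R) := fun r =>
  ⟨WittVector.truncate m (WittVector.teichmuller p r), by
    rw [truncEv_truncate, WittVector.teichmuller_coeff_zero]⟩

theorem truncFrames_isWitt {m n : ℕ} (h : n + 1 ≤ m) (R : Type u) [CommRing R] :
    ((truncFrames p m n h).frame R).IsWitt p where
  ev_surjective := truncEv_surjective (Nat.lt_of_lt_of_le (Nat.succ_pos n) h) R
  div_add := truncDiv_add h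
  div_mul := truncDiv_mul h
  σ_eq := truncFrobenius_eq_mul_truncDiv h
  exists_div_eq_one := exists_truncDiv_eq_one h R

theorem wittFrames_isUnit {R : Type u} [CommRing R] (hR : IsNilpotent (p : R))
    (a : ((wittFrames p).frame R).A) (ha : IsUnit (((wittFrames p).frame R).ev a)) : IsUnit a :=
  WittVector.isUnit_of_coeff_zero hR a ha

theorem truncFrames_isUnit {m n : ℕ} (h : n + 1 ≤ m) {R : Type u} [CommRing R]
    (hR : IsNilpotent (p : R)) (a : ((truncFrames p m n h).frame R).A)
    (ha : IsUnit (((truncFrames p m n h).frame R).ev a)) : IsUnit a := by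
  obtain ⟨a, rfl⟩ := WittVector.truncate_surjective p m R a
  exact (WittVector.isUnit_of_coeff_zero hR a
    ((truncEv_truncate p m (by omega) a) ▸ ha)).map (WittVector.truncate m)

/-- The bijection `W₁(R) ≅ R`. -/
theorem truncEv_one_bijective (R : Type u) [CommRing R] :
    Function.Bijective (truncEv p 1 one_pos R) := by
  have h : ∀ x, truncEv p 1 one_pos R x = x.coeff 0 := fun x => by
    obtain ⟨x, rfl⟩ := WittVector.truncate_surjective p 1 R x
    rw [truncEv_truncate, WittVector.coeff_truncate]
    rfl
  refine ⟨fun x y hxy => ?_, fun r => ⟨TruncatedWittVector.mk p fun _ => r, ?_⟩⟩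
  · ext i
    obtain rfl := Subsingleton.elim i 0
    rw [← h, ← h, hxy]
  · rw [h, TruncatedWittVector.coeff_mk]

/-- Under `W_1(R) ≅ R` the map is `f` itself. Length one is the only case in which flatness of `B →
B'` is needed, namely for the kernels of the `1-rdt` structure. -/
theorem truncMap_one_flat {R S : Type u} [CommRing R] [CommRing S] {f : R →+* S} (hf : f.Flat) :
    (truncMap p 1 f).Flat := by
  let e := RingEquiv.ofBijective _ (truncEv_one_bijective (p := p) R)
  let e' := RingEquiv.ofBijective _ (truncEv_one_bijective (p := p) S)
  have h : truncMap p 1 f = e'.symm.toRingHom.comp (f.comp e.toRingHom) := by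
    ext1 x
    change _ = e'.symm (f (e x))
    rw [RingEquiv.eq_symm_apply]
    exact truncMap_ev p 1 one_pos f x
  rw [h]
  exact ((RingHom.Flat.of_bijective e.bijective).comp hf).comp
    (RingHom.Flat.of_bijective e'.symm.bijective)

end WittFrames

/-! ## Solving `σ(u) = b u` -/

namespace WittVector

variable {p : ℕ} [hp : Fact p.Prime]

/-- A solution of `σ(z) = b z` modulo `p` lifts to a solution, if `p` is nilpotent. -/
theorem exists_frobenius_eq_mul {R : Type u} [CommRing R] (hR : IsNilpotent (p : R))
    (b : (WittVector p R)ˣ) (z : WittVector p R)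
    (hz : ∀ n, (frobenius z - b * z).coeff n ∈ Ideal.span {(p : R)}) :
    ∃ u : WittVector p R, frobenius u = b * u ∧ ∀ n, (u - z).coeff n ∈ Ideal.span {(p : R)} := by
  -- Fixed points of `Φ` are the solutions. The defect `Φ(Φ^k z) - Φ^k z` is carried to the next
  -- defect by `b⁻¹ F`, which improves its coordinates by a factor `p`. If `p ^ N = 0`, the
  -- iteration is stationary from step `N` on, and it never leaves the class of `z` modulo `p`.
  let Φ : WittVector p R → WittVector p R := fun x => ↑b⁻¹ * frobenius x
  let K : ℕ → Ideal (WittVector p R) := fun k =>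
    RingHom.ker (map (Ideal.Quotient.mk (Ideal.span {(p : R) ^ (k + 1)})))
  have hK : ∀ k x, x ∈ K k ↔ ∀ n, x.coeff n ∈ Ideal.span {(p : R) ^ (k + 1)} := fun k x =>
    map_mk_eq_zero_iff _ x
  have hΦ : ∀ k, Φ (Φ^[k] z) - Φ^[k] z ∈ K k := fun k => by
    induction k with
    | zero =>
      have h : Φ z - z = ↑b⁻¹ * (frobenius z - b * z) := by
        rw [mul_sub, ← mul_assoc, Units.inv_mul, one_mul]
      rw [Function.iterate_zero, id, h]
      refine Ideal.mul_mem_left _ _ ((hK 0 _).2 ?_)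
      rw [zero_add, pow_one]
      exact hz
    | succ k ih =>
      have h : Φ (Φ^[k + 1] z) - Φ^[k + 1] z = ↑b⁻¹ * frobenius (Φ (Φ^[k] z) - Φ^[k] z) := by
        rw [Function.iterate_succ_apply', map_sub, mul_sub]
      rw [h]
      exact Ideal.mul_mem_left _ _ ((hK _ _).2 (frobenius_coeff_mem ((hK k _).1 ih)))
  have hle : ∀ k, K k ≤ K 0 := fun k x hx => (hK 0 x).2 fun n =>
    Ideal.span_singleton_le_span_singleton.2 (pow_dvd_pow _ (by omega)) ((hK k x).1 hx n)
  have hz' : ∀ k, Φ^[k] z - z ∈ K 0 := fun k => by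
    induction k with
    | zero => rw [Function.iterate_zero, id, sub_self]; exact zero_mem _
    | succ k ih =>
      rw [Function.iterate_succ_apply', ← sub_add_sub_cancel _ (Φ^[k] z)]
      exact add_mem (hle k (hΦ k)) ih
  obtain ⟨N, hN⟩ := hR
  refine ⟨Φ^[N] z, ?_, ?_⟩
  · have h : Φ (Φ^[N] z) - Φ^[N] z = 0 := by
      ext n
      have := (hK N _).1 (hΦ N) n
      rw [pow_succ, hN, zero_mul, Ideal.span_singleton_zero, Ideal.mem_bot] at this
      rw [this, zero_coeff]
    conv_rhs => rw [← sub_eq_zero.1 h]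
    change frobenius (Φ^[N] z) = b * (↑b⁻¹ * frobenius (Φ^[N] z))
    rw [← mul_assoc, Units.mul_inv, one_mul]
  · have := (hK 0 _).1 (hz' N)
    rwa [zero_add, pow_one] at this

theorem frobenius_coeff_sub_pow_mem {R : Type u} [CommRing R] (x : WittVector p R) (n : ℕ) :
    (frobenius x).coeff n - x.coeff n ^ p ∈ Ideal.span {(p : R)} := by
  rw [coeff_frobenius, frobeniusPoly, map_add, map_pow, MvPolynomial.aeval_X, map_mul,
    add_sub_cancel_left, MvPolynomial.aeval_C]
  exact Ideal.mul_mem_right _ _ (by simp)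

/-- Subtraction of Witt vectors is not coordinatewise, but both conditions express equality of the
images in `W(R / I)`. The converse below holds for the same reason. -/
theorem sub_coeff_mem {R : Type u} [CommRing R] {I : Ideal R} {x y : WittVector p R}
    (h : ∀ n, x.coeff n - y.coeff n ∈ I) (n : ℕ) : (x - y).coeff n ∈ I := by
  refine (map_mk_eq_zero_iff I _).1 ?_ n
  rw [map_sub, sub_eq_zero]
  ext i
  rw [map_coeff, map_coeff]
  exact (Ideal.Quotient.eq).2 (h i)

theorem coeff_sub_coeff_mem {R : Type u} [CommRing R] {I : Ideal R} {x y : WittVector p R}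
    (h : ∀ n, (x - y).coeff n ∈ I) (n : ℕ) : x.coeff n - y.coeff n ∈ I := by
  have h1 := (map_mk_eq_zero_iff I _).2 h
  rw [map_sub, sub_eq_zero] at h1
  have h2 := congrArg (fun z => z.coeff n) h1
  simp only [map_coeff] at h2
  exact (Ideal.Quotient.eq).1 h2

/-- The coordinates of a product are affine functions of the last coordinate. -/
theorem exists_mul_coeff_eq {R : Type u} [CommRing R] (x y : WittVector p R) (n : ℕ) :
    ∃ g c : R, ∀ {A : Type u} [CommRing A] (t : R →+* A) (y' : WittVector p A),
      (∀ i < n, y'.coeff i = t (y.coeff i)) → (map t x * y').coeff n = t g * y'.coeff n + t c := by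
  cases n with
  | zero =>
    exact ⟨x.coeff 0, 0, fun t y' _ => by rw [mul_coeff_zero, map_zero, add_zero, map_coeff]⟩
  | succ n =>
    -- In the formula for the coordinate of index `n + 1` of a product, the summand `p ^ (n + 1)
    -- x_{n+1} y_{n+1}` cancels the top term of the ghost sum of `y`. So the last coordinate of `y`
    -- occurs only linearly, with the ghost component `g` of `x` as coefficient. The remaining
    -- polynomial involves earlier coordinates alone.
    refine ⟨∑ i ∈ Finset.range (n + 1 + 1), p ^ i * x.coeff i ^ p ^ (n + 1 - i),
      x.coeff (n + 1) * ∑ i ∈ Finset.range (n + 1), p ^ i * y.coeff i ^ p ^ (n + 1 - i)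
        + peval (polyOfInterest p n) ![fun i => x.coeff i, fun i => y.coeff i], @fun A _ t y' h => ?_⟩
    have h1 : t (peval (polyOfInterest p n) ![fun i => x.coeff i, fun i => y.coeff i])
        = peval (polyOfInterest p n) ![fun i => (map t x).coeff i, fun i => y'.coeff i] := by
      rw [peval, MvPolynomial.aeval_def, MvPolynomial.hom_eval₂]
      refine MvPolynomial.eval₂Hom_congr' (RingHom.ext_int _ _) (fun i hi _ => ?_) rfl
      have h2 := polyOfInterest_vars p n hi
      rw [Finset.mem_product, Finset.mem_range] at h2
      obtain ⟨a, i⟩ := i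
      fin_cases a
      · exact (map_coeff t x i).symm
      · exact (h i (by simpa using h2.2)).symm
    have h3 := peval_polyOfInterest p n (map t x) y'
    have h4 := Finset.sum_range_succ (fun i => (p : A) ^ i * y'.coeff i ^ p ^ (n + 1 - i)) (n + 1)
    rw [Nat.sub_self, pow_zero, pow_one] at h4
    have hs : t (∑ i ∈ Finset.range (n + 1), (p : R) ^ i * y.coeff i ^ p ^ (n + 1 - i))
        = ∑ i ∈ Finset.range (n + 1), (p : A) ^ i * y'.coeff i ^ p ^ (n + 1 - i) := by
      rw [map_sum]
      exact Finset.sum_congr rfl fun i hi => by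
        rw [h i (Finset.mem_range.1 hi), map_mul, map_pow, map_pow, map_natCast]
    have hg : t (∑ i ∈ Finset.range (n + 1 + 1), (p : R) ^ i * x.coeff i ^ p ^ (n + 1 - i))
        = ∑ i ∈ Finset.range (n + 1 + 1), (p : A) ^ i * (map t x).coeff i ^ p ^ (n + 1 - i) := by
      rw [map_sum]
      exact Finset.sum_congr rfl fun i hi => by
        rw [map_coeff, map_mul, map_pow, map_pow, map_natCast]
    rw [map_add, map_mul, h1, h3, hs, hg, ← map_coeff t x (n + 1)]
    linear_combination (map t x).coeff (n + 1) * h4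

end WittVector

/-! ## Direct limits of faithfully flat extensions -/

/-- Both conditions are finitary. A linear relation in the limit already holds at a finite stage,
where flatness trivializes it. If `I L = L`, then `1` lies in `I A_m` for some `m`, and faithfulness
of that stage gives that `I` is the unit ideal. -/
theorem RingHom.FaithfullyFlat.directLimit {R : Type u} [CommRing R] (A : ℕ → Type u)
    [∀ n, CommRing (A n)] (t : ∀ i j, i ≤ j → A i →+* A j) [DirectedSystem A fun i j h => t i j h]
    (f : ∀ n, R →+* A n) (hf : ∀ n, (f n).FaithfullyFlat)
    (ht : ∀ i j h r, t i j h (f i r) = f j r) :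
    ((Ring.DirectLimit.of A (fun i j h => t i j h) 0).comp (f 0)).FaithfullyFlat := by
  set L := Ring.DirectLimit A (fun i j h => t i j h)
  let o : ∀ n, A n →+* L := Ring.DirectLimit.of A (fun i j h => t i j h)
  have ho : ∀ i j h x, o j (t i j h x) = o i x := fun i j h x => Ring.DirectLimit.of_f h x
  have hof : ∀ n r, o n (f n r) = o 0 (f 0 r) := fun n r => by
    rw [← ht 0 n (Nat.zero_le n), ho]
  have hfin : ∀ {l : ℕ} (x : Fin l → L), ∃ n, ∃ y : Fin l → A n, ∀ i, o n (y i) = x i := by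
    intro l x
    choose n y hy using fun i => Ring.DirectLimit.exists_of (x i)
    let N := Finset.univ.sup n
    have hN : ∀ i, n i ≤ N := fun i => Finset.le_sup (f := n) (Finset.mem_univ i)
    exact ⟨N, fun i => t (n i) N (hN i) (y i), fun i => (ho _ _ _ _).trans (hy i)⟩
  have hzero : ∀ n (x : A n), o n x = 0 → ∃ m, ∃ h : n ≤ m, t n m h x = 0 := fun n x hx =>
    Ring.DirectLimit.of.zero_exact hx
  let iL : Algebra R L := (((o 0).comp (f 0))).toAlgebra
  let iA : ∀ n, Algebra R (A n) := fun n => (f n).toAlgebra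
  have hsA : ∀ n (r : R) (x : A n), r • x = f n r * x := fun _ _ _ => rfl
  have hsL : ∀ (r : R) (x : L), r • x = o 0 (f 0 r) * x := fun _ _ => rfl
  have hsmul : ∀ n (r : R) (x : A n), o n (r • x) = r • o n x := fun n r x => by
    rw [hsA, hsL, map_mul, hof]
  have htsmul : ∀ n m h (r : R) (x : A n), t n m h (r • x) = r • t n m h x := fun n m h r x => by
    rw [hsA, hsA, map_mul, ht]
  change Module.FaithfullyFlat R L
  have hflat : ∀ n, Module.FaithfullyFlat R (A n) := fun n => hf n
  rw [Module.FaithfullyFlat.iff_flat_and_ideal_smul_eq_top]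
  refine ⟨Module.Flat.iff_forall_isTrivialRelation.2 fun {l a x} hx => ?_, fun I hI => ?_⟩
  · obtain ⟨n, y, hy⟩ := hfin x
    have h0 : o n (∑ i, a i • y i) = 0 := by
      rw [map_sum, ← hx]
      exact Finset.sum_congr rfl fun i _ => by rw [hsmul, hy]
    obtain ⟨m, h, hm⟩ := hzero n _ h0
    have h1 : ∑ i, a i • t n m h (y i) = 0 := by
      rw [← hm, map_sum]
      exact Finset.sum_congr rfl fun i _ => (htsmul _ _ _ _ _).symm
    obtain ⟨k, b, z, hb, hz⟩ := Module.Flat.iff_forall_isTrivialRelation.1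
      (inferInstance : Module.Flat R (A m)) h1
    refine ⟨k, b, fun j => o m (z j), fun i => ?_, hz⟩
    have hb' : t n m h (y i) = ∑ j, b i j • z j := hb i
    rw [← hy, ← ho n m h, hb', map_sum]
    exact Finset.sum_congr rfl fun j _ => hsmul _ _ _
  · have key : ∀ x ∈ I • (⊤ : Submodule R L), ∃ n, ∃ y ∈ I • (⊤ : Submodule R (A n)), o n y = x := by
      intro x hx
      induction hx using Submodule.smul_induction_on' with
      | smul r hr s _ =>
        obtain ⟨n, y, rfl⟩ := Ring.DirectLimit.exists_of s
        exact ⟨n, r • y, Submodule.smul_mem_smul hr trivial, hsmul _ _ _⟩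
      | add x _ y _ hx hy =>
        obtain ⟨n, x', hx', rfl⟩ := hx
        obtain ⟨m, y', hy', rfl⟩ := hy
        have hmap : ∀ i j h, ∀ z ∈ I • (⊤ : Submodule R (A i)),
            t i j h z ∈ I • (⊤ : Submodule R (A j)) := fun i j h z hz => by
          induction hz using Submodule.smul_induction_on' with
          | smul r hr s _ => rw [htsmul]; exact Submodule.smul_mem_smul hr trivial
          | add x _ y _ hx hy => rw [map_add]; exact add_mem hx hy
        exact ⟨max n m, _, add_mem (hmap _ _ (le_max_left n m) _ hx')
          (hmap _ _ (le_max_right n m) _ hy'), by rw [map_add, ho, ho]⟩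
    have h1 : (1 : L) ∈ I • (⊤ : Submodule R L) := by rw [hI]; trivial
    obtain ⟨n, y, hy, hy1⟩ := key 1 h1
    have h2 : o n (y - 1) = 0 := by rw [map_sub, map_one, hy1, sub_self]
    obtain ⟨m, h, hm⟩ := hzero n _ h2
    rw [map_sub, map_one, sub_eq_zero] at hm
    have h3 : (1 : A m) ∈ I • (⊤ : Submodule R (A m)) := by
      rw [← hm]
      clear hm h2 hy1
      induction hy using Submodule.smul_induction_on' with
      | smul r hr s _ => rw [htsmul]; exact Submodule.smul_mem_smul hr trivial
      | add x _ y _ hx hy => rw [map_add]; exact add_mem hx hy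
    refine (Module.FaithfullyFlat.iff_flat_and_ideal_smul_eq_top R (A m)).1 (hflat m) |>.2 I ?_
    rw [eq_top_iff]
    intro z _
    have h4 : I • (⊤ : Submodule R (A m)) = (I.map (f m)).restrictScalars R :=
      Ideal.smul_top_eq_map I
    rw [h4] at h3 ⊢
    have h5 : I.map (f m) = ⊤ := (Ideal.eq_top_iff_one _).2 h3
    rw [h5]
    trivial

/-- A monic polynomial makes the quotient free, and positive degree makes it nonzero. Over the zero
ring the map is bijective. -/
theorem AdjoinRoot.faithfullyFlat {R : Type u} [CommRing R] {f : Polynomial R} (hf : f.Monic)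
    (hd : 0 < f.natDegree) : (AdjoinRoot.of f).FaithfullyFlat := by
  rcases subsingleton_or_nontrivial R with h | h
  · have : Subsingleton (AdjoinRoot f) := (AdjoinRoot.of f).codomain_trivial
    exact RingHom.FaithfullyFlat.of_bijective
      ⟨fun _ _ _ => Subsingleton.elim _ _, fun x => ⟨0, Subsingleton.elim _ _⟩⟩
  · have : Module.Free R (AdjoinRoot f) := hf.free_adjoinRoot
    have : Nontrivial (AdjoinRoot f) := by
      refine Ideal.Quotient.nontrivial_iff.2 fun h => ?_
      rw [Ideal.span_singleton_eq_top, hf.isUnit_iff] at h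
      rw [h, Polynomial.natDegree_one] at hd
      exact hd.ne rfl
    have : Module.FaithfullyFlat R (AdjoinRoot f) := inferInstance
    exact (RingHom.faithfullyFlat_algebraMap_iff (R := R) (S := AdjoinRoot f)).2 this

theorem exists_faithfullyFlat_root {R : Type u} [CommRing R] {f : Polynomial R} (hf : f.Monic)
    (hd : 0 < f.natDegree) : ∃ (A : Type u) (_ : CommRing A) (t : R →+* A) (_ : t.FaithfullyFlat)
      (r : A), f.eval₂ t r = 0 :=
  ⟨_, _, _, AdjoinRoot.faithfullyFlat hf hd, AdjoinRoot.root f, AdjoinRoot.eval₂_root f⟩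

/-- The composites of the transition maps of a sequence of rings. -/
def towerHom {A : ℕ → Type u} [∀ n, CommRing (A n)] (s : ∀ n, A n →+* A (n + 1)) (m n : ℕ)
    (h : m ≤ n) : A m →+* A n :=
  Nat.leRecOn h (fun {k} g => (s k).comp g) (RingHom.id (A m))

section Tower

variable {A : ℕ → Type u} [∀ n, CommRing (A n)] (s : ∀ n, A n →+* A (n + 1))

theorem towerHom_self (m : ℕ) (h : m ≤ m) (x : A m) : towerHom s m m h x = x := by
  rw [towerHom, Nat.leRecOn_self, RingHom.id_apply]

theorem towerHom_succ (m n : ℕ) (h : m ≤ n) (h' : m ≤ n + 1) (x : A m) :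
    towerHom s m (n + 1) h' x = s n (towerHom s m n h x) := by
  rw [towerHom, Nat.leRecOn_succ h, RingHom.comp_apply, towerHom]

instance towerHom_directedSystem : DirectedSystem A fun i j h => towerHom s i j h where
  map_self i x := towerHom_self s i le_rfl x
  map_map i j k hij hjk x := by
    induction hjk with
    | refl => rw [towerHom_self]
    | step hjk ih => rw [towerHom_succ s _ _ hjk, towerHom_succ s _ _ (hij.trans hjk), ih]

end Tower

/-! ### A tower of root adjunctions that solves `σ(u) = b u` -/

namespace WittVector

variable {p : ℕ} [hp : Fact p.Prime]

/-- By the affine formula, this coordinate of a product involves only the coordinates of the second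
factor up to the same index. Equations already solved therefore survive changes of later
coordinates. -/
theorem mul_coeff_congr {R : Type u} [CommRing R] (x : WittVector p R) {y y' : WittVector p R} {n : ℕ}
    (h : ∀ i ≤ n, y.coeff i = y'.coeff i) : (x * y).coeff n = (x * y').coeff n := by
  obtain ⟨g, c, hc⟩ := exists_mul_coeff_eq x y' n
  have hx : map (RingHom.id R) x = x := by ext i; rw [map_coeff, RingHom.id_apply]
  have h1 := hc (RingHom.id R) y fun i hi => h i hi.le
  have h2 := hc (RingHom.id R) y' fun _ _ => rfl
  rw [hx] at h1 h2
  rw [h1, h2, h n le_rfl]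

theorem map_map {R S T : Type*} [CommRing R] [CommRing S] [CommRing T] (f : R →+* S) (g : S →+* T)
    (x : WittVector p R) : map g (map f x) = map (g.comp f) x := by
  ext n
  rw [map_coeff, map_coeff, map_coeff, RingHom.comp_apply]

/-- For positive `n` the equation is `X ^ p = g X + c` with `g` and `c` already determined, and a
root is adjoined. For `n = 0` it is `X ^ p = b_0 X`, which also has the useless root zero. Solving
`X ^ (p - 1) = b_0` instead produces a unit. -/
theorem exists_coordinate {R : Type u} [CommRing R] (b : WittVector p R) (hb : IsUnit (b.coeff 0))
    (n : ℕ) (y : WittVector p R) :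
    ∃ (A : Type u) (_ : CommRing A) (t : R →+* A) (_ : t.FaithfullyFlat) (y' : WittVector p A),
      (∀ i < n, y'.coeff i = t (y.coeff i)) ∧ y'.coeff n ^ p = (map t b * y').coeff n ∧
        (n = 0 → IsUnit (y'.coeff 0)) := by
  rcases Nat.eq_zero_or_pos n with rfl | hn
  · have h0 : p - 1 ≠ 0 := by have := hp.out.two_le; omega
    rcases subsingleton_or_nontrivial R with hs | hs
    · have hz : ∀ z w : WittVector p R, z = w := fun z w => by ext; exact Subsingleton.elim _ _
      refine ⟨R, _, RingHom.id R, RingHom.FaithfullyFlat.of_bijective Function.bijective_id, 1,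
        fun i hi => absurd hi (Nat.not_lt_zero i), Subsingleton.elim _ _, fun _ => ?_⟩
      rw [one_coeff_zero]
      exact isUnit_one
    · obtain ⟨A, _, t, ht, r, hr⟩ := exists_faithfullyFlat_root
        (Polynomial.monic_X_pow_sub_C (b.coeff 0) h0)
        (by rw [Polynomial.natDegree_X_pow_sub_C]; omega)
      rw [Polynomial.eval₂_sub, Polynomial.eval₂_pow, Polynomial.eval₂_X, Polynomial.eval₂_C,
        sub_eq_zero] at hr
      -- Only coordinate zero matters here. The other coordinates are placeholders, replaced at the
      -- later steps.
      refine ⟨A, _, t, ht, mk p fun _ => r, fun i hi => absurd hi (Nat.not_lt_zero i), ?_, fun _ => ?_⟩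
      · rw [mul_coeff_zero, coeff_mk, map_coeff, ← hr, ← pow_succ,
          Nat.sub_add_cancel hp.out.one_le]
      · rw [coeff_mk, ← isUnit_pow_iff h0, hr]
        exact hb.map t
  · obtain ⟨g, c, hc⟩ := exists_mul_coeff_eq b y n
    rcases subsingleton_or_nontrivial R with hs | hs
    · exact ⟨R, _, RingHom.id R, RingHom.FaithfullyFlat.of_bijective Function.bijective_id, y,
        fun _ _ => rfl, Subsingleton.elim _ _, fun h => absurd h hn.ne'⟩
    -- As `p` is at least two, the affine part has smaller degree than `X ^ p`, so the polynomial is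
    -- monic of degree `p`.
    · have hdeg : (Polynomial.C g * Polynomial.X + Polynomial.C c).degree < ((p : ℕ) : WithBot ℕ) :=
        lt_of_le_of_lt Polynomial.degree_linear_le (by exact_mod_cast hp.out.one_lt)
      obtain ⟨A, _, t, ht, r, hr⟩ := exists_faithfullyFlat_root (Polynomial.monic_X_pow_sub hdeg) (by
        rw [Polynomial.natDegree_sub_eq_left_of_natDegree_lt, Polynomial.natDegree_X_pow]
        · exact hp.out.pos
        · rw [Polynomial.natDegree_X_pow]
          exact lt_of_le_of_lt Polynomial.natDegree_linear_le hp.out.one_lt)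
      rw [Polynomial.eval₂_sub, Polynomial.eval₂_pow, Polynomial.eval₂_X, Polynomial.eval₂_add,
        Polynomial.eval₂_mul, Polynomial.eval₂_X, Polynomial.eval₂_C, Polynomial.eval₂_C,
        sub_eq_zero] at hr
      let y' : WittVector p A := mk p fun i => if i = n then r else t (y.coeff i)
      have hy : ∀ i < n, y'.coeff i = t (y.coeff i) := fun i hi => by
        rw [coeff_mk, if_neg hi.ne]
      refine ⟨A, _, t, ht, y', hy, ?_, fun h => absurd h hn.ne'⟩
      rw [hc t y' hy, coeff_mk, if_pos rfl, hr]

/-- A faithfully flat extension of `R`, with a Witt vector over it. -/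
structure Extension (p : ℕ) (R : Type u) [CommRing R] where
  A : Type u
  [ring : CommRing A]
  f : R →+* A
  flat : f.FaithfullyFlat
  y : WittVector p A

attribute [instance] Extension.ring

/-- The first `n` coordinates of `y` solve the equations `y_i ^ p = (b y)_i`. -/
def Extension.Solves {R : Type u} [CommRing R] (s : Extension p R) (b : WittVector p R) (n : ℕ) :
    Prop :=
  (∀ i < n, s.y.coeff i ^ p = (map s.f b * s.y).coeff i) ∧ (0 < n → IsUnit (s.y.coeff 0))

/-- The step replaces only the coordinates from index `n` on and keeps the earlier ones. The first
`n` equations persist, since each involves coordinates up to its own index only. -/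
theorem Extension.exists_step {R : Type u} [CommRing R] (b : WittVector p R) (hb : IsUnit (b.coeff 0))
    (n : ℕ) (s : Extension p R) (hs : s.Solves b n) :
    ∃ (s' : Extension p R) (t : s.A →+* s'.A), s'.Solves b (n + 1) ∧ t.comp s.f = s'.f ∧
      ∀ i < n, s'.y.coeff i = t (s.y.coeff i) := by
  obtain ⟨A, _, t, ht, y, h1, h2, h3⟩ := exists_coordinate (map s.f b)
    (by rw [map_coeff]; exact hb.map _) n s.y
  refine ⟨⟨A, t.comp s.f, RingHom.FaithfullyFlat.stableUnderComposition _ _ s.flat ht, y⟩, t,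
    ⟨fun i hi => ?_, fun _ => ?_⟩, rfl, h1⟩
  · change y.coeff i ^ p = (map (t.comp s.f) b * y).coeff i
    rw [← map_map]
    rcases Nat.lt_succ_iff_lt_or_eq.1 hi with hi | rfl
    · rw [mul_coeff_congr (map t (map s.f b)) (y' := map t s.y) (fun j hj => by
          rw [map_coeff, h1 j (by omega)]), ← map_mul, map_coeff, ← hs.1 i hi, h1 i hi, map_pow]
    · exact h2
  · change IsUnit (y.coeff 0)
    rcases Nat.eq_zero_or_pos n with rfl | hn
    · exact h3 rfl
    · rw [h1 0 hn]
      exact (hs.2 hn).map t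

theorem exists_faithfullyFlat_pow_eq {R : Type u} [CommRing R] (b : WittVector p R)
    (hb : IsUnit (b.coeff 0)) :
    ∃ (S : Type u) (_ : CommRing S) (f : R →+* S) (_ : f.FaithfullyFlat) (z : WittVector p S),
      IsUnit (z.coeff 0) ∧ ∀ n, z.coeff n ^ p = (map f b * z).coeff n := by
  choose next t hnext using Extension.exists_step (p := p) b hb
  let E : ∀ n, {s : Extension p R // s.Solves b n} := fun n => Nat.rec
    ⟨⟨R, RingHom.id R, RingHom.FaithfullyFlat.of_bijective Function.bijective_id, 0⟩,
      fun i hi => absurd hi (Nat.not_lt_zero i), fun h => absurd h (lt_irrefl 0)⟩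
    (fun n s => ⟨next n s.1 s.2, (hnext n s.1 s.2).1⟩) n
  let A : ℕ → Type u := fun n => (E n).1.A
  let s : ∀ n, A n →+* A (n + 1) := fun n => t n (E n).1 (E n).2
  have hs1 : ∀ n, (s n).comp (E n).1.f = (E (n + 1)).1.f := fun n => (hnext n (E n).1 (E n).2).2.1
  have hs2 : ∀ n, ∀ i < n, (E (n + 1)).1.y.coeff i = s n ((E n).1.y.coeff i) := fun n =>
    (hnext n (E n).1 (E n).2).2.2
  let T := towerHom s
  have hT1 : ∀ i j h r, T i j h ((E i).1.f r) = (E j).1.f r := fun i j h r => by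
    induction h with
    | refl => exact towerHom_self s _ _ _
    | step h ih =>
      refine (towerHom_succ s _ _ h _ _).trans ((congrArg _ ih).trans ?_)
      exact RingHom.congr_fun (hs1 _) r
  have hT2 : ∀ i j h, ∀ k < i, T i j h ((E i).1.y.coeff k) = (E j).1.y.coeff k := fun i j h k hk => by
    induction h with
    | refl => exact towerHom_self s _ _ _
    | step h ih =>
      refine (towerHom_succ s _ _ h _ _).trans ((congrArg _ ih).trans ?_)
      exact (hs2 _ k (lt_of_lt_of_le hk h)).symm
  let o : ∀ n, A n →+* Ring.DirectLimit A (fun i j h => T i j h) :=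
    Ring.DirectLimit.of A fun i j h => T i j h
  have ho : ∀ i j h x, o j (T i j h x) = o i x := fun i j h x => Ring.DirectLimit.of_f h x
  -- Coordinate `n` is final from stage `n + 1` on, so it is taken from that stage. The equation of
  -- index `n` is then the image of an equation that holds there.
  refine ⟨_, _, _, RingHom.FaithfullyFlat.directLimit A T (fun n => (E n).1.f)
    (fun n => (E n).1.flat) hT1, mk p fun n => o (n + 1) ((E (n + 1)).1.y.coeff n), ?_, fun n => ?_⟩
  · rw [coeff_mk]
    exact ((E 1).2.2 one_pos).map (o 1)
  · have hf : (o 0).comp (E 0).1.f = (o (n + 1)).comp (E (n + 1)).1.f := by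
      ext r
      exact (ho 0 (n + 1) (Nat.zero_le _) _).symm.trans
        (congrArg (o (n + 1)) (hT1 0 (n + 1) (Nat.zero_le _) r))
    change _ = (map ((o 0).comp (E 0).1.f) b * _).coeff n
    rw [hf, ← map_map, mul_coeff_congr _ (y' := map (o (n + 1)) (E (n + 1)).1.y), ← map_mul,
      map_coeff, ← (E (n + 1)).2.1 n (Nat.lt_succ_self n), coeff_mk, map_pow]
    intro i hi
    rw [map_coeff, coeff_mk, ← hT2 (i + 1) (n + 1) (by omega) i (Nat.lt_succ_self i), ho]

/-- Modulo `p` the Frobenius raises coordinates to the power `p`, so the tower yields a solution `z`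
modulo `p`, and successive approximation corrects it to `u`. The first coordinates of `u` and `z`
differ by a multiple of the nilpotent `p`, so that `u` is again a unit. -/
theorem exists_faithfullyFlat_frobenius_eq_mul {R : Type u} [CommRing R] (hR : IsNilpotent (p : R))
    (b : (WittVector p R)ˣ) :
    ∃ (S : Type u) (_ : CommRing S) (f : R →+* S) (_ : f.FaithfullyFlat) (u : (WittVector p S)ˣ),
      frobenius (u : WittVector p S) = map f (b : WittVector p R) * (u : WittVector p S) := by
  have hb : IsUnit ((b : WittVector p R).coeff 0) := b.isUnit.map constantCoeff
  obtain ⟨S, _, f, hf, z, hz0, hz⟩ := exists_faithfullyFlat_pow_eq (b : WittVector p R) hb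
  have hS : IsNilpotent (p : S) := by rw [← map_natCast f]; exact hR.map f
  obtain ⟨u, hu, huz⟩ := exists_frobenius_eq_mul hS (Units.map (map f).toMonoidHom b) z
    (sub_coeff_mem fun n => by
      have h := frobenius_coeff_sub_pow_mem z n
      rw [hz] at h
      exact h)
  have h1 : IsUnit (u.coeff 0) := by
    have h := coeff_sub_coeff_mem huz 0
    obtain ⟨c, hc⟩ := Ideal.mem_span_singleton.1 h
    have h2 : u.coeff 0 = z.coeff 0 + p * c := by rw [← hc]; ring
    rw [h2]
    exact IsNilpotent.isUnit_add_left_of_commute (Commute.isNilpotent_mul_right (Commute.all _ _) hS)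
      hz0 (Commute.all _ _)
  obtain ⟨v, rfl⟩ := isUnit_of_coeff_zero hS u h1
  exact ⟨S, _, f, hf, v, hu⟩

end WittVector

/-! ## Local triviality of invertible modules with a Frobenius -/

section Cover

instance Module.Flat.pi_finite {R ι : Type*} [CommRing R] [Finite ι] (M : ι → Type*)
    [∀ i, AddCommGroup (M i)] [∀ i, Module R (M i)] [∀ i, Module.Flat R (M i)] :
    Module.Flat R (∀ i, M i) := by
  classical
  have := Fintype.ofFinite ι
  exact Module.Flat.of_linearEquiv (DirectSum.linearEquivFunOnFintype R ι M).symm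

/-- The product of the localizations of `R` at elements that generate the unit ideal. -/
theorem exists_faithfullyFlat_orthogonal {R : Type u} [CommRing R] {n : ℕ} (r : Fin n → R)
    (hr : ∑ k, r k = 1) :
    ∃ (S : Type u) (_ : CommRing S) (f : R →+* S) (_ : f.FaithfullyFlat) (e : Fin n → S),
      (∀ k l, e k * e l = if k = l then e k else 0) ∧ IsUnit (∑ k, e k * f (r k)) := by
  let S := ∀ k : Fin n, Localization.Away (r k)
  refine ⟨S, inferInstance, algebraMap R S, ?_, fun k => Pi.single k 1, fun k l => ?_, ?_⟩
  · refine RingHom.FaithfullyFlat.iff_flat_and_comap_surjective.2 ⟨?_, fun P => ?_⟩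
    · rw [RingHom.flat_algebraMap_iff]
      have : ∀ k, Module.Flat R (Localization.Away (r k)) := fun k =>
        IsLocalization.flat _ (Submonoid.powers (r k))
      exact Module.Flat.pi_finite _
    -- The `r_k` add up to `1`, hence no prime contains all of them, and each prime lifts to one of
    -- the factors.
    · obtain ⟨k, hk⟩ : ∃ k, r k ∉ P.asIdeal := by
        by_contra! h
        exact P.2.ne_top ((Ideal.eq_top_iff_one _).2 (hr ▸ Ideal.sum_mem _ fun k _ => h k))
      have hP : P ∈ Set.range (PrimeSpectrum.comap (algebraMap R (Localization.Away (r k)))) := by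
        rw [PrimeSpectrum.localization_away_comap_range _ (r k)]
        exact hk
      obtain ⟨Q, rfl⟩ := hP
      exact ⟨PrimeSpectrum.comap (Pi.evalRingHom _ k) Q, rfl⟩
  · split_ifs with h
    · subst h
      rw [← Pi.single_mul, one_mul]
    · ext j
      rw [Pi.mul_apply, Pi.zero_apply]
      beta_reduce
      rcases eq_or_ne j k with rfl | hj
      · rw [Pi.single_eq_of_ne h, mul_zero]
      · rw [Pi.single_eq_of_ne hj, zero_mul]
  · rw [Pi.isUnit_iff]
    intro j
    rw [Finset.sum_apply, Finset.sum_eq_single j]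
    · rw [Pi.mul_apply]
      beta_reduce
      rw [Pi.single_eq_same, one_mul]
      exact IsLocalization.Away.algebraMap_isUnit (r j)
    · intro k _ hk
      rw [Pi.mul_apply]
      beta_reduce
      rw [Pi.single_eq_of_ne hk.symm, zero_mul]
    · exact fun h => absurd (Finset.mem_univ j) h

end Cover

/-! ### Trivializing an invertible module together with `ι` -/

section Invertible

/-- The evaluation map from `I^∨ ⊗ I` to `A` is surjective; a preimage of `1` is written as a finite
sum of pure tensors. -/
theorem Module.Invertible.exists_sum_eq_one (A I : Type*) [CommRing A] [AddCommGroup I] [Module A I]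
    [Module.Invertible A I] :
    ∃ (n : ℕ) (c : Fin n → Module.Dual A I) (i : Fin n → I), ∑ k, c k (i k) = 1 := by
  obtain ⟨t, ht⟩ := (Module.Invertible.bijective (R := A) (M := I)).2 1
  obtain ⟨n, s, hs⟩ := TensorProduct.exists_sum_tmul_eq t
  obtain ⟨i, rfl⟩ := hs
  refine ⟨n, s, i, ?_⟩
  rw [← ht, map_sum]
  exact Finset.sum_congr rfl fun k _ => (contractLeft_apply _ _).symm

theorem BC.invertible {A A' : Type u} [CommRing A] [CommRing A'] (α : A →+* A') (I : Type u)
    [AddCommGroup I] [Module A I] [Module.Invertible A I] : Module.Invertible A' (BC α I) := by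
  let := α.toAlgebra
  have : Module.Invertible A' (TensorProduct A A' I) := inferInstance
  exact this

/-- A semilinear form on an invertible module is a base change if its values generate the unit
ideal. -/
theorem isBC_of_isUnit {A A' : Type u} [CommRing A] [CommRing A'] {α : A →+* A'} {I : Type u}
    [AddCommGroup I] [Module A I] [Module.Invertible A I] (ψ : I →ₛₗ[α] A') {n : ℕ} (a : Fin n → A')
    (i : Fin n → I) (h : IsUnit (∑ k, a k * ψ (i k))) : IsBC ψ := by
  have := BC.invertible α I
  -- Between invertible modules a surjective linear map is bijective, so it suffices that the values
  -- of the form generate the unit ideal.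
  refine Module.Invertible.bijective_of_surjective (R := A') fun x => ?_
  refine ⟨(x * h.unit⁻¹.1) • ∑ k, BC.tmul α (a k) (i k), ?_⟩
  rw [map_smul, map_sum]
  have h1 : ∑ k, BC.lift (f := α) (γ := RingHom.id A') (τ := α) (fun _ => rfl) ψ
      (BC.tmul α (a k) (i k)) = ∑ k, a k * ψ (i k) := rfl
  rw [h1, smul_eq_mul, mul_assoc, h.val_inv_mul, mul_one]

/-- Over the product of localizations at the elements `ev(c_k(i_k))`, the local trivializations
`c_k` are glued to `∑ a_k c_k`, where `a_k ∈ A` lifts the idempotent `e_k` of `S`. The `a_k` need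
not be idempotent. It is enough that `∑ a_k ψ(i_k)` reduces to the unit `∑ e_k ev(c_k(i_k))`, since
units are detected in `S`. -/
theorem exists_isBC_unit {R : Type u} [CommRing R] (W : FrameFunctor.{u})
    (P : ∀ (R : Type u) [CommRing R], Prop)
    (hP : ∀ {R S : Type u} [CommRing R] [CommRing S] (_ : R →+* S), P R → P S)
    (hs : ∀ (R : Type u) [CommRing R], Function.Surjective (W.frame R).ev)
    (hu : ∀ {R : Type u} [CommRing R], P R → ∀ a, IsUnit ((W.frame R).ev a) → IsUnit a)
    (hR : P R) (I : Type u) [AddCommGroup I] [Module (W.frame R).A I]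
    [Module.Invertible (W.frame R).A I] :
    ∃ (S : Type u) (_ : CommRing S) (f : R →+* S) (_ : f.FaithfullyFlat)
      (ψ : I →ₛₗ[(W.map f).α] (W.frame S).A), IsBC ψ := by
  obtain ⟨n, c, i, hci⟩ := Module.Invertible.exists_sum_eq_one (W.frame R).A I
  obtain ⟨S, _, f, hf, e, he, hu'⟩ := exists_faithfullyFlat_orthogonal
    (fun k => (W.frame R).ev (c k (i k))) (by rw [← map_sum, hci, map_one])
  choose a ha using fun k => hs S (e k)
  let ψ : I →ₛₗ[(W.map f).α] (W.frame S).A :=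
    { toFun := fun z => ∑ k, a k * (W.map f).α (c k z)
      map_add' := fun x y => by
        rw [← Finset.sum_add_distrib]
        exact Finset.sum_congr rfl fun k _ => by rw [map_add, map_add, mul_add]
      map_smul' := fun b x => by
        rw [smul_eq_mul, Finset.mul_sum]
        exact Finset.sum_congr rfl fun k _ => by
          rw [map_smul, smul_eq_mul, map_mul]; exact mul_left_comm _ _ _ }
  refine ⟨S, _, f, hf, ψ, isBC_of_isUnit ψ a i (hu (hP f hR) _ ?_)⟩
  convert hu' using 1
  rw [map_sum]
  refine Finset.sum_congr rfl fun k _ => ?_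
  change (W.frame S).ev (a k * ∑ l, a l * (W.map f).α (c l (i k))) = _
  rw [map_mul, map_sum, ha, Finset.mul_sum, Finset.sum_eq_single k]
  · rw [map_mul, ha, (W.map f).ev_comm, ← mul_assoc, he, if_pos rfl]
  · intro l _ hl
    rw [map_mul, ha, ← mul_assoc, he, if_neg hl.symm, zero_mul]
  · exact fun h => absurd (Finset.mem_univ k) h

/-- Two base changes to `B` of the same module differ by a unit. -/
theorem IsBC.exists_unit {A B : Type u} [CommRing A] [CommRing B] {β : A →+* B} {N : Type u}
    [AddCommGroup N] [Module A N] {a b : N →ₛₗ[β] B} (ha : IsBC a) (hb : IsBC b) :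
    ∃ w : Bˣ, ∀ z, b z = w * a z := by
  let e := ha.unique hb
  have he : ∀ x, e x = e 1 * x := fun x => by
    have h := e.map_smul x 1
    rw [smul_eq_mul, mul_one, smul_eq_mul, mul_comm] at h
    exact h
  have h1 : IsUnit (e 1) := IsUnit.of_mul_eq_one (e.symm 1) (by rw [← he, e.apply_symm_apply])
  exact ⟨h1.unit, fun z => (ha.unique_apply hb z).symm.trans (he _)⟩

/-- Rescaling a trivialization by `u` multiplies its `f`-twist by `f(u)`. It is applied with `σ` to
the source of `ι` and with `res` to the target. -/
theorem rid_map_scale {A A₁ A₂ B B₁ B₂ : Type u} [CommRing A] [CommRing A₁] [CommRing A₂]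
    [CommRing B] [CommRing B₁] [CommRing B₂] {f : A →+* B} {f₁ : A₁ →+* B₁} {f₂ : A₂ →+* B₂}
    {α₁ : A →+* A₁} {α : A₁ →+* A₂} {α₂ : A →+* A₂} {β₁ : B →+* B₁} {β : B₁ →+* B₂} {β₂ : B →+* B₂}
    (h₁ : ∀ a, β₁ (f a) = f₁ (α₁ a)) (h₂ : ∀ a, β₂ (f a) = f₂ (α₂ a))
    (h : ∀ a, β (f₁ a) = f₂ (α a)) (hβ : ∀ b, β (β₁ b) = β₂ b) {I : Type u} [AddCommGroup I]
    [Module A I] (ψ₁ : I →ₛₗ[α₁] A₁) (ψ₂ : I →ₛₗ[α₂] A₂) (u : A₂)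
    (hψ : ∀ x, ψ₂ x = u * α (ψ₁ x)) (z : BC f I) :
    BC.rid f₂ (BC.map h₂ ψ₂ z) = f₂ u * β (BC.rid f₁ (BC.map h₁ ψ₁ z)) := by
  induction z using BC.induction with
  | h0 => simp only [map_zero, mul_zero]
  | ht b m => rw [BC.map_tmul, BC.map_tmul, BC.rid_tmul, BC.rid_tmul, hψ, map_mul, map_mul, h, hβ,
      mul_assoc]
  | ha x y hx hy => simp only [map_add, hx, hy, mul_add]

/-- Once `I` is trivial, `ι` is multiplication by a unit `w` of `B`. Replacing `ψ` by `v ψ`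
multiplies the source by `σ(v)` and the target by `res(v)`, and the discrepancy disappears exactly
when `σ(v) = w res(v)`. A second faithfully flat extension provides such a `v`. -/
theorem exists_trivialization {R : Type u} [CommRing R] (W : FrameFunctor.{u})
    (P : ∀ (R : Type u) [CommRing R], Prop)
    (hP : ∀ {R S : Type u} [CommRing R] [CommRing S] (_ : R →+* S), P R → P S)
    (hs : ∀ (R : Type u) [CommRing R], Function.Surjective (W.frame R).ev)
    (hu : ∀ {R : Type u} [CommRing R], P R → ∀ a, IsUnit ((W.frame R).ev a) → IsUnit a)
    (hσ : ∀ {R : Type u} [CommRing R], P R → ∀ w : (W.frame R).Bˣ,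
      ∃ (S : Type u) (_ : CommRing S) (f : R →+* S) (_ : f.FaithfullyFlat) (v : (W.frame S).Aˣ),
        (W.frame S).σ v = (W.map f).β w * (W.frame S).res v)
    (hR : P R) (I : Type u) [AddCommGroup I] [Module (W.frame R).A I]
    [Module.Invertible (W.frame R).A I]
    (ι : BC (W.frame R).σ I ≃ₗ[(W.frame R).B] BC (W.frame R).res I) :
    ∃ (S : Type u) (_ : CommRing S) (f : R →+* S) (_ : f.FaithfullyFlat)
      (ψ : I →ₛₗ[(W.map f).α] (W.frame S).A), IsBC ψ ∧
      ∀ z, unitIota (W.frame S) (BC.map (W.map f).σ_comm ψ z)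
        = BC.map (W.map f).res_comm ψ (ι z) := by
  obtain ⟨S, _, f, hf, ψ, hψ⟩ := exists_isBC_unit W P hP hs hu hR I
  let a : BC (W.frame R).σ I →ₛₗ[(W.map f).β] (W.frame S).B :=
    semiComp (fun _ => rfl) (BC.rid (W.frame S).σ).toLinearMap (BC.map (W.map f).σ_comm ψ)
  let b' : BC (W.frame R).res I →ₛₗ[(W.map f).β] (W.frame S).B :=
    semiComp (fun _ => rfl) (BC.rid (W.frame S).res).toLinearMap (BC.map (W.map f).res_comm ψ)
  let b : BC (W.frame R).σ I →ₛₗ[(W.map f).β] (W.frame S).B :=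
    semiComp (fun _ => rfl) b' ι.toLinearMap
  have ha : IsBC a := (hψ.map _).linearEquiv_comp (BC.rid (W.frame S).σ) _ fun _ => rfl
  have hb' : IsBC b' := (hψ.map _).linearEquiv_comp (BC.rid (W.frame S).res) _ fun _ => rfl
  have hb : IsBC b := by
    have hι : IsBC (α := RingHom.id _) ι.toLinearMap :=
      (IsBC.id (α := RingHom.id _) (fun _ => rfl) LinearMap.id fun _ => rfl).linearEquiv_comp ι _
        fun _ => rfl
    exact hι.semiComp (fun _ => rfl) hb'
  -- `a` is the trivialization of the `σ`-twist of `I`, and `b` is that of the `res`-twist composed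
  -- with `ι`. Both present the new `B` as a base change of the same module.
  obtain ⟨w, hw⟩ := ha.exists_unit hb
  obtain ⟨S', _, f', hf', v, hv⟩ := hσ (hP f hR) w
  have hα := W.map_comp_α f f'
  have hβ := W.map_comp_β f f'
  let ψ' : I →ₛₗ[(W.map (f'.comp f)).α] (W.frame S').A :=
    { toFun := fun x => v * (W.map f').α (ψ x)
      map_add' := fun x y => by rw [map_add, map_add, mul_add]
      map_smul' := fun c x => by
        rw [LinearMap.map_smulₛₗ, smul_eq_mul, map_mul, hα]
        exact mul_left_comm _ _ _ }
  refine ⟨S', _, f'.comp f, RingHom.FaithfullyFlat.stableUnderComposition _ _ hf hf', ψ', ?_,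
    fun z => ?_⟩
  · let g : (W.frame S).A →ₛₗ[(W.map f').α] (W.frame S').A :=
      { toFun := fun x => v * (W.map f').α x
        map_add' := fun x y => by rw [map_add, mul_add]
        map_smul' := fun c x => by
          rw [smul_eq_mul, map_mul]
          exact mul_left_comm _ _ _ }
    have hg : IsBC g := isBC_of_isUnit g (n := 1) (fun _ => 1) (fun _ => 1) (by
      have h : ∑ k : Fin 1, (1 : (W.frame S').A) * g 1 = v := by
        rw [Finset.sum_const, Finset.card_univ, Fintype.card_fin, one_smul, one_mul]
        change (v : (W.frame S').A) * (W.map f').α 1 = v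
        rw [map_one, mul_one]
      rw [h]
      exact v.isUnit)
    exact IsBC.comp hα (fun _ => rfl) hψ hg
  · have h1 := rid_map_scale (W.map f).σ_comm (W.map (f'.comp f)).σ_comm (W.map f').σ_comm hβ ψ ψ' v
      (fun _ => rfl) z
    have h2 := rid_map_scale (W.map f).res_comm (W.map (f'.comp f)).res_comm (W.map f').res_comm hβ
      ψ ψ' v (fun _ => rfl) (ι z)
    have h3 : BC.rid (W.frame S).res (BC.map (W.map f).res_comm ψ (ι z))
        = w * BC.rid (W.frame S).σ (BC.map (W.map f).σ_comm ψ z) := hw z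
    rw [unitIota, LinearEquiv.trans_apply, LinearEquiv.symm_apply_eq, h1, h2, h3, hv, map_mul]
    ring

end Invertible

/-- The arithmetic input is isolated in the hypotheses: the formal rules for `div`, detection of
units in `R`, local solvability of `σ(v) = w v`, and flatness of `B → B'` in the `1-rdt` case. The
rest is the formal argument with trivializations and base change. -/
theorem isTorsor_scalarAction (p g : ℕ) (J : Set ℤ) (k : FrobKind) (W : FrameFunctor.{u})
    (P : ∀ (R : Type u) [CommRing R], Prop)
    (hP : ∀ {R S : Type u} [CommRing R] [CommRing S] (_ : R →+* S), P R → P S)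
    (hW : ∀ (R : Type u) [CommRing R], (W.frame R).IsWitt p)
    (hu : ∀ {R : Type u} [CommRing R], P R → ∀ a, IsUnit ((W.frame R).ev a) → IsUnit a)
    (hσ : ∀ {R : Type u} [CommRing R], P R → ∀ w : (W.frame R).Bˣ,
      ∃ (S : Type u) (_ : CommRing S) (f : R →+* S) (_ : f.FaithfullyFlat) (v : (W.frame S).Aˣ),
        (W.frame S).σ v = (W.map f).β w * (W.frame S).res v)
    (hβ : k = .rdt → ∀ {R S : Type u} [CommRing R] [CommRing S] (f : R →+* S), f.Flat →
      (W.map f).β.Flat) :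
    IsTorsor (scalarAction p g J k W P) where
  simply_transitive hR x x' χ := scalarAction_simply_transitive W P hR x x' χ
  locally_nonempty {R} _ hR y := by
    change HPolChain p g J k (W.frame R) at y
    have := y.invertible
    obtain ⟨S, _, f, hf, ψ, hψ, hι⟩ := exists_trivialization W P hP (fun R _ => (hW R).ev_surjective)
      hu hσ hR y.I y.ι
    exact ⟨S, _, f, hf, HPolChain.exists_polChain hf.flat (fun h => hβ h f hf.flat) (hW R) (hW S) y ψ
      hψ hι⟩

/-! ### The torsor property for full and truncated Witt vectors -/

section WittTorsors

variable (p : ℕ) [hp : Fact p.Prime]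

theorem isTorsor_scalarAction_wittFrames (g : ℕ) (J : Set ℤ) :
    IsTorsor (scalarAction p g J .full (wittFrames.{u} p) (fun R _ => IsNilpotent (p : R))) := by
  refine isTorsor_scalarAction p g J _ _ _ (fun f h => ?_) (fun R _ => wittFrames_isWitt R)
    (fun h => wittFrames_isUnit h) (fun h w => ?_) (fun h => by cases h)
  · rw [← map_natCast f]
    exact h.map f
  · exact WittVector.exists_faithfullyFlat_frobenius_eq_mul h w

/-- Any lift of `w` to `W(R)` is a unit, since its first coordinate is one; this is where `n` must
be positive. The equation is solved for the lift and the solution is truncated to length `m`. -/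
theorem exists_faithfullyFlat_truncFrobenius_eq_mul {m n : ℕ} (h : n + 1 ≤ m) (hn : 0 < n)
    {R : Type u} [CommRing R] (hR : IsNilpotent (p : R)) (w : (TruncatedWittVector p n R)ˣ) :
    ∃ (S : Type u) (_ : CommRing S) (f : R →+* S) (_ : f.FaithfullyFlat)
      (v : (TruncatedWittVector p m S)ˣ), truncFrobenius p m n h S v
        = truncMap p n f w * TruncatedWittVector.truncate (by omega)
          (v : TruncatedWittVector p m S) := by
  obtain ⟨b, hb⟩ := WittVector.truncate_surjective p n R w
  have hb' : IsUnit b := by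
    refine WittVector.isUnit_of_coeff_zero hR b ?_
    rw [← truncEv_truncate p n hn, hb]
    exact w.isUnit.map _
  obtain ⟨b, rfl⟩ := hb'
  obtain ⟨S, _, f, hf, u, hu⟩ := WittVector.exists_faithfullyFlat_frobenius_eq_mul hR b
  refine ⟨S, _, f, hf, Units.map (WittVector.truncate m).toMonoidHom u, ?_⟩
  change truncFrobenius p m n h S (WittVector.truncate m (u : WittVector p S)) = _ *
    TruncatedWittVector.truncate _ (WittVector.truncate m (u : WittVector p S))
  rw [truncFrobenius_truncate, hu, map_mul, ← hb, truncMap_truncate,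
    TruncatedWittVector.truncate_wittVector_truncate]

theorem isTorsor_scalarAction_truncFrames (g : ℕ) (J : Set ℤ) (k : FrobKind) {m n : ℕ}
    (h : n + 1 ≤ m) (hn : 0 < n) (P : ∀ (R : Type u) [CommRing R], Prop)
    (hP : ∀ {R S : Type u} [CommRing R] [CommRing S] (_ : R →+* S), P R → P S)
    (hP' : ∀ {R : Type u} [CommRing R], P R → IsNilpotent (p : R)) (hk : k = .rdt → n = 1) :
    IsTorsor (scalarAction p g J k (truncFrames.{u} p m n h) P) := by
  refine isTorsor_scalarAction p g J _ _ _ hP (fun R _ => truncFrames_isWitt h R)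
    (fun hR => truncFrames_isUnit h (hP' hR)) (fun hR w => ?_) (fun h1 _ _ _ _ f hf => ?_)
  · exact exists_faithfullyFlat_truncFrobenius_eq_mul p h hn (hP' hR) w
  · obtain rfl := hk h1
    exact truncMap_one_flat hf

end WittTorsors

/-! ## Frobenius-invariant Witt vectors -/

section Digits

variable (p : ℕ) [hp : Fact p.Prime]

/-- The coordinates of a `p`-adic integer, viewed as a Witt vector over `ZMod p`. -/
noncomputable def padicDigit (z : ℤ_[p]) (n : ℕ) : ZMod p :=
  ((WittVector.equiv p).symm z).coeff n

/-- The condition says that `z - w` is divisible by `p ^ n`, and in `W(F_p)` multiples of `p ^ n`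
have vanishing coordinates below `n`. This makes the digits locally constant. -/
theorem padicDigit_eq_of_norm_le {z w : ℤ_[p]} {n : ℕ} (h : ‖z - w‖ ≤ (p : ℝ) ^ (-n : ℤ)) {i : ℕ}
    (hi : i < n) : padicDigit p z i = padicDigit p w i := by
  rw [PadicInt.norm_le_pow_iff_mem_span_pow, Ideal.mem_span_singleton'] at h
  obtain ⟨y, hy⟩ := h
  have h1 := congrArg (WittVector.equiv p).symm hy
  rw [map_mul, map_pow, map_natCast, map_sub] at h1
  have h2 : WittVector.truncate n ((WittVector.equiv p).symm z - (WittVector.equiv p).symm w) = 0 := by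
    rw [← h1, ← RingHom.mem_ker, WittVector.mem_ker_truncate]
    exact fun i hi => WittVector.mul_pow_charP_coeff_zero _ hi
  rw [map_sub, sub_eq_zero] at h2
  have h3 := congrArg (fun t => TruncatedWittVector.coeff ⟨i, hi⟩ t) h2
  unfold padicDigit
  simpa only [WittVector.coeff_truncate] using h3

theorem WittVector.norm_equiv_sub_le {x y : WittVector p (ZMod p)} {n : ℕ}
    (h : ∀ i < n, x.coeff i = y.coeff i) :
    ‖WittVector.equiv p x - WittVector.equiv p y‖ ≤ (p : ℝ) ^ (-n : ℤ) := by
  have h1 : ∀ i < n, (x - y).coeff i = 0 := by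
    rw [← WittVector.mem_ker_truncate, RingHom.mem_ker, map_sub, sub_eq_zero]
    ext i
    rw [WittVector.coeff_truncate, WittVector.coeff_truncate]
    exact h i i.2
  -- Over `F_p` the Frobenius of `W` is the identity, so `V` is multiplication by `p`.
  have h2 : ∀ (k : ℕ) (z : WittVector p (ZMod p)),
      WittVector.verschiebung^[k] z = z * (p : WittVector p (ZMod p)) ^ k := by
    intro k z
    induction k with
    | zero => rw [pow_zero, mul_one]; rfl
    | succ k ih =>
      rw [Function.iterate_succ_apply', ih, pow_succ, ← mul_assoc,
        ← WittVector.verschiebung_frobenius, WittVector.frobenius_zmodp]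
  rw [PadicInt.norm_le_pow_iff_mem_span_pow, Ideal.mem_span_singleton', ← map_sub,
    WittVector.eq_iterate_verschiebung h1, h2]
  exact ⟨_, by rw [map_mul, map_pow, map_natCast]⟩

theorem isLocallyConstant_padicDigit (n : ℕ) : IsLocallyConstant fun z => padicDigit p z n := by
  rw [IsLocallyConstant.iff_eventually_eq]
  intro z
  have hpos : (0 : ℝ) < (p : ℝ) ^ (-(n + 1 : ℕ) : ℤ) :=
    zpow_pos (by exact_mod_cast hp.out.pos) _
  filter_upwards [Metric.closedBall_mem_nhds z hpos] with w hw
  rw [Metric.mem_closedBall, dist_eq_norm] at hw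
  exact padicDigit_eq_of_norm_le p hw (Nat.lt_succ_self n)

/-- Agreement of finitely many digits is an open condition in the product topology, and it bounds
the `p`-adic distance. -/
theorem continuous_equiv_mk :
    Continuous fun d : ℕ → ZMod p => WittVector.equiv p (WittVector.mk p d) := by
  rw [continuous_iff_continuousAt]
  intro d
  rw [ContinuousAt, Metric.tendsto_nhds]
  intro ε hε
  obtain ⟨n, hn⟩ := PadicInt.exists_pow_neg_lt p hε
  have h : ∀ᶠ d' in nhds d, ∀ i ∈ Finset.range n, d' i = d i := by
    rw [Filter.eventually_all_finset]
    intro i _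
    exact (continuous_apply (A := fun _ : ℕ => ZMod p) i).continuousAt.eventually (p := fun c => c = d i)
      (by rw [nhds_discrete]; exact Filter.eventually_pure.2 rfl)
  filter_upwards [h] with d' hd
  rw [dist_eq_norm]
  exact (WittVector.norm_equiv_sub_le p fun i hi => hd i (Finset.mem_range.2 hi)).trans_lt hn

end Digits

/-! ### Invariant Witt vectors as functions on the spectrum -/

section FieldPoints

variable {p : ℕ} [hp : Fact p.Prime]

/-- The point of the spectrum defined by a homomorphism to a field. -/
def fieldPoint {R K : Type u} [CommRing R] [Field K] (φ : R →+* K) : PrimeSpectrum R :=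
  PrimeSpectrum.comap φ ⊥

theorem mem_fieldPoint {R K : Type u} [CommRing R] [Field K] {φ : R →+* K} {r : R} :
    r ∈ (fieldPoint φ).asIdeal ↔ φ r = 0 := by
  rw [fieldPoint, PrimeSpectrum.comap_asIdeal, Ideal.mem_comap]
  exact Ideal.mem_bot

theorem fieldPoint_residueField {R : Type u} [CommRing R] (x : PrimeSpectrum R) :
    fieldPoint (algebraMap R x.asIdeal.ResidueField) = x := by
  ext r
  rw [mem_fieldPoint, Ideal.algebraMap_residueField_eq_zero]

theorem charP_of_isNilpotent {R K : Type u} [CommRing R] [Field K] (φ : R →+* K)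
    (hR : IsNilpotent (p : R)) : CharP K p := by
  rw [CharP.charP_iff_prime_eq_zero hp.out, ← map_natCast φ]
  exact (hR.map φ).eq_zero

theorem ringHom_zmod_apply {K : Type*} [Ring K] (j : ZMod p →+* K) (c : ZMod p) :
    j c = (c.val : K) := by
  rw [← map_natCast j, ZMod.natCast_zmod_val]

theorem val_mem_fieldPoint {R K : Type u} [CommRing R] [Field K] {φ : R →+* K} (j : ZMod p →+* K)
    {r : R} {c : ZMod p} : r - (c.val : R) ∈ (fieldPoint φ).asIdeal ↔ φ r = j c := by
  rw [mem_fieldPoint, map_sub, map_natCast, ringHom_zmod_apply, sub_eq_zero]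

theorem mem_range_of_pow_eq {K : Type*} [Field K] (j : ZMod p →+* K) {c : K} (hc : c ^ p = c) :
    ∃ d, j d = c := by
  have : CharP K p := by
    rw [CharP.charP_iff_prime_eq_zero hp.out, ← map_natCast j, CharP.cast_eq_zero, map_zero]
  rw [← Subfield.mem_bot_iff_pow_eq_self K p, ← ZMod.fieldRange_castHom_eq_bot p] at hc
  obtain ⟨d, hd⟩ := hc
  exact ⟨d, (RingHom.congr_fun (Subsingleton.elim _ _) d).trans hd⟩

/-- The Witt vector `a` specializes to the function `g` at every point of the spectrum. -/
def SpecializesTo {R : Type u} [CommRing R] (a : WittVector p R) (g : PrimeSpectrum R → ℤ_[p]) :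
    Prop :=
  ∀ (K : Type u) [Field K] (φ : R →+* K) (j : ZMod p →+* K),
    WittVector.map φ a = WittVector.map j ((WittVector.equiv p).symm (g (fieldPoint φ)))

theorem SpecializesTo.add {R : Type u} [CommRing R] {a b : WittVector p R}
    {g h : PrimeSpectrum R → ℤ_[p]} (ha : SpecializesTo a g) (hb : SpecializesTo b h) :
    SpecializesTo (a + b) (g + h) := fun K _ φ j => by
  rw [map_add, ha K φ j, hb K φ j, Pi.add_apply, map_add, map_add]

theorem SpecializesTo.sub {R : Type u} [CommRing R] {a b : WittVector p R}
    {g h : PrimeSpectrum R → ℤ_[p]} (ha : SpecializesTo a g) (hb : SpecializesTo b h) :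
    SpecializesTo (a - b) (g - h) := fun K _ φ j => by
  rw [map_sub, ha K φ j, hb K φ j, Pi.sub_apply, map_sub, map_sub]

theorem SpecializesTo.mul {R : Type u} [CommRing R] {a b : WittVector p R}
    {g h : PrimeSpectrum R → ℤ_[p]} (ha : SpecializesTo a g) (hb : SpecializesTo b h) :
    SpecializesTo (a * b) (g * h) := fun K _ φ j => by
  rw [map_mul, ha K φ j, hb K φ j, Pi.mul_apply, map_mul, map_mul]

theorem SpecializesTo.map {R S : Type u} [CommRing R] [CommRing S] (f : R →+* S)
    {a : WittVector p R} {g : PrimeSpectrum R → ℤ_[p]} (ha : SpecializesTo a g) :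
    SpecializesTo (WittVector.map f a) (g ∘ PrimeSpectrum.comap f) := fun K _ φ j => by
  rw [WittVector.map_map, ha K (φ.comp f) j]
  rfl

/-- Every point is realized by its residue field, which has characteristic `p`, and `W(F_p)` embeds
into the Witt vectors of that field. -/
theorem SpecializesTo.unique {R : Type u} [CommRing R] (hR : IsNilpotent (p : R))
    {a : WittVector p R} {g h : PrimeSpectrum R → ℤ_[p]} (hg : SpecializesTo a g)
    (hh : SpecializesTo a h) : g = h := by
  funext x
  have := charP_of_isNilpotent (algebraMap R x.asIdeal.ResidueField) hR
  let j := ZMod.castHom (m := p) dvd_rfl x.asIdeal.ResidueField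
  have h1 := (hg _ (algebraMap R x.asIdeal.ResidueField) j).symm.trans (hh _ _ j)
  rw [fieldPoint_residueField] at h1
  exact (WittVector.equiv p).symm.injective (WittVector.map_injective j j.injective h1)

/-- The coordinates lie in all primes, so they are nilpotent. Invariance makes each coordinate
congruent to its `p`-th power modulo `p`, hence divisible by `p`. Since `a = F a`, the contraction
property raises divisibility from `p ^ k` to `p ^ (k + 1)` for all `k`, and `p` is nilpotent. -/
theorem eq_zero_of_specializesTo_zero {R : Type u} [CommRing R] (hR : IsNilpotent (p : R))
    {a : WittVector p R} (ha : WittVector.frobenius a = a) (h : SpecializesTo a 0) : a = 0 := by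
  have hn : ∀ n, IsNilpotent (a.coeff n) := fun n => by
    rw [← mem_nilradical, nilradical_eq_sInf, Ideal.mem_sInf]
    intro P (hP : P.IsPrime)
    have hx := charP_of_isNilpotent (algebraMap R P.ResidueField) hR
    have h1 := congrArg (fun w => w.coeff n) (h _ (algebraMap R P.ResidueField)
      (ZMod.castHom (m := p) dvd_rfl P.ResidueField))
    simp only [Pi.zero_apply, map_zero, WittVector.map_coeff, WittVector.zero_coeff] at h1
    rwa [Ideal.algebraMap_residueField_eq_zero] at h1
  have h0 : ∀ n, a.coeff n ∈ Ideal.span {(p : R) ^ (0 + 1)} := fun n => by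
    rw [zero_add, pow_one]
    have h1 := WittVector.frobenius_coeff_sub_pow_mem a n
    rw [ha] at h1
    have h2 : ∀ k, a.coeff n - a.coeff n ^ p ^ k ∈ Ideal.span {(p : R)} := fun k => by
      induction k with
      | zero => rw [pow_zero, pow_one, sub_self]; exact Ideal.zero_mem _
      | succ k ih =>
        rw [← Ideal.Quotient.eq] at h1 ih ⊢
        rw [pow_succ', pow_mul, map_pow, ← h1, ← map_pow, ← ih]
    obtain ⟨k, hk⟩ := hn n
    have h3 := h2 k
    rwa [pow_eq_zero_of_le (Nat.lt_pow_self hp.out.one_lt).le hk, sub_zero] at h3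
  have hk : ∀ k n, a.coeff n ∈ Ideal.span {(p : R) ^ (k + 1)} := fun k => by
    induction k with
    | zero => exact h0
    | succ k ih => exact fun n => ha ▸ WittVector.frobenius_coeff_mem ih n
  obtain ⟨k, hk'⟩ := hR
  ext n
  have h4 := hk k n
  rw [pow_succ, hk', zero_mul, Ideal.span_singleton_zero] at h4
  rw [WittVector.zero_coeff]
  exact h4

/-- In a residue field the coordinates satisfy `c ^ p = c`, so they belong to the prime field. They
are taken as the digits of a `p`-adic integer attached to the point. -/
theorem exists_specializesTo {R : Type u} [CommRing R] (hR : IsNilpotent (p : R))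
    (a : WittVector p R) (ha : WittVector.frobenius a = a) :
    ∃ g : C(PrimeSpectrum R, ℤ_[p]), SpecializesTo a g := by
  have hd : ∀ (x : PrimeSpectrum R) (n : ℕ), ∃ c : ZMod p, a.coeff n - (c.val : R) ∈ x.asIdeal := by
    intro x n
    have := charP_of_isNilpotent (algebraMap R x.asIdeal.ResidueField) hR
    let j := ZMod.castHom (m := p) dvd_rfl x.asIdeal.ResidueField
    have h1 := congrArg (WittVector.map (algebraMap R x.asIdeal.ResidueField)) ha
    rw [WittVector.map_frobenius'] at h1
    have h2 := congrArg (fun w => w.coeff n) h1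
    simp only [WittVector.coeff_frobenius_charP, WittVector.map_coeff] at h2
    obtain ⟨c, hc⟩ := mem_range_of_pow_eq j h2
    refine ⟨c, ?_⟩
    have h3 := (val_mem_fieldPoint (R := R) j).2 hc.symm
    rwa [fieldPoint_residueField] at h3
  choose d hd using hd
  have huniq : ∀ x n c, a.coeff n - ((c : ZMod p).val : R) ∈ x.asIdeal → d x n = c := by
    intro x n c hc
    have := charP_of_isNilpotent (algebraMap R x.asIdeal.ResidueField) hR
    let j := ZMod.castHom (m := p) dvd_rfl x.asIdeal.ResidueField
    have h : ∀ c : ZMod p, a.coeff n - (c.val : R) ∈ x.asIdeal →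
        algebraMap R x.asIdeal.ResidueField (a.coeff n) = j c := fun c hc => by
      rwa [← fieldPoint_residueField x, val_mem_fieldPoint j] at hc
    exact j.injective ((h _ (hd x n)).symm.trans (h c hc))
  have hcont : ∀ n, Continuous fun x => d x n := fun n => by
    rw [continuous_iff_isClosed]
    intro s _
    -- The locus where the digit equals `c` is the closed set on which `a_n - c` vanishes. As there
    -- are only finitely many digits, preimages of all sets are closed.
    have h1 : (fun x => d x n) ⁻¹' s
        = ⋃ c ∈ s, PrimeSpectrum.zeroLocus {a.coeff n - ((c : ZMod p).val : R)} := by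
      ext x
      simp only [Set.mem_preimage, Set.mem_iUnion, PrimeSpectrum.mem_zeroLocus,
        Set.singleton_subset_iff, exists_prop, SetLike.mem_coe]
      exact ⟨fun h => ⟨_, h, hd x n⟩, fun ⟨c, hc, h⟩ => by rwa [huniq x n c h]⟩
    rw [h1]
    exact s.toFinite.isClosed_biUnion fun c _ => PrimeSpectrum.isClosed_zeroLocus _
  refine ⟨⟨fun x => WittVector.equiv p (WittVector.mk p (d x)),
    (continuous_equiv_mk p).comp (continuous_pi hcont)⟩, fun K _ φ j => ?_⟩
  ext n
  change _ = (WittVector.map j ((WittVector.equiv p).symm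
    (WittVector.equiv p (WittVector.mk p (d (fieldPoint φ)))))).coeff n
  rw [RingEquiv.symm_apply_apply, WittVector.map_coeff, WittVector.map_coeff, WittVector.coeff_mk]
  exact (val_mem_fieldPoint j).1 (hd (fieldPoint φ) n)

/-- Locally constant functions with values in `ZMod p` lift to solutions of `r ^ p = r` modulo `p`. -/
theorem exists_pow_sub_mem {R : Type u} [CommRing R] (d : PrimeSpectrum R → ZMod p)
    (hd : IsLocallyConstant d) :
    ∃ r : R, (∀ x, r - ((d x).val : R) ∈ x.asIdeal) ∧ r ^ p - r ∈ Ideal.span {(p : R)} := by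
  choose e he1 he2 using fun c : ZMod p =>
    PrimeSpectrum.exists_idempotent_basicOpen_eq_of_isClopen (hd.isClopen_fiber c)
  -- The `e c` are the idempotents of the fibres of `d`. Modulo `p` the power `r ^ p` is computed
  -- termwise, so only `e c ^ p = e c` and `c ^ p = c` in `F_p` are needed for the congruence.
  refine ⟨∑ c, e c * (c.val : R), fun x => ?_, ?_⟩
  · have h0 : ∀ c, c ≠ d x → e c ∈ x.asIdeal := fun c hc => by
      by_contra h
      have h1 : x ∈ (PrimeSpectrum.basicOpen (e c) : Set (PrimeSpectrum R)) := h
      rw [← he2 c] at h1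
      exact hc h1.symm
    have h1 : e (d x) - 1 ∈ x.asIdeal := by
      have h2 : x ∈ (PrimeSpectrum.basicOpen (e (d x)) : Set (PrimeSpectrum R)) := by
        rw [← he2]; rfl
      refine (x.2.mem_or_mem (x := e (d x)) ?_).resolve_left h2
      rw [mul_sub, mul_one, (he1 (d x)).eq, sub_self]
      exact Ideal.zero_mem _
    rw [← Finset.add_sum_erase _ _ (Finset.mem_univ (d x)), add_sub_right_comm, ← sub_one_mul]
    exact Ideal.add_mem _ (Ideal.mul_mem_right _ _ h1) (Ideal.sum_mem _ fun c hc =>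
      Ideal.mul_mem_right _ _ (h0 c (Finset.ne_of_mem_erase hc)))
  · rw [← Ideal.Quotient.eq, map_pow, map_sum]
    have hp0 : (p : R ⧸ Ideal.span {(p : R)}) = 0 := by
      rw [← map_natCast (Ideal.Quotient.mk _), Ideal.Quotient.eq_zero_iff_mem]
      exact Ideal.mem_span_singleton_self _
    rcases subsingleton_or_nontrivial (R ⧸ Ideal.span {(p : R)}) with hs | hs
    · exact Subsingleton.elim _ _
    have : CharP (R ⧸ Ideal.span {(p : R)}) p := (CharP.charP_iff_prime_eq_zero hp.out).2 hp0
    rw [sum_pow_char p]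
    refine Finset.sum_congr rfl fun c _ => ?_
    rw [map_mul, mul_pow, ← map_pow, (he1 c).pow_eq hp.out.ne_zero, map_natCast]
    congr 1
    rw [← ringHom_zmod_apply (ZMod.castHom (m := p) dvd_rfl _), ← map_pow, ZMod.pow_card]

/-- Lifting the digits of `g` with idempotents gives a Witt vector invariant modulo `p`. Successive
approximation for the equation `F a = a` corrects it without changing its coordinates modulo `p`,
hence without changing its specializations. -/
theorem exists_frobenius_eq_self {R : Type u} [CommRing R] (hR : IsNilpotent (p : R))
    (g : C(PrimeSpectrum R, ℤ_[p])) :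
    ∃ a : WittVector p R, WittVector.frobenius a = a ∧ SpecializesTo a g := by
  choose r hr1 hr2 using fun n : ℕ => exists_pow_sub_mem (fun x => padicDigit p (g x) n)
    ((isLocallyConstant_padicDigit p n).comp_continuous g.continuous)
  obtain ⟨a, ha, har⟩ := WittVector.exists_frobenius_eq_mul hR 1 (WittVector.mk p r) (by
    refine WittVector.sub_coeff_mem fun n => ?_
    have h1 := WittVector.frobenius_coeff_sub_pow_mem (WittVector.mk p r) n
    rw [Units.val_one, one_mul]
    have h2 := Ideal.add_mem _ h1 (hr2 n)
    rw [WittVector.coeff_mk] at h2 ⊢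
    rwa [sub_add_sub_cancel] at h2)
  refine ⟨a, by rw [ha, Units.val_one, one_mul], fun K _ φ j => ?_⟩
  ext n
  rw [WittVector.map_coeff, WittVector.map_coeff]
  have h1 := WittVector.coeff_sub_coeff_mem har n
  rw [WittVector.coeff_mk] at h1
  have h2 : Ideal.span {(p : R)} ≤ (fieldPoint φ).asIdeal := by
    rw [Ideal.span_singleton_le_iff_mem, mem_fieldPoint]
    exact (hR.map φ).eq_zero
  have h3 := Ideal.add_mem _ (h2 h1) (hr1 n (fieldPoint φ))
  rw [sub_add_sub_cancel] at h3
  exact (val_mem_fieldPoint j).1 h3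

end FieldPoints

/-! ## The group of Frobenius-invariant units -/

section PadicWittIso

variable {p : ℕ} [hp : Fact p.Prime]

theorem eq_of_specializesTo {R : Type u} [CommRing R] (hR : IsNilpotent (p : R))
    {a b : WittVector p R} {g : PrimeSpectrum R → ℤ_[p]} (ha : WittVector.frobenius a = a)
    (hb : WittVector.frobenius b = b) (hag : SpecializesTo a g) (hbg : SpecializesTo b g) : a = b := by
  rw [← sub_eq_zero]
  refine eq_zero_of_specializesTo_zero hR (by rw [map_sub, ha, hb]) ?_
  have h := hag.sub hbg
  rwa [sub_self] at h

/-- The continuous function to which a Frobenius-invariant Witt vector specializes. -/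
noncomputable def specialization {R : Type u} [CommRing R] (hR : IsNilpotent (p : R)) :
    RingHom.eqLocus (WittVector.frobenius (p := p) (R := R)) (RingHom.id (WittVector p R)) →+*
      C(PrimeSpectrum R, ℤ_[p]) :=
  have h := fun a : RingHom.eqLocus (WittVector.frobenius (p := p) (R := R))
    (RingHom.id (WittVector p R)) => exists_specializesTo hR a.1 a.2
  { toFun := fun a => (h a).choose
    map_zero' := DFunLike.coe_injective ((h 0).choose_spec.unique hR fun K _ φ j => by
      simp)
    map_one' := DFunLike.coe_injective ((h 1).choose_spec.unique hR fun K _ φ j => by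
      simp)
    map_add' := fun a b => DFunLike.coe_injective
      ((h (a + b)).choose_spec.unique hR ((h a).choose_spec.add (h b).choose_spec))
    map_mul' := fun a b => DFunLike.coe_injective
      ((h (a * b)).choose_spec.unique hR ((h a).choose_spec.mul (h b).choose_spec)) }

theorem specializesTo_specialization {R : Type u} [CommRing R] (hR : IsNilpotent (p : R))
    (a : RingHom.eqLocus (WittVector.frobenius (p := p) (R := R)) (RingHom.id (WittVector p R))) :
    SpecializesTo a.1 (specialization hR a) :=
  (exists_specializesTo hR a.1 a.2).choose_spec

theorem specialization_bijective {R : Type u} [CommRing R] (hR : IsNilpotent (p : R)) :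
    Function.Bijective (specialization (p := p) hR) := by
  refine ⟨fun a b h => Subtype.ext (eq_of_specializesTo hR a.2 b.2
    (specializesTo_specialization hR a) ?_), fun g => ?_⟩
  · rw [h]
    exact specializesTo_specialization hR b
  · obtain ⟨a, ha, hg⟩ := exists_frobenius_eq_self hR g
    exact ⟨⟨a, ha⟩, DFunLike.coe_injective ((specializesTo_specialization hR ⟨a, ha⟩).unique hR hg)⟩

variable (p) in
/-- The isomorphism `Cont(|Spec R|, ℤ_p) ≅ {a ∈ W(R) | F a = a}`. -/
noncomputable def padicWittIso : PadicWittIso.{u} p where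
  E hR := (RingEquiv.ofBijective _ (specialization_bijective hR)).symm
  natural {R S} _ _ hR hS f g := by
    have h : ∀ {R : Type u} [CommRing R] (hR : IsNilpotent (p : R)) (g : C(PrimeSpectrum R, ℤ_[p])),
        SpecializesTo ((RingEquiv.ofBijective _ (specialization_bijective hR)).symm g).1 g := by
      intro R _ hR g
      have h := specializesTo_specialization hR
        ((RingEquiv.ofBijective _ (specialization_bijective hR)).symm g)
      have h2 := (RingEquiv.ofBijective _ (specialization_bijective hR)).apply_symm_apply g
      rw [RingEquiv.ofBijective_apply] at h2
      rwa [h2] at h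
    refine eq_of_specializesTo hS ?_
      ((RingEquiv.ofBijective _ (specialization_bijective hS)).symm (g.comp (specMap f))).2
      ((h hR g).map f) (h hS _)
    refine (WittVector.map_frobenius' f _).symm.trans ?_
    exact congrArg (WittVector.map f) ((RingEquiv.ofBijective _ (specialization_bijective hR)).symm g).2

/-- The inverse of an invariant unit is invariant, so invariant units are the units of the invariant
ring. On the other side, units among continuous functions to `ℤ_p` are continuous functions to
`ℤ_p^×`, the topology on units being compatible with inversion. -/
theorem PadicWittIso.units_bijective (e : PadicWittIso.{u} p) {R : Type u} [CommRing R]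
    (hR : IsNilpotent (p : R)) : Function.Bijective (e.units hR) := by
  refine ⟨fun u v h => ?_, fun w => ?_⟩
  · have h1 : (e.E hR (unitsVal p u)).1 = (e.E hR (unitsVal p v)).1 :=
      congrArg (fun w : (sigmaUnits (wittFrames p)).G R =>
        ((w.1 : ((wittFrames p).frame R).Aˣ) : ((wittFrames p).frame R).A)) h
    have h2 := (e.E hR).injective (Subtype.ext h1)
    exact ContinuousMap.ext fun x => Units.ext (ContinuousMap.congr_fun h2 x)
  · let a : RingHom.eqLocus ((wittFrames p).frame R).σ ((wittFrames p).frame R).res :=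
      ⟨(w.1 : ((wittFrames p).frame R).A), sigmaUnits_spec _ w⟩
    let b : RingHom.eqLocus ((wittFrames p).frame R).σ ((wittFrames p).frame R).res :=
      ⟨((w⁻¹).1 : ((wittFrames p).frame R).A), sigmaUnits_spec _ w⁻¹⟩
    have hab : a * b = 1 := Subtype.ext w.1.mul_inv
    have hba : b * a = 1 := Subtype.ext w.1.inv_mul
    let c : C(PrimeSpectrum R, ℤ_[p])ˣ :=
      ⟨(e.E hR).symm a, (e.E hR).symm b, by rw [← map_mul, hab, map_one],
        by rw [← map_mul, hba, map_one]⟩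
    refine ⟨ContinuousMap.unitsLift.symm c, Subtype.ext (Units.ext ?_)⟩
    have h1 : unitsVal p (ContinuousMap.unitsLift.symm c) = (e.E hR).symm a :=
      ContinuousMap.ext fun x => rfl
    change (e.E hR (unitsVal p (ContinuousMap.unitsLift.symm c))).1 = a.1
    rw [h1, RingEquiv.apply_symm_apply]

end PadicWittIso

theorem IsTorsor.restrict {P : ∀ (R : Type u) [CommRing R], Prop} {X Y : CatOver.{u}}
    {π : X.Functor Y} {G : GroupFunctor.{u}} {act : ActionOver P π G} (h : IsTorsor act)
    (G' : GroupFunctor.{u}) (η : ∀ {R : Type u} [CommRing R], P R → (G'.G R →* G.G R))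
    (hη : ∀ {R S : Type u} [CommRing R] [CommRing S] (hR : P R) (hS : P S) (f : R →+* S)
      (u : G'.G R), G.map f (η hR u) = η hS (G'.map f u))
    (hb : ∀ {R : Type u} [CommRing R] (hR : P R), Function.Bijective (η hR)) :
    IsTorsor (act.restrict G' η hη) where
  simply_transitive hR x x' χ := by
    obtain ⟨⟨u, φ⟩, h1, h2⟩ := h.simply_transitive hR x x' χ
    obtain ⟨u', rfl⟩ := (hb hR).2 u
    refine ⟨⟨u', φ⟩, h1, fun ⟨v, θ⟩ hv => ?_⟩
    have h3 := h2 ⟨η hR v, θ⟩ hv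
    obtain ⟨h4, h5⟩ := Sigma.mk.inj h3
    obtain rfl := (hb hR).1 h4
    exact congrArg (Sigma.mk v) (eq_of_heq h5)
  locally_nonempty := h.locally_nonempty

theorem isTorsor_padicWittIso (p : ℕ) [Fact p.Prime] (g : ℕ) (J : Set ℤ) :
    IsTorsor ((padicWittIso.{u} p).action g J .full) :=
  (isTorsor_scalarAction_wittFrames p g J).restrict (padicUnits p)
    (fun hR => (padicWittIso p).units hR)
    (fun hR hS f u => Subtype.ext (Units.ext ((padicWittIso p).natural hR hS f (unitsVal p u))))
    fun hR => (padicWittIso p).units_bijective hR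

/-! ## Algebras of locally constant functions -/

section LocallyConstantAlgebra

/-- The element `r` of `R` is locally equal to the values of the function `g`. -/
def LocallyEq {k : Type*} {R : Type*} [CommRing k] [CommRing R] [Algebra k R] (r : R)
    (g : PrimeSpectrum R → k) : Prop :=
  ∀ x : PrimeSpectrum R, ∃ s ∉ x.asIdeal, s * r = s * algebraMap k R (g x)

variable {k R : Type*} [CommRing k] [CommRing R] [Algebra k R]

theorem LocallyEq.add {r r' : R} {g g' : PrimeSpectrum R → k} (h : LocallyEq r g)
    (h' : LocallyEq r' g') : LocallyEq (r + r') (g + g') := fun x => by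
  obtain ⟨s, hs, e⟩ := h x
  obtain ⟨s', hs', e'⟩ := h' x
  refine ⟨s * s', fun H => (x.2.mem_or_mem H).elim hs hs', ?_⟩
  rw [Pi.add_apply, map_add]
  linear_combination s' * e + s * e'

theorem LocallyEq.mul {r r' : R} {g g' : PrimeSpectrum R → k} (h : LocallyEq r g)
    (h' : LocallyEq r' g') : LocallyEq (r * r') (g * g') := fun x => by
  obtain ⟨s, hs, e⟩ := h x
  obtain ⟨s', hs', e'⟩ := h' x
  refine ⟨s * s', fun H => (x.2.mem_or_mem H).elim hs hs', ?_⟩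
  rw [Pi.mul_apply, map_mul]
  linear_combination s' * r' * e + s * algebraMap k R (g x) * e'

theorem locallyEq_algebraMap (c : k) : LocallyEq (algebraMap k R c) fun _ => c := fun x =>
  ⟨1, fun h => x.2.ne_top ((Ideal.eq_top_iff_one _).2 h), rfl⟩

theorem LocallyEq.sum {ι : Type*} (t : Finset ι) {r : ι → R} {g : ι → PrimeSpectrum R → k}
    (h : ∀ i, LocallyEq (r i) (g i)) : LocallyEq (∑ i ∈ t, r i) (∑ i ∈ t, g i) := by
  classical
  induction t using Finset.induction_on with
  | empty =>
    rw [Finset.sum_empty, Finset.sum_empty, ← map_zero (algebraMap k R)]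
    exact locallyEq_algebraMap 0
  | insert i t hi ih =>
    rw [Finset.sum_insert hi, Finset.sum_insert hi]
    exact (h i).add ih

/-- The annihilator of `r - r'` is contained in no maximal ideal, so it contains `1`. -/
theorem LocallyEq.unique {r r' : R} {g : PrimeSpectrum R → k} (h : LocallyEq r g)
    (h' : LocallyEq r' g) : r = r' := by
  let I : Ideal R := LinearMap.ker (LinearMap.mulRight R (r - r'))
  have hI : ∀ s, s ∈ I ↔ s * (r - r') = 0 := fun s => Iff.rfl
  have h1 : I = ⊤ := by
    by_contra hne
    obtain ⟨P, hP, hIP⟩ := Ideal.exists_le_maximal I hne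
    obtain ⟨s, hs, e⟩ := h ⟨P, hP.isPrime⟩
    obtain ⟨s', hs', e'⟩ := h' ⟨P, hP.isPrime⟩
    have h2 : s * s' ∈ I := by
      rw [hI]
      linear_combination s' * e - s * e'
    exact (hP.isPrime.mem_or_mem (hIP h2)).elim hs hs'
  have h3 := (hI 1).1 (h1 ▸ Submodule.mem_top)
  rwa [one_mul, sub_eq_zero] at h3

theorem LocallyEq.map {S : Type*} [CommRing S] [Algebra k S] (f : R →ₐ[k] S) {r : R}
    {g : PrimeSpectrum R → k} (h : LocallyEq r g) :
    LocallyEq (f r) (g ∘ PrimeSpectrum.comap f.toRingHom) := fun y => by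
  obtain ⟨s, hs, e⟩ := h (PrimeSpectrum.comap f.toRingHom y)
  refine ⟨f s, hs, ?_⟩
  rw [← map_mul, e, map_mul, AlgHom.commutes]
  rfl

/-- The spectrum is compact, so the range of `g` is finite, and the sum of the values weighted by
the idempotents of the fibres does the job. -/
theorem exists_locallyEq_of_isLocallyConstant {g : PrimeSpectrum R → k} (hg : IsLocallyConstant g) :
    ∃ r : R, LocallyEq r g := by
  classical
  choose e he1 he2 using fun c : k =>
    PrimeSpectrum.exists_idempotent_basicOpen_eq_of_isClopen (hg.isClopen_fiber c)
  have he : ∀ c, LocallyEq (e c) fun x => if g x = c then (1 : k) else 0 := fun c x => by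
    by_cases h : g x = c
    · refine ⟨e c, ?_, ?_⟩
      · have h1 : x ∈ (PrimeSpectrum.basicOpen (e c) : Set (PrimeSpectrum R)) := by
          rw [← he2]; exact h
        exact h1
      · beta_reduce
        rw [if_pos h, map_one, mul_one, (he1 c).eq]
    · refine ⟨1 - e c, fun h1 => ?_, ?_⟩
      · have h2 : e c ∈ x.asIdeal := by
          by_contra h3
          have h4 : x ∈ (PrimeSpectrum.basicOpen (e c) : Set (PrimeSpectrum R)) := h3
          rw [← he2] at h4
          exact h h4
        have h3 := Ideal.add_mem _ h1 h2
        rw [sub_add_cancel] at h3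
        exact x.2.ne_top ((Ideal.eq_top_iff_one _).2 h3)
      · beta_reduce
        rw [if_neg h, map_zero, mul_zero, sub_mul, one_mul, (he1 c).eq, sub_self]
  have h := LocallyEq.sum hg.range_finite.toFinset
    fun c => (he c).mul (locallyEq_algebraMap (R := R) c)
  refine ⟨_, Eq.mp (congrArg (LocallyEq _) ?_) h⟩
  funext x
  rw [Finset.sum_apply, Finset.sum_eq_single (g x)]
  · simp
  · intro c _ hc
    simp [hc.symm]
  · intro hx
    exact absurd (hg.range_finite.mem_toFinset.2 ⟨x, rfl⟩) hx

variable {X : Type*} [TopologicalSpace X]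

variable (k) in
/-- The homomorphism from locally constant functions on `X` to `R` defined by a continuous map
`Spec R → X`. -/
noncomputable def locallyConstantEval (v : C(PrimeSpectrum R, X)) : LocallyConstant X k →ₐ[k] R :=
  have h := fun f : LocallyConstant X k => exists_locallyEq_of_isLocallyConstant (R := R)
    (f.isLocallyConstant.comp_continuous v.continuous)
  { toFun := fun f => (h f).choose
    map_zero' := ((h 0).choose_spec).unique (by
      rw [← map_zero (algebraMap k R)]; exact locallyEq_algebraMap 0)
    map_one' := ((h 1).choose_spec).unique (by
      rw [← map_one (algebraMap k R)]; exact locallyEq_algebraMap 1)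
    map_add' := fun f g => ((h (f + g)).choose_spec).unique ((h f).choose_spec.add (h g).choose_spec)
    map_mul' := fun f g => ((h (f * g)).choose_spec).unique ((h f).choose_spec.mul (h g).choose_spec)
    commutes' := fun c => ((h (algebraMap k _ c)).choose_spec).unique (locallyEq_algebraMap c) }

theorem locallyEq_locallyConstantEval (v : C(PrimeSpectrum R, X)) (f : LocallyConstant X k) :
    LocallyEq (locallyConstantEval k v f) (f ∘ v) :=
  (exists_locallyEq_of_isLocallyConstant (R := R)
    (f.isLocallyConstant.comp_continuous v.continuous)).choose_spec

theorem locallyConstantEval_charFn_mem [Nontrivial k] (v : C(PrimeSpectrum R, X)) {U : Set X}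
    (hU : IsClopen U) (x : PrimeSpectrum R) :
    locallyConstantEval k v (LocallyConstant.charFn k hU) ∉ x.asIdeal ↔ v x ∈ U := by
  obtain ⟨s, hs, e⟩ := locallyEq_locallyConstantEval v (LocallyConstant.charFn k hU) x
  rw [Function.comp_apply] at e
  by_cases hx : v x ∈ U
  · rw [(LocallyConstant.charFn_eq_one k _ hU).2 hx, map_one, mul_one] at e
    exact iff_of_true (fun h => hs (e ▸ Ideal.mul_mem_left _ _ h)) hx
  · rw [(LocallyConstant.charFn_eq_zero k _ hU).2 hx, map_zero, mul_zero] at e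
    refine iff_of_false (fun h => h ((x.2.mem_or_mem (x := s) ?_).resolve_left hs)) hx
    rw [e]
    exact Ideal.zero_mem _

/-- Stone duality. For a prime `x`, the clopen sets `U` with `φ(1_U) ∉ x` have the finite
intersection property, and by compactness they share a point `v x`. Complementation shows that `v x
∈ U` exactly for these sets. Thus preimages of clopen sets are basic open sets, and clopen sets form
a basis of `X`. -/
theorem exists_continuousMap_of_algHom [Nontrivial k] [CompactSpace X] [T2Space X]
    [TotallyDisconnectedSpace X] (φ : LocallyConstant X k →ₐ[k] R) :
    ∃ v : C(PrimeSpectrum R, X), ∀ (x : PrimeSpectrum R) (U : Set X) (hU : IsClopen U),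
      φ (LocallyConstant.charFn k hU) ∉ x.asIdeal ↔ v x ∈ U := by
  have h1 : ∀ x : PrimeSpectrum R, ∃ a : X, ∀ (U : Set X) (hU : IsClopen U),
      φ (LocallyConstant.charFn k hU) ∉ x.asIdeal → a ∈ U := by
    intro x
    let ι := {U : TopologicalSpace.Clopens X // φ (LocallyConstant.charFn k U.2) ∉ x.asIdeal}
    obtain ⟨a, ha⟩ := CompactSpace.iInter_nonempty (t := fun i : ι => (i.1 : Set X))
      (fun i => i.1.2.1) (fun s => by
        by_contra hne
        rw [Set.not_nonempty_iff_eq_empty] at hne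
        -- If finitely many of these sets had empty intersection, the product of their
        -- characteristic functions would vanish, and primality would put one of the factors into
        -- `x`.
        have h0 : ∏ i ∈ s, LocallyConstant.charFn k i.1.2 = 0 := by
          ext a
          have ha : a ∉ ⋂ i ∈ s, (i.1 : Set X) := by rw [hne]; exact Set.notMem_empty a
          simp only [Set.mem_iInter, not_forall] at ha
          obtain ⟨i, hi, hia⟩ := ha
          rw [← LocallyConstant.coeFnMonoidHom_apply, map_prod, Finset.prod_apply]
          exact Finset.prod_eq_zero hi ((LocallyConstant.charFn_eq_zero k a i.1.2).2 hia)
        have h2 : ∏ i ∈ s, φ (LocallyConstant.charFn k i.1.2) ∈ x.asIdeal := by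
          rw [← map_prod, h0, map_zero]
          exact Ideal.zero_mem _
        obtain ⟨i, _, hi⟩ := (Ideal.IsPrime.prod_mem_iff (hp := x.2)).1 h2
        exact i.2 hi)
    exact ⟨a, fun U hU h => Set.mem_iInter.1 ha ⟨⟨U, hU⟩, h⟩⟩
  choose v hv using h1
  have hv' : ∀ (x : PrimeSpectrum R) (U : Set X) (hU : IsClopen U),
      φ (LocallyConstant.charFn k hU) ∉ x.asIdeal ↔ v x ∈ U := by
    refine fun x U hU => ⟨hv x U hU, fun hx h => ?_⟩
    refine hv x Uᶜ hU.compl (fun h' => ?_) hx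
    have h2 : LocallyConstant.charFn k hU + LocallyConstant.charFn k hU.compl = 1 := by
      ext a
      rw [LocallyConstant.add_apply, LocallyConstant.one_apply]
      by_cases ha : a ∈ U
      · rw [(LocallyConstant.charFn_eq_one k _ hU).2 ha,
          (LocallyConstant.charFn_eq_zero k _ hU.compl).2 (not_not.2 ha), add_zero]
      · rw [(LocallyConstant.charFn_eq_zero k _ hU).2 ha,
          (LocallyConstant.charFn_eq_one k _ hU.compl).2 ha, zero_add]
    have h3 := Ideal.add_mem _ h h'
    rw [← map_add, h2, map_one] at h3
    exact x.2.ne_top ((Ideal.eq_top_iff_one _).2 h3)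
  refine ⟨⟨v, ?_⟩, hv'⟩
  rw [isTopologicalBasis_isClopen.continuous_iff]
  intro U hU
  have h2 : v ⁻¹' U = PrimeSpectrum.basicOpen (φ (LocallyConstant.charFn k hU)) :=
    Set.ext fun x => (hv' x U hU).symm
  rw [h2]
  exact PrimeSpectrum.isOpen_basicOpen

theorem locallyConstantEval_bijective [Nontrivial k] [CompactSpace X] [T2Space X]
    [TotallyDisconnectedSpace X] :
    Function.Bijective (locallyConstantEval k : C(PrimeSpectrum R, X) → _) := by
  refine ⟨fun v w h => ContinuousMap.ext fun x => ?_, fun φ => ?_⟩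
  · by_contra hne
    obtain ⟨U, hU, hv, hw⟩ := exists_isClopen_of_totally_separated hne
    refine hw ((locallyConstantEval_charFn_mem (k := k) w hU x).1 ?_)
    rw [← h]
    exact (locallyConstantEval_charFn_mem (k := k) v hU x).2 hv
  · obtain ⟨v, hv⟩ := exists_continuousMap_of_algHom φ
    refine ⟨v, AlgHom.ext fun f => (locallyEq_locallyConstantEval v f).unique fun x => ?_⟩
    -- On the fibre through `v x` the function `f` is the constant `f (v x)`. Multiplying by the
    -- characteristic function of this fibre gives the identity that shows `φ f` to be locally equal
    -- to `f ∘ v` at `x`.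
    have hU := f.isLocallyConstant.isClopen_fiber (f (v x))
    refine ⟨φ (LocallyConstant.charFn k hU), (hv x _ hU).2 rfl, ?_⟩
    rw [← AlgHom.commutes φ, ← map_mul, ← map_mul]
    congr 1
    ext a
    rw [LocallyConstant.mul_apply, LocallyConstant.mul_apply]
    by_cases ha : f a = f (v x)
    · rw [ha]
      rfl
    · rw [(LocallyConstant.charFn_eq_zero k a hU).2 ha, zero_mul, zero_mul]

theorem locallyConstantEval_comp {S : Type*} [CommRing S] [Algebra k S] (f : R →ₐ[k] S)
    (v : C(PrimeSpectrum R, X)) (w : C(PrimeSpectrum S, X))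
    (hw : ∀ y, w y = v (PrimeSpectrum.comap f.toRingHom y)) :
    locallyConstantEval k w = f.comp (locallyConstantEval k v) := by
  refine AlgHom.ext fun g => (locallyEq_locallyConstantEval w g).unique ?_
  have h := (locallyEq_locallyConstantEval v g).map f
  have h2 : g ∘ w = (g ∘ v) ∘ PrimeSpectrum.comap f.toRingHom := funext fun y => congrArg g (hw y)
  rw [h2]
  exact h

instance Units.totallyDisconnectedSpace (M : Type*) [Monoid M] [TopologicalSpace M]
    [TotallyDisconnectedSpace M] : TotallyDisconnectedSpace Mˣ := by
  refine ⟨fun s _ hs => ?_⟩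
  have h := (hs.image _ Units.continuous_val.continuousOn).subsingleton
  exact fun a ha b hb => Units.ext (h ⟨a, ha, rfl⟩ ⟨b, hb, rfl⟩)

/-- Functions with values in a domain form a torsion-free module, and torsion-free modules over a
Dedekind domain are flat. -/
theorem LocallyConstant.flat (X k : Type*) [TopologicalSpace X] [CommRing k] [IsDedekindDomain k] :
    Module.Flat k (LocallyConstant X k) := by
  have : Module.IsTorsionFree k (LocallyConstant X k) := ⟨fun c hc f g h => by
    ext a
    have h2 := congrArg (fun q : LocallyConstant X k => q a) h
    exact hc.left h2⟩
  infer_instance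

end LocallyConstantAlgebra

/-- The coordinate ring consists of the locally constant functions from the profinite space `ℤ_p^×`
to `ℤ_p`; `ULift` only adjusts the universe. -/
theorem isFlatAffine_padicUnits (p : ℕ) [Fact p.Prime] : IsFlatAffine ℤ_[p] (padicUnits.{u} p) := by
  refine ⟨ULift.{u} (LocallyConstant ℤ_[p]ˣ ℤ_[p]), inferInstance, inferInstance, ?_, ?_⟩
  · have := LocallyConstant.flat ℤ_[p]ˣ ℤ_[p]
    exact Module.Flat.of_linearEquiv ULift.moduleEquiv
  · let E : ∀ (R : Type u) [CommRing R] [Algebra ℤ_[p] R],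
        C(PrimeSpectrum R, ℤ_[p]ˣ) ≃ (LocallyConstant ℤ_[p]ˣ ℤ_[p] →ₐ[ℤ_[p]] R) := fun R _ _ =>
      Equiv.ofBijective _ locallyConstantEval_bijective
    refine ⟨fun R _ _ => (ULift.algEquiv.arrowCongr AlgEquiv.refl).trans (E R).symm, ?_⟩
    intro R S _ _ _ _ f φ
    refine (E S).symm_apply_eq.2 ?_
    refine Eq.trans ?_ (locallyConstantEval_comp f
      ((E R).symm (ULift.algEquiv.arrowCongr AlgEquiv.refl φ)) _ fun y => rfl).symm
    have h := (E R).apply_symm_apply (ULift.algEquiv.arrowCongr AlgEquiv.refl φ)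
    change locallyConstantEval _ _ = _ at h
    rw [h]
    rfl

/-! ## Smoothness of the group of Frobenius-invariant units of truncated Witt vectors -/

section Lifting

variable {p : ℕ} [hp : Fact p.Prime]

theorem truncMap_surjective (m : ℕ) {R S : Type u} [CommRing R] [CommRing S] {f : R →+* S}
    (hf : Function.Surjective f) : Function.Surjective (truncMap p m f) := fun x => by
  choose g hg using hf
  refine ⟨TruncatedWittVector.mk p fun i => g (x.coeff i), ?_⟩
  ext i
  rw [truncMap_coeff, TruncatedWittVector.coeff_mk, hg]

theorem truncMap_mk_eq_zero_iff {m : ℕ} {R : Type u} [CommRing R] {I : Ideal R}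
    {x : TruncatedWittVector p m R} :
    truncMap p m (Ideal.Quotient.mk I) x = 0 ↔ ∀ i, x.coeff i ∈ I := by
  rw [TruncatedWittVector.ext_iff]
  refine forall_congr' fun i => ?_
  rw [truncMap_coeff, TruncatedWittVector.coeff_zero, Ideal.Quotient.eq_zero_iff_mem]

/-- A truncated Witt vector with coordinates in `I` lifts to a Witt vector with coordinates in `I`. -/
theorem exists_truncate_eq_of_coeff_mem {m : ℕ} {R : Type u} [CommRing R] {I : Ideal R}
    {x : TruncatedWittVector p m R} (hx : ∀ i, x.coeff i ∈ I) :
    ∃ y : WittVector p R, WittVector.truncate m y = x ∧ (∀ i, y.coeff i ∈ I) ∧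
      ∀ i, m ≤ i → y.coeff i = 0 := by
  refine ⟨WittVector.mk p fun i => if h : i < m then x.coeff ⟨i, h⟩ else 0, ?_, fun i => ?_,
    fun i hi => ?_⟩
  · ext i
    rw [WittVector.coeff_truncate, WittVector.coeff_mk, dif_pos i.2]
  · rw [WittVector.coeff_mk]
    split_ifs
    · exact hx _
    · exact I.zero_mem
  · rw [WittVector.coeff_mk, dif_neg (Nat.not_lt.2 hi)]

/-- A lift `y` of the inverse leaves an error `x y - 1` with coordinates in `I`. Its square is zero,
so `y (2 - x y)` is an inverse of `x`. -/
theorem isUnit_of_truncMap_mk {m : ℕ} {R : Type u} [CommRing R] {I : Ideal R}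
    (hI : ∀ a ∈ I, ∀ b ∈ I, a * b = 0) {x : TruncatedWittVector p m R}
    (hx : IsUnit (truncMap p m (Ideal.Quotient.mk I) x)) : IsUnit x := by
  obtain ⟨y', hy'⟩ := isUnit_iff_exists_inv.1 hx
  obtain ⟨y, rfl⟩ := truncMap_surjective m Ideal.Quotient.mk_surjective y'
  rw [← map_mul, ← sub_eq_zero, ← map_one (truncMap p m (Ideal.Quotient.mk I)), ← map_sub,
    truncMap_mk_eq_zero_iff] at hy'
  obtain ⟨e, he, heI, -⟩ := exists_truncate_eq_of_coeff_mem hy'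
  have h := congrArg (WittVector.truncate m) (WittVector.of_sq_zero hI heI heI).2.1
  rw [map_mul, he, map_zero] at h
  exact IsUnit.of_mul_eq_one (y * (2 - x * y)) (by linear_combination -h)

/-- The additive equation `η - F η = d` has a solution, up to truncation, if all coordinates are in
an ideal of square zero. -/
theorem exists_truncate_eq_frobenius_add {n : ℕ} {R : Type u} [CommRing R] {I : Ideal R}
    (hI : ∀ a ∈ I, ∀ b ∈ I, a * b = 0) {d : WittVector p R} (hd : ∀ i, d.coeff i ∈ I) :
    ∃ η : WittVector p R, (∀ i, η.coeff i ∈ I) ∧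
      WittVector.truncate n η = WittVector.truncate n (WittVector.frobenius η + d) := by
  -- The geometric series `∑ F ^ j d`, using `(F d)_i = p d_{i+1}`. Cutting at index `n` loses
  -- nothing in the first `n` coordinates and keeps the sums finite, without any nilpotence of `p`.
  let η : WittVector p R :=
    WittVector.mk p fun i => ∑ j ∈ Finset.range (n - i), (p : R) ^ j * d.coeff (i + j)
  have hη : ∀ i, η.coeff i ∈ I := fun i => by
    rw [WittVector.coeff_mk]
    exact Ideal.sum_mem _ fun j _ => I.mul_mem_left _ (hd _)
  have hF := (WittVector.of_sq_zero hI hη hη).2.2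
  have hadd := (WittVector.of_sq_zero hI (x := WittVector.frobenius η) (y := d)
    (fun i => by rw [hF]; exact I.mul_mem_left _ (hη _)) hd).1
  refine ⟨η, hη, ?_⟩
  ext i
  rw [WittVector.coeff_truncate, WittVector.coeff_truncate, hadd, hF, WittVector.coeff_mk,
    show n - (i : ℕ) = n - (i + 1) + 1 by omega, Finset.sum_range_succ',
    pow_zero, one_mul, add_zero, Finset.mul_sum]
  congr 1
  refine Finset.sum_congr rfl fun j _ => ?_
  rw [pow_succ', mul_assoc, add_right_comm, add_assoc]

/-- For an arbitrary lift `x` of the unit, the first `n` coordinates of `d = F x - x` lie in `I`.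
The correction `x + η` is invariant in `W_n(R)` as soon as `η - F η = d` there, and a correction
with coordinates in `I` changes neither the image modulo `I` nor invertibility. -/
theorem sigmaUnits_map_surjective {m n : ℕ} (h : n + 1 ≤ m) {R : Type u} [CommRing R] {I : Ideal R}
    (hI : ∀ a ∈ I, ∀ b ∈ I, a * b = 0) :
    Function.Surjective ((sigmaUnits.{u} (truncFrames p m n h)).map (Ideal.Quotient.mk I)) := by
  intro v
  let w : TruncatedWittVector p m (R ⧸ I) := (v.1 : ((truncFrames p m n h).frame (R ⧸ I)).A)
  have hw : IsUnit w := v.1.isUnit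
  have hv : truncFrobenius p m n h _ w
      = TruncatedWittVector.truncate (Nat.le_of_succ_le h) w := sigmaUnits_spec _ v
  obtain ⟨x', hx'⟩ := truncMap_surjective (p := p) m (Ideal.Quotient.mk_surjective (I := I)) w
  obtain ⟨x, rfl⟩ := WittVector.truncate_surjective p m R x'
  have hd : ∀ i, (WittVector.truncate n (WittVector.frobenius x - x)).coeff i ∈ I := by
    rw [← truncMap_mk_eq_zero_iff, map_sub, ← truncFrobenius_truncate h, map_sub,
      truncMap_frobenius, hx', hv, ← hx', ← truncMap_res,
      TruncatedWittVector.truncate_wittVector_truncate, sub_self]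
  obtain ⟨d, hd1, hd2, -⟩ := exists_truncate_eq_of_coeff_mem hd
  obtain ⟨η, hη, hη'⟩ := exists_truncate_eq_frobenius_add (n := n) hI hd2
  have h1 : truncMap p m (Ideal.Quotient.mk I) (WittVector.truncate m (x + η)) = w := by
    rw [map_add, map_add, hx', add_eq_left, truncMap_mk_eq_zero_iff]
    intro i
    rw [WittVector.coeff_truncate]
    exact hη i
  have h2 : IsUnit (WittVector.truncate m (x + η)) :=
    isUnit_of_truncMap_mk hI (by rw [h1]; exact hw)
  have h3 : truncFrobenius p m n h R (WittVector.truncate m (x + η))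
      = TruncatedWittVector.truncate (Nat.le_of_succ_le h) (WittVector.truncate m (x + η)) := by
    rw [truncFrobenius_truncate, TruncatedWittVector.truncate_wittVector_truncate, map_add, map_add,
      map_add, hη', map_add, hd1, map_sub]
    ring
  exact ⟨⟨h2.unit, Units.ext h3⟩, Subtype.ext (Units.ext h1)⟩

end Lifting

/-! ### The coordinate ring of the group of invariant units, and its smoothness -/

section Representing

variable (p : ℕ) [hp : Fact p.Prime] (k : Type) [CommRing k] {m n : ℕ} (h : n + 1 ≤ m)

/-- The polynomial ring in the coordinates of two Witt vectors of length `m`. -/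
abbrev WittPairRing (m : ℕ) : Type u := MvPolynomial (ULift.{u} (Fin m ⊕ Fin m)) k

/-- The first of the two generic Witt vectors. -/
noncomputable def genericUnit : TruncatedWittVector p m (WittPairRing.{u} k m) :=
  TruncatedWittVector.mk p fun i => MvPolynomial.X ⟨Sum.inl i⟩

/-- The second of the two generic Witt vectors. -/
noncomputable def genericInverse : TruncatedWittVector p m (WittPairRing.{u} k m) :=
  TruncatedWittVector.mk p fun i => MvPolynomial.X ⟨Sum.inr i⟩

/-- The equations `x y = 1` and `σ(x) = x`. -/
noncomputable def sigmaUnitsIdeal : Ideal (WittPairRing.{u} k m) :=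
  Ideal.span (Set.range (fun i : Fin m =>
      (genericUnit p k * genericInverse p k).coeff i
        - (1 : TruncatedWittVector p m (WittPairRing.{u} k m)).coeff i) ∪
    Set.range (fun i : Fin n => (truncFrobenius p m n h _ (genericUnit p k)).coeff i
      - (TruncatedWittVector.truncate (Nat.le_of_succ_le h) (genericUnit p k)).coeff i))

theorem sigmaUnitsIdeal_fg : (sigmaUnitsIdeal.{u} p k h).FG :=
  Submodule.fg_span ((Set.finite_range _).union (Set.finite_range _))

/-- The generators of the ideal are differences of coordinates, and `ψ` commutes with all Witt
vector operations by functoriality. -/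
theorem sigmaUnitsIdeal_le_ker_iff {R : Type u} [CommRing R] (ψ : WittPairRing.{u} k m →+* R) :
    sigmaUnitsIdeal p k h ≤ RingHom.ker ψ ↔
      truncMap p m ψ (genericUnit p k) * truncMap p m ψ (genericInverse p k) = 1 ∧
      truncFrobenius p m n h R (truncMap p m ψ (genericUnit p k))
        = TruncatedWittVector.truncate (Nat.le_of_succ_le h) (truncMap p m ψ (genericUnit p k)) := by
  rw [sigmaUnitsIdeal, Ideal.span_le, Set.union_subset_iff, Set.range_subset_iff,
    Set.range_subset_iff, ← map_mul, ← truncMap_frobenius, ← truncMap_res,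
    ← map_one (truncMap p m ψ), TruncatedWittVector.ext_iff, TruncatedWittVector.ext_iff]
  refine and_congr (forall_congr' fun i => ?_) (forall_congr' fun i => ?_) <;>
    rw [SetLike.mem_coe, RingHom.mem_ker, map_sub, sub_eq_zero, truncMap_coeff, truncMap_coeff]

/-- The coordinate ring of the group scheme `R ↦ {u ∈ W_m(R)^× | σ(u) = u in W_n(R)}`. -/
abbrev SigmaUnitsRing : Type u := WittPairRing.{u} k m ⧸ sigmaUnitsIdeal.{u} p k h

/-- The universal unit `u` with `σ(u) = u`. -/
noncomputable def universalSigmaUnit :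
    (sigmaUnits.{u} (truncFrames p m n h)).G (SigmaUnitsRing.{u} p k h) :=
  have e := (sigmaUnitsIdeal_le_ker_iff p k h (Ideal.Quotient.mk (sigmaUnitsIdeal.{u} p k h))).1
    Ideal.mk_ker.ge
  ⟨{ val := truncMap p m (Ideal.Quotient.mk _) (genericUnit p k)
     inv := truncMap p m (Ideal.Quotient.mk _) (genericInverse p k)
     val_inv := e.1
     inv_val := (mul_comm _ _).trans e.1 }, Units.ext e.2⟩

/-- A homomorphism is determined by the images of the variables, which are the coordinates of the
unit and of its inverse. Conversely, the coordinates of a pair of mutually inverse vectors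
satisfying the invariance equation define one. -/
theorem sigmaUnits_map_bijective (R : Type u) [CommRing R] [Algebra k R] :
    Function.Bijective fun φ : SigmaUnitsRing.{u} p k h →ₐ[k] R =>
      (sigmaUnits.{u} (truncFrames p m n h)).map φ.toRingHom (universalSigmaUnit p k h) := by
  refine ⟨fun φ χ e => ?_, fun u => ?_⟩
  · have h1 : truncMap p m φ.toRingHom (truncMap p m (Ideal.Quotient.mk _) (genericUnit p k))
        = truncMap p m χ.toRingHom (truncMap p m (Ideal.Quotient.mk _) (genericUnit p k)) :=
      congrArg (fun w : (sigmaUnits.{u} (truncFrames p m n h)).G R =>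
        ((w.1 : ((truncFrames p m n h).frame R).Aˣ) : ((truncFrames p m n h).frame R).A)) e
    have h2 : truncMap p m φ.toRingHom (truncMap p m (Ideal.Quotient.mk _) (genericInverse p k))
        = truncMap p m χ.toRingHom (truncMap p m (Ideal.Quotient.mk _) (genericInverse p k)) :=
      congrArg (fun w : (sigmaUnits.{u} (truncFrames p m n h)).G R =>
        ((w.1⁻¹ : ((truncFrames p m n h).frame R).Aˣ) : ((truncFrames p m n h).frame R).A)) e
    refine Ideal.Quotient.algHom_ext _ (MvPolynomial.algHom_ext ?_)
    rintro ⟨i | i⟩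
    · have h3 := congrArg (fun w => TruncatedWittVector.coeff i w) h1
      simp only [truncMap_coeff, genericUnit, TruncatedWittVector.coeff_mk] at h3
      exact h3
    · have h3 := congrArg (fun w => TruncatedWittVector.coeff i w) h2
      simp only [truncMap_coeff, genericInverse, TruncatedWittVector.coeff_mk] at h3
      exact h3
  · let a : TruncatedWittVector p m R := (u.1 : ((truncFrames p m n h).frame R).A)
    let b : TruncatedWittVector p m R :=
      ((u.1⁻¹ : ((truncFrames p m n h).frame R).Aˣ) : ((truncFrames p m n h).frame R).A)
    let ψ : WittPairRing.{u} k m →ₐ[k] R :=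
      MvPolynomial.aeval fun i => Sum.elim (fun i => a.coeff i) (fun i => b.coeff i) i.down
    have ha : truncMap p m ψ.toRingHom (genericUnit p k) = a := by
      ext i
      rw [truncMap_coeff, genericUnit, TruncatedWittVector.coeff_mk]
      exact MvPolynomial.aeval_X _ _
    have hb : truncMap p m ψ.toRingHom (genericInverse p k) = b := by
      ext i
      rw [truncMap_coeff, genericInverse, TruncatedWittVector.coeff_mk]
      exact MvPolynomial.aeval_X _ _
    have hψ := (sigmaUnitsIdeal_le_ker_iff p k h ψ.toRingHom).2
      ⟨by rw [ha, hb]; exact u.1.mul_inv, by rw [ha]; exact sigmaUnits_spec _ u⟩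
    refine ⟨Ideal.Quotient.liftₐ _ ψ fun x hx => hψ hx, Subtype.ext (Units.ext ?_)⟩
    change truncMap p m (Ideal.Quotient.liftₐ _ ψ fun x hx => hψ hx).toRingHom
      (truncMap p m (Ideal.Quotient.mk _) (genericUnit p k)) = a
    rw [truncMap_comp]
    exact ha

theorem isRepresentedBy_sigmaUnits : IsRepresentedBy (k := k)
    (sigmaUnits.{u} (truncFrames p m n h)) (SigmaUnitsRing.{u} p k h) :=
  ⟨fun R _ _ => Equiv.ofBijective _ (sigmaUnits_map_bijective p k h R), fun _ _ _ _ _ _ f φ =>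
    ((sigmaUnits.{u} (truncFrames p m n h)).map_comp φ.toRingHom f.toRingHom _).symm⟩

/-- Through the functor of points, formal smoothness is the surjectivity of the invariant units
under quotients by ideals of square zero. Finite presentation is clear, the ideal being generated by
`m + n` polynomials in `2 m` variables. The base ring `k` is arbitrary. -/
theorem smooth_sigmaUnitsRing : Algebra.Smooth k (SigmaUnitsRing.{u} p k h) where
  formallySmooth := Algebra.FormallySmooth.of_comp_surjective fun B _ _ I hI φ => by
    have hI' : ∀ a ∈ I, ∀ b ∈ I, a * b = 0 := fun a ha b hb => by
      have hab := Ideal.mul_mem_mul ha hb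
      rwa [← pow_two, hI, Ideal.mem_bot] at hab
    obtain ⟨u, hu⟩ := sigmaUnits_map_surjective h hI'
      ((sigmaUnits.{u} (truncFrames p m n h)).map φ.toRingHom (universalSigmaUnit p k h))
    obtain ⟨χ, rfl⟩ := (sigmaUnits_map_bijective p k h B).2 u
    refine ⟨χ, (sigmaUnits_map_bijective p k h (B ⧸ I)).1 ?_⟩
    refine Eq.trans ?_ hu
    exact ((sigmaUnits.{u} (truncFrames p m n h)).map_comp χ.toRingHom _ _).symm
  finitePresentation := Algebra.FinitePresentation.quotient (sigmaUnitsIdeal_fg p k h)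

theorem isSmoothAffine_sigmaUnits :
    IsSmoothAffine k (sigmaUnits.{u} (truncFrames p m n h)) :=
  ⟨_, _, _, smooth_sigmaUnitsRing p k h, isRepresentedBy_sigmaUnits p k h⟩

end Representing
theorem lemma3p7 (p : ℕ) [Fact p.Prime] (g : ℕ) (hg : 0 < g) (J : Set ℤ) (hJ : J.Nonempty)
    (hper : ∀ i : ℤ, i ∈ J ↔ i + 2 * g ∈ J) (hneg : ∀ i ∈ J, -i ∈ J) :
    -- the untruncated case
    (IsFlatAffine ℤ_[p] (padicUnits.{u} p) ∧
      ∃ e : PadicWittIso.{u} p, IsTorsor (e.action g J FrobKind.full)) ∧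
    -- the `(m, n)`-truncated case, over rings in which `p` is nilpotent
    (∀ (m n : ℕ) (h : n + 1 ≤ m), 0 < n →
      IsSmoothAffine ℤ_[p] (sigmaUnits.{u} (truncFrames p m n h)) ∧
      IsTorsor (scalarAction p g J FrobKind.full (truncFrames.{u} p m n h)
        (fun R _ => IsNilpotent (p : R)))) ∧
    -- the `(m, 1-rdt)`-truncated case, over rings of characteristic `p`
    (∀ (m : ℕ) (h : 1 + 1 ≤ m),
      IsTorsor (scalarAction p g J FrobKind.rdt (truncFrames.{u} p m 1 h)
        (fun R _ => (p : R) = 0))) :=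
  ⟨⟨isFlatAffine_padicUnits p, padicWittIso p, isTorsor_padicWittIso p g J⟩,
    fun m n h hn => ⟨isSmoothAffine_sigmaUnits p ℤ_[p] h,
      isTorsor_scalarAction_truncFrames p g J .full h hn _
        (fun f hR => by rw [← map_natCast f]; exact hR.map f) (fun hR => hR) (fun e => by cases e)⟩,
    fun m h => isTorsor_scalarAction_truncFrames p g J .rdt h one_pos _
      (fun f hR => by rw [← map_natCast f, hR, map_zero])
      (fun hR => hR ▸ IsNilpotent.zero) (fun _ => rfl)⟩
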